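/- Let $X$ be a compact connected complex manifold of dimension $n$, $\omega_0$ a Kähler form and $B_0$ a smooth closed real $(1,1)$-form on $X$, and let $\alpha^{\mathbb C}=[B_0]+i[\omega_0]$ be the corresponding complexified Kähler class, identified with the set of all $\omega^{\mathbb C}=B+i\omega$ with $\omega$ a Kähler form de Rham cohomologous to $\omega_0$ and $B$ a smooth closed real $(1,1)$-form cohomologous to $B_0$. Let $\gamma=|\gamma|e^{-i\hat\vartheta}\in\mathbb C$ be such that $\gamma\int_X(B_0+i\omega_0)^n\in\mathbb R$, let $s(\omega)=g^{j\bar k}R_{j\bar k}$ with $R_{j\bar k}=-\partial_j\partial_{\bar k}\log\det g$ (so $s(\omega)\,\omega^n=n\,\mathrm{Ric}(\omega)\wedge\omega^{n-1}$), and let $c=c_\gamma\in\mathbb R$ be the constant with $$\int_X s(\omega_0)\,\omega_0^n=c\int_X\omega_0^n+\gamma\int_X(B_0+i\omega_0)^n .$$ For $\omega^{\mathbb C}=B+i\omega\in\alpha^{\mathbb C}$ and $\varphi\in C^\infty(X,\mathbb C)$ put $$\sigma_{\omega^{\mathbb C}}(\varphi)=\int_X\mathrm{Im}\left[\varphi\left(\gamma(\omega^{\mathbb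 C})^n-(s(\omega)-c)\,\omega^n\right)\right].$$ (1) $\sigma$ is closed: for all $\omega^{\mathbb C}\in\alpha^{\mathbb C}$ and $\varphi_1,\varphi_2\in C^\infty(X,\mathbb C)$ the derivative $\frac{d}{dt}\big|_{t=0}\,\sigma_{\omega^{\mathbb C}+i\partial\bar\partial (t\varphi_2)}(\varphi_1)$ exists and is symmetric in $\varphi_1,\varphi_2$. (2) There is a functional $\widetilde{\mathcal M}:\alpha^{\mathbb C}\to\mathbb R$ (a complexified K-energy) whose first variation is $\sigma$: $\frac{d}{dt}\big|_{t=0}\,\widetilde{\mathcal M}(\omega^{\mathbb C}+i\partial\bar\partial(t\varphi))=\sigma_{\omega^{\mathbb C}}(\varphi)$ for all $\omega^{\mathbb C}\in\alpha^{\mathbb C}$ and $\varphi\in C^\infty(X,\mathbb C)$. (3) For every such functional, the Euler–Lagrange equation is the scalar curvature equation with B-field: the first variation of $\widetilde{\mathcal M}$ at $\omega^{\mathbb C}=B+i\omega\in\alpha^{\mathbb C}$ vanishes if and only if $$s(\omega)=c+\gamma\,\frac{(B+i\omega)^n}{\omega^n}.$$ (4) Every such functional is convex along smooth geodesics of almost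 calibrated representatives. That is, let $\omega_1^{\mathbb C}\in\alpha^{\mathbb C}$, let $I\subseteq\mathbb R$ be an interval, and let $\varphi_t$, $t\in I$, be a smooth path in $C^\infty(X,\mathbb C)$ such that, for every $t\in I$, the form $\omega^{\mathbb C}_t=\omega_1^{\mathbb C}+i\partial\bar\partial\varphi_t=B_t+i\omega_t$ lies in $\alpha^{\mathbb C}$ (in particular $\omega_t$ is Kähler), $\mathrm{Re}\left(e^{-i\hat\vartheta}(\omega^{\mathbb C}_t)^n\right)>0$, and $$\mathrm{Im}(\ddot\varphi_t)-\left\|\partial\,\mathrm{Im}(\dot\varphi_t)\right\|^2_{\omega_t}=0,\qquad \mathrm{Re}\left[e^{-i\hat\vartheta}\left(\ddot\varphi_t\,(\omega^{\mathbb C}_t)^n-n\,i\partial\dot\varphi_t\wedge\bar\partial\dot\varphi_t\wedge(\omega^{\mathbb C}_t)^{n-1}\right)\right]=0,$$ where $\|\partial f\|^2_\omega=g^{j\bar k}\,\partial_jf\,\partial_{\bar k}f$. Then $t\mapsto\widetilde{\mathcal M}(\omega^{\mathbb C}_t)$ is convex on $I$. -/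

import Mathlib

open scoped Manifold ContDiff

noncomputable section

namespace BField

/-- The model space `ℂⁿ`.  A complex manifold of dimension `n` is a space `X` with
`[ChartedSpace (Cn n) X] [IsManifold 𝓘(ℂ, Cn n) ω X]`. The same atlas, read over `ℝ`, gives the
underlying smooth real manifold, with model `𝓘(ℝ, Cn n)`. -/
abbrev Cn (n : ℕ) : Type := Fin n → ℂ

/-- The `j`-th standard basis vector of `ℂⁿ`. -/
def basisVec {n : ℕ} (j : Fin n) : Cn n := Pi.single j 1

/-- Multiplication by `i` on `ℂⁿ`, as a real linear map. -/
def mulI (n : ℕ) : Cn n →L[ℝ] Cn n :=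
  (Complex.I • ContinuousLinearMap.id ℂ (Cn n)).restrictScalars ℝ

/-! ### Linear algebra of real `(1,1)`-forms -/

/-- The coefficient matrix `(h_{jk})` of a real `(1,1)`-form `η = i ∑ h_{jk} dz_j ∧ dz̄_k`
on `ℂⁿ`: `h_{jk} = -i η(∂_j, ∂_k̄) = (η(e_j, i e_k) - i η(e_j, e_k)) / 2`. -/
def coeff {n : ℕ} (η : Cn n [⋀^Fin 2]→L[ℝ] ℝ) : Matrix (Fin n) (Fin n) ℂ :=
  Matrix.of fun j k =>
    ((η ![basisVec j, Complex.I • basisVec k] : ℂ) -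
      Complex.I * (η ![basisVec j, basisVec k] : ℂ)) / 2

/-! ### Wirtinger derivatives on `ℂⁿ` -/

/-- `∂f/∂z_j` at `z`. -/
def dz {n : ℕ} (j : Fin n) (f : Cn n → ℂ) (z : Cn n) : ℂ :=
  (fderiv ℝ f z (basisVec j) - Complex.I * fderiv ℝ f z (Complex.I • basisVec j)) / 2

/-- `∂f/∂z̄_k` at `z`. -/
def dzbar {n : ℕ} (k : Fin n) (f : Cn n → ℂ) (z : Cn n) : ℂ :=
  (fderiv ℝ f z (basisVec k) + Complex.I * fderiv ℝ f z (Complex.I • basisVec k)) / 2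

section Manifold

variable {n : ℕ} {X : Type*} [TopologicalSpace X] [ChartedSpace (Cn n) X]

/-! ### Differential forms on `X` -/

/-- Real differential `k`-forms on `X` (no regularity): a real alternating `k`-linear form on every
tangent space `T_x X = TangentSpace 𝓘(ℝ, Cn n) x`.  That space is, as a type, `ℂⁿ`: it is identified
with `ℂⁿ` by the preferred chart at `x`, and its complex structure is multiplication by `i`. -/
abbrev DForm (n k : ℕ) (X : Type*) [TopologicalSpace X] [ChartedSpace (Cn n) X] :=
  X → Cn n [⋀^Fin k]→L[ℝ] ℝ

/-- The differential of the inverse of a chart `e` at `z`, as a real linear map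
`ℂⁿ → T_x X = ℂⁿ` with `x = e.symm z`. -/
def chartFrame (e : OpenPartialHomeomorph X (Cn n)) (z : Cn n) : Cn n →L[ℝ] Cn n :=
  mfderiv 𝓘(ℝ, Cn n) 𝓘(ℝ, Cn n) e.symm z

/-- The differential at `x` of a function on `X`, as a real linear map on `T_x X = ℂⁿ`. -/
def diffAt {F : Type*} [NormedAddCommGroup F] [NormedSpace ℝ F] (f : X → F) (x : X) :
    Cn n →L[ℝ] F :=
  mfderiv 𝓘(ℝ, Cn n) 𝓘(ℝ, F) f x

/-- The expression of a form in a chart `e`: its pullback by `e.symm`, defined on `e.target`. -/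
def inChart {k : ℕ} (η : DForm n k X) (e : OpenPartialHomeomorph X (Cn n)) (z : Cn n) :
    Cn n [⋀^Fin k]→L[ℝ] ℝ :=
  (η (e.symm z)).compContinuousLinearMap (chartFrame e z)

/-- Smoothness of a form: its expression in every chart is smooth. -/
def IsSmoothForm {k : ℕ} (η : DForm n k X) : Prop :=
  ∀ e ∈ atlas (Cn n) X, ContDiffOn ℝ ∞ (inChart η e) e.target

/-- The exterior derivative of a form, computed at `x` in the preferred chart at `x`. -/
def dForm {k : ℕ} (η : DForm n k X) : DForm n (k + 1) X := fun x =>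
  extDeriv (inChart η (chartAt (Cn n) x)) (chartAt (Cn n) x x)

/-- Exact forms: exterior derivatives of smooth forms. -/
def IsExactForm {k : ℕ} (η : DForm n (k + 1) X) : Prop :=
  ∃ ξ : DForm n k X, IsSmoothForm ξ ∧ η = dForm ξ

/-- Smooth closed real `(1,1)`-forms. -/
structure IsClosedReal11 (η : DForm n 2 X) : Prop where
  smooth : IsSmoothForm η
  type11 : ∀ (x : X) (v w : Cn n), η x ![Complex.I • v, Complex.I • w] = η x ![v, w]
  closed : dForm η = 0

/-- Kähler forms: positive smooth closed real `(1,1)`-forms. -/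
structure IsKahlerForm (η : DForm n 2 X) : Prop extends IsClosedReal11 η where
  pos : ∀ (x : X) (v : Cn n), v ≠ 0 → 0 < η x ![v, Complex.I • v]

/-- Smooth complex-valued functions on `X`. -/
def IsSmoothFun (n : ℕ) {X : Type*} [TopologicalSpace X] [ChartedSpace (Cn n) X]
    (φ : X → ℂ) : Prop :=
  ContMDiff 𝓘(ℝ, Cn n) 𝓘(ℝ, ℂ) ∞ φ

/-- The `1`-form `v ↦ du(i v)`. -/
def dJ (n : ℕ) {X : Type*} [TopologicalSpace X] [ChartedSpace (Cn n) X] (u : X → ℝ) :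
    DForm n 1 X := fun x =>
  ContinuousAlternatingMap.ofSubsingleton ℝ (Cn n) ℝ (0 : Fin 1) ((diffAt u x).comp (mulI n))

/-- The real `(1,1)`-form `i∂∂̄u = -½ d(du ∘ J)` of a real function `u`; in holomorphic coordinates
it is `i ∑ (∂²u/∂z_j∂z̄_k) dz_j ∧ dz̄_k`. -/
def iddbar (n : ℕ) {X : Type*} [TopologicalSpace X] [ChartedSpace (Cn n) X] (u : X → ℝ) :
    DForm n 2 X :=
  (-(1 / 2) : ℝ) • dForm (dJ n u)

/-! ### Complexified Kähler forms, represented as pairs `(B, Ω)`, for `B + iΩ` -/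

/-- `B + iΩ + i∂∂̄φ` for a complex potential `φ`: the pair `(B + i∂∂̄ Re φ, Ω + i∂∂̄ Im φ)`. -/
def addPotential (p : DForm n 2 X × DForm n 2 X) (φ : X → ℂ) : DForm n 2 X × DForm n 2 X :=
  (p.1 + iddbar n (fun x => (φ x).re), p.2 + iddbar n (fun x => (φ x).im))

/-- The complexified Kähler class `[B₀] + i[Ω₀]`, as the set of its complexified Kähler forms: pairs
`(B, Ω)` of closed real `(1,1)`-forms, with `Ω` Kähler, in the de Rham classes of
`B₀` and `Ω₀`. -/
def complexifiedClass (p₀ : DForm n 2 X × DForm n 2 X) : Set (DForm n 2 X × DForm n 2 X) :=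
  {p | IsClosedReal11 p.1 ∧ IsKahlerForm p.2 ∧
    IsExactForm (p.1 - p₀.1) ∧ IsExactForm (p.2 - p₀.2)}

/-- The coefficient matrix at `x` of the complex `(1,1)`-form `B + iΩ`. -/
def complexCoeff (p : DForm n 2 X × DForm n 2 X) (x : X) : Matrix (Fin n) (Fin n) ℂ :=
  coeff (p.1 x) + Complex.I • coeff (p.2 x)

/-- The function `(B + iΩ)ⁿ / Ωⁿ`.  Recall that
`(i ∑ h_{jk} dz_j ∧ dz̄_k)ⁿ = n! det(h) ∏ⱼ (i dz_j ∧ dz̄_j)`. -/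
def powerRatio (p : DForm n 2 X × DForm n 2 X) (x : X) : ℂ :=
  (complexCoeff p x).det / (coeff (p.2 x)).det

/-- The coefficients `R_{jk} = -∂²(log det(g))/∂z_j∂z̄_k` of the Ricci form of `Ω` in a
holomorphic chart, where `Ω = i ∑ g_{jk} dz_j ∧ dz̄_k` in that chart. -/
def ricciCoeff (Ω : DForm n 2 X) (e : OpenPartialHomeomorph X (Cn n)) (z : Cn n) :
    Matrix (Fin n) (Fin n) ℂ :=
  Matrix.of fun j k =>
    -dz j (dzbar k fun z' => ((Real.log (coeff (inChart Ω e z')).det.re : ℝ) : ℂ)) z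

/-- The scalar curvature `s(Ω) = g^{jk̄} R_{jk̄}`, so that `s(Ω) Ωⁿ = n Ric(Ω) ∧ Ωⁿ⁻¹`. -/
def scalarCurvature (Ω : DForm n 2 X) (x : X) : ℝ :=
  (Matrix.trace
    ((coeff (inChart Ω (chartAt (Cn n) x) (chartAt (Cn n) x x)))⁻¹ *
      ricciCoeff Ω (chartAt (Cn n) x) (chartAt (Cn n) x x))).re

/-- `∂φ/∂z_j` at `x`, in the frame of `T_x X` given by the preferred chart. -/
def partialAt (j : Fin n) (φ : X → ℂ) (x : X) : ℂ :=
  (diffAt φ x (basisVec j) - Complex.I * diffAt φ x (Complex.I • basisVec j)) / 2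

/-- `∂φ/∂z̄_k` at `x`, in the frame of `T_x X` given by the preferred chart. -/
def partialBarAt (k : Fin n) (φ : X → ℂ) (x : X) : ℂ :=
  (diffAt φ x (basisVec k) + Complex.I * diffAt φ x (Complex.I • basisVec k)) / 2

/-- The coefficient matrix of `i ∂φ ∧ ∂̄φ` at `x`. -/
def gradCoeff (φ : X → ℂ) (x : X) : Matrix (Fin n) (Fin n) ℂ :=
  Matrix.of fun j k => partialAt j φ x * partialBarAt k φ x

/-- `‖∂f‖²_Ω = g^{jk̄} ∂_j f ∂_k̄ f`, for a real function `f`. -/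
def normSqPartial (Ω : DForm n 2 X) (f : X → ℝ) (x : X) : ℝ :=
  (Matrix.trace ((coeff (Ω x))⁻¹ * gradCoeff (fun y => (f y : ℂ)) x)).re

/-- `(a (B + iΩ)ⁿ - n i∂f ∧ ∂̄f ∧ (B + iΩ)ⁿ⁻¹) / Ωⁿ`, for complex functions `a` and `f`.  As the
derivative of `det` at `C` in the direction `A` is `tr(adj(C) A)`, one has
`n η ∧ χⁿ⁻¹ = n! tr(adj(C) A) ∏ⱼ (i dz_j ∧ dz̄_j)` when `χ`, `η` have
coefficient matrices `C`, `A`. -/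
def geodesicDensity (p : DForm n 2 X × DForm n 2 X) (a f : X → ℂ) (x : X) : ℂ :=
  (a x * (complexCoeff p x).det -
    Matrix.trace ((complexCoeff p x).adjugate * gradCoeff f x)) / (coeff (p.2 x)).det

/-! ### Integration -/

/-- A complex manifold is, with the same atlas, a smooth real manifold. -/
theorem isManifold_real (n : ℕ) (X : Type*) [TopologicalSpace X] [ChartedSpace (Cn n) X]
    [IsManifold 𝓘(ℂ, Cn n) ω X] : IsManifold 𝓘(ℝ, Cn n) ∞ X := by
  refine isManifold_of_contDiffOn _ _ _ ?_
  intro e e' he he'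
  have h := HasGroupoid.compatible (G := contDiffGroupoid ω 𝓘(ℂ, Cn n)) he he'
  rw [contDiffGroupoid, mem_groupoid_of_pregroupoid] at h
  exact (ContDiffOn.restrict_scalars ℝ h.1).of_le le_top

variable [T2Space X] [CompactSpace X] [IsManifold 𝓘(ℂ, Cn n) ω X]

/-- A smooth partition of unity subordinate to the domains of the preferred charts. -/
def pou (n : ℕ) (X : Type*) [TopologicalSpace X] [ChartedSpace (Cn n) X]
    [T2Space X] [CompactSpace X] [IsManifold 𝓘(ℂ, Cn n) ω X] :
    SmoothPartitionOfUnity X 𝓘(ℝ, Cn n) X Set.univ :=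
  haveI := isManifold_real n X
  (SmoothPartitionOfUnity.exists_isSubordinate_chartAt_source 𝓘(ℝ, Cn n) X).choose

theorem pou_isSubordinate :
    (pou n X).IsSubordinate fun x => (chartAt (Cn n) x).source :=
  haveI := isManifold_real n X
  (SmoothPartitionOfUnity.exists_isSubordinate_chartAt_source 𝓘(ℝ, Cn n) X).choose_spec

/-- The integral `∫_X f Ωⁿ`, computed in charts with a partition of unity: in a chart where
`Ω = i ∑ g_{jk} dz_j ∧ dz̄_k`, the form `Ωⁿ` is `2ⁿ n! det(g)` times the Lebesgue measure. -/
def volIntegral {F : Type*} [NormedAddCommGroup F] [NormedSpace ℝ F]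
    (Ω : DForm n 2 X) (f : X → F) : F :=
  ∑ᶠ i : X, ∫ z in (chartAt (Cn n) i).target,
    (pou n X i ((chartAt (Cn n) i).symm z) *
      (2 ^ n * (n.factorial : ℝ) * (coeff (inChart Ω (chartAt (Cn n) i) z)).det.re)) •
        f ((chartAt (Cn n) i).symm z)

/-- The complexified volume `∫_X (B + iΩ)ⁿ`. -/
def complexVolume (p : DForm n 2 X × DForm n 2 X) : ℂ :=
  volIntegral p.2 (powerRatio p)

/-- The real constant `c_γ` of a complexified class with representative `p = (B, Ω)`, determined by
`∫_X s(Ω) Ωⁿ = c_γ ∫_X Ωⁿ + Re (γ ∫_X (B + iΩ)ⁿ)`. -/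
def cGamma (γ : ℂ) (p : DForm n 2 X × DForm n 2 X) : ℝ :=
  (volIntegral p.2 (scalarCurvature p.2) - (γ * complexVolume p).re) /
    volIntegral p.2 (fun _ => (1 : ℝ))

/-! ### The equation, the first variation, the functional, the geodesics -/

/-- The scalar curvature equation with B-field, `s(Ω) = c + γ (B + iΩ)ⁿ / Ωⁿ`. -/
def SolvesBFieldEquation (γ : ℂ) (c : ℝ) (p : DForm n 2 X × DForm n 2 X) : Prop :=
  ∀ x : X, (scalarCurvature p.2 x : ℂ) = (c : ℂ) + γ * powerRatio p x

/-- `σ_p(φ) = ∫_X Im [φ (γ (B + iΩ)ⁿ - (s(Ω) - c) Ωⁿ)]`, for `p = (B, Ω)`. -/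
def sigma (γ : ℂ) (c : ℝ) (p : DForm n 2 X × DForm n 2 X) (φ : X → ℂ) : ℝ :=
  volIntegral p.2 fun x =>
    (φ x * (γ * powerRatio p x - ((scalarCurvature p.2 x : ℂ) - (c : ℂ)))).im

/-- The functional `M` has first variation `D` at `p`: its
derivative at `p` in the direction `i∂∂̄φ` is `D φ`, for every smooth complex function `φ`. (The form
`p + i∂∂̄(tφ)` stays in the complexified class of `p` for small `t`.) -/
def HasFirstVariationAt (M : DForm n 2 X × DForm n 2 X → ℝ) (D : (X → ℂ) → ℝ)
    (p : DForm n 2 X × DForm n 2 X) : Prop :=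
  ∀ φ : X → ℂ, IsSmoothFun n φ →
    HasDerivAt (fun t : ℝ => M (addPotential p fun x => (t : ℂ) * φ x)) (D φ) 0

/-- `M` is a complexified K-energy of the complexified class of `p₀`: its first variation is `σ`. Only
the values of `M` on the class matter. -/
def IsComplexifiedKEnergy (γ : ℂ) (p₀ : DForm n 2 X × DForm n 2 X)
    (M : DForm n 2 X × DForm n 2 X → ℝ) : Prop :=
  ∀ p ∈ complexifiedClass p₀, HasFirstVariationAt M (sigma γ (cGamma γ p₀) p) p

/-- The almost calibrated representatives of the class of `p₀`:
`Re (e^{-iθ} (B + iΩ)ⁿ) > 0`. -/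
def almostCalibrated (θ : ℝ) (p₀ : DForm n 2 X × DForm n 2 X) :
    Set (DForm n 2 X × DForm n 2 X) :=
  {p | p ∈ complexifiedClass p₀ ∧
    ∀ x : X, 0 < (Complex.exp (-(θ : ℂ) * Complex.I) * powerRatio p x).re}

/-- The velocity at time `t ∈ S` of a path of complex functions. -/
def velocity (S : Set ℝ) (φ : ℝ → X → ℂ) (t : ℝ) (x : X) : ℂ :=
  derivWithin (fun s => φ s x) S t

/-- The acceleration at time `t ∈ S` of a path of complex functions. -/
def acceleration (S : Set ℝ) (φ : ℝ → X → ℂ) (t : ℝ) (x : X) : ℂ :=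
  iteratedDerivWithin 2 (fun s => φ s x) S t

/-- `t ↦ p + i∂∂̄φ_t`, for `t` in the interval `S`, is a smooth geodesic of almost
calibrated representatives of the complexified class of `p₀`. -/
structure IsCoupledGeodesic (θ : ℝ) (p₀ p : DForm n 2 X × DForm n 2 X) (S : Set ℝ)
    (φ : ℝ → X → ℂ) : Prop where
  smooth : ContMDiffOn (𝓘(ℝ, ℝ).prod 𝓘(ℝ, Cn n)) 𝓘(ℝ, ℂ) ∞
    (fun q : ℝ × X => φ q.1 q.2) (S ×ˢ Set.univ)
  mem : ∀ t ∈ S, addPotential p (φ t) ∈ almostCalibrated θ p₀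
  kahler_geodesic : ∀ t ∈ S, ∀ x : X,
    (acceleration S φ t x).im -
      normSqPartial (addPotential p (φ t)).2 (fun y => (velocity S φ t y).im) x = 0
  calibrated_geodesic : ∀ t ∈ S, ∀ x : X,
    (Complex.exp (-(θ : ℂ) * Complex.I) *
      geodesicDensity (addPotential p (φ t)) (acceleration S φ t) (velocity S φ t) x).re = 0

end Manifold

end BField

end

open BField

/-!
Complex `(1,1)`-forms are handled through their coefficient matrices in all charts of the atlas
(`ChartMat`), with the transformation law `IsTensor`. For a closed form `K` the matrix `adj K` of
the `(n-1,n-1)`-form `Kⁿ⁻¹` is divergence free (`sum_dz_adjugate`), so that integration by parts on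
`X` (`integral_divergence`, from a partition of unity and the divergence theorem on `ℂⁿ`) gives
`∫ u n i∂∂̄v ∧ Kⁿ⁻¹ = -∫ n i∂u ∧ ∂̄v ∧ Kⁿ⁻¹` (`integral_trDiv_hess_add_grad`). The same holds for the
derivative `adjDeriv` of `adj` in the direction of another closed form, such as the Ricci form.

*Closedness.* Along a path of potentials the derivative of `σ` is computed under the integral sign
(`hasDerivAt_sig`). Integrating by parts shows that the resulting bilinear form `sigHess` is
symmetric (`sigHess_symm`).

*Existence.* The class is star-shaped about each of its members as far as potentials are concerned:
if `p` and `p + i∂∂̄u` are in the class, then so is the segment between them. As `σ` is closed, its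
integral along rays `rayEnergy` is a primitive (`hasDerivAt_rayEnergy`). It depends only on
`p + i∂∂̄u`: potentials of the same form differ by a constant, as pluriharmonic functions on a compact
connected manifold are constant (`eq_of_iddbar_eq_zero`), and `σ` kills constants (`sigma_const`):
for imaginary constants by the choice of `c_γ` and for real ones as `γ ∫ (B + iΩ)ⁿ` is real, both
integrals being invariants of the class. No `∂∂̄`-lemma is needed: the functional is defined orbit by
orbit, each orbit being the set of the forms `p + i∂∂̄u` for a chosen `p`.

*Euler–Lagrange equation.* The first variation is `∫ Im (φ h) Ωⁿ` with
`h = γ (B + iΩ)ⁿ / Ωⁿ - (s(Ω) - c)`, and vanishes for all `φ` only if `h = 0`; take `φ = i h̄`.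

*Convexity.* Any complexified K-energy is a constant plus `rayEnergy` along a path of potentials, so
its second derivative is `σ(φ̈) + sigHess(φ̇, φ̇)`. Its scalar curvature part is, by an integrated Bochner
formula (`integral_bochner`), the integral of the square norm of the `(0,1)`-derivative of the
gradient of `Im φ̇`, thanks to the equation `Im φ̈ = ‖∂ Im φ̇‖²`. Its other part is, after integration by
parts, `|γ|` times the integral of the imaginary part of
`e^{-iθ} (φ̈ Cⁿ - n i∂φ̇ ∧ ∂̄φ̇ ∧ Cⁿ⁻¹)`, with `C` the complexified form. The real part of this
vanishes along a geodesic. As `Re (e^{-iθ} Cⁿ) > 0`, the sign of the imaginary part is that of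
`Im φ̈ - Im (C⁻¹(∂φ̇, ∂̄φ̇))`, and a computation with matrices shows
`Im (C⁻¹(∂φ̇, ∂̄φ̇)) ≤ ‖∂ Im φ̇‖²` (`im_dotProduct_inv_mulVec_le`).
-/

set_option linter.unusedSectionVars false
set_option linter.style.haveILetI false

noncomputable section

namespace BField

open scoped Matrix ComplexOrder

/-! ### Derivatives of determinants and adjugates -/

theorem det_updateRow_eq_sum_adjugate {n : ℕ} (M : Matrix (Fin n) (Fin n) ℂ) (i : Fin n)
    (v : Fin n → ℂ) :
    (M.updateRow i v).det = ∑ m, M.adjugate m i * v m := by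
  rw [← Matrix.cramer_transpose_apply, Matrix.cramer_eq_adjugate_mulVec]
  simp [Matrix.mulVec, dotProduct, ← Matrix.adjugate_transpose]

theorem trace_adjugate_mul {n : ℕ} (M A : Matrix (Fin n) (Fin n) ℂ) :
    (M.adjugate * A).trace = ∑ i, (M.updateRow i (A i)).det := by
  simp only [det_updateRow_eq_sum_adjugate, Matrix.trace, Matrix.diag, Matrix.mul_apply]
  rw [Finset.sum_comm]

/-- Jacobi's formula, row by row. -/
theorem hasFDerivAt_det {E : Type*} [NormedAddCommGroup E] [NormedSpace ℝ E] {n : ℕ}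
    {K : E → Matrix (Fin n) (Fin n) ℂ} {K' : Fin n → Fin n → E →L[ℝ] ℂ} {z : E}
    (h : ∀ j k, HasFDerivAt (fun w => K w j k) (K' j k) z) :
    HasFDerivAt (fun w => (K w).det) (∑ i, ∑ m, (K z).adjugate m i • K' i m) z := by
  let f : ContinuousMultilinearMap ℝ (fun _ : Fin n => Fin n → ℂ) ℂ :=
    ⟨((Matrix.detRowAlternating (R := ℂ) (n := Fin n)).toMultilinearMap).restrictScalars ℝ,
      by
        show Continuous fun M : Fin n → Fin n → ℂ => Matrix.det (Matrix.of M)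
        exact Continuous.matrix_det continuous_id⟩
  have hf : ∀ M : Matrix (Fin n) (Fin n) ℂ, f (fun i => M i) = M.det := fun M => rfl
  have hr : ∀ i, HasFDerivAt (fun w => K w i) (ContinuousLinearMap.pi (K' i)) z := fun i =>
    hasFDerivAt_pi.2 (h i)
  have := HasFDerivAt.multilinear_comp (f := f) hr
  simp only [hf] at this
  refine this.congr_fderiv ?_
  ext v
  simp only [sum_apply, ContinuousLinearMap.comp_apply, smul_apply, smul_eq_mul]
  refine Finset.sum_congr rfl fun i _ => ?_
  rw [← det_updateRow_eq_sum_adjugate (K z) i (fun m => K' i m v)]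
  rfl

theorem hasDerivAt_det {n : ℕ} {K : ℝ → Matrix (Fin n) (Fin n) ℂ} {K' : Matrix (Fin n) (Fin n) ℂ}
    {t : ℝ} (h : ∀ j k, HasDerivAt (fun s => K s j k) (K' j k) t) :
    HasDerivAt (fun s => (K s).det) ((K t).adjugate * K').trace t := by
  have := (hasFDerivAt_det fun j k => (h j k).hasFDerivAt).hasDerivAt
  convert this using 1
  simp only [Matrix.trace, Matrix.diag, Matrix.mul_apply, sum_apply, smul_apply,
    ContinuousLinearMap.toSpanSingleton_apply, smul_eq_mul, one_smul]
  rw [Finset.sum_comm]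

/-- The derivative of the adjugate at an invertible matrix `G` in the direction `R`; the adjugate of
`G + εR` is `adj G + ε · adjDeriv G R + O(ε²)`. -/
def adjDeriv {n : ℕ} (G R : Matrix (Fin n) (Fin n) ℂ) : Matrix (Fin n) (Fin n) ℂ :=
  G.det • ((G⁻¹ * R).trace • G⁻¹ - G⁻¹ * R * G⁻¹)

theorem adjugate_eq_det_smul_inv {n : ℕ} {G : Matrix (Fin n) (Fin n) ℂ} (h : G.det ≠ 0) :
    G.adjugate = G.det • G⁻¹ := by
  rw [Matrix.inv_def, smul_smul, Ring.inverse_eq_inv', mul_inv_cancel₀ h, one_smul]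

theorem exists_hasDerivAt_adjugate {n : ℕ} {K : ℝ → Matrix (Fin n) (Fin n) ℂ}
    {K' : Matrix (Fin n) (Fin n) ℂ} {t : ℝ} (h : ∀ j k, HasDerivAt (fun s => K s j k) (K' j k) t)
    (k j : Fin n) : ∃ a, HasDerivAt (fun s => (K s).adjugate k j) a t := by
  simp only [Matrix.adjugate_apply]
  refine ⟨_, hasDerivAt_det (K' := K'.updateRow j 0) fun i m => ?_⟩
  by_cases hi : i = j
  · subst hi
    simpa using hasDerivAt_const t _
  · simpa [Matrix.updateRow_ne hi] using h i m

theorem hasDerivAt_adjugate {n : ℕ} {K : ℝ → Matrix (Fin n) (Fin n) ℂ}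
    {K' : Matrix (Fin n) (Fin n) ℂ} {t : ℝ} (hdet : (K t).det ≠ 0)
    (h : ∀ j k, HasDerivAt (fun s => K s j k) (K' j k) t) (k j : Fin n) :
    HasDerivAt (fun s => (K s).adjugate k j) (adjDeriv (K t) K' k j) t := by
  choose A hA using exists_hasDerivAt_adjugate h
  have hu : IsUnit (K t).det := isUnit_iff_ne_zero.2 hdet
  have key : Matrix.of A * K t + (K t).adjugate * K' =
      ((K t).adjugate * K').trace • (1 : Matrix (Fin n) (Fin n) ℂ) := by
    ext a b
    have h1 : HasDerivAt (fun s => ((K s).adjugate * K s) a b)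
        ((Matrix.of A * K t + (K t).adjugate * K') a b) t := by
      simp only [Matrix.mul_apply, Matrix.add_apply, Matrix.of_apply, ← Finset.sum_add_distrib]
      exact HasDerivAt.fun_sum fun m _ => (hA a m).mul (h m b)
    have h2 : HasDerivAt (fun s => ((K s).adjugate * K s) a b)
        ((((K t).adjugate * K').trace • (1 : Matrix (Fin n) (Fin n) ℂ)) a b) t := by
      simp only [Matrix.adjugate_mul, Matrix.smul_apply, smul_eq_mul]
      exact (hasDerivAt_det h).mul_const _
    exact h1.unique h2
  have hAeq : Matrix.of A = adjDeriv (K t) K' := by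
    have : Matrix.of A * K t = ((K t).adjugate * K').trace • (1 : Matrix (Fin n) (Fin n) ℂ)
        - (K t).adjugate * K' := eq_sub_of_add_eq key
    calc Matrix.of A = Matrix.of A * K t * (K t)⁻¹ := by
          rw [Matrix.mul_assoc, Matrix.mul_nonsing_inv _ hu, Matrix.mul_one]
      _ = _ := by
          rw [this, adjugate_eq_det_smul_inv hdet, adjDeriv]
          simp only [Matrix.sub_mul, Matrix.smul_mul, Matrix.one_mul, Matrix.trace_smul, smul_sub,
            smul_smul, smul_eq_mul]
  have := congrFun (congrFun hAeq k) j
  rw [← this]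
  exact hA k j

theorem trace_adjDeriv_mul {n : ℕ} (G R A : Matrix (Fin n) (Fin n) ℂ) :
    (adjDeriv G R * A).trace =
      G.det * ((G⁻¹ * R).trace * (G⁻¹ * A).trace - (G⁻¹ * R * (G⁻¹ * A)).trace) := by
  simp only [adjDeriv, Matrix.smul_mul, Matrix.sub_mul, Matrix.trace_smul, Matrix.trace_sub,
    smul_eq_mul, Matrix.mul_assoc]

theorem trace_adjDeriv_mul_comm {n : ℕ} (G R A : Matrix (Fin n) (Fin n) ℂ) :
    (adjDeriv G R * A).trace = (adjDeriv G A * R).trace := by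
  rw [trace_adjDeriv_mul, trace_adjDeriv_mul, Matrix.trace_mul_comm (G⁻¹ * R) (G⁻¹ * A),
    mul_comm (G⁻¹ * R).trace]

/-- The double sum that makes the adjugate of a closed `(1,1)`-form divergence free: exchanging the
two distinguished rows changes the sign of the determinant. -/
theorem sum_updateRow_updateRow_eq_zero {n : ℕ} (M : Matrix (Fin n) (Fin n) ℂ) (u : Fin n → ℂ)
    (v : Fin n → Fin n → Fin n → ℂ) (hv : ∀ i j, v i j = v j i) :
    ∑ j, ∑ i, (if i = j then 0 else ((M.updateRow j u).updateRow i (v i j)).det) = 0 := by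
  set T : Fin n → Fin n → ℂ := fun j i =>
    if i = j then 0 else ((M.updateRow j u).updateRow i (v i j)).det with hT
  have hanti : ∀ i j, T j i = -T i j := by
    intro i j
    simp only [hT]
    by_cases hij : i = j
    · simp [hij]
    · rw [if_neg hij, if_neg (Ne.symm hij)]
      have h1 : (M.updateRow j u).updateRow i (v i j) =
          ((M.updateRow i u).updateRow j (v j i)).submatrix (Equiv.swap i j) id := by
        ext a b
        rw [hv i j]
        simp only [Matrix.submatrix_apply, id, Matrix.updateRow_apply]
        by_cases hai : a = i
        · subst hai
          simp
        · by_cases haj : a = j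
          · subst haj
            simp [hai, hij]
          · simp [hai, haj, Equiv.swap_apply_of_ne_of_ne hai haj]
      rw [h1, Matrix.det_permute, Equiv.Perm.sign_swap hij]
      simp
  have : ∑ j, ∑ i, T j i = -∑ j, ∑ i, T j i := by
    conv_rhs => rw [Finset.sum_comm]
    rw [← Finset.sum_neg_distrib]
    refine Finset.sum_congr rfl fun j _ => ?_
    rw [← Finset.sum_neg_distrib]
    exact Finset.sum_congr rfl fun i _ => hanti i j
  exact self_eq_neg.1 this

/-! ### Positivity -/

/-- The entrywise complex conjugate of a matrix. -/
def conjM {n : ℕ} (M : Matrix (Fin n) (Fin n) ℂ) : Matrix (Fin n) (Fin n) ℂ :=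
  M.map (starRingEnd ℂ)

theorem conjM_eq {n : ℕ} (M : Matrix (Fin n) (Fin n) ℂ) : conjM M = (Mᴴ)ᵀ := by
  ext i j; simp [conjM]

theorem det_conjM {n : ℕ} (M : Matrix (Fin n) (Fin n) ℂ) : (conjM M).det = star M.det := by
  rw [conjM_eq, Matrix.det_transpose, Matrix.det_conjTranspose]

theorem conjM_mul {n : ℕ} (M N : Matrix (Fin n) (Fin n) ℂ) :
    conjM (M * N) = conjM M * conjM N := by
  simp [conjM, Matrix.map_mul]

theorem trace_mul_nonneg_of_posSemidef {n : ℕ} {P Q : Matrix (Fin n) (Fin n) ℂ}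
    (hP : P.PosSemidef) (hQ : Q.PosSemidef) : 0 ≤ (P * Q).trace := by
  obtain ⟨m, v, rfl⟩ := Matrix.posSemidef_iff_eq_sum_vecMulVec.1 hP
  rw [Finset.sum_mul, Matrix.trace_sum]
  refine Finset.sum_nonneg fun i _ => ?_
  rw [Matrix.vecMulVec_mul, Matrix.trace_vecMulVec, dotProduct_comm, ← Matrix.dotProduct_mulVec]
  exact hQ.dotProduct_mulVec_nonneg _

/-- If `G` is positive and `Gᵀ D` is symmetric then `tr(D D̄)` is the squared norm of `D` in the
metric `G`. -/
theorem trace_mul_conjM_nonneg {n : ℕ} {G D : Matrix (Fin n) (Fin n) ℂ} (hG : G.PosDef)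
    (hS : (Gᵀ * D)ᵀ = Gᵀ * D) : 0 ≤ ((D * conjM D).trace).re := by
  have hdet : IsUnit (Gᵀ).det := by
    rw [Matrix.det_transpose]; exact isUnit_iff_ne_zero.2 hG.det_pos.ne'
  have hdet' : IsUnit G.det := isUnit_iff_ne_zero.2 hG.det_pos.ne'
  set S := Gᵀ * D with hSdef
  have hD : D = (Gᵀ)⁻¹ * S := by
    rw [hSdef, ← Matrix.mul_assoc, Matrix.nonsing_inv_mul _ hdet, Matrix.one_mul]
  have hcG : conjM Gᵀ = G := by
    ext i j
    simpa [conjM] using hG.1.apply i j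
  have hSc : conjM S = Sᴴ := by
    conv_lhs => rw [← hS]
    ext i j
    simp [conjM]
  have hcD : conjM D = G⁻¹ * Sᴴ := by
    have : G * conjM D = Sᴴ := by rw [← hSc, hSdef, conjM_mul, hcG]
    rw [← this, ← Matrix.mul_assoc, Matrix.nonsing_inv_mul _ hdet', Matrix.one_mul]
  have h0 := trace_mul_nonneg_of_posSemidef (hG.transpose.inv.posSemidef)
    (hG.inv.posSemidef.mul_mul_conjTranspose_same S)
  have : D * conjM D = (Gᵀ)⁻¹ * (S * G⁻¹ * Sᴴ) := by
    rw [hcD]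
    conv_lhs => rw [hD]
    simp only [Matrix.mul_assoc]
  rw [this]
  exact (Complex.le_def.1 h0).1

/-- For `C = H + iG` with `H` Hermitian and `G` positive, the imaginary part of
`(U + iV, C⁻¹ (U + iV))`, for the complex bilinear extension of the Hermitian pairing, is at most
`(V, G⁻¹ V)`. With `W = U - H G⁻¹ V` one has `U + iV = W + C G⁻¹ V`, and the difference is
`(y, G y)` for `y = C⁻¹ W`. -/
theorem im_dotProduct_inv_mulVec_le {n : ℕ} {G H : Matrix (Fin n) (Fin n) ℂ} (hG : G.PosDef)
    (hH : H.IsHermitian) (hC : (H + Complex.I • G).det ≠ 0) (U V : Fin n → ℂ) :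
    ((star U + Complex.I • star V) ⬝ᵥ ((H + Complex.I • G)⁻¹ *ᵥ (U + Complex.I • V))).im ≤
      (star V ⬝ᵥ (G⁻¹ *ᵥ V)).re := by
  set C := H + Complex.I • G with hCdef
  have hCu : IsUnit C.det := isUnit_iff_ne_zero.2 hC
  have hGu : IsUnit G.det := isUnit_iff_ne_zero.2 hG.det_pos.ne'
  set X := G⁻¹ *ᵥ V with hX
  have hV : G *ᵥ X = V := by
    rw [hX, Matrix.mulVec_mulVec, Matrix.mul_nonsing_inv _ hGu, Matrix.one_mulVec]
  set W := U - H *ᵥ X with hW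
  set y := C⁻¹ *ᵥ W with hy
  have hWy : C *ᵥ y = W := by
    rw [hy, Matrix.mulVec_mulVec, Matrix.mul_nonsing_inv _ hCu, Matrix.one_mulVec]
  have h1 : U + Complex.I • V = C *ᵥ (y + X) := by
    rw [Matrix.mulVec_add, hWy, hCdef, Matrix.add_mulVec, Matrix.smul_mulVec, hV, hW]
    abel
  have h2 : C⁻¹ *ᵥ (U + Complex.I • V) = y + X := by
    rw [h1, Matrix.mulVec_mulVec, Matrix.nonsing_inv_mul _ hCu, Matrix.one_mulVec]
  have hU : U = H *ᵥ y + Complex.I • (G *ᵥ y) + H *ᵥ X := by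
    have : U = W + H *ᵥ X := by rw [hW]; abel
    rw [this, ← hWy, hCdef, Matrix.add_mulVec, Matrix.smul_mulVec]
  -- the Hermitian forms of `H` and `G`
  have herm : ∀ {A : Matrix (Fin n) (Fin n) ℂ}, A.IsHermitian → ∀ a b : Fin n → ℂ,
      star (A *ᵥ a) ⬝ᵥ b = star a ⬝ᵥ (A *ᵥ b) := by
    intro A hA a b
    rw [Matrix.star_mulVec, hA.eq, Matrix.dotProduct_mulVec]
  have hermc : ∀ {A : Matrix (Fin n) (Fin n) ℂ}, A.IsHermitian → ∀ a b : Fin n → ℂ,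
      star a ⬝ᵥ (A *ᵥ b) = star (star b ⬝ᵥ (A *ᵥ a)) := by
    intro A hA a b
    rw [← herm hA b a, ← Matrix.star_dotProduct_star, star_star, dotProduct_comm]
  rw [h2, hU, ← hV]
  have e : (star (H *ᵥ y + Complex.I • (G *ᵥ y) + H *ᵥ X) + Complex.I • star (G *ᵥ X)) ⬝ᵥ (y + X)
      = (star y ⬝ᵥ (H *ᵥ y)) - Complex.I * (star y ⬝ᵥ (G *ᵥ y)) + star X ⬝ᵥ (H *ᵥ X)
        + (star y ⬝ᵥ (H *ᵥ X) + star X ⬝ᵥ (H *ᵥ y))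
        - Complex.I * (star y ⬝ᵥ (G *ᵥ X) - star X ⬝ᵥ (G *ᵥ y))
        + Complex.I * (star X ⬝ᵥ (G *ᵥ X)) := by
    simp only [star_add, star_smul, add_dotProduct, dotProduct_add, smul_dotProduct, herm hH,
      herm hG.1, smul_eq_mul]
    simp only [Complex.star_def, Complex.conj_I]
    ring
  rw [e, herm hG.1 X X, hermc hH X y, hermc hG.1 X y]
  have r1 : (star y ⬝ᵥ (H *ᵥ y)).im = 0 := by
    have := congrArg Complex.im (hermc hH y y)
    simp at this; linarith
  have r2 : (star X ⬝ᵥ (H *ᵥ X)).im = 0 := by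
    have := congrArg Complex.im (hermc hH X X)
    simp at this; linarith
  have r3 : 0 ≤ (star y ⬝ᵥ (G *ᵥ y)).re :=
    (Complex.le_def.1 (hG.posSemidef.dotProduct_mulVec_nonneg y)).1
  simp [r1, r2]
  exact r3

/-! ### Real `(1,1)`-forms and Hermitian matrices -/

/-- The sesquilinear form `-i η(v^{1,0}, w^{0,1})` attached to a real `(1,1)`-form `η`. -/
def sesq {n : ℕ} (η : Cn n [⋀^Fin 2]→L[ℝ] ℝ) (v w : Cn n) : ℂ :=
  ((η ![v, Complex.I • w] : ℂ) - Complex.I * (η ![v, w] : ℂ)) / 2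

/-- A real `2`-form on `ℂⁿ` is of type `(1,1)` when it is invariant under multiplication by `i`. -/
abbrev IsType11 {n : ℕ} (η : Cn n [⋀^Fin 2]→L[ℝ] ℝ) : Prop :=
  ∀ v w : Cn n, η ![Complex.I • v, Complex.I • w] = η ![v, w]

section Alternating

variable {n : ℕ} (η : Cn n [⋀^Fin 2]→L[ℝ] ℝ)

theorem alt_swap (v w : Cn n) : η ![w, v] = -η ![v, w] := by
  have := η.toAlternatingMap.map_swap ![v, w] (i := 0) (j := 1) (by decide)
  have e : (![v, w] ∘ ⇑(Equiv.swap (0 : Fin 2) 1)) = ![w, v] := by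
    ext i
    fin_cases i <;> simp
  rw [e] at this
  exact this

theorem alt_add_left (v v' w : Cn n) : η ![v + v', w] = η ![v, w] + η ![v', w] :=
  η.toContinuousMultilinearMap.toMultilinearMap.cons_add ![w] v v'

theorem alt_smul_left (a : ℝ) (v w : Cn n) : η ![a • v, w] = a * η ![v, w] :=
  η.toContinuousMultilinearMap.toMultilinearMap.cons_smul ![w] a v

theorem alt_smul_right (a : ℝ) (v w : Cn n) : η ![v, a • w] = a * η ![v, w] := by
  rw [alt_swap, alt_smul_left, alt_swap η v w]; ring

theorem alt_neg_right (v w : Cn n) : η ![v, -w] = -η ![v, w] := by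
  have := alt_smul_right η (-1) v w
  simpa using this

variable {η}

theorem alt_I_left (hη : IsType11 η) (v w : Cn n) : η ![Complex.I • v, w] = -η ![v, Complex.I • w] := by
  rw [← hη v (Complex.I • w), smul_smul, Complex.I_mul_I, neg_one_smul, alt_neg_right, neg_neg]

theorem sesq_add_left (v v' w : Cn n) : sesq η (v + v') w = sesq η v w + sesq η v' w := by
  simp only [sesq, alt_add_left]; push_cast; ring

theorem sesq_conj (hη : IsType11 η) (v w : Cn n) : star (sesq η v w) = sesq η w v := by
  simp only [sesq]
  rw [alt_swap η v w, alt_swap η (Complex.I • v) w, alt_I_left hη]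
  simp [Complex.conj_ofReal]

theorem sesq_smul_left (hη : IsType11 η) (a : ℂ) (v w : Cn n) : sesq η (a • v) w = a * sesq η v w := by
  have hI : ∀ v, sesq η (Complex.I • v) w = Complex.I * sesq η v w := by
    intro v
    simp only [sesq, hη, alt_I_left hη]
    push_cast
    linear_combination ((1 / 2) : ℂ) * (η ![v, w] : ℂ) * Complex.I_sq
  have hr : ∀ (r : ℝ) v, sesq η (r • v) w = r * sesq η v w := by
    intro r v
    simp only [sesq, alt_smul_left]
    push_cast; ring
  have ha : a • v = a.re • v + a.im • (Complex.I • v) := by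
    conv_lhs => rw [← Complex.re_add_im a]
    rw [add_smul, mul_smul]
    simp
  rw [ha, sesq_add_left, hr, hr, hI]
  conv_rhs => rw [← Complex.re_add_im a]
  ring

theorem sesq_sum_left (hη : IsType11 η) {ι : Type*} (s : Finset ι) (f : ι → Cn n) (w : Cn n) :
    sesq η (∑ i ∈ s, f i) w = ∑ i ∈ s, sesq η (f i) w := by
  let g : Cn n →ₗ[ℂ] ℂ :=
    { toFun := fun v => sesq η v w
      map_add' := fun v v' => sesq_add_left v v' w
      map_smul' := fun a v => sesq_smul_left hη a v w }
  exact map_sum g f s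

theorem sesq_eq_sum (hη : IsType11 η) (v w : Cn n) :
    sesq η v w = ∑ j, ∑ k, v j * coeff η j k * star (w k) := by
  have hexp : ∀ v : Cn n, v = ∑ j, v j • basisVec j := by
    intro v
    ext i
    simp [basisVec, Finset.sum_apply, Pi.single_apply]
  have h1 : ∀ v w, sesq η v w = ∑ j, v j * sesq η (basisVec j) w := by
    intro v w
    conv_lhs => rw [hexp v, sesq_sum_left hη]
    simp only [sesq_smul_left hη]
  rw [h1]
  refine Finset.sum_congr rfl fun j _ => ?_
  rw [← sesq_conj hη, h1, star_sum, Finset.mul_sum]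
  refine Finset.sum_congr rfl fun k _ => ?_
  rw [star_mul, sesq_conj hη]
  simp only [coeff, sesq, Matrix.of_apply]
  ring

/-- The coefficient matrix of the pullback of a `(1,1)`-form by a complex linear map. -/
theorem coeff_compContinuousLinearMap (hη : IsType11 η) (L : Cn n →L[ℂ] Cn n) :
    coeff (η.compContinuousLinearMap (L.restrictScalars ℝ)) =
      (Matrix.of fun i j => L (basisVec j) i)ᵀ * coeff η *
        conjM (Matrix.of fun i j => L (basisVec j) i) := by
  ext j k
  have : coeff (η.compContinuousLinearMap (L.restrictScalars ℝ)) j k =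
      sesq η (L (basisVec j)) (L (basisVec k)) := by
    simp only [coeff, sesq, Matrix.of_apply, ContinuousAlternatingMap.compContinuousLinearMap_apply]
    have e : ∀ v w : Cn n, (⇑(L.restrictScalars ℝ) ∘ ![v, w]) = ![L v, L w] := by
      intro v w; ext i; fin_cases i <;> rfl
    rw [e, e, map_smul]
  rw [this, sesq_eq_sum hη]
  simp only [Matrix.mul_apply, Matrix.transpose_apply, Matrix.of_apply, conjM, Matrix.map_apply,
    Finset.sum_mul, starRingEnd_apply]
  rw [Finset.sum_comm]

theorem coeff_isHermitian (hη : IsType11 η) : (coeff η).IsHermitian := by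
  ext j k
  have := sesq_conj hη (basisVec k) (basisVec j)
  simpa [coeff, sesq] using this

theorem coeff_posDef (hη : IsType11 η) (hpos : ∀ v : Cn n, v ≠ 0 → 0 < η ![v, Complex.I • v]) :
    (coeff η).PosDef := by
  refine Matrix.PosDef.of_dotProduct_mulVec_pos (coeff_isHermitian hη) fun x hx => ?_
  have h0 : star x ≠ 0 := by simpa using hx
  have h1 : star x ⬝ᵥ (coeff η *ᵥ x) = sesq η (star x) (star x) := by
    rw [sesq_eq_sum hη]
    simp only [dotProduct, Matrix.mulVec, Finset.mul_sum, Pi.star_apply, star_star, mul_assoc]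
  have h2 : η ![star x, star x] = 0 := by
    have := alt_swap η (star x) (star x)
    linarith
  rw [h1, sesq, h2]
  have := hpos _ h0
  simp only [Complex.ofReal_zero, mul_zero, sub_zero]
  have h3 : ((η ![star x, Complex.I • star x] : ℝ) : ℂ) / 2 =
      ((η ![star x, Complex.I • star x] / 2 : ℝ) : ℂ) := by push_cast; ring
  rw [h3]
  exact_mod_cast half_pos this

end Alternating

theorem coeff_add {n : ℕ} (η ξ : Cn n [⋀^Fin 2]→L[ℝ] ℝ) :
    coeff (η + ξ) = coeff η + coeff ξ := by
  ext j k
  simp only [coeff, Matrix.of_apply, Matrix.add_apply, ContinuousAlternatingMap.add_apply]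
  push_cast; ring

theorem coeff_smul {n : ℕ} (a : ℝ) (η : Cn n [⋀^Fin 2]→L[ℝ] ℝ) :
    coeff (a • η) = (a : ℂ) • coeff η := by
  ext j k
  simp only [coeff, Matrix.of_apply, Matrix.smul_apply, ContinuousAlternatingMap.smul_apply,
    smul_eq_mul]
  push_cast; ring

/-! ### Wirtinger calculus on `ℂⁿ` -/

section Wirtinger

variable {n : ℕ}

/-- The complex linear part of a real linear form on `ℂⁿ`, evaluated at `e_j`. -/
def wz (j : Fin n) (L : Cn n →L[ℝ] ℂ) : ℂ :=
  (L (basisVec j) - Complex.I * L (Complex.I • basisVec j)) / 2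

/-- The conjugate linear part of a real linear form on `ℂⁿ`, evaluated at `e_k`. -/
def wzbar (k : Fin n) (L : Cn n →L[ℝ] ℂ) : ℂ :=
  (L (basisVec k) + Complex.I * L (Complex.I • basisVec k)) / 2

theorem clm_apply_eq_sum (L : Cn n →L[ℝ] ℂ) (v : Cn n) :
    L v = ∑ i, (wz i L * v i + wzbar i L * star (v i)) := by
  have hv : v = ∑ i, ((v i).re • basisVec i + (v i).im • (Complex.I • basisVec i)) := by
    ext k
    simp only [Finset.sum_apply, Pi.add_apply, Pi.smul_apply, basisVec, Pi.single_apply,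
      Finset.sum_add_distrib]
    simp [Complex.re_add_im]
  conv_lhs => rw [hv]
  rw [map_sum]
  refine Finset.sum_congr rfl fun i _ => ?_
  rw [map_add, map_smul, map_smul, wz, wzbar]
  have h1 : v i = (v i).re + (v i).im * Complex.I := (Complex.re_add_im _).symm
  have h2 : star (v i) = (v i).re - (v i).im * Complex.I := by
    apply Complex.ext <;> simp
  rw [h2]
  conv_rhs => rw [h1]
  simp only [Complex.real_smul, Complex.add_re, Complex.ofReal_re, Complex.mul_re, Complex.I_re,
    Complex.ofReal_im, Complex.I_im, Complex.add_im, Complex.mul_im]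
  push_cast
  linear_combination (((v i).im : ℂ) * L (Complex.I • basisVec i)) * Complex.I_sq

variable {f g : Cn n → ℂ} {z : Cn n}

theorem _root_.HasFDerivAt.dz_eq {f' : Cn n →L[ℝ] ℂ} (h : HasFDerivAt f f' z) (j : Fin n) :
    dz j f z = wz j f' := by rw [dz, wz, h.fderiv]

theorem _root_.HasFDerivAt.dzbar_eq {f' : Cn n →L[ℝ] ℂ} (h : HasFDerivAt f f' z) (j : Fin n) :
    dzbar j f z = wzbar j f' := by rw [dzbar, wzbar, h.fderiv]

theorem dz_congr (h : f =ᶠ[nhds z] g) (j : Fin n) : dz j f z = dz j g z := by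
  rw [dz, dz, h.fderiv_eq]

theorem dzbar_congr (h : f =ᶠ[nhds z] g) (j : Fin n) : dzbar j f z = dzbar j g z := by
  rw [dzbar, dzbar, h.fderiv_eq]

theorem dz_const (c : ℂ) (j : Fin n) : dz j (fun _ => c) z = 0 := by simp [dz]

theorem dzbar_const (c : ℂ) (j : Fin n) : dzbar j (fun _ => c) z = 0 := by simp [dzbar]

theorem dz_add (hf : DifferentiableAt ℝ f z) (hg : DifferentiableAt ℝ g z) (j : Fin n) :
    dz j (fun w => f w + g w) z = dz j f z + dz j g z := by
  rw [(hf.hasFDerivAt.fun_add hg.hasFDerivAt).dz_eq, dz, dz, wz]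
  simp only [add_apply]; ring

theorem dzbar_add (hf : DifferentiableAt ℝ f z) (hg : DifferentiableAt ℝ g z) (j : Fin n) :
    dzbar j (fun w => f w + g w) z = dzbar j f z + dzbar j g z := by
  rw [(hf.hasFDerivAt.fun_add hg.hasFDerivAt).dzbar_eq, dzbar, dzbar, wzbar]
  simp only [add_apply]; ring

theorem dz_mul (hf : DifferentiableAt ℝ f z) (hg : DifferentiableAt ℝ g z) (j : Fin n) :
    dz j (fun w => f w * g w) z = f z * dz j g z + dz j f z * g z := by
  rw [(hf.hasFDerivAt.fun_mul hg.hasFDerivAt).dz_eq, dz, dz, wz]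
  simp only [add_apply, smul_apply, smul_eq_mul]; ring

theorem dzbar_mul (hf : DifferentiableAt ℝ f z) (hg : DifferentiableAt ℝ g z) (j : Fin n) :
    dzbar j (fun w => f w * g w) z = f z * dzbar j g z + dzbar j f z * g z := by
  rw [(hf.hasFDerivAt.fun_mul hg.hasFDerivAt).dzbar_eq, dzbar, dzbar, wzbar]
  simp only [add_apply, smul_apply, smul_eq_mul]; ring

theorem dz_const_mul (hf : DifferentiableAt ℝ f z) (c : ℂ) (j : Fin n) :
    dz j (fun w => c * f w) z = c * dz j f z := by
  rw [dz_mul (differentiableAt_const c) hf, dz_const]; ring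

theorem dzbar_const_mul (hf : DifferentiableAt ℝ f z) (c : ℂ) (j : Fin n) :
    dzbar j (fun w => c * f w) z = c * dzbar j f z := by
  rw [dzbar_mul (differentiableAt_const c) hf, dzbar_const]; ring

theorem dz_sum {ι : Type*} {s : Finset ι} {F : ι → Cn n → ℂ}
    (h : ∀ i ∈ s, DifferentiableAt ℝ (F i) z) (j : Fin n) :
    dz j (fun w => ∑ i ∈ s, F i w) z = ∑ i ∈ s, dz j (F i) z := by
  rw [(HasFDerivAt.fun_sum fun i hi => (h i hi).hasFDerivAt).dz_eq, wz]
  simp only [sum_apply, dz]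
  rw [Finset.mul_sum, ← Finset.sum_sub_distrib, Finset.sum_div]

theorem dzbar_sum {ι : Type*} {s : Finset ι} {F : ι → Cn n → ℂ}
    (h : ∀ i ∈ s, DifferentiableAt ℝ (F i) z) (j : Fin n) :
    dzbar j (fun w => ∑ i ∈ s, F i w) z = ∑ i ∈ s, dzbar j (F i) z := by
  rw [(HasFDerivAt.fun_sum fun i hi => (h i hi).hasFDerivAt).dzbar_eq, wzbar]
  simp only [sum_apply, dzbar]
  rw [Finset.mul_sum, ← Finset.sum_add_distrib, Finset.sum_div]

theorem dz_conj (f : Cn n → ℂ) (z : Cn n) (j : Fin n) :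
    dz j (fun w => star (f w)) z = star (dzbar j f z) := by
  have h : fderiv ℝ (fun w => star (f w)) z = (Complex.conjCLE : ℂ →L[ℝ] ℂ).comp (fderiv ℝ f z) := by
    have := Complex.conjCLE.comp_fderiv (f := f) (x := z)
    exact this
  rw [dz, dzbar, h]
  simp [sub_eq_add_neg]

theorem dzbar_conj (f : Cn n → ℂ) (z : Cn n) (j : Fin n) :
    dzbar j (fun w => star (f w)) z = star (dz j f z) := by
  have := dz_conj (fun w => star (f w)) z j
  simp only [star_star] at this
  rw [this, star_star]

theorem dz_det {K : Cn n → Matrix (Fin n) (Fin n) ℂ}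
    (h : ∀ j k, DifferentiableAt ℝ (fun w => K w j k) z) (l : Fin n) :
    dz l (fun w => (K w).det) z =
      ((K z).adjugate * Matrix.of fun j k => dz l (fun w => K w j k) z).trace := by
  rw [(hasFDerivAt_det fun j k => (h j k).hasFDerivAt).dz_eq, wz]
  simp only [sum_apply, smul_apply, smul_eq_mul, Matrix.trace, Matrix.diag, Matrix.mul_apply,
    Matrix.of_apply, dz]
  rw [Finset.sum_comm, Finset.sum_comm (f := fun i m => _ * (_ : Cn n →L[ℝ] ℂ) (Complex.I • _)),
    Finset.mul_sum, ← Finset.sum_sub_distrib, Finset.sum_div]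
  refine Finset.sum_congr rfl fun i _ => ?_
  rw [Finset.mul_sum, ← Finset.sum_sub_distrib, Finset.sum_div]
  refine Finset.sum_congr rfl fun m _ => ?_
  ring

theorem dz_cexp (hf : DifferentiableAt ℝ f z) (j : Fin n) :
    dz j (fun w => Complex.exp (f w)) z = Complex.exp (f z) * dz j f z := by
  rw [hf.hasFDerivAt.cexp.dz_eq, wz, dz]
  simp only [smul_apply, smul_eq_mul]; ring

theorem dzbar_cexp (hf : DifferentiableAt ℝ f z) (j : Fin n) :
    dzbar j (fun w => Complex.exp (f w)) z = Complex.exp (f z) * dzbar j f z := by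
  rw [hf.hasFDerivAt.cexp.dzbar_eq, wzbar, dzbar]
  simp only [smul_apply, smul_eq_mul]; ring

/-! #### Composition with holomorphic maps -/

theorem wz_comp (L : Cn n →L[ℝ] ℂ) (T : Cn n →L[ℂ] Cn n) (j : Fin n) :
    wz j (L.comp (T.restrictScalars ℝ)) = ∑ i, T (basisVec j) i * wz i L := by
  rw [wz]
  simp only [ContinuousLinearMap.comp_apply, ContinuousLinearMap.coe_restrictScalars', map_smul]
  rw [clm_apply_eq_sum L (T (basisVec j)), clm_apply_eq_sum L (Complex.I • T (basisVec j)),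
    Finset.mul_sum, ← Finset.sum_sub_distrib, Finset.sum_div]
  refine Finset.sum_congr rfl fun i _ => ?_
  simp only [Pi.smul_apply, smul_eq_mul, star_mul, Complex.star_def, Complex.conj_I]
  linear_combination (-wz i L * T (basisVec j) i / 2 + wzbar i L * (starRingEnd ℂ) (T (basisVec j) i) / 2) * Complex.I_sq

theorem wzbar_comp (L : Cn n →L[ℝ] ℂ) (T : Cn n →L[ℂ] Cn n) (j : Fin n) :
    wzbar j (L.comp (T.restrictScalars ℝ)) = ∑ i, star (T (basisVec j) i) * wzbar i L := by
  rw [wzbar]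
  simp only [ContinuousLinearMap.comp_apply, ContinuousLinearMap.coe_restrictScalars', map_smul]
  rw [clm_apply_eq_sum L (T (basisVec j)), clm_apply_eq_sum L (Complex.I • T (basisVec j)),
    Finset.mul_sum, ← Finset.sum_add_distrib, Finset.sum_div]
  refine Finset.sum_congr rfl fun i _ => ?_
  simp only [Pi.smul_apply, smul_eq_mul, star_mul, Complex.star_def, Complex.conj_I]
  linear_combination (wz i L * T (basisVec j) i / 2 - wzbar i L * (starRingEnd ℂ) (T (basisVec j) i) / 2) * Complex.I_sq

theorem dz_comp {τ : Cn n → Cn n} {T : Cn n →L[ℂ] Cn n} (hτ : HasFDerivAt τ T z)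
    (hf : DifferentiableAt ℝ f (τ z)) (j : Fin n) :
    dz j (fun w => f (τ w)) z = ∑ i, T (basisVec j) i * dz i f (τ z) := by
  have := (hf.hasFDerivAt.comp z (hτ.restrictScalars ℝ)).dz_eq j
  rw [wz_comp] at this
  exact this

theorem dzbar_comp {τ : Cn n → Cn n} {T : Cn n →L[ℂ] Cn n} (hτ : HasFDerivAt τ T z)
    (hf : DifferentiableAt ℝ f (τ z)) (j : Fin n) :
    dzbar j (fun w => f (τ w)) z = ∑ i, star (T (basisVec j) i) * dzbar i f (τ z) := by
  have := (hf.hasFDerivAt.comp z (hτ.restrictScalars ℝ)).dzbar_eq j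
  rw [wzbar_comp] at this
  exact this

theorem dzbar_eq_zero_of_differentiableAt (hf : DifferentiableAt ℂ f z) (j : Fin n) :
    dzbar j f z = 0 := by
  rw [(hf.hasFDerivAt.restrictScalars ℝ).dzbar_eq, wzbar]
  simp only [ContinuousLinearMap.coe_restrictScalars', map_smul, smul_eq_mul]
  linear_combination ((fderiv ℂ f z) (basisVec j) / 2) * Complex.I_sq

theorem two_le_smooth : (2 : WithTop ℕ∞) ≤ (∞ : WithTop ℕ∞) := by
  exact WithTop.coe_le_coe.2 (le_top : (2 : ℕ∞) ≤ ⊤)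

/-! #### Second derivatives and smoothness -/

theorem fderiv_fderiv_comm (hf : ContDiffAt ℝ 2 f z) (v w : Cn n) :
    fderiv ℝ (fun y => fderiv ℝ f y v) z w = fderiv ℝ (fun y => fderiv ℝ f y w) z v := by
  have hd : DifferentiableAt ℝ (fderiv ℝ f) z :=
    (hf.fderiv_right (m := 1) (by norm_num)).differentiableAt (by norm_num)
  rw [fderiv_clm_apply hd (differentiableAt_const v), fderiv_clm_apply hd (differentiableAt_const w)]
  have := (hf.isSymmSndFDerivAt (by simp)).eq v w
  simp [this]

theorem _root_.ContDiffAt.differentiableAt_fderiv_apply (hf : ContDiffAt ℝ 2 f z) (v : Cn n) :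
    DifferentiableAt ℝ (fun y => fderiv ℝ f y v) z :=
  ((hf.fderiv_right (m := 1) (by norm_num)).differentiableAt (by norm_num)).clm_apply
    (differentiableAt_const v)

theorem fderiv_dz_apply (hf : ContDiffAt ℝ 2 f z) (j : Fin n) (v : Cn n) :
    fderiv ℝ (dz j f) z v = (fderiv ℝ (fun y => fderiv ℝ f y v) z (basisVec j) -
      Complex.I * fderiv ℝ (fun y => fderiv ℝ f y v) z (Complex.I • basisVec j)) / 2 := by
  have h := ((hf.differentiableAt_fderiv_apply (basisVec j)).hasFDerivAt.sub
    ((hf.differentiableAt_fderiv_apply (Complex.I • basisVec j)).hasFDerivAt.const_mul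
      Complex.I)).mul_const ((2 : ℂ)⁻¹)
  have e : dz j f = fun y => (fderiv ℝ f y (basisVec j) -
      Complex.I * fderiv ℝ f y (Complex.I • basisVec j)) * (2 : ℂ)⁻¹ := by
    ext y; rw [dz, div_eq_mul_inv]
  rw [e]
  erw [h.fderiv]
  simp only [smul_apply, sub_apply, smul_eq_mul]
  rw [fderiv_fderiv_comm hf (basisVec j) v, fderiv_fderiv_comm hf (Complex.I • basisVec j) v]
  ring

theorem fderiv_dzbar_apply (hf : ContDiffAt ℝ 2 f z) (j : Fin n) (v : Cn n) :
    fderiv ℝ (dzbar j f) z v = (fderiv ℝ (fun y => fderiv ℝ f y v) z (basisVec j) +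
      Complex.I * fderiv ℝ (fun y => fderiv ℝ f y v) z (Complex.I • basisVec j)) / 2 := by
  have h := ((hf.differentiableAt_fderiv_apply (basisVec j)).hasFDerivAt.add
    ((hf.differentiableAt_fderiv_apply (Complex.I • basisVec j)).hasFDerivAt.const_mul
      Complex.I)).mul_const ((2 : ℂ)⁻¹)
  have e : dzbar j f = fun y => (fderiv ℝ f y (basisVec j) +
      Complex.I * fderiv ℝ f y (Complex.I • basisVec j)) * (2 : ℂ)⁻¹ := by
    ext y; rw [dzbar, div_eq_mul_inv]
  rw [e]
  erw [h.fderiv]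
  simp only [smul_apply, add_apply, smul_eq_mul]
  rw [fderiv_fderiv_comm hf (basisVec j) v, fderiv_fderiv_comm hf (Complex.I • basisVec j) v]
  ring

theorem dz_dz_comm (hf : ContDiffAt ℝ 2 f z) (j k : Fin n) :
    dz j (dz k f) z = dz k (dz j f) z := by
  have hd := fun v w => fderiv_fderiv_comm hf v w
  conv_lhs => rw [dz]
  conv_rhs => rw [dz]
  simp only [fderiv_dz_apply hf]
  rw [hd (basisVec j) (basisVec k), hd (basisVec j) (Complex.I • basisVec k),
    hd (Complex.I • basisVec j) (basisVec k), hd (Complex.I • basisVec j) (Complex.I • basisVec k)]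
  ring

theorem dzbar_dzbar_comm (hf : ContDiffAt ℝ 2 f z) (j k : Fin n) :
    dzbar j (dzbar k f) z = dzbar k (dzbar j f) z := by
  have hd := fun v w => fderiv_fderiv_comm hf v w
  conv_lhs => rw [dzbar]
  conv_rhs => rw [dzbar]
  simp only [fderiv_dzbar_apply hf]
  rw [hd (basisVec j) (basisVec k), hd (basisVec j) (Complex.I • basisVec k),
    hd (Complex.I • basisVec j) (basisVec k), hd (Complex.I • basisVec j) (Complex.I • basisVec k)]
  ring

theorem dz_dzbar_comm (hf : ContDiffAt ℝ 2 f z) (j k : Fin n) :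
    dz j (dzbar k f) z = dzbar k (dz j f) z := by
  have hd := fun v w => fderiv_fderiv_comm hf v w
  conv_lhs => rw [dz]
  conv_rhs => rw [dzbar]
  simp only [fderiv_dz_apply hf, fderiv_dzbar_apply hf]
  rw [hd (basisVec j) (basisVec k), hd (basisVec j) (Complex.I • basisVec k),
    hd (Complex.I • basisVec j) (basisVec k), hd (Complex.I • basisVec j) (Complex.I • basisVec k)]
  ring

/-- Derivatives in the second variable of a smooth family of functions, up to the boundary of the
parameter set, form a smooth family. -/
theorem contDiffOn_fderiv_slice {E : Type*} [NormedAddCommGroup E] [NormedSpace ℝ E] {W : Set E}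
    (hW : UniqueDiffOn ℝ W) {U : Set (Cn n)} (hU : IsOpen U) {F : E → Cn n → ℂ}
    (hF : ContDiffOn ℝ ∞ (fun q : E × Cn n => F q.1 q.2) (W ×ˢ U)) (v : Cn n) :
    ContDiffOn ℝ ∞ (fun q : E × Cn n => fderiv ℝ (F q.1) q.2 v) (W ×ˢ U) := by
  have h1 : ContDiffOn ℝ ∞ (fun q => fderivWithin ℝ (fun q : E × Cn n => F q.1 q.2) (W ×ˢ U) q
      ((0 : E), v)) (W ×ˢ U) :=
    (hF.fderivWithin (hW.prod hU.uniqueDiffOn) (by simp)).clm_apply contDiffOn_const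
  refine h1.congr fun q hq => ?_
  have h2 := (hF.differentiableOn (by simp) q hq).hasFDerivWithinAt
  have h3 : HasFDerivWithinAt (fun z : Cn n => ((q.1, z) : E × Cn n))
      (ContinuousLinearMap.inr ℝ E (Cn n)) U q.2 := (hasFDerivAt_prodMk_right q.1 q.2).hasFDerivWithinAt
  have h4 := HasFDerivWithinAt.comp (t := W ×ˢ U) q.2 h2 h3 (fun z hz => Set.mk_mem_prod hq.1 hz)
  have h5 : HasFDerivAt (F q.1) _ q.2 := h4.hasFDerivAt (hU.mem_nhds hq.2)
  rw [h5.fderiv]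
  simp

theorem contDiffOn_dz_slice {E : Type*} [NormedAddCommGroup E] [NormedSpace ℝ E] {W : Set E}
    (hW : UniqueDiffOn ℝ W) {U : Set (Cn n)} (hU : IsOpen U) {F : E → Cn n → ℂ}
    (hF : ContDiffOn ℝ ∞ (fun q : E × Cn n => F q.1 q.2) (W ×ˢ U)) (j : Fin n) :
    ContDiffOn ℝ ∞ (fun q : E × Cn n => dz j (F q.1) q.2) (W ×ˢ U) := by
  have h := contDiffOn_fderiv_slice hW hU hF
  exact ((h _).sub (contDiffOn_const.mul (h _))).div_const 2

theorem contDiffOn_dzbar_slice {E : Type*} [NormedAddCommGroup E] [NormedSpace ℝ E] {W : Set E}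
    (hW : UniqueDiffOn ℝ W) {U : Set (Cn n)} (hU : IsOpen U) {F : E → Cn n → ℂ}
    (hF : ContDiffOn ℝ ∞ (fun q : E × Cn n => F q.1 q.2) (W ×ˢ U)) (j : Fin n) :
    ContDiffOn ℝ ∞ (fun q : E × Cn n => dzbar j (F q.1) q.2) (W ×ˢ U) := by
  have h := contDiffOn_fderiv_slice hW hU hF
  exact ((h _).add (contDiffOn_const.mul (h _))).div_const 2

theorem _root_.ContDiffOn.fderiv_apply_of_isOpen {U : Set (Cn n)} (hf : ContDiffOn ℝ ∞ f U)
    (hU : IsOpen U) (v : Cn n) : ContDiffOn ℝ ∞ (fun y => fderiv ℝ f y v) U :=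
  (hf.fderiv_of_isOpen hU (by simp)).clm_apply contDiffOn_const

theorem _root_.ContDiffOn.dz {U : Set (Cn n)} (hf : ContDiffOn ℝ ∞ f U) (hU : IsOpen U)
    (j : Fin n) : ContDiffOn ℝ ∞ (dz j f) U :=
  ((hf.fderiv_apply_of_isOpen hU _).sub
    (contDiffOn_const.mul (hf.fderiv_apply_of_isOpen hU _))).div_const 2

theorem _root_.ContDiffOn.dzbar {U : Set (Cn n)} (hf : ContDiffOn ℝ ∞ f U) (hU : IsOpen U)
    (j : Fin n) : ContDiffOn ℝ ∞ (dzbar j f) U :=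
  ((hf.fderiv_apply_of_isOpen hU _).add
    (contDiffOn_const.mul (hf.fderiv_apply_of_isOpen hU _))).div_const 2

theorem _root_.ContDiffOn.differentiableAt_of_isOpen {U : Set (Cn n)} (hf : ContDiffOn ℝ ∞ f U)
    (hU : IsOpen U) (hz : z ∈ U) : DifferentiableAt ℝ f z :=
  (hf.contDiffAt (hU.mem_nhds hz)).differentiableAt (by simp)

theorem _root_.ContDiffOn.contDiffAt_two {U : Set (Cn n)} (hf : ContDiffOn ℝ ∞ f U)
    (hU : IsOpen U) (hz : z ∈ U) : ContDiffAt ℝ 2 f z :=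
  (hf.contDiffAt (hU.mem_nhds hz)).of_le two_le_smooth

/-- In a smooth family, the time derivative commutes with derivatives in space. -/
theorem hasDerivAt_fderiv_slice {S : Set ℝ} (hS : IsOpen S) {U : Set (Cn n)} (hU : IsOpen U)
    {F F' : ℝ → Cn n → ℂ} (hF : ContDiffOn ℝ ∞ (fun q : ℝ × Cn n => F q.1 q.2) (S ×ˢ U))
    (hF' : ∀ s ∈ S, ∀ y ∈ U, HasDerivAt (fun r => F r y) (F' s y) s) {t : ℝ} (ht : t ∈ S)
    (hz : z ∈ U) (v : Cn n) :
    HasDerivAt (fun s => fderiv ℝ (F s) z v) (fderiv ℝ (F' t) z v) t := by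
  set G : ℝ × Cn n → ℂ := fun q => F q.1 q.2 with hG
  have hopen : IsOpen (S ×ˢ U) := hS.prod hU
  have hGd : ∀ q ∈ S ×ˢ U, HasFDerivAt G (fderiv ℝ G q) q := fun q hq =>
    ((hF.contDiffAt (hopen.mem_nhds hq)).differentiableAt (by simp)).hasFDerivAt
  have hGt : ContDiffAt ℝ 2 G (t, z) :=
    (hF.contDiffAt (hopen.mem_nhds ⟨ht, hz⟩)).of_le two_le_smooth
  have hD : HasFDerivAt (fderiv ℝ G) (fderiv ℝ (fderiv ℝ G) (t, z)) (t, z) :=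
    ((hGt.fderiv_right (m := 1) (by norm_num)).differentiableAt (by norm_num)).hasFDerivAt
  have e1 : (fun s => fderiv ℝ (F s) z v) =ᶠ[nhds t] fun s => fderiv ℝ G (s, z) (0, v) := by
    filter_upwards [hS.mem_nhds ht] with s hs
    have h5 : HasFDerivAt (F s) _ z := (hGd (s, z) ⟨hs, hz⟩).comp z (hasFDerivAt_prodMk_right s z)
    rw [h5.fderiv]
    simp
  have e2 : F' t =ᶠ[nhds z] fun y => fderiv ℝ G (t, y) (1, 0) := by
    filter_upwards [hU.mem_nhds hz] with y hy
    have h5 : HasFDerivAt (fun r => F r y) _ t :=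
      HasFDerivAt.comp (g := G) (f := fun r => (r, y)) t (hGd (t, y) ⟨ht, hy⟩)
        (hasFDerivAt_prodMk_left t y)
    have := h5.hasDerivAt.unique (hF' t ht y hy)
    rw [← this]
    simp
  have h1 : HasFDerivAt (fun s : ℝ => fderiv ℝ G (s, z) (0, v)) _ t :=
    (hD.comp t (hasFDerivAt_prodMk_left t z)).clm_apply (hasFDerivAt_const ((0 : ℝ), v) t)
  have h2 : HasFDerivAt (fun y : Cn n => fderiv ℝ G (t, y) (1, 0)) _ z :=
    (hD.comp z (hasFDerivAt_prodMk_right t z)).clm_apply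
      (hasFDerivAt_const ((1 : ℝ), (0 : Cn n)) z)
  rw [e2.fderiv_eq, h2.fderiv]
  refine (h1.hasDerivAt.congr_of_eventuallyEq e1).congr_deriv ?_
  have := (hGt.isSymmSndFDerivAt (by simp)).eq ((1 : ℝ), (0 : Cn n)) ((0 : ℝ), v)
  simpa using this

theorem hasDerivAt_dz_slice {S : Set ℝ} (hS : IsOpen S) {U : Set (Cn n)} (hU : IsOpen U)
    {F F' : ℝ → Cn n → ℂ} (hF : ContDiffOn ℝ ∞ (fun q : ℝ × Cn n => F q.1 q.2) (S ×ˢ U))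
    (hF' : ∀ s ∈ S, ∀ y ∈ U, HasDerivAt (fun r => F r y) (F' s y) s) {t : ℝ} (ht : t ∈ S)
    (hz : z ∈ U) (j : Fin n) : HasDerivAt (fun s => dz j (F s) z) (dz j (F' t) z) t := by
  have h := hasDerivAt_fderiv_slice hS hU hF hF' ht hz
  exact ((h _).sub ((h _).const_mul Complex.I)).div_const 2

theorem hasDerivAt_dzbar_slice {S : Set ℝ} (hS : IsOpen S) {U : Set (Cn n)} (hU : IsOpen U)
    {F F' : ℝ → Cn n → ℂ} (hF : ContDiffOn ℝ ∞ (fun q : ℝ × Cn n => F q.1 q.2) (S ×ˢ U))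
    (hF' : ∀ s ∈ S, ∀ y ∈ U, HasDerivAt (fun r => F r y) (F' s y) s) {t : ℝ} (ht : t ∈ S)
    (hz : z ∈ U) (j : Fin n) : HasDerivAt (fun s => dzbar j (F s) z) (dzbar j (F' t) z) t := by
  have h := hasDerivAt_fderiv_slice hS hU hF hF' ht hz
  exact ((h _).add ((h _).const_mul Complex.I)).div_const 2

/-! #### The adjugate of a closed `(1,1)`-form is divergence free -/

/-- As `K` is closed, `∂_l K_jk` is symmetric in `l` and `j`, whereas the determinant is alternating
in the rows `l` and `j`: the adjugate is divergence free. -/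
theorem sum_dz_adjugate {K : Cn n → Matrix (Fin n) (Fin n) ℂ}
    (h : ∀ j k, DifferentiableAt ℝ (fun w => K w j k) z)
    (hcl : ∀ l j k, dz l (fun w => K w j k) z = dz j (fun w => K w l k) z) (k : Fin n) :
    ∑ j, dz j (fun w => (K w).adjugate k j) z = 0 := by
  have key := sum_updateRow_updateRow_eq_zero (K z) (Pi.single k 1)
    (fun i j m => dz j (fun w => K w i m) z) (fun i j => funext fun m => hcl j i m)
  rw [← key]
  refine Finset.sum_congr rfl fun j _ => ?_
  simp only [Matrix.adjugate_apply]
  have hd : ∀ i m, DifferentiableAt ℝ (fun w => ((K w).updateRow j (Pi.single k 1)) i m) z := by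
    intro i m
    by_cases hi : i = j
    · subst hi; simp
    · simpa [Matrix.updateRow_ne hi] using h i m
  rw [dz_det hd, trace_adjugate_mul]
  refine Finset.sum_congr rfl fun i _ => ?_
  by_cases hi : i = j
  · subst hi
    rw [if_pos rfl]
    refine Matrix.det_eq_zero_of_row_eq_zero i fun m => ?_
    simp [dz_const]
  · rw [if_neg hi]
    congr 2
    ext m
    simp [Matrix.updateRow_ne hi]

theorem sum_dzbar_adjugate {K : Cn n → Matrix (Fin n) (Fin n) ℂ}
    (h : ∀ j k, DifferentiableAt ℝ (fun w => K w j k) z)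
    (hcl : ∀ l j k, dzbar l (fun w => K w j k) z = dzbar k (fun w => K w j l) z) (j : Fin n) :
    ∑ k, dzbar k (fun w => (K w).adjugate k j) z = 0 := by
  -- apply the holomorphic statement to the conjugate transpose
  have h1 := sum_dz_adjugate (K := fun w => (K w).conjTranspose) (z := z)
    (fun a b => Complex.conjCLE.differentiableAt.comp z (h b a))
    (fun l a b => by
      simp only [Matrix.conjTranspose_apply, dz_conj]
      rw [hcl l b a]) j
  simp only [← Matrix.adjugate_conjTranspose, Matrix.conjTranspose_apply, dz_conj] at h1
  rw [← star_sum] at h1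
  exact star_eq_zero.1 h1

end Wirtinger

/-! ### Changes of charts -/

section Charts

variable {n : ℕ} {X : Type*} [TopologicalSpace X] [ChartedSpace (Cn n) X]

/-- The change of coordinates from the chart `e` to the chart `e'`. -/
def chartChange (e e' : OpenPartialHomeomorph X (Cn n)) (z : Cn n) : Cn n := e' (e.symm z)

/-- The part of the target of `e` on which the change of coordinates to `e'` is defined. -/
def overlap (e e' : OpenPartialHomeomorph X (Cn n)) : Set (Cn n) :=
  e.target ∩ e.symm ⁻¹' e'.source

/-- The complex Jacobian matrix of a change of coordinates. -/
def jac (e e' : OpenPartialHomeomorph X (Cn n)) (z : Cn n) : Matrix (Fin n) (Fin n) ℂ :=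
  Matrix.of fun i j => fderiv ℂ (chartChange e e') z (basisVec j) i

variable {e e' e'' : OpenPartialHomeomorph X (Cn n)} {z : Cn n}

theorem isOpen_overlap (e e' : OpenPartialHomeomorph X (Cn n)) : IsOpen (overlap e e') :=
  e.isOpen_inter_preimage_symm e'.open_source

theorem chartChange_mem (hz : z ∈ overlap e e') : chartChange e e' z ∈ overlap e' e := by
  refine ⟨e'.map_source hz.2, ?_⟩
  show e'.symm (e' (e.symm z)) ∈ e.source
  rw [e'.left_inv hz.2]
  exact e.map_target hz.1

theorem symm_chartChange (hz : z ∈ overlap e e') : e'.symm (chartChange e e' z) = e.symm z :=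
  e'.left_inv hz.2

theorem chartChange_chartChange (hz : z ∈ overlap e e') :
    chartChange e' e (chartChange e e' z) = z := by
  rw [chartChange, symm_chartChange hz, e.right_inv hz.1]

theorem chartChange_eventuallyEq (hz : z ∈ overlap e e') (e'' : OpenPartialHomeomorph X (Cn n)) :
    chartChange e e'' =ᶠ[nhds z] chartChange e' e'' ∘ chartChange e e' := by
  filter_upwards [(isOpen_overlap e e').mem_nhds hz] with w hw
  simp only [Function.comp, chartChange]
  rw [e'.left_inv hw.2]

theorem comp_symm_eventuallyEq {F : Type*} (f : X → F) (hz : z ∈ overlap e e') :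
    (fun w => f (e.symm w)) =ᶠ[nhds z] fun w => f (e'.symm (chartChange e e' w)) := by
  filter_upwards [(isOpen_overlap e e').mem_nhds hz] with w hw
  rw [symm_chartChange hw]

theorem overlap_self : overlap e e = e.target :=
  Set.Subset.antisymm (fun _ h => h.1) fun _ h => ⟨h, e.map_target h⟩

section Holomorphic

variable [IsManifold 𝓘(ℂ, Cn n) ω X]

theorem contDiffOn_chartChange (he : e ∈ atlas (Cn n) X) (he' : e' ∈ atlas (Cn n) X) :
    ContDiffOn ℂ ω (chartChange e e') (overlap e e') := by
  have h := HasGroupoid.compatible (G := contDiffGroupoid ω 𝓘(ℂ, Cn n)) he he'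
  rw [contDiffGroupoid, mem_groupoid_of_pregroupoid] at h
  have h1 := h.1
  refine ContDiffOn.congr_mono h1 (fun _ _ => rfl) fun z hz => ?_
  simpa [overlap] using hz

theorem contDiffAt_chartChange (he : e ∈ atlas (Cn n) X) (he' : e' ∈ atlas (Cn n) X)
    (hz : z ∈ overlap e e') : ContDiffAt ℂ ω (chartChange e e') z :=
  (contDiffOn_chartChange he he').contDiffAt ((isOpen_overlap e e').mem_nhds hz)

theorem hasFDerivAt_chartChange (he : e ∈ atlas (Cn n) X) (he' : e' ∈ atlas (Cn n) X)
    (hz : z ∈ overlap e e') :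
    HasFDerivAt (chartChange e e') (fderiv ℂ (chartChange e e') z) z :=
  ((contDiffAt_chartChange he he' hz).differentiableAt (by simp)).hasFDerivAt

theorem contDiffOn_real_chartChange (he : e ∈ atlas (Cn n) X) (he' : e' ∈ atlas (Cn n) X) :
    ContDiffOn ℝ ∞ (chartChange e e') (overlap e e') :=
  ((contDiffOn_chartChange he he').restrict_scalars ℝ).of_le le_top

theorem fderiv_chartChange_comp (he : e ∈ atlas (Cn n) X) (he' : e' ∈ atlas (Cn n) X)
    (he'' : e'' ∈ atlas (Cn n) X) (hz : z ∈ overlap e e') (hz' : z ∈ overlap e e'') :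
    fderiv ℂ (chartChange e e'') z =
      (fderiv ℂ (chartChange e' e'') (chartChange e e' z)).comp (fderiv ℂ (chartChange e e') z) := by
  rw [(chartChange_eventuallyEq hz e'').fderiv_eq]
  have h2 : chartChange e e' z ∈ overlap e' e'' :=
    ⟨(chartChange_mem hz).1, by
      show e'.symm (chartChange e e' z) ∈ e''.source
      rw [symm_chartChange hz]; exact hz'.2⟩
  exact ((hasFDerivAt_chartChange he' he'' h2).comp z (hasFDerivAt_chartChange he he' hz)).fderiv

theorem fderiv_chartChange_self (hz : z ∈ e.target) :
    fderiv ℂ (chartChange e e) z = ContinuousLinearMap.id ℂ (Cn n) := by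
  have : chartChange e e =ᶠ[nhds z] id := by
    filter_upwards [e.open_target.mem_nhds hz] with w hw
    exact e.right_inv hw
  rw [this.fderiv_eq, fderiv_id]

theorem toMatrix_comp (S T : Cn n →L[ℂ] Cn n) :
    (Matrix.of fun i j => (S.comp T) (basisVec j) i) =
      (Matrix.of fun i j => S (basisVec j) i) * Matrix.of fun i j => T (basisVec j) i := by
  ext i j
  have hexp : ∀ v : Cn n, v = ∑ k, v k • basisVec k := by
    intro v
    ext i
    simp [basisVec, Finset.sum_apply, Pi.single_apply]
  simp only [Matrix.of_apply, ContinuousLinearMap.comp_apply, Matrix.mul_apply]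
  conv_lhs => rw [hexp (T (basisVec j)), map_sum]
  simp only [map_smul, Finset.sum_apply, Pi.smul_apply, smul_eq_mul]
  exact Finset.sum_congr rfl fun k _ => mul_comm _ _

theorem jac_mul_jac (he : e ∈ atlas (Cn n) X) (he' : e' ∈ atlas (Cn n) X)
    (hz : z ∈ overlap e e') : jac e' e (chartChange e e' z) * jac e e' z = 1 := by
  have h := fderiv_chartChange_comp he he' he hz (by rw [overlap_self]; exact hz.1)
  rw [fderiv_chartChange_self hz.1] at h
  have h2 := toMatrix_comp (fderiv ℂ (chartChange e' e) (chartChange e e' z))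
    (fderiv ℂ (chartChange e e') z)
  rw [← h] at h2
  rw [jac, jac, ← h2]
  ext i j
  simp [basisVec, Matrix.one_apply, Pi.single_apply]

theorem det_jac_ne_zero (he : e ∈ atlas (Cn n) X) (he' : e' ∈ atlas (Cn n) X)
    (hz : z ∈ overlap e e') : (jac e e' z).det ≠ 0 := by
  have := congrArg Matrix.det (jac_mul_jac he he' hz)
  rw [Matrix.det_mul, Matrix.det_one] at this
  exact right_ne_zero_of_mul (this ▸ one_ne_zero)

theorem contDiffOn_jac (he : e ∈ atlas (Cn n) X) (he' : e' ∈ atlas (Cn n) X) (i j : Fin n) :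
    ContDiffOn ℂ ω (fun w => jac e e' w i j) (overlap e e') := by
  have h := (contDiffOn_chartChange he he').fderiv_of_isOpen (m := ω) (isOpen_overlap e e')
    (by simp)
  have h2 : ContDiffOn ℂ ω (fun w => fderiv ℂ (chartChange e e') w (basisVec j)) (overlap e e') :=
    h.clm_apply contDiffOn_const
  exact contDiffOn_pi.1 h2 i

theorem chartFrame_eq (he : e ∈ atlas (Cn n) X) (hz : z ∈ e.target) :
    chartFrame e z =
      (fderiv ℂ (chartChange e (chartAt (Cn n) (e.symm z))) z).restrictScalars ℝ := by
  haveI := isManifold_real n X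
  haveI : IsManifold 𝓘(ℝ, Cn n) 1 X := IsManifold.of_le (n := ∞) (by simp)
  have hmd : MDifferentiableAt 𝓘(ℝ, Cn n) 𝓘(ℝ, Cn n) e.symm z := mdifferentiableAt_atlas_symm he hz
  have hov : z ∈ overlap e (chartAt (Cn n) (e.symm z)) := ⟨hz, mem_chart_source _ _⟩
  rw [chartFrame, hmd.mfderiv]
  have h := ((hasFDerivAt_chartChange he (chart_mem_atlas _ _) hov).restrictScalars ℝ).fderiv
  rw [← h]
  simp only [writtenInExtChartAt, extChartAt, mfld_simps, fderivWithin_univ]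
  rfl

theorem chartFrame_chartAt (x : X) :
    chartFrame (chartAt (Cn n) x) (chartAt (Cn n) x x) = ContinuousLinearMap.id ℝ (Cn n) := by
  rw [chartFrame_eq (chart_mem_atlas _ _) (mem_chart_target _ _),
    (chartAt (Cn n) x).left_inv (mem_chart_source _ _),
    fderiv_chartChange_self (mem_chart_target _ _)]
  rfl

theorem chartFrame_comp (he : e ∈ atlas (Cn n) X) (he' : e' ∈ atlas (Cn n) X)
    (hz : z ∈ overlap e e') :
    chartFrame e z = (chartFrame e' (chartChange e e' z)).comp
      ((fderiv ℂ (chartChange e e') z).restrictScalars ℝ) := by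
  rw [chartFrame_eq he hz.1, chartFrame_eq he' (chartChange_mem hz).1, symm_chartChange hz,
    fderiv_chartChange_comp he he' (chart_mem_atlas _ _) hz ⟨hz.1, mem_chart_source _ _⟩]
  rfl

theorem inChart_eq {k : ℕ} (η : DForm n k X) (he : e ∈ atlas (Cn n) X)
    (he' : e' ∈ atlas (Cn n) X) (hz : z ∈ overlap e e') :
    inChart η e z = (inChart η e' (chartChange e e' z)).compContinuousLinearMap
      ((fderiv ℂ (chartChange e e') z).restrictScalars ℝ) := by
  rw [inChart, inChart, symm_chartChange hz, chartFrame_comp he he' hz]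
  rfl

theorem inChart_chartAt {k : ℕ} (η : DForm n k X) (x : X) :
    inChart η (chartAt (Cn n) x) (chartAt (Cn n) x x) = η x := by
  rw [inChart, chartFrame_chartAt, (chartAt (Cn n) x).left_inv (mem_chart_source _ _)]
  rfl

theorem inChart_contDiffAt {k : ℕ} {η : DForm n k X} (hη : IsSmoothForm η)
    (he : e ∈ atlas (Cn n) X) (hz : z ∈ e.target) : ContDiffAt ℝ ∞ (inChart η e) z :=
  (hη e he).contDiffAt (e.open_target.mem_nhds hz)

/-- The exterior derivative can be computed in any chart. -/
theorem inChart_dForm {k : ℕ} {η : DForm n k X} (hη : IsSmoothForm η) (he : e ∈ atlas (Cn n) X)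
    (hz : z ∈ e.target) : inChart (dForm η) e z = extDeriv (inChart η e) z := by
  set c := chartAt (Cn n) (e.symm z) with hc
  have hca : c ∈ atlas (Cn n) X := chart_mem_atlas _ _
  have hov : z ∈ overlap e c := ⟨hz, mem_chart_source _ _⟩
  have h1 : inChart η e =ᶠ[nhds z] fun w => (inChart η c (chartChange e c w)).compContinuousLinearMap
      (fderiv ℝ (chartChange e c) w) := by
    filter_upwards [(isOpen_overlap e c).mem_nhds hov] with w hw
    rw [inChart_eq η he hca hw]
    congr 1
    exact ((hasFDerivAt_chartChange he hca hw).restrictScalars ℝ).fderiv.symm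
  rw [h1.extDeriv_eq, extDeriv_pullback (r := ∞)
    ((inChart_contDiffAt hη hca (chartChange_mem hov).1).differentiableAt (by simp))
    ((contDiffOn_real_chartChange he hca).contDiffAt ((isOpen_overlap e c).mem_nhds hov))
    (by simpa using two_le_smooth)]
  rw [inChart, dForm, chartFrame_eq he hz]
  congr 1
  exact ((hasFDerivAt_chartChange he hca hov).restrictScalars ℝ).fderiv.symm

end Holomorphic

theorem inChart_add {k : ℕ} (η ξ : DForm n k X) (e : OpenPartialHomeomorph X (Cn n)) :
    inChart (η + ξ) e = inChart η e + inChart ξ e := rfl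

theorem inChart_smul {k : ℕ} (a : ℝ) (η : DForm n k X) (e : OpenPartialHomeomorph X (Cn n)) :
    inChart (a • η) e = a • inChart η e := rfl

end Charts

/-! ### Smooth functions -/

section Smooth

variable {n : ℕ} {X : Type*} [TopologicalSpace X] [ChartedSpace (Cn n) X]

/-- Smoothness of a complex function, read in the charts of the atlas. -/
def CSmooth (n : ℕ) {X : Type*} [TopologicalSpace X] [ChartedSpace (Cn n) X] (f : X → ℂ) : Prop :=
  ∀ e ∈ atlas (Cn n) X, ContDiffOn ℝ ∞ (fun z => f (e.symm z)) e.target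

variable [IsManifold 𝓘(ℂ, Cn n) ω X]

theorem isSmoothFun_iff {f : X → ℂ} : IsSmoothFun n f ↔ CSmooth n f := by
  haveI := isManifold_real n X
  constructor
  · intro h e he
    have h1 : ContMDiffOn 𝓘(ℝ, Cn n) 𝓘(ℝ, Cn n) ∞ e.symm e.target :=
      contMDiffOn_symm_of_mem_maximalAtlas (IsManifold.subset_maximalAtlas he)
    have h2 := ContMDiff.comp_contMDiffOn h h1
    exact contMDiffOn_iff_contDiffOn.1 h2
  · intro h x
    have he : chartAt (Cn n) x ∈ atlas (Cn n) X := chart_mem_atlas _ _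
    have h1 : ContMDiffOn 𝓘(ℝ, Cn n) 𝓘(ℝ, Cn n) ∞ (chartAt (Cn n) x) (chartAt (Cn n) x).source :=
      contMDiffOn_of_mem_maximalAtlas (IsManifold.subset_maximalAtlas he)
    have h2 := (contMDiffOn_iff_contDiffOn.2 (h _ he)).comp h1
      (fun y hy => (chartAt (Cn n) x).map_source hy)
    have h3 : ContMDiffOn 𝓘(ℝ, Cn n) 𝓘(ℝ, ℂ) ∞ f (chartAt (Cn n) x).source :=
      h2.congr fun y hy => by simp [(chartAt (Cn n) x).left_inv hy]
    exact h3.contMDiffAt ((chartAt (Cn n) x).open_source.mem_nhds (mem_chart_source _ _))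

theorem CSmooth.continuous {f : X → ℂ} (h : CSmooth n f) : Continuous f :=
  (isSmoothFun_iff.2 h).continuous

end Smooth

/-! ### Complex `(1,1)`-forms, given by their coefficient matrices in all charts -/

section Tensors

variable {n : ℕ} {X : Type*} [TopologicalSpace X] [ChartedSpace (Cn n) X]

/-- A family of matrix valued functions, one for every chart. -/
abbrev ChartMat (n : ℕ) (X : Type*) [TopologicalSpace X] :=
  OpenPartialHomeomorph X (Cn n) → Cn n → Matrix (Fin n) (Fin n) ℂ

/-- The coefficient matrices of a real `(1,1)`-form in the charts. -/
def cf (η : DForm n 2 X) : ChartMat n X := fun e z => coeff (inChart η e z)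

/-- The complex Hessian `(∂²u/∂z_j∂z̄_k)` in the charts. -/
def hess (u : X → ℂ) : ChartMat n X := fun e z =>
  Matrix.of fun j k => dz j (dzbar k fun w => u (e.symm w)) z

/-- The coefficient matrices of `i ∂u ∧ ∂̄v` in the charts. -/
def gradMat (u v : X → ℂ) : ChartMat n X := fun e z =>
  Matrix.of fun j k => dz j (fun w => u (e.symm w)) z * dzbar k (fun w => v (e.symm w)) z

/-- The transformation law of the coefficients of a complex `(1,1)`-form. -/
def IsTensor (K : ChartMat n X) : Prop :=
  ∀ e ∈ atlas (Cn n) X, ∀ e' ∈ atlas (Cn n) X, ∀ z ∈ overlap e e',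
    K e z = (jac e e' z)ᵀ * K e' (chartChange e e' z) * conjM (jac e e' z)

/-- Smooth closed complex `(1,1)`-forms, in terms of their coefficient matrices. -/
structure IsClosed11 (K : ChartMat n X) : Prop where
  tensor : IsTensor K
  smooth : ∀ e ∈ atlas (Cn n) X, ∀ j k, ContDiffOn ℝ ∞ (fun z => K e z j k) e.target
  dz_symm : ∀ e ∈ atlas (Cn n) X, ∀ z ∈ e.target, ∀ l j k,
    dz l (fun w => K e w j k) z = dz j (fun w => K e w l k) z
  dzbar_symm : ∀ e ∈ atlas (Cn n) X, ∀ z ∈ e.target, ∀ l j k,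
    dzbar l (fun w => K e w j k) z = dzbar k (fun w => K e w j l) z

theorem IsTensor.add {K L : ChartMat n X} (hK : IsTensor K) (hL : IsTensor L) :
    IsTensor (K + L) := by
  intro e he e' he' z hz
  simp only [Pi.add_apply, hK e he e' he' z hz, hL e he e' he' z hz, Matrix.mul_add,
    Matrix.add_mul]

theorem IsTensor.smul {K : ChartMat n X} (hK : IsTensor K) (c : ℂ) : IsTensor (c • K) := by
  intro e he e' he' z hz
  simp only [Pi.smul_apply, hK e he e' he' z hz, Matrix.mul_smul, Matrix.smul_mul]

theorem IsClosed11.differentiableAt {K : ChartMat n X} (hK : IsClosed11 K)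
    {e : OpenPartialHomeomorph X (Cn n)} (he : e ∈ atlas (Cn n) X) {z : Cn n} (hz : z ∈ e.target)
    (j k : Fin n) : DifferentiableAt ℝ (fun w => K e w j k) z :=
  (hK.smooth e he j k).differentiableAt_of_isOpen e.open_target hz

theorem IsClosed11.add {K L : ChartMat n X} (hK : IsClosed11 K) (hL : IsClosed11 L) :
    IsClosed11 (K + L) where
  tensor := hK.tensor.add hL.tensor
  smooth e he j k := (hK.smooth e he j k).add (hL.smooth e he j k)
  dz_symm e he z hz l j k := by
    simp only [Pi.add_apply, Matrix.add_apply]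
    rw [dz_add (hK.differentiableAt he hz _ _) (hL.differentiableAt he hz _ _),
      dz_add (hK.differentiableAt he hz _ _) (hL.differentiableAt he hz _ _),
      hK.dz_symm e he z hz l j k, hL.dz_symm e he z hz l j k]
  dzbar_symm e he z hz l j k := by
    simp only [Pi.add_apply, Matrix.add_apply]
    rw [dzbar_add (hK.differentiableAt he hz _ _) (hL.differentiableAt he hz _ _),
      dzbar_add (hK.differentiableAt he hz _ _) (hL.differentiableAt he hz _ _),
      hK.dzbar_symm e he z hz l j k, hL.dzbar_symm e he z hz l j k]

theorem IsClosed11.smul {K : ChartMat n X} (hK : IsClosed11 K) (c : ℂ) : IsClosed11 (c • K) where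
  tensor := hK.tensor.smul c
  smooth e he j k := contDiffOn_const.mul (hK.smooth e he j k)
  dz_symm e he z hz l j k := by
    simp only [Pi.smul_apply, Matrix.smul_apply, smul_eq_mul]
    rw [dz_const_mul (hK.differentiableAt he hz _ _), dz_const_mul (hK.differentiableAt he hz _ _),
      hK.dz_symm e he z hz l j k]
  dzbar_symm e he z hz l j k := by
    simp only [Pi.smul_apply, Matrix.smul_apply, smul_eq_mul]
    rw [dzbar_const_mul (hK.differentiableAt he hz _ _),
      dzbar_const_mul (hK.differentiableAt he hz _ _), hK.dzbar_symm e he z hz l j k]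

theorem cf_add (η ξ : DForm n 2 X) : cf (η + ξ) = cf η + cf ξ := by
  ext1 e; ext1 z
  rw [cf, inChart_add, Pi.add_apply, coeff_add]
  rfl

/-! #### Hessians of functions -/

theorem contDiffAt_comp_symm {u : X → ℂ} (hu : CSmooth n u) {e : OpenPartialHomeomorph X (Cn n)}
    (he : e ∈ atlas (Cn n) X) {z : Cn n} (hz : z ∈ e.target) :
    ContDiffAt ℝ ∞ (fun w => u (e.symm w)) z :=
  (hu e he).contDiffAt (e.open_target.mem_nhds hz)

theorem differentiableAt_comp_symm {u : X → ℂ} (hu : CSmooth n u)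
    {e : OpenPartialHomeomorph X (Cn n)} (he : e ∈ atlas (Cn n) X) {z : Cn n} (hz : z ∈ e.target) :
    DifferentiableAt ℝ (fun w => u (e.symm w)) z :=
  (contDiffAt_comp_symm hu he hz).differentiableAt (by simp)

/-- Smooth functions have symmetric third derivatives, so that complex Hessians are closed. -/
theorem dz_hess_symm {f : Cn n → ℂ} {U : Set (Cn n)} (hU : IsOpen U) (hf : ContDiffOn ℝ ∞ f U)
    {z : Cn n} (hz : z ∈ U) (l j k : Fin n) :
    dz l (fun w => dz j (dzbar k f) w) z = dz j (fun w => dz l (dzbar k f) w) z :=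
  dz_dz_comm ((hf.dzbar hU k).contDiffAt_two hU hz) l j

theorem dzbar_hess_symm {f : Cn n → ℂ} {U : Set (Cn n)} (hU : IsOpen U) (hf : ContDiffOn ℝ ∞ f U)
    {z : Cn n} (hz : z ∈ U) (l j k : Fin n) :
    dzbar l (fun w => dz j (dzbar k f) w) z = dzbar k (fun w => dz j (dzbar l f) w) z := by
  have h1 : ∀ k, (fun w => dz j (dzbar k f) w) =ᶠ[nhds z] fun w => dzbar k (dz j f) w := by
    intro k
    filter_upwards [hU.mem_nhds hz] with w hw
    exact dz_dzbar_comm (hf.contDiffAt_two hU hw) j k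
  rw [dzbar_congr (h1 k), dzbar_congr (h1 l)]
  exact dzbar_dzbar_comm ((hf.dz hU j).contDiffAt_two hU hz) l k

section Holomorphic

variable [IsManifold 𝓘(ℂ, Cn n) ω X]
variable {e e' : OpenPartialHomeomorph X (Cn n)} {z : Cn n}

theorem dz_chartChange (he : e ∈ atlas (Cn n) X) (he' : e' ∈ atlas (Cn n) X)
    (hz : z ∈ overlap e e') {f : Cn n → ℂ} (hf : DifferentiableAt ℝ f (chartChange e e' z))
    (j : Fin n) : dz j (fun w => f (chartChange e e' w)) z =
      ∑ i, jac e e' z i j * dz i f (chartChange e e' z) :=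
  dz_comp (hasFDerivAt_chartChange he he' hz) hf j

theorem dzbar_chartChange (he : e ∈ atlas (Cn n) X) (he' : e' ∈ atlas (Cn n) X)
    (hz : z ∈ overlap e e') {f : Cn n → ℂ} (hf : DifferentiableAt ℝ f (chartChange e e' z))
    (j : Fin n) : dzbar j (fun w => f (chartChange e e' w)) z =
      ∑ i, star (jac e e' z i j) * dzbar i f (chartChange e e' z) :=
  dzbar_comp (hasFDerivAt_chartChange he he' hz) hf j

theorem differentiableAt_chartChange (he : e ∈ atlas (Cn n) X) (he' : e' ∈ atlas (Cn n) X)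
    (hz : z ∈ overlap e e') : DifferentiableAt ℝ (chartChange e e') z :=
  ((hasFDerivAt_chartChange he he' hz).restrictScalars ℝ).differentiableAt

theorem differentiableAt_jac (he : e ∈ atlas (Cn n) X) (he' : e' ∈ atlas (Cn n) X)
    (hz : z ∈ overlap e e') (i j : Fin n) : DifferentiableAt ℂ (fun w => jac e e' w i j) z :=
  ((contDiffOn_jac he he' i j).contDiffAt
    ((isOpen_overlap e e').mem_nhds hz)).differentiableAt (by simp)

theorem differentiableAt_star {f : Cn n → ℂ} (hf : DifferentiableAt ℝ f z) :
    DifferentiableAt ℝ (fun w => star (f w)) z :=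
  Complex.conjCLE.differentiableAt.comp z hf

/-- The complex Hessian of a composition with a holomorphic change of coordinates. -/
theorem hess_chartChange (he : e ∈ atlas (Cn n) X) (he' : e' ∈ atlas (Cn n) X)
    (hz : z ∈ overlap e e') {f : Cn n → ℂ} (hf : ContDiffOn ℝ ∞ f (overlap e' e)) :
    (Matrix.of fun j k => dz j (dzbar k fun w => f (chartChange e e' w)) z) =
      (jac e e' z)ᵀ * (Matrix.of fun j k => dz j (dzbar k f) (chartChange e e' z)) *
        conjM (jac e e' z) := by
  ext j k
  have hU := isOpen_overlap e' e
  have h1 : dzbar k (fun w => f (chartChange e e' w)) =ᶠ[nhds z] fun w =>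
      ∑ i, star (jac e e' w i k) * dzbar i f (chartChange e e' w) := by
    filter_upwards [(isOpen_overlap e e').mem_nhds hz] with w hw
    exact dzbar_chartChange he he' hw (hf.differentiableAt_of_isOpen hU (chartChange_mem hw)) k
  have hd : ∀ i, DifferentiableAt ℝ (dzbar i f) (chartChange e e' z) := fun i =>
    (hf.dzbar hU i).differentiableAt_of_isOpen hU (chartChange_mem hz)
  have hdc : ∀ i, DifferentiableAt ℝ (fun w => dzbar i f (chartChange e e' w)) z := fun i =>
    (hd i).comp z (differentiableAt_chartChange he he' hz)
  have hj : ∀ i, DifferentiableAt ℝ (fun w => star (jac e e' w i k)) z := fun i =>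
    differentiableAt_star ((differentiableAt_jac he he' hz i k).restrictScalars ℝ)
  rw [Matrix.of_apply, dz_congr h1, dz_sum fun i _ => (hj i).fun_mul (hdc i)]
  simp only [Matrix.mul_apply, Matrix.transpose_apply, Matrix.of_apply, conjM, Matrix.map_apply,
    Finset.sum_mul]
  refine Finset.sum_congr rfl fun i _ => ?_
  rw [dz_mul (hj i) (hdc i), dz_conj,
    dzbar_eq_zero_of_differentiableAt (differentiableAt_jac he he' hz i k), star_zero, zero_mul,
    add_zero, dz_chartChange he he' hz (hd i), Finset.mul_sum]
  refine Finset.sum_congr rfl fun l _ => ?_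
  rw [starRingEnd_apply]; ring

theorem overlap_subset : overlap e e' ⊆ e.target := fun _ h => h.1

theorem isTensor_hess {u : X → ℂ} (hu : CSmooth n u) : IsTensor (hess u : ChartMat n X) := by
  intro e he e' he' z hz
  refine Eq.trans ?_ (hess_chartChange he he' hz (f := fun w => u (e'.symm w))
    ((hu e' he').mono overlap_subset))
  ext j k
  simp only [Matrix.of_apply]
  refine dz_congr ?_ j
  filter_upwards [(isOpen_overlap e e').mem_nhds hz] with w hw
  exact dzbar_congr (comp_symm_eventuallyEq u hw) k

theorem isTensor_gradMat {u v : X → ℂ} (hu : CSmooth n u) (hv : CSmooth n v) :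
    IsTensor (gradMat u v : ChartMat n X) := by
  intro e he e' he' z hz
  ext j k
  simp only [gradMat, Matrix.of_apply, Matrix.mul_apply, Matrix.transpose_apply, conjM,
    Matrix.map_apply, Finset.sum_mul]
  rw [dz_congr (comp_symm_eventuallyEq u hz), dzbar_congr (comp_symm_eventuallyEq v hz),
    dz_chartChange he he' hz (f := fun w => u (e'.symm w))
      (differentiableAt_comp_symm hu he' (chartChange_mem hz).1),
    dzbar_chartChange he he' hz (f := fun w => v (e'.symm w))
      (differentiableAt_comp_symm hv he' (chartChange_mem hz).1), Finset.mul_sum]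
  refine Finset.sum_congr rfl fun i _ => ?_
  rw [Finset.sum_mul]
  refine Finset.sum_congr rfl fun l _ => ?_
  rw [starRingEnd_apply]; ring

theorem isClosed11_hess {u : X → ℂ} (hu : CSmooth n u) : IsClosed11 (hess u : ChartMat n X) where
  tensor := isTensor_hess hu
  smooth e he j k := ((hu e he).dzbar e.open_target k).dz e.open_target j
  dz_symm e he _ hz l j k := dz_hess_symm e.open_target (hu e he) hz l j k
  dzbar_symm e he _ hz l j k := dzbar_hess_symm e.open_target (hu e he) hz l j k

/-! #### The coefficients of closed real forms -/

theorem type11_inChart {η : DForm n 2 X}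
    (hη : ∀ (x : X) (v w : Cn n), η x ![Complex.I • v, Complex.I • w] = η x ![v, w])
    (he : e ∈ atlas (Cn n) X) (hz : z ∈ e.target) : IsType11 (inChart η e z) := by
  intro v w
  have h : ∀ a b : Cn n, inChart η e z ![a, b] =
      η (e.symm z) ![chartFrame e z a, chartFrame e z b] := by
    intro a b
    rw [inChart, ContinuousAlternatingMap.compContinuousLinearMap_apply]
    congr 1
    ext i; fin_cases i <;> rfl
  rw [h, h, chartFrame_eq he hz]
  simp only [ContinuousLinearMap.coe_restrictScalars', map_smul, hη]

theorem isTensor_cf {η : DForm n 2 X}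
    (hη : ∀ (x : X) (v w : Cn n), η x ![Complex.I • v, Complex.I • w] = η x ![v, w]) :
    IsTensor (cf η) := by
  intro e he e' he' z hz
  rw [cf, inChart_eq η he he' hz,
    coeff_compContinuousLinearMap (type11_inChart hη he' (chartChange_mem hz).1)]
  rfl

theorem differentiableAt_apply {k : ℕ} {F : Cn n → Cn n [⋀^Fin k]→L[ℝ] ℝ}
    (hF : DifferentiableAt ℝ F z) (v : Fin k → Cn n) : DifferentiableAt ℝ (fun w => F w v) z :=
  (ContinuousAlternatingMap.apply ℝ (Cn n) ℝ v).differentiableAt.comp z hF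

theorem contDiffOn_apply {k : ℕ} {F : Cn n → Cn n [⋀^Fin k]→L[ℝ] ℝ} {U : Set (Cn n)}
    (hF : ContDiffOn ℝ ∞ F U) (v : Fin k → Cn n) : ContDiffOn ℝ ∞ (fun w => F w v) U :=
  (ContinuousAlternatingMap.apply ℝ (Cn n) ℝ v).contDiff.comp_contDiffOn hF

/-- The derivative of `w ↦ F w (b, c)` in the direction `a`. -/
def dirDeriv (F : Cn n → Cn n [⋀^Fin 2]→L[ℝ] ℝ) (z a b c : Cn n) : ℝ :=
  fderiv ℝ (fun w => F w ![b, c]) z a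

theorem extDeriv_two_apply {F : Cn n → Cn n [⋀^Fin 2]→L[ℝ] ℝ} (hF : DifferentiableAt ℝ F z)
    (a b c : Cn n) : extDeriv F z ![a, b, c] =
      dirDeriv F z a b c - dirDeriv F z b a c + dirDeriv F z c a b := by
  rw [extDeriv_apply hF, Fin.sum_univ_three]
  have h0 : Fin.removeNth (0 : Fin 3) ![a, b, c] = ![b, c] := by
    ext i; fin_cases i <;> rfl
  have h1 : Fin.removeNth (1 : Fin 3) ![a, b, c] = ![a, c] := by
    ext i; fin_cases i <;> rfl
  have h2 : Fin.removeNth (2 : Fin 3) ![a, b, c] = ![a, b] := by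
    ext i; fin_cases i <;> rfl
  rw [h0, h1, h2]
  simp [dirDeriv]
  ring

theorem fderiv_ofReal {f : Cn n → ℝ} (hf : DifferentiableAt ℝ f z) (v : Cn n) :
    fderiv ℝ (fun w => (f w : ℂ)) z v = (fderiv ℝ f z v : ℂ) := by
  have := (Complex.ofRealCLM.hasFDerivAt.comp z hf.hasFDerivAt).fderiv
  have h2 : fderiv ℝ (fun w => (f w : ℂ)) z = Complex.ofRealCLM.comp (fderiv ℝ f z) := this
  rw [h2]; rfl

theorem fderiv_coeff {F : Cn n → Cn n [⋀^Fin 2]→L[ℝ] ℝ} (hF : DifferentiableAt ℝ F z)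
    (j k : Fin n) (v : Cn n) : fderiv ℝ (fun w => coeff (F w) j k) z v =
      ((dirDeriv F z v (basisVec j) (Complex.I • basisVec k) : ℂ) -
        Complex.I * (dirDeriv F z v (basisVec j) (basisVec k) : ℂ)) / 2 := by
  have hd : ∀ u : Fin 2 → Cn n, DifferentiableAt ℝ (fun w => ((F w u : ℝ) : ℂ)) z := fun u =>
    Complex.ofRealCLM.differentiableAt.comp z (differentiableAt_apply hF u)
  have h := (((hd ![basisVec j, Complex.I • basisVec k]).hasFDerivAt.fun_sub
    ((hd ![basisVec j, basisVec k]).hasFDerivAt.const_mul Complex.I)).mul_const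
      ((2 : ℂ)⁻¹)).fderiv
  have e : (fun w => coeff (F w) j k) = fun w => (((F w ![basisVec j, Complex.I • basisVec k] : ℝ) : ℂ)
      - Complex.I * ((F w ![basisVec j, basisVec k] : ℝ) : ℂ)) * (2 : ℂ)⁻¹ := by
    ext w
    simp only [coeff, Matrix.of_apply, div_eq_mul_inv]
  rw [e, h]
  simp only [smul_apply, sub_apply, smul_eq_mul]
  rw [fderiv_ofReal (differentiableAt_apply hF _), fderiv_ofReal (differentiableAt_apply hF _)]
  simp only [dirDeriv]
  ring

theorem dirDeriv_I {F : Cn n → Cn n [⋀^Fin 2]→L[ℝ] ℝ} (hF : ∀ᶠ w in nhds z, IsType11 (F w))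
    (a b c : Cn n) : dirDeriv F z a (Complex.I • b) (Complex.I • c) = dirDeriv F z a b c := by
  have : (fun w => F w ![Complex.I • b, Complex.I • c]) =ᶠ[nhds z] fun w => F w ![b, c] :=
    hF.mono fun w hw => hw b c
  rw [dirDeriv, this.fderiv_eq, dirDeriv]

theorem dirDeriv_I_left {F : Cn n → Cn n [⋀^Fin 2]→L[ℝ] ℝ}
    (hF : ∀ᶠ w in nhds z, IsType11 (F w)) (a b c : Cn n) :
    dirDeriv F z a (Complex.I • b) c = -dirDeriv F z a b (Complex.I • c) := by
  have : (fun w => F w ![Complex.I • b, c]) =ᶠ[nhds z] fun w => -F w ![b, Complex.I • c] :=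
    hF.mono fun w hw => alt_I_left hw b c
  rw [dirDeriv, this.fderiv_eq, fderiv_fun_neg]
  rfl

theorem dz_coeff_symm {F : Cn n → Cn n [⋀^Fin 2]→L[ℝ] ℝ} (hF : DifferentiableAt ℝ F z)
    (h11 : ∀ᶠ w in nhds z, IsType11 (F w)) (hcl : extDeriv F z = 0) (l j k : Fin n) :
    dz l (fun w => coeff (F w) j k) z = dz j (fun w => coeff (F w) l k) z := by
  have hc : ∀ a b c : Cn n,
      dirDeriv F z a b c - dirDeriv F z b a c + dirDeriv F z c a b = 0 := by
    intro a b c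
    rw [← extDeriv_two_apply hF, hcl]; rfl
  set L : Cn n := basisVec l
  set J : Cn n := basisVec j
  set K : Cn n := basisVec k
  have r1 := hc L J (Complex.I • K)
  have r2 := hc (Complex.I • L) (Complex.I • J) (Complex.I • K)
  have r3 := hc L J K
  have r4 := hc (Complex.I • L) (Complex.I • J) K
  rw [dirDeriv_I h11, dirDeriv_I h11, dirDeriv_I h11] at r2
  rw [dirDeriv_I h11, dirDeriv_I_left h11, dirDeriv_I_left h11] at r4
  rw [dz, dz, fderiv_coeff hF, fderiv_coeff hF, fderiv_coeff hF, fderiv_coeff hF]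
  have r1' := congrArg (Complex.ofReal) r1
  have r2' := congrArg (Complex.ofReal) r2
  have r3' := congrArg (Complex.ofReal) r3
  have r4' := congrArg (Complex.ofReal) r4
  push_cast at r1' r2' r3' r4'
  linear_combination (1 / 4 : ℂ) * r1' - (1 / 4 : ℂ) * r2' - (Complex.I / 4) * r3' +
    (Complex.I / 4) * r4' + ((dirDeriv F z (Complex.I • L) J K : ℂ) -
      (dirDeriv F z (Complex.I • J) L K : ℂ)) / 4 * Complex.I_sq

theorem isClosed11_cf {η : DForm n 2 X} (hη : IsClosedReal11 η) : IsClosed11 (cf η) := by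
  have h11 : ∀ e ∈ atlas (Cn n) X, ∀ z ∈ e.target, ∀ᶠ w in nhds z, IsType11 (inChart η e w) := by
    intro e he z hz
    filter_upwards [e.open_target.mem_nhds hz] with w hw
    exact type11_inChart hη.type11 he hw
  have hd : ∀ e ∈ atlas (Cn n) X, ∀ z ∈ e.target, DifferentiableAt ℝ (inChart η e) z := by
    intro e he z hz
    exact (inChart_contDiffAt hη.smooth he hz).differentiableAt (by simp)
  have hcl : ∀ e ∈ atlas (Cn n) X, ∀ z ∈ e.target, extDeriv (inChart η e) z = 0 := by
    intro e he z hz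
    rw [← inChart_dForm hη.smooth he hz, hη.closed]
    rfl
  have h1 : ∀ e ∈ atlas (Cn n) X, ∀ z ∈ e.target, ∀ l j k,
      dz l (fun w => cf η e w j k) z = dz j (fun w => cf η e w l k) z := fun e he z hz l j k =>
    dz_coeff_symm (hd e he z hz) (h11 e he z hz) (hcl e he z hz) l j k
  have hherm : ∀ e ∈ atlas (Cn n) X, ∀ z ∈ e.target, ∀ j k,
      (fun w => cf η e w j k) =ᶠ[nhds z] fun w => star (cf η e w k j) := by
    intro e he z hz j k
    filter_upwards [h11 e he z hz] with w hw
    exact ((coeff_isHermitian hw).apply j k).symm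
  refine ⟨isTensor_cf hη.type11, ?_, h1, ?_⟩
  · intro e he j k
    have h := fun v => Complex.ofRealCLM.contDiff.comp_contDiffOn
      (contDiffOn_apply (hη.smooth e he) v)
    exact ((h ![basisVec j, Complex.I • basisVec k]).sub
      (contDiffOn_const.mul (h ![basisVec j, basisVec k]))).div_const 2
  · intro e he z hz l j k
    rw [dzbar_congr (hherm e he z hz j k), dzbar_congr (hherm e he z hz j l), dzbar_conj,
      dzbar_conj, h1 e he z hz l k j]

theorem posDef_cf {Ω : DForm n 2 X} (hΩ : IsKahlerForm Ω) (he : e ∈ atlas (Cn n) X)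
    (hz : z ∈ e.target) : (cf Ω e z).PosDef := by
  refine coeff_posDef (type11_inChart hΩ.type11 he hz) fun v hv => ?_
  have h : inChart Ω e z ![v, Complex.I • v] =
      Ω (e.symm z) ![chartFrame e z v, Complex.I • chartFrame e z v] := by
    rw [inChart, ContinuousAlternatingMap.compContinuousLinearMap_apply]
    congr 1
    have := chartFrame_eq he hz
    ext i; fin_cases i
    · rfl
    · simp [this]
  rw [h]
  refine hΩ.pos _ _ ?_
  set c := chartAt (Cn n) (e.symm z)
  have hov : z ∈ overlap e c := ⟨hz, mem_chart_source _ _⟩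
  have hca : c ∈ atlas (Cn n) X := chart_mem_atlas _ _
  intro h0
  have h1 := fderiv_chartChange_comp he hca he hov (by rw [overlap_self]; exact hz)
  rw [fderiv_chartChange_self hz] at h1
  have h2 := congrArg (fun L : Cn n →L[ℂ] Cn n => L v) h1
  rw [chartFrame_eq he hz] at h0
  have h0' : fderiv ℂ (chartChange e c) z v = 0 := h0
  refine hv (h2.trans ?_)
  rw [ContinuousLinearMap.comp_apply, h0', map_zero]

end Holomorphic

end Tensors

/-! ### Smoothness of matrix expressions -/

section MatrixSmooth

variable {V : Type*} [NormedAddCommGroup V] [NormedSpace ℝ V] {n : ℕ} {s : Set V}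
  {K L : V → Matrix (Fin n) (Fin n) ℂ}

theorem contDiffOn_det (h : ∀ j k, ContDiffOn ℝ ∞ (fun q => K q j k) s) :
    ContDiffOn ℝ ∞ (fun q => (K q).det) s := by
  simp only [Matrix.det_apply']
  exact ContDiffOn.sum fun σ _ => contDiffOn_const.mul (contDiffOn_prod fun i _ => h _ _)

theorem contDiffOn_adjugate (h : ∀ j k, ContDiffOn ℝ ∞ (fun q => K q j k) s) (k j : Fin n) :
    ContDiffOn ℝ ∞ (fun q => (K q).adjugate k j) s := by
  simp only [Matrix.adjugate_apply]
  refine contDiffOn_det fun i m => ?_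
  by_cases hi : i = j
  · subst hi; simpa using contDiffOn_const
  · simpa [Matrix.updateRow_ne hi] using h i m

theorem contDiffOn_inv (h : ∀ j k, ContDiffOn ℝ ∞ (fun q => K q j k) s)
    (h0 : ∀ q ∈ s, (K q).det ≠ 0) (k j : Fin n) :
    ContDiffOn ℝ ∞ (fun q => (K q)⁻¹ k j) s := by
  simp only [Matrix.inv_def, Matrix.smul_apply, Ring.inverse_eq_inv', smul_eq_mul]
  exact ((contDiffOn_det h).inv h0).mul (contDiffOn_adjugate h k j)

theorem contDiffOn_mul (h : ∀ j k, ContDiffOn ℝ ∞ (fun q => K q j k) s)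
    (h' : ∀ j k, ContDiffOn ℝ ∞ (fun q => L q j k) s) (j k : Fin n) :
    ContDiffOn ℝ ∞ (fun q => (K q * L q) j k) s := by
  simp only [Matrix.mul_apply]
  exact ContDiffOn.sum fun i _ => (h _ _).mul (h' _ _)

theorem contDiffOn_trace (h : ∀ j k, ContDiffOn ℝ ∞ (fun q => K q j k) s) :
    ContDiffOn ℝ ∞ (fun q => (K q).trace) s := by
  simp only [Matrix.trace, Matrix.diag]
  exact ContDiffOn.sum fun i _ => h _ _

theorem contDiffOn_adjDeriv (h : ∀ j k, ContDiffOn ℝ ∞ (fun q => K q j k) s)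
    (h' : ∀ j k, ContDiffOn ℝ ∞ (fun q => L q j k) s) (h0 : ∀ q ∈ s, (K q).det ≠ 0) (j k : Fin n) :
    ContDiffOn ℝ ∞ (fun q => adjDeriv (K q) (L q) j k) s := by
  simp only [adjDeriv, Matrix.smul_apply, Matrix.sub_apply, smul_eq_mul]
  have hi := contDiffOn_inv h h0
  exact (contDiffOn_det h).mul (((contDiffOn_trace (contDiffOn_mul hi h')).mul (hi j k)).sub
    (contDiffOn_mul (contDiffOn_mul hi h') hi j k))

theorem contDiffOn_logDet (h : ∀ j k, ContDiffOn ℝ ∞ (fun q => K q j k) s)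
    (h0 : ∀ q ∈ s, (K q).PosDef) :
    ContDiffOn ℝ ∞ (fun q => ((Real.log (K q).det.re : ℝ) : ℂ)) s := by
  have h1 : ContDiffOn ℝ ∞ (fun q => (K q).det.re) s :=
    Complex.reCLM.contDiff.comp_contDiffOn (contDiffOn_det h)
  exact Complex.ofRealCLM.contDiff.comp_contDiffOn
    (h1.log fun q hq => ((Complex.lt_def.1 (h0 q hq).det_pos).1).ne')

end MatrixSmooth

theorem PosDef.det_eq_re {n : ℕ} {G : Matrix (Fin n) (Fin n) ℂ} (hG : G.PosDef) :
    G.det = (G.det.re : ℂ) := by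
  have := (Complex.lt_def.1 hG.det_pos).2
  apply Complex.ext
  · simp
  · simpa using this.symm

theorem PosDef.det_re_pos {n : ℕ} {G : Matrix (Fin n) (Fin n) ℂ} (hG : G.PosDef) :
    0 < G.det.re := (Complex.lt_def.1 hG.det_pos).1

theorem PosDef.cexp_logDet {n : ℕ} {G : Matrix (Fin n) (Fin n) ℂ} (hG : G.PosDef) :
    Complex.exp ((Real.log G.det.re : ℝ) : ℂ) = G.det := by
  rw [← Complex.ofReal_exp, Real.exp_log (PosDef.det_re_pos hG), ← PosDef.det_eq_re hG]

section Invariants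

variable {n : ℕ} {X : Type*} [TopologicalSpace X] [ChartedSpace (Cn n) X]

/-! ### Functions given by their expressions in charts -/

/-- The function on `X` whose value at `x` is read off from an expression in the preferred chart. -/
def glue (F : OpenPartialHomeomorph X (Cn n) → Cn n → ℂ) (x : X) : ℂ :=
  F (chartAt (Cn n) x) (chartAt (Cn n) x x)

/-- Expressions in charts that are compatible with changes of charts. -/
def IsInvariant (F : OpenPartialHomeomorph X (Cn n) → Cn n → ℂ) : Prop :=
  ∀ e ∈ atlas (Cn n) X, ∀ e' ∈ atlas (Cn n) X, ∀ z ∈ overlap e e',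
    F e z = F e' (chartChange e e' z)

variable {e e' : OpenPartialHomeomorph X (Cn n)} {z : Cn n}

theorem glue_symm {F : OpenPartialHomeomorph X (Cn n) → Cn n → ℂ} (hF : IsInvariant F)
    (he : e ∈ atlas (Cn n) X) (hz : z ∈ e.target) : glue F (e.symm z) = F e z := by
  rw [hF e he _ (chart_mem_atlas _ (e.symm z)) z ⟨hz, mem_chart_source _ _⟩]
  rfl

theorem cSmooth_glue {F : OpenPartialHomeomorph X (Cn n) → Cn n → ℂ} (hF : IsInvariant F)
    (h : ∀ e ∈ atlas (Cn n) X, ContDiffOn ℝ ∞ (F e) e.target) : CSmooth n (glue F) := fun e he =>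
  (h e he).congr fun _ hz => glue_symm hF he hz

/-- Positivity of a `(1,1)`-form. -/
def IsPosMat (G : ChartMat n X) : Prop :=
  ∀ e ∈ atlas (Cn n) X, ∀ z ∈ e.target, (G e z).PosDef

/-- The transformation law of the coefficients of an `(n-1,n-1)`-form, such as the adjugate of the
coefficient matrix of a `(1,1)`-form. -/
def IsCotensor (N : ChartMat n X) : Prop :=
  ∀ e ∈ atlas (Cn n) X, ∀ e' ∈ atlas (Cn n) X, ∀ z ∈ overlap e e',
    conjM (jac e e' z) * N e z * (jac e e' z)ᵀ =
      ((jac e e' z).det * star (jac e e' z).det) • N e' (chartChange e e' z)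

/-- Smooth closed complex `(n-1,n-1)`-forms, in terms of their coefficient matrices. -/
structure IsCoclosed (N : ChartMat n X) : Prop where
  cotensor : IsCotensor N
  smooth : ∀ e ∈ atlas (Cn n) X, ∀ j k, ContDiffOn ℝ ∞ (fun z => N e z j k) e.target
  sum_dz : ∀ e ∈ atlas (Cn n) X, ∀ z ∈ e.target, ∀ k, ∑ j, dz j (fun w => N e w k j) z = 0
  sum_dzbar : ∀ e ∈ atlas (Cn n) X, ∀ z ∈ e.target, ∀ j, ∑ k, dzbar k (fun w => N e w k j) z = 0

section Matrices

theorem IsTensor.det {K : ChartMat n X} (hK : IsTensor K) (he : e ∈ atlas (Cn n) X)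
    (he' : e' ∈ atlas (Cn n) X) (hz : z ∈ overlap e e') : (K e z).det =
      ((jac e e' z).det * star (jac e e' z).det) * (K e' (chartChange e e' z)).det := by
  rw [hK e he e' he' z hz, Matrix.det_mul, Matrix.det_mul, Matrix.det_transpose, det_conjM]
  ring

theorem IsTensor.adjugate {K : ChartMat n X} (hK : IsTensor K) :
    IsCotensor fun e z => (K e z).adjugate := by
  intro e he e' he' z hz
  simp only
  rw [hK e he e' he' z hz, Matrix.adjugate_mul_distrib, Matrix.adjugate_mul_distrib]
  simp only [Matrix.mul_assoc]
  rw [Matrix.adjugate_mul, Matrix.det_transpose, ← Matrix.mul_assoc, Matrix.mul_adjugate, det_conjM]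
  simp only [Matrix.mul_smul, Matrix.smul_mul, Matrix.one_mul, Matrix.mul_one, smul_smul]

theorem IsClosed11.adjugate {K : ChartMat n X} (hK : IsClosed11 K) :
    IsCoclosed fun e z => (K e z).adjugate where
  cotensor := hK.tensor.adjugate
  smooth e he j k := contDiffOn_adjugate (hK.smooth e he) j k
  sum_dz e he z hz k := sum_dz_adjugate (hK.differentiableAt he hz) (hK.dz_symm e he z hz) k
  sum_dzbar e he z hz j :=
    sum_dzbar_adjugate (hK.differentiableAt he hz) (hK.dzbar_symm e he z hz) j

end Matrices

section Holomorphic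

variable [IsManifold 𝓘(ℂ, Cn n) ω X]

theorem IsTensor.isInvariant_det_div {K G : ChartMat n X} (hK : IsTensor K) (hG : IsTensor G) :
    IsInvariant fun e z => (K e z).det / (G e z).det := by
  intro e he e' he' z hz
  simp only
  rw [hK.det he he' hz, hG.det he he' hz, mul_div_mul_left]
  have := det_jac_ne_zero he he' hz
  exact mul_ne_zero this (star_ne_zero.2 this)

theorem IsCotensor.isInvariant_trace_div {N L G : ChartMat n X} (hN : IsCotensor N)
    (hL : IsTensor L) (hG : IsTensor G) :
    IsInvariant fun e z => (N e z * L e z).trace / (G e z).det := by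
  intro e he e' he' z hz
  simp only
  have h1 : (N e z * L e z).trace = ((jac e e' z).det * star (jac e e' z).det) *
      (N e' (chartChange e e' z) * L e' (chartChange e e' z)).trace := by
    rw [hL e he e' he' z hz, ← Matrix.mul_assoc, Matrix.trace_mul_comm]
    have h2 := hN e he e' he' z hz
    rw [show conjM (jac e e' z) * (N e z * ((jac e e' z)ᵀ * L e' (chartChange e e' z))) =
      conjM (jac e e' z) * N e z * (jac e e' z)ᵀ * L e' (chartChange e e' z) by
        simp only [Matrix.mul_assoc], h2, Matrix.smul_mul, Matrix.trace_smul, smul_eq_mul]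
  rw [h1, hG.det he he' hz, mul_div_mul_left]
  have := det_jac_ne_zero he he' hz
  exact mul_ne_zero this (star_ne_zero.2 this)

theorem trace_inv_mul_eq {G L : Matrix (Fin n) (Fin n) ℂ} (hG : G.det ≠ 0) :
    (G⁻¹ * L).trace = (G.adjugate * L).trace / G.det := by
  rw [adjugate_eq_det_smul_inv hG, Matrix.smul_mul, Matrix.trace_smul, smul_eq_mul,
    mul_div_cancel_left₀ _ hG]

theorem isInvariant_congr {F F' : OpenPartialHomeomorph X (Cn n) → Cn n → ℂ} (hF : IsInvariant F)
    (h : ∀ e ∈ atlas (Cn n) X, ∀ z ∈ e.target, F' e z = F e z) : IsInvariant F' := by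
  intro e he e' he' z hz
  rw [h e he z hz.1, h e' he' _ (chartChange_mem hz).1, hF e he e' he' z hz]

theorem IsTensor.isInvariant_trace_inv {L G : ChartMat n X} (hL : IsTensor L) (hG : IsTensor G)
    (hpos : IsPosMat G) : IsInvariant fun e z => ((G e z)⁻¹ * L e z).trace :=
  isInvariant_congr (hG.adjugate.isInvariant_trace_div hL hG) fun e he z hz =>
    trace_inv_mul_eq (hpos e he z hz).det_pos.ne'

/-! ### The Ricci form -/

/-- The coefficients of the Ricci form of the metric with coefficient matrices `G`. -/
def ricMat (G : ChartMat n X) : ChartMat n X := fun e z =>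
  Matrix.of fun j k => -dz j (dzbar k fun w => ((Real.log (G e w).det.re : ℝ) : ℂ)) z

theorem dz_dzbar_add {f g : Cn n → ℂ} {U : Set (Cn n)} (hU : IsOpen U) (hf : ContDiffOn ℝ ∞ f U)
    (hg : ContDiffOn ℝ ∞ g U) (hz : z ∈ U) (j k : Fin n) :
    dz j (dzbar k fun w => f w + g w) z = dz j (dzbar k f) z + dz j (dzbar k g) z := by
  have : dzbar k (fun w => f w + g w) =ᶠ[nhds z] fun w => dzbar k f w + dzbar k g w := by
    filter_upwards [hU.mem_nhds hz] with w hw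
    exact dzbar_add (hf.differentiableAt_of_isOpen hU hw) (hg.differentiableAt_of_isOpen hU hw) k
  rw [dz_congr this, dz_add ((hf.dzbar hU k).differentiableAt_of_isOpen hU hz)
    ((hg.dzbar hU k).differentiableAt_of_isOpen hU hz)]

/-- The logarithm of `|F|²` is pluriharmonic, for a holomorphic function `F` without zeros. -/
theorem dz_dzbar_log_normSq {F : Cn n → ℂ} {U : Set (Cn n)} (hU : IsOpen U)
    (hF : ContDiffOn ℂ ω F U) (h0 : ∀ w ∈ U, F w ≠ 0) (hz : z ∈ U) (j k : Fin n) :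
    dz j (dzbar k fun w => ((Real.log (Complex.normSq (F w)) : ℝ) : ℂ)) z = 0 := by
  have hFd : ∀ w ∈ U, DifferentiableAt ℂ F w := fun w hw =>
    (hF.contDiffAt (hU.mem_nhds hw)).differentiableAt (by simp)
  have hFr : ContDiffOn ℝ ∞ F U := (hF.restrict_scalars ℝ).of_le le_top
  have hu : ContDiffOn ℝ ∞ (fun w => ((Real.log (Complex.normSq (F w)) : ℝ) : ℂ)) U := by
    have h1 : ContDiffOn ℝ ∞ (fun w => Complex.normSq (F w)) U := by
      simp only [Complex.normSq_apply]
      have hre := Complex.reCLM.contDiff.comp_contDiffOn hFr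
      have him := Complex.imCLM.contDiff.comp_contDiffOn hFr
      exact (hre.mul hre).add (him.mul him)
    exact Complex.ofRealCLM.contDiff.comp_contDiffOn
      (h1.log fun w hw => (Complex.normSq_pos.2 (h0 w hw)).ne')
  have h1 : dzbar k (fun w => ((Real.log (Complex.normSq (F w)) : ℝ) : ℂ)) =ᶠ[nhds z]
      fun w => star (fderiv ℂ F w (basisVec k) / F w) := by
    filter_upwards [hU.mem_nhds hz] with w hw
    have hexp : (fun y => Complex.exp ((Real.log (Complex.normSq (F y)) : ℝ) : ℂ)) =ᶠ[nhds w]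
        fun y => F y * star (F y) := by
      filter_upwards [hU.mem_nhds hw] with y hy
      rw [← Complex.ofReal_exp, Real.exp_log (Complex.normSq_pos.2 (h0 y hy)), Complex.star_def,
        Complex.mul_conj]
    have h2 := dzbar_congr hexp k
    have hw0 : Complex.exp ((Real.log (Complex.normSq (F w)) : ℝ) : ℂ) = F w * star (F w) :=
      hexp.self_of_nhds
    rw [dzbar_cexp (hu.differentiableAt_of_isOpen hU hw), hw0,
      dzbar_mul ((hFd w hw).restrictScalars ℝ) (differentiableAt_star ((hFd w hw).restrictScalars ℝ)),
      dzbar_eq_zero_of_differentiableAt (hFd w hw), zero_mul, add_zero, dzbar_conj] at h2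
    have h3 : dz k F w = fderiv ℂ F w (basisVec k) := by
      rw [((hFd w hw).hasFDerivAt.restrictScalars ℝ).dz_eq, wz]
      simp only [ContinuousLinearMap.coe_restrictScalars', map_smul, smul_eq_mul]
      linear_combination (-(fderiv ℂ F w) (basisVec k) / 2) * Complex.I_sq
    rw [h3] at h2
    have hs : star (F w) ≠ 0 := star_ne_zero.2 (h0 w hw)
    rw [star_div₀, eq_div_iff hs]
    refine mul_left_cancel₀ (h0 w hw) ?_
    rw [← h2]; ring
  rw [dz_congr h1, dz_conj, dzbar_eq_zero_of_differentiableAt, star_zero]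
  have h4 : ContDiffOn ℂ ω (fun w => fderiv ℂ F w (basisVec k)) U :=
    (hF.fderiv_of_isOpen (m := ω) hU (by simp)).clm_apply contDiffOn_const
  simp only [div_eq_mul_inv]
  exact ((h4.contDiffAt (hU.mem_nhds hz)).differentiableAt (by simp)).mul
    ((hFd z hz).fun_inv (h0 z hz))

theorem isClosed11_ricMat {G : ChartMat n X} (hG : IsClosed11 G) (hpos : IsPosMat G) :
    IsClosed11 (ricMat G) := by
  have hlog : ∀ e ∈ atlas (Cn n) X,
      ContDiffOn ℝ ∞ (fun w => ((Real.log (G e w).det.re : ℝ) : ℂ)) e.target := fun e he =>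
    contDiffOn_logDet (hG.smooth e he) (hpos e he)
  have hsm : ∀ e ∈ atlas (Cn n) X, ∀ j k, ContDiffOn ℝ ∞ (fun z =>
      dz j (dzbar k fun w => ((Real.log (G e w).det.re : ℝ) : ℂ)) z) e.target := fun e he j k =>
    ((hlog e he).dzbar e.open_target k).dz e.open_target j
  have hneg : ∀ f : Cn n → ℂ, (fun w => -f w) = fun w => (-1 : ℂ) * f w := fun f =>
    funext fun w => by ring
  refine ⟨?_, fun e he j k => (hsm e he j k).neg, ?_, ?_⟩
  · intro e he e' he' z hz
    have hov := isOpen_overlap e e'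
    have hdet : ContDiffOn ℂ ω (fun w => (jac e e' w).det) (overlap e e') := by
      simp only [Matrix.det_apply']
      exact ContDiffOn.sum fun σ _ => contDiffOn_const.mul
        (contDiffOn_prod fun i _ => contDiffOn_jac he he' _ _)
    -- `log det` changes by `log |det J|²`, which is pluriharmonic as `det J` is holomorphic
    have h1 : ∀ w ∈ overlap e e', ((Real.log (G e w).det.re : ℝ) : ℂ) =
        ((Real.log (Complex.normSq (jac e e' w).det) : ℝ) : ℂ) +
          ((Real.log (G e' (chartChange e e' w)).det.re : ℝ) : ℂ) := by
      intro w hw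
      have hp := hpos e' he' _ (chartChange_mem hw).1
      have h2 : (G e w).det.re =
          Complex.normSq (jac e e' w).det * (G e' (chartChange e e' w)).det.re := by
        rw [hG.tensor.det he he' hw, Complex.star_def, Complex.mul_conj, Complex.re_ofReal_mul]
      rw [h2, Real.log_mul (Complex.normSq_pos.2 (det_jac_ne_zero he he' hw)).ne'
        (PosDef.det_re_pos hp).ne']
      push_cast; ring
    have hlog' : ContDiffOn ℝ ∞ (fun w => ((Real.log (G e' w).det.re : ℝ) : ℂ)) (overlap e' e) :=
      (hlog e' he').mono overlap_subset
    have h3 := hess_chartChange he he' hz hlog'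
    have h4 : ricMat G e' (chartChange e e' z) = -Matrix.of fun j k =>
        dz j (dzbar k fun w => ((Real.log (G e' w).det.re : ℝ) : ℂ)) (chartChange e e' z) := by
      ext j k; rfl
    rw [h4, Matrix.mul_neg, Matrix.neg_mul, ← h3]
    ext j k
    simp only [ricMat, Matrix.of_apply, Matrix.neg_apply, neg_inj]
    have hcomp : ContDiffOn ℝ ∞ (fun w => ((Real.log (G e' (chartChange e e' w)).det.re : ℝ) : ℂ))
        (overlap e e') :=
      ContDiffOn.comp (g := fun w => ((Real.log (G e' w).det.re : ℝ) : ℂ)) hlog'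
        (contDiffOn_real_chartChange he he') fun w hw => chartChange_mem hw
    have hn : ContDiffOn ℝ ∞ (fun w => ((Real.log (Complex.normSq (jac e e' w).det) : ℝ) : ℂ))
        (overlap e e') := by
      refine (((hlog e he).mono overlap_subset).sub hcomp).congr fun w hw => ?_
      rw [h1 w hw]; ring
    have h5 : (dzbar k fun w => ((Real.log (G e w).det.re : ℝ) : ℂ)) =ᶠ[nhds z]
        dzbar k fun w => ((Real.log (Complex.normSq (jac e e' w).det) : ℝ) : ℂ) +
          ((Real.log (G e' (chartChange e e' w)).det.re : ℝ) : ℂ) := by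
      filter_upwards [hov.mem_nhds hz] with w hw
      refine dzbar_congr ?_ k
      filter_upwards [hov.mem_nhds hw] with y hy
      exact h1 y hy
    rw [dz_congr h5, dz_dzbar_add hov hn hcomp hz, dz_dzbar_log_normSq hov hdet
      (fun w hw => det_jac_ne_zero he he' hw) hz, zero_add]
  · intro e he z hz l j k
    simp only [ricMat, Matrix.of_apply]
    rw [hneg, hneg, dz_const_mul ((hsm e he j k).differentiableAt_of_isOpen e.open_target hz),
      dz_const_mul ((hsm e he l k).differentiableAt_of_isOpen e.open_target hz),
      dz_hess_symm e.open_target (hlog e he) hz l j k]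
  · intro e he z hz l j k
    simp only [ricMat, Matrix.of_apply]
    rw [hneg, hneg, dzbar_const_mul ((hsm e he j k).differentiableAt_of_isOpen e.open_target hz),
      dzbar_const_mul ((hsm e he j l).differentiableAt_of_isOpen e.open_target hz),
      dzbar_hess_symm e.open_target (hlog e he) hz l j k]

end Holomorphic

end Invariants

section ExactForms

variable {n : ℕ} {X : Type*} [TopologicalSpace X] [ChartedSpace (Cn n) X]
variable {e e' : OpenPartialHomeomorph X (Cn n)} {z : Cn n}

/-! ### Exact forms and the form `i∂∂̄u` -/

/-- The derivative of `w ↦ F w (b)` in the direction `a`, for a `1`-form `F`. -/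
def dirDeriv1 (F : Cn n → Cn n [⋀^Fin 1]→L[ℝ] ℝ) (z a b : Cn n) : ℝ :=
  fderiv ℝ (fun w => F w ![b]) z a

theorem extDeriv_one_apply {F : Cn n → Cn n [⋀^Fin 1]→L[ℝ] ℝ} (hF : DifferentiableAt ℝ F z)
    (a b : Cn n) : extDeriv F z ![a, b] = dirDeriv1 F z a b - dirDeriv1 F z b a := by
  rw [extDeriv_apply hF, Fin.sum_univ_two]
  have h0 : Fin.removeNth (0 : Fin 2) ![a, b] = ![b] := by
    ext i; fin_cases i; rfl
  have h1 : Fin.removeNth (1 : Fin 2) ![a, b] = ![a] := by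
    ext i; fin_cases i; rfl
  rw [h0, h1]
  simp [dirDeriv1]
  ring

/-- The coefficients `a_k` of the `(1,0)`-part `∑ a_k dz_k` of a real `1`-form. -/
def coeff1 (η : Cn n [⋀^Fin 1]→L[ℝ] ℝ) (k : Fin n) : ℂ :=
  ((η ![basisVec k] : ℂ) - Complex.I * (η ![Complex.I • basisVec k] : ℂ)) / 2

theorem fderiv_coeff1 {F : Cn n → Cn n [⋀^Fin 1]→L[ℝ] ℝ} (hF : DifferentiableAt ℝ F z)
    (k : Fin n) (v : Cn n) : fderiv ℝ (fun w => coeff1 (F w) k) z v =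
      ((dirDeriv1 F z v (basisVec k) : ℂ) -
        Complex.I * (dirDeriv1 F z v (Complex.I • basisVec k) : ℂ)) / 2 := by
  have hd : ∀ u : Fin 1 → Cn n, DifferentiableAt ℝ (fun w => ((F w u : ℝ) : ℂ)) z := fun u =>
    Complex.ofRealCLM.differentiableAt.comp z (differentiableAt_apply hF u)
  have h := (((hd ![basisVec k]).hasFDerivAt.fun_sub
    ((hd ![Complex.I • basisVec k]).hasFDerivAt.const_mul Complex.I)).mul_const
      ((2 : ℂ)⁻¹)).fderiv
  have e : (fun w => coeff1 (F w) k) = fun w => (((F w ![basisVec k] : ℝ) : ℂ)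
      - Complex.I * ((F w ![Complex.I • basisVec k] : ℝ) : ℂ)) * (2 : ℂ)⁻¹ := by
    ext w
    simp only [coeff1, div_eq_mul_inv]
  rw [e, h]
  simp only [smul_apply, sub_apply, smul_eq_mul]
  rw [fderiv_ofReal (differentiableAt_apply hF _), fderiv_ofReal (differentiableAt_apply hF _)]
  simp only [dirDeriv1]
  ring

/-- The coefficients of `dξ` when it has type `(1,1)`: they are `-i ∂_j ā_k + i ∂_k̄ a_j`. -/
theorem coeff_extDeriv_one {F : Cn n → Cn n [⋀^Fin 1]→L[ℝ] ℝ} (hF : DifferentiableAt ℝ F z)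
    (h11 : IsType11 (extDeriv F z)) (j k : Fin n) :
    coeff (extDeriv F z) j k = -Complex.I * dz j (fun w => star (coeff1 (F w) k)) z +
      Complex.I * dzbar k (fun w => coeff1 (F w) j) z := by
  rw [dz_conj, dzbar, dzbar, fderiv_coeff1 hF, fderiv_coeff1 hF, fderiv_coeff1 hF,
    fderiv_coeff1 hF]
  simp only [coeff, Matrix.of_apply]
  have h1 := h11 (basisVec j) (basisVec k)
  have h2 := alt_I_left h11 (basisVec j) (basisVec k)
  simp only [extDeriv_one_apply hF] at h1 h2 ⊢
  have h1' := congrArg Complex.ofReal h1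
  have h2' := congrArg Complex.ofReal h2
  push_cast at h1' h2' ⊢
  simp only [Complex.star_def, map_div₀, map_add, map_sub, map_mul, Complex.conj_I,
    Complex.conj_ofReal, map_ofNat]
  generalize (dirDeriv1 F z (basisVec j) (basisVec k) : ℂ) = a1 at *
  generalize (dirDeriv1 F z (basisVec k) (basisVec j) : ℂ) = a2 at *
  generalize (dirDeriv1 F z (Complex.I • basisVec j) (basisVec k) : ℂ) = a3 at *
  generalize (dirDeriv1 F z (basisVec k) (Complex.I • basisVec j) : ℂ) = a4 at *
  generalize (dirDeriv1 F z (basisVec j) (Complex.I • basisVec k) : ℂ) = a5 at *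
  generalize (dirDeriv1 F z (Complex.I • basisVec k) (basisVec j) : ℂ) = a6 at *
  generalize (dirDeriv1 F z (Complex.I • basisVec j) (Complex.I • basisVec k) : ℂ) = a7 at *
  generalize (dirDeriv1 F z (Complex.I • basisVec k) (Complex.I • basisVec j) : ℂ) = a8 at *
  linear_combination (1 / 4 : ℂ) * h2' + (Complex.I / 4) * h1' -
    (-a5 + a3 + Complex.I * a7 - a4 + a6 - Complex.I * a8) / 4 * Complex.I_sq

theorem contDiffOn_coeff1 {F : Cn n → Cn n [⋀^Fin 1]→L[ℝ] ℝ} {U : Set (Cn n)}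
    (hF : ContDiffOn ℝ ∞ F U) (k : Fin n) : ContDiffOn ℝ ∞ (fun w => coeff1 (F w) k) U := by
  have h := fun v => Complex.ofRealCLM.contDiff.comp_contDiffOn (contDiffOn_apply hF v)
  exact ((h ![basisVec k]).sub (contDiffOn_const.mul (h ![Complex.I • basisVec k]))).div_const 2

theorem coeff1_comp (η : Cn n [⋀^Fin 1]→L[ℝ] ℝ) (T : Cn n →L[ℂ] Cn n) (k : Fin n) :
    coeff1 (η.compContinuousLinearMap (T.restrictScalars ℝ)) k =
      ∑ i, T (basisVec k) i * coeff1 η i := by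
  obtain ⟨L, hL⟩ : ∃ L : Cn n →L[ℝ] ℂ, ∀ v, L v = (η ![v] : ℂ) := by
    refine ⟨Complex.ofRealCLM.comp
      ((ContinuousAlternatingMap.ofSubsingleton ℝ (Cn n) ℝ (0 : Fin 1)).symm η), fun v => ?_⟩
    show ((η (fun _ => v) : ℝ) : ℂ) = _
    congr 2
    ext i; fin_cases i; rfl
  have h1 : ∀ i, coeff1 η i = wz i L := fun i => by rw [wz, hL, hL, coeff1]
  have h2 : coeff1 (η.compContinuousLinearMap (T.restrictScalars ℝ)) k =
      wz k (L.comp (T.restrictScalars ℝ)) := by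
    rw [wz, ContinuousLinearMap.comp_apply, ContinuousLinearMap.comp_apply, hL, hL, coeff1]
    have e : ∀ v : Cn n, (⇑(T.restrictScalars ℝ) ∘ ![v]) = ![T v] := by
      intro v; ext i; fin_cases i; rfl
    simp only [ContinuousAlternatingMap.compContinuousLinearMap_apply, e]
    rfl
  rw [h2, wz_comp]
  simp only [h1]

theorem fderiv_comp_fderiv_comm {g : Cn n → ℝ} (hg : ContDiffAt ℝ 2 g z) (v w : Cn n) :
    fderiv ℝ (fun y => fderiv ℝ g y v) z w = fderiv ℝ (fun y => fderiv ℝ g y w) z v := by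
  have hd : DifferentiableAt ℝ (fderiv ℝ g) z :=
    (hg.fderiv_right (m := 1) (by norm_num)).differentiableAt (by norm_num)
  rw [fderiv_clm_apply hd (differentiableAt_const v), fderiv_clm_apply hd (differentiableAt_const w)]
  have := (hg.isSymmSndFDerivAt (by simp)).eq v w
  simp [this]

/-- The `1`-form `v ↦ dg(i v)` on `ℂⁿ`. -/
def dJflat (g : Cn n → ℝ) (w : Cn n) : Cn n [⋀^Fin 1]→L[ℝ] ℝ :=
  ContinuousAlternatingMap.ofSubsingleton ℝ (Cn n) ℝ (0 : Fin 1) ((fderiv ℝ g w).comp (mulI n))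

theorem dirDeriv1_dJflat (g : Cn n → ℝ) (a b : Cn n) : dirDeriv1 (dJflat g) z a b =
    fderiv ℝ (fun y => fderiv ℝ g y (Complex.I • b)) z a := rfl

theorem type11_extDeriv_dJflat {g : Cn n → ℝ} (hg : ContDiffAt ℝ 2 g z)
    (hd : DifferentiableAt ℝ (dJflat g) z) : IsType11 (extDeriv (dJflat g) z) := by
  intro v w
  have hII : ∀ v : Cn n, Complex.I • Complex.I • v = -v := fun v => by
    rw [smul_smul, Complex.I_mul_I, neg_one_smul]
  simp only [extDeriv_one_apply hd, dirDeriv1_dJflat, hII, map_neg, fderiv_fun_neg]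
  simp only [neg_apply]
  rw [fderiv_comp_fderiv_comm hg w (Complex.I • v), fderiv_comp_fderiv_comm hg v (Complex.I • w)]
  ring

theorem coeff_extDeriv_dJflat {g : Cn n → ℝ} (hg : ContDiffAt ℝ 2 g z)
    (hd : DifferentiableAt ℝ (dJflat g) z) (j k : Fin n) :
    coeff ((-(1 / 2) : ℝ) • extDeriv (dJflat g) z) j k =
      dz j (dzbar k fun w => (g w : ℂ)) z := by
  have hII : ∀ v : Cn n, Complex.I • Complex.I • v = -v := fun v => by
    rw [smul_smul, Complex.I_mul_I, neg_one_smul]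
  have hgc : ContDiffAt ℝ 2 (fun w => (g w : ℂ)) z := Complex.ofRealCLM.contDiff.contDiffAt.comp z hg
  have hcomp : ∀ v w : Cn n, fderiv ℝ (fun y => fderiv ℝ (fun w => (g w : ℂ)) y v) z w =
      (fderiv ℝ (fun y => fderiv ℝ g y v) z w : ℂ) := by
    intro v w
    have h1 : (fun y => fderiv ℝ (fun w => (g w : ℂ)) y v) =ᶠ[nhds z]
        fun y => ((fderiv ℝ g y v : ℝ) : ℂ) := by
      have : ∀ᶠ y in nhds z, ContDiffAt ℝ 2 g y := hg.eventually (by simp)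
      filter_upwards [this] with y hy
      exact fderiv_ofReal (hy.differentiableAt (by simp)) v
    rw [h1.fderiv_eq, fderiv_ofReal]
    exact ((hg.fderiv_right (m := 1) (by norm_num)).differentiableAt (by norm_num)).clm_apply
      (differentiableAt_const v)
  rw [dz, fderiv_dzbar_apply hgc, fderiv_dzbar_apply hgc, hcomp, hcomp, hcomp, hcomp, coeff_smul]
  simp only [coeff, Matrix.smul_apply, Matrix.of_apply, extDeriv_one_apply hd, dirDeriv1_dJflat,
    hII, map_neg, fderiv_fun_neg, smul_eq_mul]
  simp only [neg_apply]
  rw [fderiv_comp_fderiv_comm hg (basisVec k) (basisVec j),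
    fderiv_comp_fderiv_comm hg (Complex.I • basisVec k) (basisVec j)]
  push_cast
  linear_combination (1 / 4 : ℂ) * (fderiv ℝ (fun y => fderiv ℝ g y (Complex.I • basisVec j)) z
    (Complex.I • basisVec k) : ℂ) * Complex.I_sq

section Holomorphic

variable [IsManifold 𝓘(ℂ, Cn n) ω X]

theorem diffAt_comp_chartFrame {F : Type*} [NormedAddCommGroup F] [NormedSpace ℝ F] {f : X → F}
    (he : e ∈ atlas (Cn n) X) (hz : z ∈ e.target)
    (hf : MDifferentiableAt 𝓘(ℝ, Cn n) 𝓘(ℝ, F) f (e.symm z)) :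
    (diffAt f (e.symm z)).comp (chartFrame e z) = fderiv ℝ (fun w => f (e.symm w)) z := by
  haveI := isManifold_real n X
  haveI : IsManifold 𝓘(ℝ, Cn n) 1 X := IsManifold.of_le (n := ∞) (by simp)
  have hmd : MDifferentiableAt 𝓘(ℝ, Cn n) 𝓘(ℝ, Cn n) e.symm z := mdifferentiableAt_atlas_symm he hz
  have := mfderiv_comp (I := 𝓘(ℝ, Cn n)) (I' := 𝓘(ℝ, Cn n)) (I'' := 𝓘(ℝ, F)) z hf hmd
  rw [mfderiv_eq_fderiv] at this
  exact this.symm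

theorem contMDiff_real {u : X → ℝ} (hu : CSmooth n fun x => (u x : ℂ)) :
    ContMDiff 𝓘(ℝ, Cn n) 𝓘(ℝ, ℝ) ∞ u :=
  Complex.reCLM.contDiff.contMDiff.comp (isSmoothFun_iff.2 hu)

theorem inChart_dJ {u : X → ℝ} (hu : CSmooth n fun x => (u x : ℂ)) (he : e ∈ atlas (Cn n) X)
    (hz : z ∈ e.target) : inChart (dJ n u) e z = dJflat (fun w => u (e.symm w)) z := by
  have h := diffAt_comp_chartFrame he hz (f := u)
    ((contMDiff_real hu).contMDiffAt.mdifferentiableAt (by simp))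
  ext v
  rw [dJflat, ← h]
  simp only [inChart, dJ, ContinuousAlternatingMap.compContinuousLinearMap_apply]
  have hI : chartFrame e z (Complex.I • v 0) = Complex.I • chartFrame e z (v 0) := by
    rw [chartFrame_eq he hz]
    simp only [ContinuousLinearMap.coe_restrictScalars', map_smul]
  show diffAt u (e.symm z) (Complex.I • chartFrame e z (v 0)) =
    diffAt u (e.symm z) (chartFrame e z (Complex.I • v 0))
  rw [hI]

theorem contDiffOn_real_symm {u : X → ℝ} (hu : CSmooth n fun x => (u x : ℂ))
    (he : e ∈ atlas (Cn n) X) : ContDiffOn ℝ ∞ (fun w => u (e.symm w)) e.target :=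
  Complex.reCLM.contDiff.comp_contDiffOn (hu e he)

theorem contDiffOn_dJflat {g : Cn n → ℝ} {U : Set (Cn n)} (hU : IsOpen U)
    (hg : ContDiffOn ℝ ∞ g U) : ContDiffOn ℝ ∞ (dJflat g) U :=
  (ContinuousAlternatingMap.ofSubsingletonLIE (𝕜 := ℝ) (E := Cn n) (F := ℝ)
    (0 : Fin 1)).contDiff.comp_contDiffOn ((hg.fderiv_of_isOpen (m := ∞) hU (by simp)).clm_comp contDiffOn_const)

theorem contDiffOn_extDeriv {k : ℕ} {F : Cn n → Cn n [⋀^Fin k]→L[ℝ] ℝ} {U : Set (Cn n)}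
    (hU : IsOpen U) (hF : ContDiffOn ℝ ∞ F U) : ContDiffOn ℝ ∞ (extDeriv F) U := by
  have h := hF.fderiv_of_isOpen (m := ∞) hU (by simp)
  exact (ContinuousAlternatingMap.alternatizeUncurryFinCLM ℝ (Cn n) ℝ).contDiff.comp_contDiffOn h

theorem isSmoothForm_dJ {u : X → ℝ} (hu : CSmooth n fun x => (u x : ℂ)) :
    IsSmoothForm (dJ n u) := fun e he =>
  (contDiffOn_dJflat e.open_target (contDiffOn_real_symm hu he)).congr fun _ hz =>
    inChart_dJ hu he hz

theorem isSmoothForm_dForm {k : ℕ} {ξ : DForm n k X} (hξ : IsSmoothForm ξ) :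
    IsSmoothForm (dForm ξ) := fun e he =>
  (contDiffOn_extDeriv e.open_target (hξ e he)).congr fun _ hz => inChart_dForm hξ he hz

theorem isSmoothForm_smul {k : ℕ} {ξ : DForm n k X} (hξ : IsSmoothForm ξ) (a : ℝ) :
    IsSmoothForm (a • ξ) := fun e he => (hξ e he).const_smul a

theorem isSmoothForm_add {k : ℕ} {ξ η : DForm n k X} (hξ : IsSmoothForm ξ)
    (hη : IsSmoothForm η) : IsSmoothForm (ξ + η) := fun e he => (hξ e he).add (hη e he)

theorem dForm_add {k : ℕ} {ξ η : DForm n k X} (hξ : IsSmoothForm ξ) (hη : IsSmoothForm η) :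
    dForm (ξ + η) = dForm ξ + dForm η := by
  ext1 x
  have hd : ∀ {ζ : DForm n k X}, IsSmoothForm ζ →
      DifferentiableAt ℝ (inChart ζ (chartAt (Cn n) x)) (chartAt (Cn n) x x) := fun hζ =>
    (inChart_contDiffAt hζ (chart_mem_atlas _ _) (mem_chart_target _ _)).differentiableAt (by simp)
  rw [dForm, inChart_add, extDeriv_add (hd hξ) (hd hη)]
  rfl

theorem dForm_smul {k : ℕ} (ξ : DForm n k X) (a : ℝ) : dForm (a • ξ) = a • dForm ξ := by
  ext1 x
  rw [dForm, inChart_smul, extDeriv_smul]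
  rfl

theorem dForm_dForm {k : ℕ} {ξ : DForm n k X} (hξ : IsSmoothForm ξ) : dForm (dForm ξ) = 0 := by
  ext1 x
  have hx := mem_chart_target (Cn n) x
  have hc : chartAt (Cn n) x ∈ atlas (Cn n) X := chart_mem_atlas _ _
  have h1 : inChart (dForm ξ) (chartAt (Cn n) x) =ᶠ[nhds (chartAt (Cn n) x x)]
      extDeriv (inChart ξ (chartAt (Cn n) x)) := by
    filter_upwards [(chartAt (Cn n) x).open_target.mem_nhds hx] with w hw
    exact inChart_dForm hξ hc hw
  rw [dForm, h1.extDeriv_eq, extDeriv_extDeriv_apply (inChart_contDiffAt hξ hc hx)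
    (by simpa using two_le_smooth)]
  rfl

theorem inChart_iddbar {u : X → ℝ} (hu : CSmooth n fun x => (u x : ℂ)) (he : e ∈ atlas (Cn n) X)
    (hz : z ∈ e.target) : inChart (iddbar n u) e z =
      (-(1 / 2) : ℝ) • extDeriv (dJflat fun w => u (e.symm w)) z := by
  rw [iddbar, inChart_smul, Pi.smul_apply, inChart_dForm (isSmoothForm_dJ hu) he hz]
  congr 1
  refine Filter.EventuallyEq.extDeriv_eq ?_
  filter_upwards [e.open_target.mem_nhds hz] with w hw
  exact inChart_dJ hu he hw

theorem differentiableAt_dJflat {u : X → ℝ} (hu : CSmooth n fun x => (u x : ℂ))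
    (he : e ∈ atlas (Cn n) X) (hz : z ∈ e.target) :
    DifferentiableAt ℝ (dJflat fun w => u (e.symm w)) z :=
  ((contDiffOn_dJflat e.open_target (contDiffOn_real_symm hu he)).contDiffAt
    (e.open_target.mem_nhds hz)).differentiableAt (by simp)

theorem contDiffAt_two_real_symm {u : X → ℝ} (hu : CSmooth n fun x => (u x : ℂ))
    (he : e ∈ atlas (Cn n) X) (hz : z ∈ e.target) :
    ContDiffAt ℝ 2 (fun w => u (e.symm w)) z :=
  ((contDiffOn_real_symm hu he).contDiffAt (e.open_target.mem_nhds hz)).of_le two_le_smooth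

theorem cf_iddbar {u : X → ℝ} (hu : CSmooth n fun x => (u x : ℂ)) (he : e ∈ atlas (Cn n) X)
    (hz : z ∈ e.target) : cf (iddbar n u) e z = hess (fun x => (u x : ℂ)) e z := by
  ext j k
  rw [cf, inChart_iddbar hu he hz, coeff_extDeriv_dJflat (contDiffAt_two_real_symm hu he hz)
    (differentiableAt_dJflat hu he hz)]
  rfl

theorem isClosedReal11_iddbar {u : X → ℝ} (hu : CSmooth n fun x => (u x : ℂ)) :
    IsClosedReal11 (iddbar n u) where
  smooth := isSmoothForm_smul (isSmoothForm_dForm (isSmoothForm_dJ hu)) _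
  type11 x v w := by
    have hc : chartAt (Cn n) x ∈ atlas (Cn n) X := chart_mem_atlas _ _
    have hx := mem_chart_target (Cn n) x
    rw [← inChart_chartAt (iddbar n u) x, inChart_iddbar hu hc hx]
    have := type11_extDeriv_dJflat (contDiffAt_two_real_symm hu hc hx)
      (differentiableAt_dJflat hu hc hx) v w
    simp only [ContinuousAlternatingMap.smul_apply, this]
  closed := by rw [iddbar, dForm_smul, dForm_dForm (isSmoothForm_dJ hu), smul_zero]

theorem isExactForm_iddbar {u : X → ℝ} (hu : CSmooth n fun x => (u x : ℂ)) :
    IsExactForm (iddbar n u) :=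
  ⟨(-(1 / 2) : ℝ) • dJ n u, isSmoothForm_smul (isSmoothForm_dJ hu) _, by
    rw [dForm_smul, iddbar]⟩

theorem IsExactForm.add {k : ℕ} {ξ η : DForm n (k + 1) X} (hξ : IsExactForm ξ)
    (hη : IsExactForm η) : IsExactForm (ξ + η) := by
  obtain ⟨a, ha, rfl⟩ := hξ
  obtain ⟨b, hb, rfl⟩ := hη
  exact ⟨a + b, isSmoothForm_add ha hb, (dForm_add ha hb).symm⟩

theorem IsClosedReal11.add {ξ η : DForm n 2 X} (hξ : IsClosedReal11 ξ) (hη : IsClosedReal11 η) :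
    IsClosedReal11 (ξ + η) where
  smooth := isSmoothForm_add hξ.smooth hη.smooth
  type11 x v w := by
    simp only [Pi.add_apply, ContinuousAlternatingMap.add_apply, hξ.type11, hη.type11]
  closed := by rw [dForm_add hξ.smooth hη.smooth, hξ.closed, hη.closed, add_zero]

theorem IsClosedReal11.smul {ξ : DForm n 2 X} (hξ : IsClosedReal11 ξ) (a : ℝ) :
    IsClosedReal11 (a • ξ) where
  smooth := isSmoothForm_smul hξ.smooth a
  type11 x v w := by
    simp only [Pi.smul_apply, ContinuousAlternatingMap.smul_apply, hξ.type11]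
  closed := by rw [dForm_smul, hξ.closed, smul_zero]

end Holomorphic

end ExactForms

/-! ### The volume measure of a Kähler form -/

section Volume

open MeasureTheory

variable {n : ℕ} {X : Type*} [TopologicalSpace X] [ChartedSpace (Cn n) X]
variable {F : Type*} [NormedAddCommGroup F] [NormedSpace ℝ F]
variable {e e' : OpenPartialHomeomorph X (Cn n)} {z : Cn n}

/-- The density `2ⁿ n! det(g)` of `Ωⁿ` in a chart. -/
def volWeight (Ω : DForm n 2 X) (e : OpenPartialHomeomorph X (Cn n)) (z : Cn n) : ℝ :=
  2 ^ n * (n.factorial : ℝ) * (cf Ω e z).det.re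

theorem integrableOn_chart {K : Set X} (hK : IsCompact K) (hKe : K ⊆ e.source) {k : Cn n → F}
    (hk : ContinuousOn k e.target) (h0 : ∀ z ∈ e.target, e.symm z ∉ K → k z = 0) :
    IntegrableOn k e.target := by
  have h1 : IsCompact (e '' K) := hK.image_of_continuousOn (e.continuousOn.mono hKe)
  have h2 : e '' K ⊆ e.target := by
    rintro _ ⟨x, hx, rfl⟩
    exact e.map_source (hKe hx)
  refine ((hk.mono h2).integrableOn_compact h1).of_forall_sdiff_eq_zero
    e.open_target.measurableSet ?_
  intro z hz
  refine h0 z hz.1 fun h => hz.2 ⟨_, h, e.right_inv hz.1⟩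

section Holomorphic

variable [IsManifold 𝓘(ℂ, Cn n) ω X]

theorem contDiffOn_volWeight {Ω : DForm n 2 X} (hΩ : IsClosedReal11 Ω)
    (he : e ∈ atlas (Cn n) X) : ContDiffOn ℝ ∞ (volWeight Ω e) e.target :=
  contDiffOn_const.mul (Complex.reCLM.contDiff.comp_contDiffOn
    (contDiffOn_det ((isClosed11_cf hΩ).smooth e he)))

theorem volWeight_pos {Ω : DForm n 2 X} (hΩ : IsKahlerForm Ω) (he : e ∈ atlas (Cn n) X)
    (hz : z ∈ e.target) : 0 < volWeight Ω e z := by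
  have := PosDef.det_re_pos (posDef_cf hΩ he hz)
  unfold volWeight
  positivity

theorem abs_det_fderiv_chartChange :
    |((fderiv ℂ (chartChange e e') z).restrictScalars ℝ).det| =
      Complex.normSq (jac e e' z).det := by
  have h1 : ((fderiv ℂ (chartChange e e') z).restrictScalars ℝ).det =
      Algebra.norm ℝ (LinearMap.det (fderiv ℂ (chartChange e e') z : Cn n →ₗ[ℂ] Cn n)) :=
    LinearMap.det_restrictScalars
  have h2 : jac e e' z =
      LinearMap.toMatrix' (fderiv ℂ (chartChange e e') z : Cn n →ₗ[ℂ] Cn n) := by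
    ext i j
    simp [jac, LinearMap.toMatrix'_apply, basisVec, Pi.single]
  rw [h1, h2, LinearMap.det_toMatrix', Algebra.norm_complex_apply]
  exact abs_of_nonneg (Complex.normSq_nonneg _)

theorem volWeight_chartChange {Ω : DForm n 2 X} (hΩ : IsClosedReal11 Ω)
    (he : e ∈ atlas (Cn n) X) (he' : e' ∈ atlas (Cn n) X) (hz : z ∈ overlap e e') :
    volWeight Ω e z =
      Complex.normSq (jac e e' z).det * volWeight Ω e' (chartChange e e' z) := by
  rw [volWeight, (isTensor_cf hΩ.type11).det he he' hz, Complex.star_def, Complex.mul_conj,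
    Complex.re_ofReal_mul, volWeight]
  ring

theorem chartChange_image_overlap : chartChange e e' '' overlap e e' = overlap e' e := by
  ext y
  constructor
  · rintro ⟨w, hw, rfl⟩
    exact chartChange_mem hw
  · intro hy
    exact ⟨chartChange e' e y, chartChange_mem hy, chartChange_chartChange hy⟩

variable [T2Space X] [CompactSpace X]

/-- The indices of the nonzero members of the partition of unity. -/
def pouIndex (n : ℕ) (X : Type*) [TopologicalSpace X] [ChartedSpace (Cn n) X]
    [IsManifold 𝓘(ℂ, Cn n) ω X] [T2Space X] [CompactSpace X] : Finset X :=
  ((pou n X).locallyFinite.finite_nonempty_of_compact).toFinset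

theorem pou_eq_zero_of_notMem {i : X} (hi : i ∉ pouIndex n X) (x : X) : pou n X i x = 0 := by
  by_contra h
  exact hi ((Set.Finite.mem_toFinset _).2 ⟨x, h⟩)

theorem sum_pou (x : X) : ∑ i ∈ pouIndex n X, pou n X i x = 1 := by
  rw [← (pou n X).sum_eq_one (Set.mem_univ x)]
  refine (finsum_eq_sum_of_support_subset _ fun i hi => ?_).symm
  by_contra h
  exact hi (pou_eq_zero_of_notMem h x)

theorem pou_eq_zero_of_notMem_source {i x : X} (hx : x ∉ (chartAt (Cn n) i).source) :
    pou n X i x = 0 :=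
  image_eq_zero_of_notMem_tsupport fun h => hx (pou_isSubordinate i h)

theorem cSmooth_pou (i : X) : CSmooth n fun x => ((pou n X i x : ℝ) : ℂ) := by
  haveI := isManifold_real n X
  exact isSmoothFun_iff.1 (Complex.ofRealCLM.contDiff.contMDiff.comp (pou n X i).contMDiff)

theorem contDiffOn_pou (i : X) (he : e ∈ atlas (Cn n) X) :
    ContDiffOn ℝ ∞ (fun z => pou n X i (e.symm z)) e.target :=
  Complex.reCLM.contDiff.comp_contDiffOn (cSmooth_pou i e he)

theorem volIntegral_eq_sum (Ω : DForm n 2 X) (f : X → F) : volIntegral Ω f =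
    ∑ i ∈ pouIndex n X, ∫ z in (chartAt (Cn n) i).target,
      (pou n X i ((chartAt (Cn n) i).symm z) * volWeight Ω (chartAt (Cn n) i) z) •
        f ((chartAt (Cn n) i).symm z) := by
  refine finsum_eq_sum_of_support_subset _ fun i hi => ?_
  by_contra h
  refine hi ?_
  simp [pou_eq_zero_of_notMem h]

theorem integrableOn_pou {Ω : DForm n 2 X} (hΩ : IsClosedReal11 Ω) {f : X → F}
    (hf : Continuous f) (i : X) : IntegrableOn (fun z =>
      (pou n X i ((chartAt (Cn n) i).symm z) * volWeight Ω (chartAt (Cn n) i) z) •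
        f ((chartAt (Cn n) i).symm z)) (chartAt (Cn n) i).target := by
  have hc := chart_mem_atlas (Cn n) i
  refine integrableOn_chart (isClosed_tsupport (pou n X i)).isCompact (pou_isSubordinate i)
    (((contDiffOn_pou i hc).continuousOn.mul (contDiffOn_volWeight hΩ hc).continuousOn).smul
      (hf.comp_continuousOn (chartAt (Cn n) i).continuousOn_symm)) fun z _ h => ?_
  rw [image_eq_zero_of_notMem_tsupport h]
  simp

variable [MeasurableSpace X] [BorelSpace X]

/-- The measure `Ωⁿ` on `X`. -/
def volMeasure (Ω : DForm n 2 X) : Measure X :=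
  ∑ i ∈ pouIndex n X, ((volume.restrict (chartAt (Cn n) i).target).withDensity fun z =>
    ENNReal.ofReal (pou n X i ((chartAt (Cn n) i).symm z) *
      volWeight Ω (chartAt (Cn n) i) z)).map (chartAt (Cn n) i).symm

theorem aemeasurable_pou {Ω : DForm n 2 X} (hΩ : IsClosedReal11 Ω) (i : X) :
    AEMeasurable (fun z => ENNReal.ofReal (pou n X i ((chartAt (Cn n) i).symm z) *
      volWeight Ω (chartAt (Cn n) i) z)) (volume.restrict (chartAt (Cn n) i).target) :=
  ENNReal.measurable_ofReal.comp_aemeasurable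
    (((contDiffOn_pou i (chart_mem_atlas (Cn n) i)).continuousOn.mul
      (contDiffOn_volWeight hΩ (chart_mem_atlas (Cn n) i)).continuousOn).aemeasurable
      (chartAt (Cn n) i).open_target.measurableSet)

theorem aemeasurable_symm (i : X) (d : Cn n → ENNReal) : AEMeasurable (chartAt (Cn n) i).symm
    ((volume.restrict (chartAt (Cn n) i).target).withDensity d) :=
  ((chartAt (Cn n) i).continuousOn_symm.aemeasurable
    (chartAt (Cn n) i).open_target.measurableSet).mono_ac (withDensity_absolutelyContinuous _ _)

theorem isFiniteMeasure_volMeasure {Ω : DForm n 2 X} (hΩ : IsKahlerForm Ω) :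
    IsFiniteMeasure (volMeasure Ω) := by
  haveI : ∀ i : X, IsFiniteMeasure ((volume.restrict (chartAt (Cn n) i).target).withDensity fun z =>
      ENNReal.ofReal (pou n X i ((chartAt (Cn n) i).symm z) *
        volWeight Ω (chartAt (Cn n) i) z)) := by
    intro i
    have h := integrableOn_pou hΩ.toIsClosedReal11 (f := fun _ => (1 : ℝ)) continuous_const i
    simp only [smul_eq_mul, mul_one] at h
    exact isFiniteMeasure_withDensity_ofReal h.2
  rw [volMeasure]
  infer_instance

theorem _root_.Continuous.integrable_volMeasure {Ω : DForm n 2 X} (hΩ : IsKahlerForm Ω) {f : X → F}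
    (hf : Continuous f) : Integrable f (volMeasure Ω) := by
  haveI := isFiniteMeasure_volMeasure hΩ
  exact hf.integrable_of_hasCompactSupport (HasCompactSupport.of_compactSpace f)

theorem integral_volMeasure {Ω : DForm n 2 X} (hΩ : IsKahlerForm Ω) {f : X → F}
    (hf : Continuous f) : ∫ x, f x ∂volMeasure Ω = ∑ i ∈ pouIndex n X,
      ∫ z in (chartAt (Cn n) i).target,
        (pou n X i ((chartAt (Cn n) i).symm z) * volWeight Ω (chartAt (Cn n) i) z) •
          f ((chartAt (Cn n) i).symm z) := by
  have hint := hf.integrable_volMeasure hΩ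
  rw [volMeasure, integral_finsetSum_measure]
  · refine Finset.sum_congr rfl fun i hi => ?_
    have hm := aemeasurable_pou hΩ.toIsClosedReal11 i
    have hsm : AEStronglyMeasurable f (((volume.restrict (chartAt (Cn n) i).target).withDensity
        fun z => ENNReal.ofReal (pou n X i ((chartAt (Cn n) i).symm z) *
          volWeight Ω (chartAt (Cn n) i) z)).map (chartAt (Cn n) i).symm) :=
      hint.aestronglyMeasurable.mono_measure (Finset.single_le_sum
        (f := fun i => ((volume.restrict (chartAt (Cn n) i).target).withDensity
        fun z => ENNReal.ofReal (pou n X i ((chartAt (Cn n) i).symm z) *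
          volWeight Ω (chartAt (Cn n) i) z)).map (chartAt (Cn n) i).symm)
        (fun _ _ => Measure.zero_le _) hi)
    rw [integral_map (aemeasurable_symm i _) hsm, integral_withDensity_eq_integral_toReal_smul₀ hm
      (by simp)]
    refine setIntegral_congr_fun (chartAt (Cn n) i).open_target.measurableSet fun z hz => ?_
    rw [ENNReal.toReal_ofReal]
    exact mul_nonneg ((pou n X).nonneg i _) (volWeight_pos hΩ (chart_mem_atlas _ _) hz).le
  · intro i hi
    exact hint.mono_measure (Finset.single_le_sum
        (f := fun i => ((volume.restrict (chartAt (Cn n) i).target).withDensity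
        fun z => ENNReal.ofReal (pou n X i ((chartAt (Cn n) i).symm z) *
          volWeight Ω (chartAt (Cn n) i) z)).map (chartAt (Cn n) i).symm)
        (fun _ _ => Measure.zero_le _) hi)

/-- The ratio `Ωⁿ / Ω₀ⁿ`. -/
def volRatio (Ω₀ Ω : DForm n 2 X) : X → ℂ :=
  glue fun e z => (cf Ω e z).det / (cf Ω₀ e z).det

theorem volRatio_symm {Ω₀ Ω : DForm n 2 X} (hΩ₀ : IsKahlerForm Ω₀) (hΩ : IsKahlerForm Ω)
    (he : e ∈ atlas (Cn n) X) (hz : z ∈ e.target) :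
    volRatio Ω₀ Ω (e.symm z) = (cf Ω e z).det / (cf Ω₀ e z).det :=
  glue_symm ((isTensor_cf hΩ.type11).isInvariant_det_div (isTensor_cf hΩ₀.type11)) he hz

/-- Integrals against `Ωⁿ`, in terms of the measure of a reference Kähler form. -/
theorem volIntegral_eq {Ω₀ Ω : DForm n 2 X} (hΩ₀ : IsKahlerForm Ω₀) (hΩ : IsKahlerForm Ω)
    {f : X → F} (hf : Continuous f) :
    volIntegral Ω f = ∫ x, (volRatio Ω₀ Ω x).re • f x ∂volMeasure Ω₀ := by
  have hc : Continuous fun x => (volRatio Ω₀ Ω x).re := by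
    refine Complex.continuous_re.comp (CSmooth.continuous (n := n) (cSmooth_glue
      ((isTensor_cf hΩ.type11).isInvariant_det_div (isTensor_cf hΩ₀.type11)) fun e he => ?_))
    simp only [div_eq_mul_inv]
    exact (contDiffOn_det ((isClosed11_cf hΩ.toIsClosedReal11).smooth e he)).mul
      ((contDiffOn_det ((isClosed11_cf hΩ₀.toIsClosedReal11).smooth e he)).inv fun z hz =>
        (posDef_cf hΩ₀ he hz).det_pos.ne')
  rw [integral_volMeasure hΩ₀ (f := fun x => (volRatio Ω₀ Ω x).re • f x) (hc.smul hf), volIntegral_eq_sum]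
  refine Finset.sum_congr rfl fun i _ => setIntegral_congr_fun
    (chartAt (Cn n) i).open_target.measurableSet fun z hz => ?_
  have he := chart_mem_atlas (Cn n) i
  rw [volRatio_symm hΩ₀ hΩ he hz, smul_smul, volWeight, volWeight]
  congr 1
  have h0 := posDef_cf hΩ₀ he hz
  have h1 := posDef_cf hΩ he hz
  rw [PosDef.det_eq_re h0, PosDef.det_eq_re h1, ← Complex.ofReal_div, Complex.ofReal_re,
    Complex.ofReal_re, Complex.ofReal_re]
  have := (PosDef.det_re_pos h0).ne'
  field_simp

/-- The integral of a function supported in the domain of a chart, computed in that chart. -/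
theorem integral_eq_chart {Ω : DForm n 2 X} (hΩ : IsKahlerForm Ω) {f : X → F}
    (hf : Continuous f) (he : e ∈ atlas (Cn n) X) (h0 : ∀ x ∉ e.source, f x = 0) :
    ∫ x, f x ∂volMeasure Ω = ∫ z in e.target, volWeight Ω e z • f (e.symm z) := by
  have hΩ' := hΩ.toIsClosedReal11
  set A : X → Cn n → F := fun i z =>
    (pou n X i ((chartAt (Cn n) i).symm z) * volWeight Ω (chartAt (Cn n) i) z) •
      f ((chartAt (Cn n) i).symm z) with hA
  set B : X → Cn n → F := fun i z =>
    (pou n X i (e.symm z) * volWeight Ω e z) • f (e.symm z) with hB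
  have hA0 : ∀ i, ∀ z ∈ (chartAt (Cn n) i).target \ overlap (chartAt (Cn n) i) e, A i z = 0 := by
    intro i z hz
    have : (chartAt (Cn n) i).symm z ∉ e.source := fun h => hz.2 ⟨hz.1, h⟩
    simp only [hA, h0 _ this, smul_zero]
  have hB0 : ∀ i, ∀ z ∈ e.target \ overlap e (chartAt (Cn n) i), B i z = 0 := by
    intro i z hz
    have : e.symm z ∉ (chartAt (Cn n) i).source := fun h => hz.2 ⟨hz.1, h⟩
    simp only [hB, pou_eq_zero_of_notMem_source this, zero_mul, zero_smul]
  have hd : ∀ i, ∀ z ∈ overlap e (chartAt (Cn n) i),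
      HasFDerivWithinAt (chartChange e (chartAt (Cn n) i))
        ((fderiv ℂ (chartChange e (chartAt (Cn n) i)) z).restrictScalars ℝ)
        (overlap e (chartAt (Cn n) i)) z := fun i z hz =>
    ((hasFDerivAt_chartChange he (chart_mem_atlas _ _) hz).restrictScalars ℝ).hasFDerivWithinAt
  have hinj : ∀ i, Set.InjOn (chartChange e (chartAt (Cn n) i))
      (overlap e (chartAt (Cn n) i)) := by
    intro i z hz w hw h
    rw [← chartChange_chartChange hz, h, chartChange_chartChange hw]
  have hAB : ∀ i, ∀ z ∈ overlap e (chartAt (Cn n) i),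
      |((fderiv ℂ (chartChange e (chartAt (Cn n) i)) z).restrictScalars ℝ).det| •
        A i (chartChange e (chartAt (Cn n) i) z) = B i z := by
    intro i z hz
    simp only [hA, hB]
    rw [abs_det_fderiv_chartChange, symm_chartChange hz,
      volWeight_chartChange hΩ' he (chart_mem_atlas _ _) hz, smul_smul]
    congr 1; ring
  have hmeas : ∀ i, MeasurableSet (overlap e (chartAt (Cn n) i)) := fun i =>
    (isOpen_overlap _ _).measurableSet
  have hBint : ∀ i, IntegrableOn (B i) e.target := by
    intro i
    have h1 : IntegrableOn (A i) (overlap (chartAt (Cn n) i) e) :=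
      (integrableOn_pou hΩ' hf i).mono_set overlap_subset
    rw [← chartChange_image_overlap, integrableOn_image_iff_integrableOn_abs_det_fderiv_smul
      volume (hmeas i) (hd i) (hinj i)] at h1
    refine IntegrableOn.of_forall_sdiff_eq_zero (h1.congr_fun (hAB i) (hmeas i))
      e.open_target.measurableSet (hB0 i)
  have hI : ∀ i, ∫ z in (chartAt (Cn n) i).target, A i z = ∫ z in e.target, B i z := by
    intro i
    rw [setIntegral_eq_of_subset_of_forall_sdiff_eq_zero
        (chartAt (Cn n) i).open_target.measurableSet overlap_subset (hA0 i),
      setIntegral_eq_of_subset_of_forall_sdiff_eq_zero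
        e.open_target.measurableSet overlap_subset (hB0 i),
      ← chartChange_image_overlap, integral_image_eq_integral_abs_det_fderiv_smul
      volume (hmeas i) (hd i) (hinj i)]
    exact setIntegral_congr_fun (hmeas i) (hAB i)
  rw [integral_volMeasure hΩ hf, Finset.sum_congr rfl fun i _ => hI i,
    ← integral_finsetSum _ fun i _ => hBint i]
  refine setIntegral_congr_fun e.open_target.measurableSet fun z _ => ?_
  simp only [hB]
  rw [← Finset.sum_smul, ← Finset.sum_mul, sum_pou, one_mul]

theorem isOpenPosMeasure_volMeasure {Ω : DForm n 2 X} (hΩ : IsKahlerForm Ω) :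
    (volMeasure Ω).IsOpenPosMeasure := by
  refine ⟨fun U hU hne h0 => ?_⟩
  obtain ⟨x, hx⟩ := hne
  obtain ⟨i, hi, hix⟩ : ∃ i ∈ pouIndex n X, pou n X i x ≠ 0 :=
    Finset.exists_ne_zero_of_sum_ne_zero (by rw [sum_pou]; exact one_ne_zero)
  set c := chartAt (Cn n) i with hc
  have hca : c ∈ atlas (Cn n) X := chart_mem_atlas _ _
  have hxc : x ∈ c.source := by
    by_contra h
    exact hix (pou_eq_zero_of_notMem_source h)
  set d : Cn n → ENNReal := fun z => ENNReal.ofReal (pou n X i (c.symm z) * volWeight Ω c z) with hd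
  have h1 : (((volume.restrict c.target).withDensity d).map c.symm) U = 0 := by
    refine le_antisymm (le_trans ?_ h0.le) zero_le
    exact (Finset.single_le_sum (f := fun i => ((volume.restrict
        (chartAt (Cn n) i).target).withDensity
        fun z => ENNReal.ofReal (pou n X i ((chartAt (Cn n) i).symm z) *
          volWeight Ω (chartAt (Cn n) i) z)).map (chartAt (Cn n) i).symm)
        (fun _ _ => Measure.zero_le _) hi) U
  rw [Measure.map_apply_of_aemeasurable (aemeasurable_symm i _) hU.measurableSet] at h1
  set V : Set (Cn n) := c.target ∩ c.symm ⁻¹' (U ∩ {y | pou n X i y ≠ 0}) with hV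
  have hVo : IsOpen V := c.isOpen_inter_preimage_symm
    (hU.inter (isOpen_ne_fun (pou n X i).contMDiff.continuous continuous_const))
  have hVne : V.Nonempty := ⟨c x, c.map_source hxc,
    Set.mem_preimage.2 (by rw [c.left_inv hxc]; exact ⟨hx, hix⟩)⟩
  have h2 : (volume.restrict c.target).withDensity d V = 0 :=
    measure_mono_null (fun y hy => hy.2.1) h1
  rw [withDensity_apply _ hVo.measurableSet, Measure.restrict_restrict hVo.measurableSet,
    Set.inter_eq_left.2 (fun y hy => hy.1)] at h2
  have h3 : ∀ᵐ y ∂volume.restrict V, d y = 0 := by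
    refine (lintegral_eq_zero_iff' ?_).1 h2
    exact (aemeasurable_pou hΩ.toIsClosedReal11 i).mono_measure
      (Measure.restrict_mono (fun y hy => hy.1) le_rfl)
  rw [ae_restrict_iff' hVo.measurableSet] at h3
  have h4 : volume V = 0 := by
    refine measure_mono_null (fun y hy => ?_) h3
    intro h
    have h5 := h hy
    rw [hd, ENNReal.ofReal_eq_zero] at h5
    have h6 : 0 < pou n X i (c.symm y) := lt_of_le_of_ne ((pou n X).nonneg i _) (Ne.symm hy.2.2)
    exact absurd h5 (not_le.2 (mul_pos h6 (volWeight_pos hΩ hca hy.1)))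
  exact (hVo.measure_pos volume hVne).ne' h4

end Holomorphic

end Volume

/-! ### The divergence theorem and integration by parts -/

section Divergence

open MeasureTheory

variable {n : ℕ} {X : Type*} [TopologicalSpace X] [ChartedSpace (Cn n) X]
variable {e e' : OpenPartialHomeomorph X (Cn n)} {z : Cn n}

theorem contDiff_indicator_chart {K : Set X} (hK : IsCompact K) (hKe : K ⊆ e.source)
    {k : Cn n → ℂ} (hk : ContDiffOn ℝ ∞ k e.target)
    (h0 : ∀ z ∈ e.target, e.symm z ∉ K → k z = 0) :
    ContDiff ℝ ∞ (e.target.indicator k) ∧ HasCompactSupport (e.target.indicator k) := by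
  have h1 : IsCompact (e '' K) := hK.image_of_continuousOn (e.continuousOn.mono hKe)
  have hz : ∀ z ∉ e '' K, e.target.indicator k z = 0 := by
    intro z hz
    by_cases hzt : z ∈ e.target
    · rw [Set.indicator_of_mem hzt]
      exact h0 z hzt fun h => hz ⟨_, h, e.right_inv hzt⟩
    · exact Set.indicator_of_notMem hzt _
  refine ⟨contDiff_iff_contDiffAt.2 fun z => ?_, HasCompactSupport.intro h1 hz⟩
  by_cases hzK : z ∈ e '' K
  · have hzt : z ∈ e.target := by
      obtain ⟨x, hx, rfl⟩ := hzK
      exact e.map_source (hKe hx)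
    refine (hk.contDiffAt (e.open_target.mem_nhds hzt)).congr_of_eventuallyEq ?_
    filter_upwards [e.open_target.mem_nhds hzt] with w hw
    exact Set.indicator_of_mem hw _
  · refine (contDiffAt_const (c := (0 : ℂ))).congr_of_eventuallyEq ?_
    filter_upwards [h1.isClosed.isOpen_compl.mem_nhds hzK] with w hw
    exact hz w hw

theorem integral_fderiv_eq_zero {k : Cn n → ℂ} (hk : ContDiff ℝ ∞ k) (hc : HasCompactSupport k)
    (v : Cn n) : ∫ z, fderiv ℝ k z v = 0 := by
  have hd : Continuous fun z => fderiv ℝ k z v :=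
    (hk.continuous_fderiv (by simp)).clm_apply continuous_const
  have h := integral_smul_fderiv_eq_neg_fderiv_smul_of_integrable (𝕜 := ℝ) (f := fun _ : Cn n => (1 : ℝ))
    (g := k) (v := v) (μ := volume) (by simp) (by
      simpa using hd.integrable_of_hasCompactSupport (hc.fderiv_apply ℝ v))
    (by simpa using hk.continuous.integrable_of_hasCompactSupport hc)
    (fun _ _ => differentiableAt_const _)
    (fun _ _ => hk.differentiable (by simp) _)
  simpa using h

theorem integral_fderiv_chart {K : Set X} (hK : IsCompact K) (hKe : K ⊆ e.source)
    {k : Cn n → ℂ} (hk : ContDiffOn ℝ ∞ k e.target)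
    (h0 : ∀ z ∈ e.target, e.symm z ∉ K → k z = 0) (v : Cn n) :
    IntegrableOn (fun z => fderiv ℝ k z v) e.target ∧ ∫ z in e.target, fderiv ℝ k z v = 0 := by
  obtain ⟨h1, h2⟩ := contDiff_indicator_chart hK hKe hk h0
  have hd : Continuous fun z => fderiv ℝ (e.target.indicator k) z v :=
    (h1.continuous_fderiv (by simp)).clm_apply continuous_const
  have hi : Integrable fun z => fderiv ℝ (e.target.indicator k) z v :=
    hd.integrable_of_hasCompactSupport (h2.fderiv_apply ℝ v)
  have heq : ∀ z ∈ e.target, fderiv ℝ (e.target.indicator k) z v = fderiv ℝ k z v := by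
    intro z hz
    have : e.target.indicator k =ᶠ[nhds z] k := by
      filter_upwards [e.open_target.mem_nhds hz] with w hw
      exact Set.indicator_of_mem hw _
    rw [this.fderiv_eq]
  refine ⟨(hi.integrableOn (s := e.target)).congr_fun heq e.open_target.measurableSet, ?_⟩
  rw [← setIntegral_congr_fun e.open_target.measurableSet heq, ← integral_fderiv_eq_zero h1 h2 v]
  refine setIntegral_eq_integral_of_forall_compl_eq_zero fun z hz => ?_
  have hzs : z ∉ tsupport (e.target.indicator k) := by
    have h1 : IsCompact (e '' K) := hK.image_of_continuousOn (e.continuousOn.mono hKe)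
    have h3 : tsupport (e.target.indicator k) ⊆ e '' K := by
      refine closure_minimal (fun w hw => ?_) h1.isClosed
      have hwt : w ∈ e.target := by
        by_contra h
        exact hw (Set.indicator_of_notMem h _)
      by_contra hwK
      refine hw ?_
      rw [Set.indicator_of_mem hwt]
      exact h0 w hwt fun h => hwK ⟨_, h, e.right_inv hwt⟩
    intro h
    obtain ⟨x, hx, rfl⟩ := h3 h
    exact hz (e.map_source (hKe hx))
  have : fderiv ℝ (e.target.indicator k) z = 0 :=
    image_eq_zero_of_notMem_tsupport fun h => hzs (tsupport_fderiv_subset ℝ h)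
  rw [this]; rfl

theorem integral_dz_chart {K : Set X} (hK : IsCompact K) (hKe : K ⊆ e.source)
    {k : Cn n → ℂ} (hk : ContDiffOn ℝ ∞ k e.target)
    (h0 : ∀ z ∈ e.target, e.symm z ∉ K → k z = 0) (j : Fin n) :
    IntegrableOn (dz j k) e.target ∧ ∫ z in e.target, dz j k z = 0 := by
  obtain ⟨h1, h2⟩ := integral_fderiv_chart hK hKe hk h0 (basisVec j)
  obtain ⟨h3, h4⟩ := integral_fderiv_chart hK hKe hk h0 (Complex.I • basisVec j)
  refine ⟨(h1.sub (h3.const_mul Complex.I)).div_const 2, ?_⟩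
  simp only [dz]
  rw [integral_div, integral_sub h1 (h3.const_mul Complex.I), integral_const_mul, h2, h4]
  simp

theorem integral_dzbar_chart {K : Set X} (hK : IsCompact K) (hKe : K ⊆ e.source)
    {k : Cn n → ℂ} (hk : ContDiffOn ℝ ∞ k e.target)
    (h0 : ∀ z ∈ e.target, e.symm z ∉ K → k z = 0) (j : Fin n) :
    IntegrableOn (dzbar j k) e.target ∧ ∫ z in e.target, dzbar j k z = 0 := by
  obtain ⟨h1, h2⟩ := integral_fderiv_chart hK hKe hk h0 (basisVec j)
  obtain ⟨h3, h4⟩ := integral_fderiv_chart hK hKe hk h0 (Complex.I • basisVec j)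
  refine ⟨(h1.add (h3.const_mul Complex.I)).div_const 2, ?_⟩
  simp only [dzbar]
  rw [integral_div, integral_add h1 (h3.const_mul Complex.I), integral_const_mul, h2, h4]
  simp

section Holomorphic

variable [IsManifold 𝓘(ℂ, Cn n) ω X] [T2Space X] [CompactSpace X] [MeasurableSpace X] [BorelSpace X]

/-- The divergence theorem on `X`. The vector field is given by the coefficients `Y`, `Y'` of its
product with the volume density; that it is globally defined is expressed by the invariance of the
derivatives of functions along it. -/
theorem integral_divergence {Ω : DForm n 2 X} (hΩ : IsKahlerForm Ω) {f : X → ℂ} (hf : CSmooth n f)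
    {Y Y' : OpenPartialHomeomorph X (Cn n) → Cn n → Fin n → ℂ}
    (hY : ∀ e ∈ atlas (Cn n) X, ∀ j, ContDiffOn ℝ ∞ (fun z => Y e z j) e.target)
    (hY' : ∀ e ∈ atlas (Cn n) X, ∀ j, ContDiffOn ℝ ∞ (fun z => Y' e z j) e.target)
    (hdiv : ∀ e ∈ atlas (Cn n) X, ∀ z ∈ e.target, f (e.symm z) * (cf Ω e z).det =
      ∑ j, dz j (fun w => Y e w j) z + ∑ j, dzbar j (fun w => Y' e w j) z)
    (hinv : ∀ ρ : X → ℂ, CSmooth n ρ → IsInvariant fun e z =>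
      (∑ j, Y e z j * dz j (fun w => ρ (e.symm w)) z +
        ∑ j, Y' e z j * dzbar j (fun w => ρ (e.symm w)) z) / (cf Ω e z).det) :
    ∫ x, f x ∂volMeasure Ω = 0 := by
  classical
  set L : (X → ℂ) → OpenPartialHomeomorph X (Cn n) → Cn n → ℂ := fun ρ e z =>
    (∑ j, Y e z j * dz j (fun w => ρ (e.symm w)) z +
        ∑ j, Y' e z j * dzbar j (fun w => ρ (e.symm w)) z) / (cf Ω e z).det with hL
  have hdet0 : ∀ e ∈ atlas (Cn n) X, ∀ z ∈ e.target, (cf Ω e z).det ≠ 0 := fun e he z hz =>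
    (posDef_cf hΩ he hz).det_pos.ne'
  have hLs : ∀ ρ, CSmooth n ρ → CSmooth n (glue (L ρ)) := by
    intro ρ hρ
    refine cSmooth_glue (hinv ρ hρ) fun e he => ?_
    simp only [hL, div_eq_mul_inv]
    exact ((ContDiffOn.sum fun j _ => (hY e he j).mul ((hρ e he).dz e.open_target j)).add
      (ContDiffOn.sum fun j _ => (hY' e he j).mul ((hρ e he).dzbar e.open_target j))).mul
      ((contDiffOn_det ((isClosed11_cf hΩ.toIsClosedReal11).smooth e he)).inv (hdet0 e he))
  set r : X → X → ℂ := fun i x => ((pou n X i x : ℝ) : ℂ) with hr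
  have hrs : ∀ i, CSmooth n (r i) := cSmooth_pou
  -- each function `ρ_i f + L ρ_i` is the divergence of a field supported in a chart
  have hpiece : ∀ i, ∫ x, (r i x * f x + glue (L (r i)) x) ∂volMeasure Ω = 0 := by
    intro i
    set c := chartAt (Cn n) i
    have hca : c ∈ atlas (Cn n) X := chart_mem_atlas _ _
    have hr0 : ∀ x ∉ tsupport (pou n X i), r i x = 0 := fun x hx => by
      simp only [hr, image_eq_zero_of_notMem_tsupport hx, Complex.ofReal_zero]
    have hL0 : ∀ x ∉ tsupport (pou n X i), glue (L (r i)) x = 0 := by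
      intro x hx
      have h1 : (fun w => r i ((chartAt (Cn n) x).symm w)) =ᶠ[nhds (chartAt (Cn n) x x)]
          fun _ => 0 := by
        have hcont : ContinuousAt (chartAt (Cn n) x).symm (chartAt (Cn n) x x) :=
          (chartAt (Cn n) x).symm.continuousAt (mem_chart_target _ _)
        have hn : (tsupport (pou n X i))ᶜ ∈ nhds ((chartAt (Cn n) x).symm (chartAt (Cn n) x x)) := by
          rw [(chartAt (Cn n) x).left_inv (mem_chart_source _ _)]
          exact (isClosed_tsupport _).isOpen_compl.mem_nhds hx
        filter_upwards [hcont hn] with w hw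
        exact hr0 _ hw
      simp only [glue, hL]
      simp only [dz_congr h1, dzbar_congr h1, dz_const, dzbar_const]
      simp
    rw [integral_eq_chart hΩ (f := fun x => r i x * f x + glue (L (r i)) x) (((hrs i).continuous.mul hf.continuous).add
      (hLs _ (hrs i)).continuous) hca (fun x hx => by
        have : x ∉ tsupport (pou n X i) := fun h => hx (pou_isSubordinate i h)
        rw [hr0 x this, hL0 x this]; simp)]
    have hK : IsCompact (tsupport (pou n X i)) := (isClosed_tsupport _).isCompact
    have hKc : tsupport (pou n X i) ⊆ c.source := pou_isSubordinate i
    have hkz : ∀ y : Cn n → ℂ, ∀ z ∈ c.target, c.symm z ∉ tsupport (pou n X i) →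
        r i (c.symm z) * y z = 0 := fun y z _ h => by rw [hr0 _ h, zero_mul]
    have e1 := fun j => integral_dz_chart hK hKc ((hrs i c hca).mul (hY c hca j))
      (hkz fun z => Y c z j) j
    have e2 := fun j => integral_dzbar_chart hK hKc ((hrs i c hca).mul (hY' c hca j))
      (hkz fun z => Y' c z j) j
    have hfun : ∀ z ∈ c.target, volWeight Ω c z •
        (r i (c.symm z) * f (c.symm z) + glue (L (r i)) (c.symm z)) =
        (2 ^ n * (n.factorial : ℂ)) * (∑ j, dz j (fun w => r i (c.symm w) * Y c w j) z +
          ∑ j, dzbar j (fun w => r i (c.symm w) * Y' c w j) z) := by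
      intro z hz
      have hd := hdiv c hca z hz
      have h0 := hdet0 c hca z hz
      have hrd : DifferentiableAt ℝ (fun w => r i (c.symm w)) z :=
        differentiableAt_comp_symm (hrs i) hca hz
      have hYd : ∀ j, DifferentiableAt ℝ (fun w => Y c w j) z := fun j =>
        (hY c hca j).differentiableAt_of_isOpen c.open_target hz
      have hYd' : ∀ j, DifferentiableAt ℝ (fun w => Y' c w j) z := fun j =>
        (hY' c hca j).differentiableAt_of_isOpen c.open_target hz
      rw [glue_symm (hinv _ (hrs i)) hca hz]
      simp only [dz_mul hrd (hYd _), dzbar_mul hrd (hYd' _), Finset.sum_add_distrib,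
        ← Finset.mul_sum]
      have hre := (PosDef.det_eq_re (posDef_cf hΩ hca hz)).symm
      have h3 : (cf Ω c z).det * L (r i) c z =
          ∑ j, dz j (fun w => r i (c.symm w)) z * Y c z j +
            ∑ j, dzbar j (fun w => r i (c.symm w)) z * Y' c z j := by
        simp only [hL]
        rw [mul_div_cancel₀ _ h0]
        simp only [mul_comm]
      rw [Complex.real_smul, volWeight]
      push_cast
      rw [hre]
      linear_combination (2 ^ n * (n.factorial : ℂ)) * r i (c.symm z) * hd +
        (2 ^ n * (n.factorial : ℂ)) * h3
    rw [setIntegral_congr_fun c.open_target.measurableSet hfun, integral_const_mul,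
      integral_add (integrable_finsetSum _ fun j _ => (e1 j).1)
        (integrable_finsetSum _ fun j _ => (e2 j).1),
      integral_finsetSum _ fun j _ => (e1 j).1, integral_finsetSum _ fun j _ => (e2 j).1,
      Finset.sum_eq_zero fun j _ => (e1 j).2, Finset.sum_eq_zero fun j _ => (e2 j).2]
    simp
  -- as `∑ ρ_i = 1`, the terms `L ρ_i` add up to zero
  have hsum : ∀ x, ∑ i ∈ pouIndex n X, (r i x * f x + glue (L (r i)) x) = f x := by
    intro x
    rw [Finset.sum_add_distrib, ← Finset.sum_mul]
    have h1 : ∀ y, ∑ i ∈ pouIndex n X, r i y = 1 := fun y => by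
      simp only [hr]
      rw [← Complex.ofReal_sum, sum_pou, Complex.ofReal_one]
    have h2 : ∑ i ∈ pouIndex n X, glue (L (r i)) x = 0 := by
      have hd : ∀ i ∈ pouIndex n X,
          DifferentiableAt ℝ (fun w => r i ((chartAt (Cn n) x).symm w)) (chartAt (Cn n) x x) :=
        fun i _ => differentiableAt_comp_symm (hrs i) (chart_mem_atlas _ _) (mem_chart_target _ _)
      have h3 : ∀ j, ∑ i ∈ pouIndex n X, dz j (fun w => r i ((chartAt (Cn n) x).symm w))
          (chartAt (Cn n) x x) = 0 := fun j => by
        rw [← dz_sum hd]; simp only [h1]; exact dz_const _ _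
      have h4 : ∀ j, ∑ i ∈ pouIndex n X, dzbar j (fun w => r i ((chartAt (Cn n) x).symm w))
          (chartAt (Cn n) x x) = 0 := fun j => by
        rw [← dzbar_sum hd]; simp only [h1]; exact dzbar_const _ _
      simp only [glue, hL]
      rw [← Finset.sum_div, Finset.sum_add_distrib, Finset.sum_comm,
        Finset.sum_comm (s := pouIndex n X)]
      simp only [← Finset.mul_sum, h3, h4]
      simp
    rw [h1, h2]; ring
  rw [← integral_congr_ae (Filter.Eventually.of_forall hsum), integral_finsetSum]
  · exact Finset.sum_eq_zero fun i _ => hpiece i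
  · intro i _
    exact (((hrs i).continuous.mul hf.continuous).add
      (hLs _ (hrs i)).continuous).integrable_volMeasure hΩ

end Holomorphic

end Divergence

/-! ### Integration by parts against closed `(n-1,n-1)`-forms -/

section IntegrationByParts

open MeasureTheory

variable {n : ℕ} {X : Type*} [TopologicalSpace X] [ChartedSpace (Cn n) X]
variable {e e' : OpenPartialHomeomorph X (Cn n)} {z : Cn n} {Ω : DForm n 2 X}
variable {N L K : ChartMat n X}

/-- Smoothness of a family of matrix valued functions in the charts. -/
def IsSmoothMat (K : ChartMat n X) : Prop :=
  ∀ e ∈ atlas (Cn n) X, ∀ j k, ContDiffOn ℝ ∞ (fun z => K e z j k) e.target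

/-- The function `tr(N L) / det(g)`; it is the ratio of the top degree form obtained from an
`(n-1,n-1)`-form `N` and a `(1,1)`-form `L` to the volume form of `Ω`. -/
def trDiv (Ω : DForm n 2 X) (N L : ChartMat n X) : X → ℂ :=
  glue fun e z => (N e z * L e z).trace / (cf Ω e z).det

/-- The function `det(K) / det(g)`, the ratio of the top power of a `(1,1)`-form `K` to the volume
form of `Ω`. -/
def detDiv (Ω : DForm n 2 X) (K : ChartMat n X) : X → ℂ :=
  glue fun e z => (K e z).det / (cf Ω e z).det

/-- The coefficients of the `(n-1,n-1)`-form `K^(n-1)`. -/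
def adj (K : ChartMat n X) : ChartMat n X := fun e z => (K e z).adjugate

section Holomorphic

variable [IsManifold 𝓘(ℂ, Cn n) ω X]

theorem det_cf_ne_zero (hΩ : IsKahlerForm Ω) (he : e ∈ atlas (Cn n) X) (hz : z ∈ e.target) :
    (cf Ω e z).det ≠ 0 := (posDef_cf hΩ he hz).det_pos.ne'

theorem trDiv_symm (hΩ : IsKahlerForm Ω) (hN : IsCotensor N) (hL : IsTensor L)
    (he : e ∈ atlas (Cn n) X) (hz : z ∈ e.target) :
    trDiv Ω N L (e.symm z) = (N e z * L e z).trace / (cf Ω e z).det :=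
  glue_symm (hN.isInvariant_trace_div hL (isTensor_cf hΩ.type11)) he hz

theorem detDiv_symm (hΩ : IsKahlerForm Ω) (hK : IsTensor K)
    (he : e ∈ atlas (Cn n) X) (hz : z ∈ e.target) :
    detDiv Ω K (e.symm z) = (K e z).det / (cf Ω e z).det :=
  glue_symm (hK.isInvariant_det_div (isTensor_cf hΩ.type11)) he hz

theorem contDiffOn_det_inv (hΩ : IsKahlerForm Ω) (he : e ∈ atlas (Cn n) X) :
    ContDiffOn ℝ ∞ (fun z => (cf Ω e z).det⁻¹) e.target :=
  (contDiffOn_det ((isClosed11_cf hΩ.toIsClosedReal11).smooth e he)).inv fun _ hz =>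
    det_cf_ne_zero hΩ he hz

theorem cSmooth_trDiv (hΩ : IsKahlerForm Ω) (hN : IsCotensor N) (hNs : IsSmoothMat N)
    (hL : IsTensor L) (hLs : IsSmoothMat L) : CSmooth n (trDiv Ω N L) := by
  refine cSmooth_glue (hN.isInvariant_trace_div hL (isTensor_cf hΩ.type11)) fun e he => ?_
  simp only [div_eq_mul_inv]
  exact (contDiffOn_trace (contDiffOn_mul (hNs e he) (hLs e he))).mul (contDiffOn_det_inv hΩ he)

theorem cSmooth_detDiv (hΩ : IsKahlerForm Ω) (hK : IsTensor K) (hKs : IsSmoothMat K) :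
    CSmooth n (detDiv Ω K) := by
  refine cSmooth_glue (hK.isInvariant_det_div (isTensor_cf hΩ.type11)) fun e he => ?_
  simp only [div_eq_mul_inv]
  exact (contDiffOn_det (hKs e he)).mul (contDiffOn_det_inv hΩ he)

theorem isSmoothMat_gradMat {u v : X → ℂ} (hu : CSmooth n u) (hv : CSmooth n v) :
    IsSmoothMat (gradMat u v : ChartMat n X) := fun e he j k =>
  ((hu e he).dz e.open_target j).mul ((hv e he).dzbar e.open_target k)

theorem CSmooth.mul {u v : X → ℂ} (hu : CSmooth n u) (hv : CSmooth n v) :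
    CSmooth n fun x => u x * v x := fun e he => (hu e he).mul (hv e he)

theorem CSmooth.add {u v : X → ℂ} (hu : CSmooth n u) (hv : CSmooth n v) :
    CSmooth n fun x => u x + v x := fun e he => (hu e he).add (hv e he)

variable [T2Space X] [CompactSpace X] [MeasurableSpace X] [BorelSpace X]

/-- Integration by parts, in the holomorphic directions. -/
theorem integral_trDiv_hess_add_grad (hΩ : IsKahlerForm Ω) (hN : IsCoclosed N) {u v : X → ℂ}
    (hu : CSmooth n u) (hv : CSmooth n v) :
    ∫ x, (u x * trDiv Ω N (hess v) x + trDiv Ω N (gradMat u v) x) ∂volMeasure Ω = 0 := by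
  have hh := isClosed11_hess (n := n) (X := X) hv
  have hg := isTensor_gradMat (n := n) (X := X) hu hv
  have hvk : ∀ e ∈ atlas (Cn n) X, ∀ k,
      ContDiffOn ℝ ∞ (dzbar k fun w => v (e.symm w)) e.target := fun e he k =>
    (hv e he).dzbar e.open_target k
  refine integral_divergence hΩ (f := fun x => u x * trDiv Ω N (hess v) x + trDiv Ω N (gradMat u v) x)
    ((hu.mul (cSmooth_trDiv hΩ hN.cotensor hN.smooth hh.tensor hh.smooth)).add
      (cSmooth_trDiv hΩ hN.cotensor hN.smooth hg (isSmoothMat_gradMat hu hv)))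
    (Y := fun e z j => ∑ k, u (e.symm z) * (N e z k j * dzbar k (fun w => v (e.symm w)) z))
    (Y' := fun _ _ _ => 0) (fun e he j => ContDiffOn.sum fun k _ =>
      (hu e he).mul ((hN.smooth e he k j).mul (hvk e he k))) (fun _ _ _ => contDiffOn_const) ?_ ?_
  · intro e he z hz
    have hud := differentiableAt_comp_symm hu he hz
    have hvd : ∀ k, DifferentiableAt ℝ (dzbar k fun w => v (e.symm w)) z := fun k =>
      (hvk e he k).differentiableAt_of_isOpen e.open_target hz
    have hNd : ∀ k j, DifferentiableAt ℝ (fun w => N e w k j) z := fun k j =>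
      (hN.smooth e he k j).differentiableAt_of_isOpen e.open_target hz
    rw [trDiv_symm hΩ hN.cotensor hh.tensor he hz, trDiv_symm hΩ hN.cotensor hg he hz]
    have h0 := det_cf_ne_zero hΩ he hz
    have h1 : ∀ j, dz j (fun w => ∑ k, u (e.symm w) *
        (N e w k j * dzbar k (fun w => v (e.symm w)) w)) z =
        ∑ k, (u (e.symm z) * (N e z k j * hess v e z j k) + N e z k j * gradMat u v e z j k +
          u (e.symm z) * (dz j (fun w => N e w k j) z * dzbar k (fun w => v (e.symm w)) z)) := by
      intro j
      rw [dz_sum fun k _ => hud.fun_mul ((hNd k j).fun_mul (hvd k))]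
      refine Finset.sum_congr rfl fun k _ => ?_
      rw [dz_mul hud ((hNd k j).fun_mul (hvd k)), dz_mul (hNd k j) (hvd k)]
      simp only [hess, gradMat, Matrix.of_apply]
      ring
    simp only [h1, dzbar_const, Finset.sum_const_zero, add_zero, Finset.sum_add_distrib]
    simp only [← Finset.mul_sum]
    have h2 : ∑ j, ∑ k, dz j (fun w => N e w k j) z * dzbar k (fun w => v (e.symm w)) z = 0 := by
      rw [Finset.sum_comm]
      refine Finset.sum_eq_zero fun k _ => ?_
      rw [← Finset.sum_mul, hN.sum_dz e he z hz k, zero_mul]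
    have h3 : ∀ L : Matrix (Fin n) (Fin n) ℂ,
        (N e z * L).trace = ∑ j, ∑ k, N e z k j * L j k := fun L => by
      simp only [Matrix.trace, Matrix.diag, Matrix.mul_apply]
      rw [Finset.sum_comm]
    rw [h2, h3, h3]
    field_simp
    ring
  · intro ρ hρ
    have hg' := isTensor_gradMat (n := n) (X := X) hρ hv
    refine isInvariant_congr (F := fun e z => u (e.symm z) *
      ((N e z * gradMat ρ v e z).trace / (cf Ω e z).det)) ?_ ?_
    · intro e he e' he' z hz
      have h := hN.cotensor.isInvariant_trace_div hg' (isTensor_cf hΩ.type11) e he e' he' z hz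
      simp only at h ⊢
      rw [h, symm_chartChange hz]
    · intro e he z hz
      have h3 : (N e z * gradMat ρ v e z).trace = ∑ j, ∑ k, N e z k j * gradMat ρ v e z j k := by
        simp only [Matrix.trace, Matrix.diag, Matrix.mul_apply]
        rw [Finset.sum_comm]
      rw [h3, mul_div_assoc']
      congr 1
      simp only [zero_mul, Finset.sum_const_zero, add_zero, gradMat, Matrix.of_apply,
        Finset.mul_sum, Finset.sum_mul]
      exact Finset.sum_congr rfl fun j _ => Finset.sum_congr rfl fun k _ => by ring

/-- Integration by parts, in the antiholomorphic directions. -/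
theorem integral_trDiv_hess_add_grad' (hΩ : IsKahlerForm Ω) (hN : IsCoclosed N) {u v : X → ℂ}
    (hu : CSmooth n u) (hv : CSmooth n v) :
    ∫ x, (u x * trDiv Ω N (hess v) x + trDiv Ω N (gradMat v u) x) ∂volMeasure Ω = 0 := by
  have hh := isClosed11_hess (n := n) (X := X) hv
  have hg := isTensor_gradMat (n := n) (X := X) hv hu
  have hvk : ∀ e ∈ atlas (Cn n) X, ∀ k,
      ContDiffOn ℝ ∞ (dz k fun w => v (e.symm w)) e.target := fun e he k =>
    (hv e he).dz e.open_target k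
  refine integral_divergence hΩ (f := fun x => u x * trDiv Ω N (hess v) x + trDiv Ω N (gradMat v u) x)
    ((hu.mul (cSmooth_trDiv hΩ hN.cotensor hN.smooth hh.tensor hh.smooth)).add
      (cSmooth_trDiv hΩ hN.cotensor hN.smooth hg (isSmoothMat_gradMat hv hu)))
    (Y' := fun e z k => ∑ j, u (e.symm z) * (N e z k j * dz j (fun w => v (e.symm w)) z))
    (Y := fun _ _ _ => 0) (fun _ _ _ => contDiffOn_const) (fun e he k => ContDiffOn.sum fun j _ =>
      (hu e he).mul ((hN.smooth e he k j).mul (hvk e he j))) ?_ ?_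
  · intro e he z hz
    have hud := differentiableAt_comp_symm hu he hz
    have hvd : ∀ k, DifferentiableAt ℝ (dz k fun w => v (e.symm w)) z := fun k =>
      (hvk e he k).differentiableAt_of_isOpen e.open_target hz
    have hNd : ∀ k j, DifferentiableAt ℝ (fun w => N e w k j) z := fun k j =>
      (hN.smooth e he k j).differentiableAt_of_isOpen e.open_target hz
    rw [trDiv_symm hΩ hN.cotensor hh.tensor he hz, trDiv_symm hΩ hN.cotensor hg he hz]
    have h0 := det_cf_ne_zero hΩ he hz
    have h1 : ∀ k, dzbar k (fun w => ∑ j, u (e.symm w) *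
        (N e w k j * dz j (fun w => v (e.symm w)) w)) z =
        ∑ j, (u (e.symm z) * (N e z k j * hess v e z j k) + N e z k j * gradMat v u e z j k +
          u (e.symm z) * (dzbar k (fun w => N e w k j) z * dz j (fun w => v (e.symm w)) z)) := by
      intro k
      rw [dzbar_sum fun j _ => hud.fun_mul ((hNd k j).fun_mul (hvd j))]
      refine Finset.sum_congr rfl fun j _ => ?_
      rw [dzbar_mul hud ((hNd k j).fun_mul (hvd j)), dzbar_mul (hNd k j) (hvd j),
        ← dz_dzbar_comm ((hv e he).contDiffAt_two e.open_target hz)]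
      simp only [hess, gradMat, Matrix.of_apply]
      ring
    simp only [h1, dz_const, Finset.sum_const_zero, zero_add, Finset.sum_add_distrib]
    simp only [← Finset.mul_sum]
    have h2 : ∑ k, ∑ j, dzbar k (fun w => N e w k j) z * dz j (fun w => v (e.symm w)) z = 0 := by
      rw [Finset.sum_comm]
      refine Finset.sum_eq_zero fun j _ => ?_
      rw [← Finset.sum_mul, hN.sum_dzbar e he z hz j, zero_mul]
    have h3 : ∀ L : Matrix (Fin n) (Fin n) ℂ,
        (N e z * L).trace = ∑ k, ∑ j, N e z k j * L j k := fun L => by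
      simp only [Matrix.trace, Matrix.diag, Matrix.mul_apply]
    rw [h2, h3, h3]
    field_simp
    ring
  · intro ρ hρ
    have hg' := isTensor_gradMat (n := n) (X := X) hv hρ
    refine isInvariant_congr (F := fun e z => u (e.symm z) *
      ((N e z * gradMat v ρ e z).trace / (cf Ω e z).det)) ?_ ?_
    · intro e he e' he' z hz
      have h := hN.cotensor.isInvariant_trace_div hg' (isTensor_cf hΩ.type11) e he e' he' z hz
      simp only at h ⊢
      rw [h, symm_chartChange hz]
    · intro e he z hz
      have h3 : (N e z * gradMat v ρ e z).trace = ∑ k, ∑ j, N e z k j * gradMat v ρ e z j k := by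
        simp only [Matrix.trace, Matrix.diag, Matrix.mul_apply]
      rw [h3, mul_div_assoc']
      congr 1
      simp only [zero_mul, Finset.sum_const_zero, zero_add, gradMat, Matrix.of_apply,
        Finset.mul_sum, Finset.sum_mul]
      exact Finset.sum_congr rfl fun j _ => Finset.sum_congr rfl fun k _ => by ring

theorem integral_trDiv_hess_symm (hΩ : IsKahlerForm Ω) (hN : IsCoclosed N) {u v : X → ℂ}
    (hu : CSmooth n u) (hv : CSmooth n v) :
    ∫ x, u x * trDiv Ω N (hess v) x ∂volMeasure Ω =
      ∫ x, v x * trDiv Ω N (hess u) x ∂volMeasure Ω := by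
  have h1 := integral_trDiv_hess_add_grad hΩ hN hu hv
  have h2 := integral_trDiv_hess_add_grad' hΩ hN hv hu
  have hc : ∀ {u v : X → ℂ}, CSmooth n u → CSmooth n v →
      Integrable (fun x => u x * trDiv Ω N (hess v) x) (volMeasure Ω) := fun {u v} hu hv =>
    (hu.mul (cSmooth_trDiv hΩ hN.cotensor hN.smooth (isTensor_hess hv)
      (isClosed11_hess hv).smooth)).continuous.integrable_volMeasure hΩ
  have hg : Integrable (trDiv Ω N (gradMat u v)) (volMeasure Ω) :=
    (cSmooth_trDiv hΩ hN.cotensor hN.smooth (isTensor_gradMat hu hv)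
      (isSmoothMat_gradMat hu hv)).continuous.integrable_volMeasure hΩ
  rw [integral_add (hc hu hv) hg] at h1
  rw [integral_add (hc hv hu) hg] at h2
  exact add_right_cancel (h1.trans h2.symm)

theorem integral_trDiv_hess (hΩ : IsKahlerForm Ω) (hN : IsCoclosed N) {v : X → ℂ}
    (hv : CSmooth n v) : ∫ x, trDiv Ω N (hess v) x ∂volMeasure Ω = 0 := by
  have h := integral_trDiv_hess_symm hΩ hN (u := fun _ => 1) (fun _ _ => contDiffOn_const) hv
  have h0 : ∀ x, trDiv Ω N (hess fun _ : X => (1 : ℂ)) x = 0 := by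
    intro x
    have : hess (fun _ : X => (1 : ℂ)) (chartAt (Cn n) x) (chartAt (Cn n) x x) = 0 := by
      ext j k
      have : (dzbar k fun _ : Cn n => (1 : ℂ)) = fun _ => 0 := funext fun z => dzbar_const _ _
      simp only [hess, Matrix.of_apply, this, dz_const, Matrix.zero_apply]
    simp [trDiv, glue, this]
  simpa [h0] using h

/-- Stokes' theorem for the product of a closed `(n-1,n-1)`-form and an exact `(1,1)`-form. -/
theorem integral_trDiv_dForm (hΩ : IsKahlerForm Ω) (hN : IsCoclosed N) {ξ : DForm n 1 X}
    (hξ : IsSmoothForm ξ) (h11 : IsClosedReal11 (dForm ξ)) :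
    ∫ x, trDiv Ω N (cf (dForm ξ)) x ∂volMeasure Ω = 0 := by
  have hA := isClosed11_cf h11
  set a : OpenPartialHomeomorph X (Cn n) → Cn n → Fin n → ℂ := fun e z k =>
    coeff1 (inChart ξ e z) k with ha
  have has : ∀ e ∈ atlas (Cn n) X, ∀ k, ContDiffOn ℝ ∞ (fun z => a e z k) e.target :=
    fun e he k => contDiffOn_coeff1 (hξ e he) k
  have hass : ∀ e ∈ atlas (Cn n) X, ∀ k, ContDiffOn ℝ ∞ (fun z => star (a e z k)) e.target :=
    fun e he k => Complex.conjCLE.contDiff.comp_contDiffOn (has e he k)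
  have hat : ∀ e ∈ atlas (Cn n) X, ∀ e' ∈ atlas (Cn n) X, ∀ z ∈ overlap e e', ∀ k,
      a e z k = ∑ i, jac e e' z i k * a e' (chartChange e e' z) i := by
    intro e he e' he' z hz k
    simp only [ha]
    rw [inChart_eq ξ he he' hz, coeff1_comp]
    rfl
  -- the fields are the contractions of `N` with the `(0,1)`- and `(1,0)`-parts of `ξ`
  refine integral_divergence hΩ (f := trDiv Ω N (cf (dForm ξ)))
    (cSmooth_trDiv hΩ hN.cotensor hN.smooth hA.tensor hA.smooth)
    (Y := fun e z j => ∑ k, N e z k j * (-Complex.I * star (a e z k)))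
    (Y' := fun e z k => ∑ j, N e z k j * (Complex.I * a e z j))
    (fun e he j => ContDiffOn.sum fun k _ =>
      (hN.smooth e he k j).mul (contDiffOn_const.mul (hass e he k)))
    (fun e he k => ContDiffOn.sum fun j _ =>
      (hN.smooth e he k j).mul (contDiffOn_const.mul (has e he j))) ?_ ?_
  · intro e he z hz
    have hd : ∀ k, DifferentiableAt ℝ (fun w => a e w k) z := fun k =>
      (has e he k).differentiableAt_of_isOpen e.open_target hz
    have hds : ∀ k, DifferentiableAt ℝ (fun w => star (a e w k)) z := fun k =>
      (hass e he k).differentiableAt_of_isOpen e.open_target hz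
    have hNd : ∀ k j, DifferentiableAt ℝ (fun w => N e w k j) z := fun k j =>
      (hN.smooth e he k j).differentiableAt_of_isOpen e.open_target hz
    have hco : ∀ j k, cf (dForm ξ) e z j k = -Complex.I * dz j (fun w => star (a e w k)) z +
        Complex.I * dzbar k (fun w => a e w j) z := by
      intro j k
      rw [cf, inChart_dForm hξ he hz]
      refine coeff_extDeriv_one ((inChart_contDiffAt hξ he hz).differentiableAt (by simp)) ?_ j k
      rw [← inChart_dForm hξ he hz]
      exact type11_inChart h11.type11 he hz
    have h1 : ∀ j, dz j (fun w => ∑ k, N e w k j * (-Complex.I * star (a e w k))) z =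
        ∑ k, (N e z k j * (-Complex.I * dz j (fun w => star (a e w k)) z) +
          dz j (fun w => N e w k j) z * (-Complex.I * star (a e z k))) := by
      intro j
      rw [dz_sum fun k _ => (hNd k j).fun_mul ((hds k).const_mul _)]
      refine Finset.sum_congr rfl fun k _ => ?_
      rw [dz_mul (hNd k j) ((hds k).const_mul _), dz_const_mul (hds k)]
    have h2 : ∀ k, dzbar k (fun w => ∑ j, N e w k j * (Complex.I * a e w j)) z =
        ∑ j, (N e z k j * (Complex.I * dzbar k (fun w => a e w j) z) +
          dzbar k (fun w => N e w k j) z * (Complex.I * a e z j)) := by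
      intro k
      rw [dzbar_sum fun j _ => (hNd k j).fun_mul ((hd j).const_mul _)]
      refine Finset.sum_congr rfl fun j _ => ?_
      rw [dzbar_mul (hNd k j) ((hd j).const_mul _), dzbar_const_mul (hd j)]
    have h3 : ∑ j, ∑ k, dz j (fun w => N e w k j) z * (-Complex.I * star (a e z k)) = 0 := by
      rw [Finset.sum_comm]
      refine Finset.sum_eq_zero fun k _ => ?_
      rw [← Finset.sum_mul, hN.sum_dz e he z hz k, zero_mul]
    have h4 : ∑ k, ∑ j, dzbar k (fun w => N e w k j) z * (Complex.I * a e z j) = 0 := by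
      rw [Finset.sum_comm]
      refine Finset.sum_eq_zero fun j _ => ?_
      rw [← Finset.sum_mul, hN.sum_dzbar e he z hz j, zero_mul]
    rw [trDiv_symm hΩ hN.cotensor hA.tensor he hz, div_mul_cancel₀ _ (det_cf_ne_zero hΩ he hz)]
    simp only [h1, h2, Finset.sum_add_distrib, h3, h4, add_zero]
    simp only [Matrix.trace, Matrix.diag, Matrix.mul_apply, hco, mul_add, Finset.sum_add_distrib]
    congr 1
    rw [Finset.sum_comm]
  · intro ρ hρ
    have hT1 : IsTensor (fun e z => Matrix.of fun j k =>
        dz j (fun w => ρ (e.symm w)) z * star (a e z k) : ChartMat n X) := by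
      intro e he e' he' z hz
      ext j k
      simp only [Matrix.of_apply, Matrix.mul_apply, Matrix.transpose_apply, conjM,
        Matrix.map_apply, Finset.sum_mul]
      rw [dz_congr (comp_symm_eventuallyEq ρ hz), dz_chartChange he he' hz
        (f := fun w => ρ (e'.symm w)) (differentiableAt_comp_symm hρ he' (chartChange_mem hz).1),
        hat e he e' he' z hz k, star_sum, Finset.mul_sum]
      refine Finset.sum_congr rfl fun i _ => ?_
      rw [Finset.sum_mul]
      refine Finset.sum_congr rfl fun l _ => ?_
      rw [starRingEnd_apply, star_mul']; ring
    have hT2 : IsTensor (fun e z => Matrix.of fun j k =>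
        a e z j * dzbar k (fun w => ρ (e.symm w)) z : ChartMat n X) := by
      intro e he e' he' z hz
      ext j k
      simp only [Matrix.of_apply, Matrix.mul_apply, Matrix.transpose_apply, conjM,
        Matrix.map_apply, Finset.sum_mul]
      rw [dzbar_congr (comp_symm_eventuallyEq ρ hz), dzbar_chartChange he he' hz
        (f := fun w => ρ (e'.symm w)) (differentiableAt_comp_symm hρ he' (chartChange_mem hz).1),
        hat e he e' he' z hz j, Finset.mul_sum]
      refine Finset.sum_congr rfl fun i _ => ?_
      rw [Finset.sum_mul]
      refine Finset.sum_congr rfl fun l _ => ?_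
      rw [starRingEnd_apply]; ring
    have hI := hN.cotensor.isInvariant_trace_div ((hT1.smul (-Complex.I)).add (hT2.smul Complex.I))
      (isTensor_cf hΩ.type11)
    refine isInvariant_congr hI fun e he z hz => ?_
    congr 1
    simp only [Matrix.trace, Matrix.diag, Matrix.mul_apply, Pi.add_apply, Pi.smul_apply,
      Matrix.add_apply, Matrix.smul_apply, Matrix.of_apply, smul_eq_mul, mul_add,
      Finset.sum_add_distrib, Finset.sum_mul]
    congr 1
    · rw [Finset.sum_comm]
      exact Finset.sum_congr rfl fun j _ => Finset.sum_congr rfl fun k _ => by ring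
    · exact Finset.sum_congr rfl fun j _ => Finset.sum_congr rfl fun k _ => by ring

end Holomorphic

end IntegrationByParts

section AdjDeriv

variable {n : ℕ} {X : Type*} [TopologicalSpace X] [ChartedSpace (Cn n) X]
variable {e e' : OpenPartialHomeomorph X (Cn n)} {z : Cn n}
variable [IsManifold 𝓘(ℂ, Cn n) ω X]

theorem IsTensor.conjM_mul_inv_mul {G : ChartMat n X} (hG : IsTensor G)
    (he : e ∈ atlas (Cn n) X) (he' : e' ∈ atlas (Cn n) X) (hz : z ∈ overlap e e') :
    conjM (jac e e' z) * (G e z)⁻¹ * (jac e e' z)ᵀ = (G e' (chartChange e e' z))⁻¹ := by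
  have hJ : IsUnit (jac e e' z).det := isUnit_iff_ne_zero.2 (det_jac_ne_zero he he' hz)
  have hJ1 : IsUnit (jac e e' z)ᵀ.det := by rwa [Matrix.det_transpose]
  have hJ2 : IsUnit (conjM (jac e e' z)).det := by
    rw [det_conjM]; exact isUnit_iff_ne_zero.2 (star_ne_zero.2 (det_jac_ne_zero he he' hz))
  rw [hG e he e' he' z hz, Matrix.mul_inv_rev, Matrix.mul_inv_rev, Matrix.mul_assoc,
    Matrix.mul_assoc, Matrix.mul_assoc, Matrix.nonsing_inv_mul _ hJ1, Matrix.mul_one,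
    ← Matrix.mul_assoc, Matrix.mul_nonsing_inv _ hJ2, Matrix.one_mul]

/-- The `(n-1,n-1)`-form `R ∧ G^(n-2)` is closed when `G` and `R` are: differentiate the
divergence-free matrices `adj (G + sR)` at `s = 0`. -/
theorem isCoclosed_adjDeriv {G R : ChartMat n X} (hG : IsClosed11 G) (hpos : IsPosMat G)
    (hR : IsClosed11 R) : IsCoclosed fun e z => adjDeriv (G e z) (R e z) := by
  have hsum : ∀ s : ℝ, IsClosed11 (G + (s : ℂ) • R) := fun s => hG.add (hR.smul s)
  have hF : ∀ e ∈ atlas (Cn n) X, ∀ k j, ContDiffOn ℝ ∞ (fun q : ℝ × Cn n =>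
      (G e q.2 + (q.1 : ℂ) • R e q.2).adjugate k j) (Set.univ ×ˢ e.target) := by
    intro e he k j
    refine contDiffOn_adjugate (fun a b => ?_) k j
    have h1 : ∀ {K : ChartMat n X}, IsClosed11 K → ContDiffOn ℝ ∞ (fun q : ℝ × Cn n => K e q.2 a b)
        (Set.univ ×ˢ e.target) := fun hK =>
      (hK.smooth e he a b).comp contDiff_snd.contDiffOn fun q hq => hq.2
    exact (h1 hG).add ((Complex.ofRealCLM.contDiff.comp contDiff_fst).contDiffOn.mul (h1 hR))
  have hd : ∀ e, ∀ z, ∀ s : ℝ, ∀ a b, HasDerivAt (fun r : ℝ => (G e z + (r : ℂ) • R e z) a b)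
      (R e z a b) s := by
    intro e z s a b
    simp only [Matrix.add_apply, Matrix.smul_apply, smul_eq_mul]
    simpa using (((hasDerivAt_id s).ofReal_comp.mul_const (R e z a b)).const_add (G e z a b))
  have hF' : ∀ e, ∀ k j, ∀ s ∈ (Set.univ : Set ℝ), ∀ y ∈ e.target,
      HasDerivAt (fun r : ℝ => (G e y + (r : ℂ) • R e y).adjugate k j)
        (deriv (fun r : ℝ => (G e y + (r : ℂ) • R e y).adjugate k j) s) s := by
    intro e k j s _ y _
    obtain ⟨a, ha⟩ := exists_hasDerivAt_adjugate (hd e y s) k j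
    exact ha.differentiableAt.hasDerivAt
  have hder : ∀ e ∈ atlas (Cn n) X, ∀ z ∈ e.target, ∀ k j,
      (fun y => deriv (fun r : ℝ => (G e y + (r : ℂ) • R e y).adjugate k j) 0) =ᶠ[nhds z]
        fun y => adjDeriv (G e y) (R e y) k j := by
    intro e he z hz k j
    filter_upwards [e.open_target.mem_nhds hz] with y hy
    have h0 : G e y + ((0 : ℝ) : ℂ) • R e y = G e y := by simp
    have := (hasDerivAt_adjugate (t := 0) (K := fun r : ℝ => G e y + (r : ℂ) • R e y)
      (by rw [h0]; exact (hpos e he y hy).det_pos.ne') (hd e y 0) k j).deriv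
    simpa using this
  refine ⟨?_, fun e he j k => contDiffOn_adjDeriv (hG.smooth e he) (hR.smooth e he)
    (fun q hq => (hpos e he q hq).det_pos.ne') j k, ?_, ?_⟩
  · intro e he e' he' z hz
    have h1 := hG.tensor.conjM_mul_inv_mul he he' hz
    have h2 : ((G e z)⁻¹ * R e z).trace =
        ((G e' (chartChange e e' z))⁻¹ * R e' (chartChange e e' z)).trace :=
      hR.tensor.isInvariant_trace_inv hG.tensor hpos e he e' he' z hz
    simp only [adjDeriv]
    rw [hG.tensor.det he he' hz, smul_smul, ← h2, ← h1]
    simp only [Matrix.mul_smul, Matrix.smul_mul, Matrix.mul_sub, Matrix.sub_mul]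
    congr 2
    rw [hR.tensor e he e' he' z hz]
    simp only [Matrix.mul_assoc]
  · intro e he z hz k
    have h1 : HasDerivAt (fun s : ℝ => ∑ j, dz j (fun w =>
        (G e w + (s : ℂ) • R e w).adjugate k j) z) (∑ j, dz j (fun w =>
          deriv (fun r : ℝ => (G e w + (r : ℂ) • R e w).adjugate k j) 0) z) 0 :=
      HasDerivAt.fun_sum fun j _ => hasDerivAt_dz_slice isOpen_univ e.open_target
        (F := fun s w => (G e w + (s : ℂ) • R e w).adjugate k j) (hF e he k j) (hF' e k j)
        (Set.mem_univ 0) hz j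
    have h2 : (fun s : ℝ => ∑ j, dz j (fun w =>
        (G e w + (s : ℂ) • R e w).adjugate k j) z) = fun _ => 0 := funext fun s =>
      (hsum s).adjugate.sum_dz e he z hz k
    rw [h2] at h1
    rw [← h1.unique (hasDerivAt_const 0 0)]
    exact Finset.sum_congr rfl fun j _ => dz_congr (hder e he z hz k j).symm j
  · intro e he z hz j
    have h1 : HasDerivAt (fun s : ℝ => ∑ k, dzbar k (fun w =>
        (G e w + (s : ℂ) • R e w).adjugate k j) z) (∑ k, dzbar k (fun w =>
          deriv (fun r : ℝ => (G e w + (r : ℂ) • R e w).adjugate k j) 0) z) 0 :=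
      HasDerivAt.fun_sum fun k _ => hasDerivAt_dzbar_slice isOpen_univ e.open_target
        (F := fun s w => (G e w + (s : ℂ) • R e w).adjugate k j) (hF e he k j) (hF' e k j)
        (Set.mem_univ 0) hz k
    have h2 : (fun s : ℝ => ∑ k, dzbar k (fun w =>
        (G e w + (s : ℂ) • R e w).adjugate k j) z) = fun _ => 0 := funext fun s =>
      (hsum s).adjugate.sum_dzbar e he z hz j
    rw [h2] at h1
    rw [← h1.unique (hasDerivAt_const 0 0)]
    exact Finset.sum_congr rfl fun k _ => dzbar_congr (hder e he z hz k j).symm k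

end AdjDeriv

/-! ### Smooth families of functions and of forms -/

section Families

open MeasureTheory

variable {n : ℕ} {X : Type*} [TopologicalSpace X] [ChartedSpace (Cn n) X]
variable {E : Type*} [NormedAddCommGroup E] [NormedSpace ℝ E] {W : Set E}

/-- Families of complex functions, with parameters in `W`, that are jointly smooth. -/
def SmoothFam (n : ℕ) {X : Type*} [TopologicalSpace X] [ChartedSpace (Cn n) X] {E : Type*}
    [NormedAddCommGroup E] [NormedSpace ℝ E] (W : Set E) (f : E → X → ℂ) : Prop :=
  ∀ e ∈ atlas (Cn n) X,
    ContDiffOn ℝ ∞ (fun q : E × Cn n => f q.1 (e.symm q.2)) (W ×ˢ e.target)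

/-- Families of matrix valued functions in the charts, with parameters in `W`, that are jointly
smooth. -/
def SmoothMatFam (W : Set E) (K : E → ChartMat n X) : Prop :=
  ∀ e ∈ atlas (Cn n) X, ∀ j k,
    ContDiffOn ℝ ∞ (fun q : E × Cn n => K q.1 e q.2 j k) (W ×ˢ e.target)

variable {f g : E → X → ℂ} {K L : E → ChartMat n X} {w : E}

theorem SmoothFam.slice (hf : SmoothFam n W f) (hw : w ∈ W) : CSmooth n (f w) := fun e he =>
  (hf e he).comp (contDiffOn_const.prodMk contDiffOn_id) fun _ hz => ⟨hw, hz⟩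

theorem SmoothFam.comp {E' : Type*} [NormedAddCommGroup E'] [NormedSpace ℝ E'] {W' : Set E'}
    (hf : SmoothFam n W f) {h : E' → E} (hh : ContDiffOn ℝ ∞ h W') (hm : Set.MapsTo h W' W) :
    SmoothFam n W' fun w => f (h w) := fun e he =>
  (hf e he).comp ((hh.comp contDiffOn_fst fun _ hq => hq.1).prodMk contDiffOn_snd)
    fun _ hq => ⟨hm hq.1, hq.2⟩

theorem SmoothFam.mono {W' : Set E} (hf : SmoothFam n W f) (h : W' ⊆ W) : SmoothFam n W' f :=
  fun e he => (hf e he).mono (Set.prod_mono h subset_rfl)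

theorem smoothFam_const {u : X → ℂ} (hu : CSmooth n u) : SmoothFam n W fun _ => u := fun e he =>
  (hu e he).comp contDiffOn_snd fun _ hq => hq.2

theorem smoothFam_param {c : E → ℂ} (hc : ContDiffOn ℝ ∞ c W) :
    SmoothFam n W fun w (_ : X) => c w := fun _ _ => hc.comp contDiffOn_fst fun _ hq => hq.1

theorem SmoothFam.mul (hf : SmoothFam n W f) (hg : SmoothFam n W g) :
    SmoothFam n W fun w x => f w x * g w x := fun e he => (hf e he).mul (hg e he)

theorem SmoothFam.add (hf : SmoothFam n W f) (hg : SmoothFam n W g) :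
    SmoothFam n W fun w x => f w x + g w x := fun e he => (hf e he).add (hg e he)

theorem SmoothFam.sub (hf : SmoothFam n W f) (hg : SmoothFam n W g) :
    SmoothFam n W fun w x => f w x - g w x := fun e he => (hf e he).sub (hg e he)

theorem SmoothFam.im (hf : SmoothFam n W f) : SmoothFam n W fun w x => ((f w x).im : ℂ) :=
  fun e he => (Complex.ofRealCLM.comp Complex.imCLM).contDiff.comp_contDiffOn (hf e he)

theorem SmoothFam.hess (hf : SmoothFam n W f) (hW : UniqueDiffOn ℝ W) :
    SmoothMatFam W fun w => (hess (f w) : ChartMat n X) := fun e he j k =>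
  contDiffOn_dz_slice hW e.open_target (F := fun w => dzbar k fun y => f w (e.symm y))
    (contDiffOn_dzbar_slice hW e.open_target (F := fun w y => f w (e.symm y)) (hf e he) k) j

theorem SmoothMatFam.add (hK : SmoothMatFam W K) (hL : SmoothMatFam W L) :
    SmoothMatFam W fun w => K w + L w := fun e he j k => (hK e he j k).add (hL e he j k)

theorem smoothMatFam_const {K : ChartMat n X} (hK : IsSmoothMat K) :
    SmoothMatFam W fun _ => K := fun e he j k =>
  (hK e he j k).comp contDiffOn_snd fun _ hq => hq.2

theorem SmoothMatFam.smul {c : E → ℂ} (hc : ContDiffOn ℝ ∞ c W) (hK : SmoothMatFam W K) :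
    SmoothMatFam W fun w => c w • K w := fun e he j k =>
  ContDiffOn.mul (hc.comp contDiffOn_fst fun _ hq => hq.1) (hK e he j k)

theorem SmoothMatFam.adj (hK : SmoothMatFam W K) : SmoothMatFam W fun w => adj (K w) :=
  fun e he j k => contDiffOn_adjugate (hK e he) j k

theorem SmoothMatFam.adjDeriv (hK : SmoothMatFam W K) (hL : SmoothMatFam W L)
    (hpos : ∀ w ∈ W, IsPosMat (K w)) :
    SmoothMatFam W fun w => (fun e z => adjDeriv (K w e z) (L w e z) : ChartMat n X) :=
  fun e he j k => contDiffOn_adjDeriv (hK e he) (hL e he)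
    (fun q hq => (hpos q.1 hq.1 e he q.2 hq.2).det_pos.ne') j k

theorem SmoothMatFam.ricMat (hK : SmoothMatFam W K) (hW : UniqueDiffOn ℝ W)
    (hpos : ∀ w ∈ W, IsPosMat (K w)) : SmoothMatFam W fun w => ricMat (K w) := fun e he j k =>
  (contDiffOn_dz_slice hW e.open_target
    (F := fun w => dzbar k fun y => ((Real.log (K w e y).det.re : ℝ) : ℂ))
    (contDiffOn_dzbar_slice hW e.open_target (F := fun w y => ((Real.log (K w e y).det.re : ℝ) : ℂ))
    (contDiffOn_logDet (hK e he) fun q hq => hpos q.1 hq.1 e he q.2 hq.2) k) j).neg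

section Holomorphic

variable [IsManifold 𝓘(ℂ, Cn n) ω X]

theorem smoothFam_glue {F : E → OpenPartialHomeomorph X (Cn n) → Cn n → ℂ}
    (hF : ∀ w ∈ W, IsInvariant (F w))
    (hs : ∀ e ∈ atlas (Cn n) X, ContDiffOn ℝ ∞ (fun q : E × Cn n => F q.1 e q.2) (W ×ˢ e.target)) :
    SmoothFam n W fun w => glue (F w) := fun e he =>
  (hs e he).congr fun q hq => glue_symm (hF q.1 hq.1) he hq.2

theorem contDiffOn_det_inv_snd {Ω : DForm n 2 X} (hΩ : IsKahlerForm Ω)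
    {e : OpenPartialHomeomorph X (Cn n)} (he : e ∈ atlas (Cn n) X) :
    ContDiffOn ℝ ∞ (fun q : E × Cn n => (cf Ω e q.2).det⁻¹) (W ×ˢ e.target) :=
  (contDiffOn_det_inv hΩ he).comp contDiffOn_snd fun _ hq => hq.2

theorem smoothFam_trDiv {Ω : DForm n 2 X} (hΩ : IsKahlerForm Ω) (hK : SmoothMatFam W K)
    (hKt : ∀ w ∈ W, IsCotensor (K w)) (hL : SmoothMatFam W L) (hLt : ∀ w ∈ W, IsTensor (L w)) :
    SmoothFam n W fun w => trDiv Ω (K w) (L w) := by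
  refine smoothFam_glue (fun w hw => (hKt w hw).isInvariant_trace_div (hLt w hw)
    (isTensor_cf hΩ.type11)) fun e he => ?_
  simp only [div_eq_mul_inv]
  exact (contDiffOn_trace (contDiffOn_mul (hK e he) (hL e he))).mul (contDiffOn_det_inv_snd hΩ he)

theorem smoothFam_detDiv {Ω : DForm n 2 X} (hΩ : IsKahlerForm Ω) (hK : SmoothMatFam W K)
    (hKt : ∀ w ∈ W, IsTensor (K w)) : SmoothFam n W fun w => detDiv Ω (K w) := by
  refine smoothFam_glue (fun w hw => (hKt w hw).isInvariant_det_div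
    (isTensor_cf hΩ.type11)) fun e he => ?_
  simp only [div_eq_mul_inv]
  exact (contDiffOn_det (hK e he)).mul (contDiffOn_det_inv_snd hΩ he)

theorem SmoothFam.continuousOn (hf : SmoothFam n W f) :
    ContinuousOn (fun q : E × X => f q.1 q.2) (W ×ˢ Set.univ) := by
  intro q hq
  set c := chartAt (Cn n) q.2
  have hc : c ∈ atlas (Cn n) X := chart_mem_atlas _ _
  have h1 : ContinuousWithinAt (fun r : E × X => f r.1 (c.symm (c r.2))) (W ×ˢ c.source) q := by
    refine ((hf c hc).continuousOn (q.1, c q.2) ⟨hq.1, mem_chart_target _ _⟩).comp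
      (f := fun r : E × X => (r.1, c r.2)) (s := W ×ˢ c.source) ?_
      fun r hr => ⟨hr.1, c.map_source hr.2⟩
    exact (continuous_fst.continuousWithinAt).prodMk
      ((c.continuousAt (mem_chart_source _ _)).comp continuous_snd.continuousAt).continuousWithinAt
  have h2 : ContinuousWithinAt (fun r : E × X => f r.1 r.2) (W ×ˢ c.source) q := by
    refine h1.congr (fun r hr => by rw [c.left_inv hr.2]) ?_
    rw [c.left_inv (mem_chart_source _ _)]
  refine h2.mono_of_mem_nhdsWithin ?_
  have : Set.univ ×ˢ c.source ∈ nhds q :=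
    (isOpen_univ.prod c.open_source).mem_nhds ⟨Set.mem_univ _, mem_chart_source _ _⟩
  filter_upwards [self_mem_nhdsWithin, mem_nhdsWithin_of_mem_nhds this] with r h3 h4
  exact ⟨h3.1, h4.2⟩

variable [T2Space X] [CompactSpace X] [MeasurableSpace X] [BorelSpace X]

/-- A jointly continuous family on a compact space is uniformly bounded near each parameter. -/
theorem SmoothFam.eventually_norm_le (hf : SmoothFam n W f) (hw : w ∈ W) :
    ∃ C : ℝ, ∀ᶠ v in nhdsWithin w W, ∀ x, ‖f v x‖ ≤ C := by
  obtain ⟨C, hC⟩ : ∃ C : ℝ, ∀ x, ‖f w x‖ < C := by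
    obtain ⟨C, hC⟩ := (isCompact_range (hf.slice hw).continuous.norm).bddAbove
    exact ⟨C + 1, fun x => lt_of_le_of_lt (hC ⟨x, rfl⟩) (lt_add_one C)⟩
  refine ⟨C, ?_⟩
  have h1 : ∀ x ∈ (Set.univ : Set X),
      {q : E × X | ‖f q.1 q.2‖ ≤ C} ∈ nhdsWithin w W ×ˢ nhds x := by
    intro x _
    have h2 := (hf.continuousOn (w, x) ⟨hw, Set.mem_univ _⟩).norm.eventually_lt
      continuousWithinAt_const (hC x)
    rw [nhdsWithin_prod_eq, nhdsWithin_univ] at h2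
    filter_upwards [h2] with q hq using hq.le
  have h2 := isCompact_univ.mem_prod_nhdsSet_of_forall h1
  rw [nhdsSet_univ, Filter.mem_prod_top] at h2
  exact h2

theorem SmoothFam.continuousOn_integral {Ω : DForm n 2 X} (hΩ : IsKahlerForm Ω)
    (hf : SmoothFam n W f) : ContinuousOn (fun w => ∫ x, f w x ∂volMeasure Ω) W := by
  haveI := isFiniteMeasure_volMeasure hΩ
  exact continuousOn_integral_of_compact_support isCompact_univ hf.continuousOn
    fun p x _ hx => absurd (Set.mem_univ x) hx

/-- Differentiation under the integral sign, for smooth families. -/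
theorem hasDerivAt_integral {Ω : DForm n 2 X} (hΩ : IsKahlerForm Ω) {T : Set ℝ} (hT : IsOpen T)
    {f f' : ℝ → X → ℂ} (hf : SmoothFam n T f) (hf' : SmoothFam n T f')
    (hd : ∀ t ∈ T, ∀ x, HasDerivAt (fun s => f s x) (f' t x) t) {t : ℝ} (ht : t ∈ T) :
    HasDerivAt (fun s => ∫ x, f s x ∂volMeasure Ω) (∫ x, f' t x ∂volMeasure Ω) t := by
  haveI := isFiniteMeasure_volMeasure hΩ
  obtain ⟨C, hC⟩ := hf'.eventually_norm_le ht
  rw [hT.nhdsWithin_eq ht] at hC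
  refine (hasDerivAt_integral_of_dominated_loc_of_deriv_le (F := f) (F' := f')
    (bound := fun _ => C) (s := {s | s ∈ T ∧ ∀ x, ‖f' s x‖ ≤ C})
    ((Filter.Eventually.and (hT.mem_nhds ht) hC)) ?_ ((hf.slice ht).continuous.integrable_volMeasure hΩ)
    ((hf'.slice ht).continuous.integrable_volMeasure hΩ).aestronglyMeasurable ?_
    (integrable_const C) ?_).2
  · filter_upwards [hT.mem_nhds ht] with v hv
    exact ((hf.slice hv).continuous.integrable_volMeasure hΩ).aestronglyMeasurable
  · exact Filter.Eventually.of_forall fun x s hs => hs.2 x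
  · exact Filter.Eventually.of_forall fun x s hs => hd s hs.1 x

end Holomorphic

end Families

/-! ### The first variation `1`-form and its derivative -/

section Variation

open MeasureTheory

variable {n : ℕ} {X : Type*} [TopologicalSpace X] [ChartedSpace (Cn n) X]
variable {e e' : OpenPartialHomeomorph X (Cn n)} {z : Cn n} {Ω₀ : DForm n 2 X}
variable {C G : ChartMat n X} {γ : ℂ} {c : ℝ}

/-- The coefficients of the complexified form `B + iΩ`. -/
def complexMat (p : DForm n 2 X × DForm n 2 X) : ChartMat n X := cf p.1 + Complex.I • cf p.2

/-- The imaginary part of a complex function, as a complex function. -/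
def imPart (f : X → ℂ) : X → ℂ := fun x => ((f x).im : ℂ)

/-- The `∂̄`-Laplacian `g^{jk̄} ∂_j ∂_k̄ v` of the metric with coefficients `G`. -/
def lap (G : ChartMat n X) (v : X → ℂ) : X → ℂ := glue fun e z => ((G e z)⁻¹ * hess v e z).trace

/-- The coefficients of the `(n-1,n-1)`-form obtained from `adj` by differentiation at `G` in the
direction `R`. -/
def adjD (G R : ChartMat n X) : ChartMat n X := fun e z => adjDeriv (G e z) (R e z)

/-- Agreement of coefficient matrices on the domains of the charts of the atlas. -/
def MatEq (K L : ChartMat n X) : Prop := ∀ e ∈ atlas (Cn n) X, ∀ z ∈ e.target, K e z = L e z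

theorem MatEq.ricMat {K L : ChartMat n X} (h : MatEq K L) : MatEq (ricMat K) (ricMat L) := by
  intro e he z hz
  ext j k
  simp only [BField.ricMat, Matrix.of_apply, neg_inj]
  refine dz_congr ?_ j
  filter_upwards [e.open_target.mem_nhds hz] with w hw
  refine dzbar_congr ?_ k
  filter_upwards [e.open_target.mem_nhds hw] with y hy
  rw [h e he y hy]

theorem MatEq.adj {K L : ChartMat n X} (h : MatEq K L) : MatEq (adj K) (adj L) := by
  intro e he z hz
  simp only [BField.adj, h e he z hz]

theorem MatEq.trDiv {K L K' L' : ChartMat n X} (h : MatEq K L) (h' : MatEq K' L') :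
    trDiv Ω₀ K K' = trDiv Ω₀ L L' := by
  ext x
  simp only [BField.trDiv, glue, h _ (chart_mem_atlas _ x) _ (mem_chart_target _ x),
    h' _ (chart_mem_atlas _ x) _ (mem_chart_target _ x)]

theorem MatEq.detDiv {K L : ChartMat n X} (h : MatEq K L) : detDiv Ω₀ K = detDiv Ω₀ L := by
  ext x
  simp only [BField.detDiv, glue, h _ (chart_mem_atlas _ x) _ (mem_chart_target _ x)]

theorem matEq_refl (K : ChartMat n X) : MatEq K K := fun _ _ _ _ => rfl

theorem cf_chartAt (η : DForm n 2 X) [IsManifold 𝓘(ℂ, Cn n) ω X] (x : X) :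
    cf η (chartAt (Cn n) x) (chartAt (Cn n) x x) = coeff (η x) := by
  rw [cf, inChart_chartAt]

section Holomorphic

variable [IsManifold 𝓘(ℂ, Cn n) ω X]

theorem CSmooth.imPart {f : X → ℂ} (hf : CSmooth n f) : CSmooth n (imPart f) := fun e he =>
  (Complex.ofRealCLM.comp Complex.imCLM).contDiff.comp_contDiffOn (hf e he)

theorem CSmooth.rePart {f : X → ℂ} (hf : CSmooth n f) : CSmooth n fun x => ((f x).re : ℂ) :=
  fun e he => (Complex.ofRealCLM.comp Complex.reCLM).contDiff.comp_contDiffOn (hf e he)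

theorem hess_add {u v : X → ℂ} (hu : CSmooth n u) (hv : CSmooth n v) :
    MatEq (hess (fun x => u x + v x) : ChartMat n X) (hess u + hess v) := by
  intro e he z hz
  ext j k
  exact dz_dzbar_add e.open_target (hu e he) (hv e he) hz j k

theorem hess_const_mul {u : X → ℂ} (hu : CSmooth n u) (a : ℂ) :
    MatEq (hess (fun x => a * u x) : ChartMat n X) (a • hess u) := by
  intro e he z hz
  ext j k
  have h1 : dzbar k (fun w => a * u (e.symm w)) =ᶠ[nhds z]
      fun w => a * dzbar k (fun w => u (e.symm w)) w := by
    filter_upwards [e.open_target.mem_nhds hz] with w hw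
    exact dzbar_const_mul (differentiableAt_comp_symm hu he hw) a k
  simp only [hess, Matrix.of_apply, Pi.smul_apply, Matrix.smul_apply, smul_eq_mul]
  rw [dz_congr h1, dz_const_mul (((hu e he).dzbar e.open_target k).differentiableAt_of_isOpen
    e.open_target hz)]

theorem cf_addPotential_snd (p : DForm n 2 X × DForm n 2 X) {φ : X → ℂ} (hφ : CSmooth n φ) :
    MatEq (cf (addPotential p φ).2) (cf p.2 + hess (imPart φ)) := by
  intro e he z hz
  rw [addPotential, cf_add, Pi.add_apply, Pi.add_apply, cf_iddbar hφ.imPart he hz]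
  rfl

theorem complexMat_addPotential (p : DForm n 2 X × DForm n 2 X) {φ : X → ℂ} (hφ : CSmooth n φ) :
    MatEq (complexMat (addPotential p φ)) (complexMat p + hess φ) := by
  intro e he z hz
  have h1 : hess φ e z = hess (fun x => ((φ x).re : ℂ)) e z + Complex.I • hess (imPart φ) e z := by
    have h2 := hess_add (hφ.rePart) (u := fun x => ((φ x).re : ℂ))
      (v := fun x => Complex.I * imPart φ x) (fun e he => contDiffOn_const.mul (hφ.imPart e he))
      e he z hz
    rw [Pi.add_apply, Pi.add_apply, hess_const_mul hφ.imPart Complex.I e he z hz] at h2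
    have h3 : (fun x => ((φ x).re : ℂ) + Complex.I * imPart φ x) = φ := funext fun x => by
      rw [imPart, mul_comm, Complex.re_add_im]
    rw [h3] at h2
    exact h2
  have h3 := cf_addPotential_snd p hφ e he z hz
  simp only [complexMat, Pi.add_apply, Pi.smul_apply] at h3 ⊢
  rw [h3, h1, smul_add]
  rw [addPotential]
  simp only [cf_add, Pi.add_apply]
  rw [cf_iddbar hφ.rePart he hz]
  abel

theorem isClosed11_complexMat {p : DForm n 2 X × DForm n 2 X} (h1 : IsClosedReal11 p.1)
    (h2 : IsClosedReal11 p.2) : IsClosed11 (complexMat p) :=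
  (isClosed11_cf h1).add ((isClosed11_cf h2).smul _)

theorem powerRatio_eq (p : DForm n 2 X × DForm n 2 X) :
    powerRatio p = detDiv p.2 (complexMat p) := by
  ext x
  rw [detDiv, glue, complexMat, powerRatio, complexCoeff, cf_chartAt, Pi.add_apply, Pi.add_apply,
    Pi.smul_apply, Pi.smul_apply, cf_chartAt, cf_chartAt]

theorem scalarCurvature_eq {Ω : DForm n 2 X} (hΩ : IsKahlerForm Ω) (x : X) :
    scalarCurvature Ω x = (trDiv Ω (adj (cf Ω)) (ricMat (cf Ω)) x).re := by
  rw [trDiv, glue, adj, ← trace_inv_mul_eq (det_cf_ne_zero hΩ (chart_mem_atlas _ _)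
    (mem_chart_target _ _))]
  rfl

theorem isClosed11_ricMat_cf {Ω : DForm n 2 X} (hΩ : IsKahlerForm Ω) : IsClosed11 (ricMat (cf Ω)) :=
  isClosed11_ricMat (isClosed11_cf hΩ.toIsClosedReal11) fun _ he _ hz => posDef_cf hΩ he hz

theorem cSmooth_powerRatio {p : DForm n 2 X × DForm n 2 X} (h1 : IsClosedReal11 p.1)
    (h2 : IsKahlerForm p.2) : CSmooth n (powerRatio p) := by
  rw [powerRatio_eq]
  have := isClosed11_complexMat h1 h2.toIsClosedReal11
  exact cSmooth_detDiv h2 this.tensor this.smooth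

theorem cSmooth_scalarCurvature {Ω : DForm n 2 X} (hΩ : IsKahlerForm Ω) :
    CSmooth n fun x => (scalarCurvature Ω x : ℂ) := by
  have h := isClosed11_ricMat_cf hΩ
  have ha := (isClosed11_cf hΩ.toIsClosedReal11).adjugate
  simp only [scalarCurvature_eq hΩ]
  exact (cSmooth_trDiv hΩ ha.cotensor ha.smooth h.tensor h.smooth).rePart

theorem trDiv_adj_hess {v : X → ℂ} (hpos : IsPosMat G) (x : X) :
    trDiv Ω₀ (adj G) (hess v) x = lap G v x * detDiv Ω₀ G x := by
  have h0 := (hpos _ (chart_mem_atlas _ x) _ (mem_chart_target _ x)).det_pos.ne'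
  simp only [trDiv, lap, detDiv, glue, adj]
  rw [trace_inv_mul_eq h0]
  field_simp

theorem cSmooth_lap (hG : IsClosed11 G) (hpos : IsPosMat G) {v : X → ℂ} (hv : CSmooth n v) :
    CSmooth n (lap G v) :=
  cSmooth_glue ((isTensor_hess hv).isInvariant_trace_inv hG.tensor hpos) fun e he =>
    contDiffOn_trace (contDiffOn_mul (contDiffOn_inv (hG.smooth e he)
      fun q hq => (hpos e he q hq).det_pos.ne') ((isClosed11_hess hv).smooth e he))

variable [T2Space X] [CompactSpace X] [MeasurableSpace X] [BorelSpace X]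

/-- The first variation `1`-form, in terms of the coefficients `C` of `B + iΩ` and `G` of `Ω`, with
all integrals taken against a reference volume form. -/
def sig (Ω₀ : DForm n 2 X) (γ : ℂ) (c : ℝ) (C G : ChartMat n X) (f : X → ℂ) : ℝ :=
  (∫ x, γ * (f x * detDiv Ω₀ C x) ∂volMeasure Ω₀).im -
    (∫ x, imPart f x * (trDiv Ω₀ (adj G) (ricMat G) x - c * detDiv Ω₀ G x) ∂volMeasure Ω₀).re

/-- The derivative of the first variation `1`-form at `(C, G)`, in the direction `i∂∂̄g`. -/
def sigHess (Ω₀ : DForm n 2 X) (γ : ℂ) (c : ℝ) (C G : ChartMat n X) (f g : X → ℂ) : ℝ :=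
  (∫ x, γ * (f x * trDiv Ω₀ (adj C) (hess g) x) ∂volMeasure Ω₀).im -
    (∫ x, imPart f x * (trDiv Ω₀ (adjD G (ricMat G)) (hess (imPart g)) x -
      trDiv Ω₀ (adj G) (hess (lap G (imPart g))) x -
        c * trDiv Ω₀ (adj G) (hess (imPart g)) x) ∂volMeasure Ω₀).re

theorem sig_congr {C' G' : ChartMat n X} (hC : MatEq C C') (hG : MatEq G G') (f : X → ℂ) :
    sig Ω₀ γ c C G f = sig Ω₀ γ c C' G' f := by
  simp only [sig, hC.detDiv, hG.detDiv, hG.adj.trDiv hG.ricMat]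

/-- The form `σ` in terms of the coefficient matrices. -/
theorem sigma_eq_sig (hΩ₀ : IsKahlerForm Ω₀) {p : DForm n 2 X × DForm n 2 X}
    (h1 : IsClosedReal11 p.1) (h2 : IsKahlerForm p.2) {f : X → ℂ} (hf : CSmooth n f) :
    sigma γ c p f = sig Ω₀ γ c (complexMat p) (cf p.2) f := by
  have hC := isClosed11_complexMat h1 h2.toIsClosedReal11
  have hG := isClosed11_cf h2.toIsClosedReal11
  have hR := isClosed11_ricMat_cf h2
  have hA := hG.adjugate
  have i1 : CSmooth n fun x => γ * (f x * detDiv Ω₀ (complexMat p) x) := fun e he =>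
    contDiffOn_const.mul ((hf.mul (cSmooth_detDiv hΩ₀ hC.tensor hC.smooth)) e he)
  have i2 : CSmooth n fun x => imPart f x * (trDiv Ω₀ (adj (cf p.2)) (ricMat (cf p.2)) x -
      c * detDiv Ω₀ (cf p.2) x) := fun e he =>
    (hf.imPart e he).mul ((cSmooth_trDiv hΩ₀ hA.cotensor hA.smooth hR.tensor hR.smooth e he).sub
      (contDiffOn_const.mul (cSmooth_detDiv hΩ₀ hG.tensor hG.smooth e he)))
  have hcont : Continuous fun x =>
      (f x * (γ * powerRatio p x - ((scalarCurvature p.2 x : ℂ) - (c : ℂ)))).im :=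
    Complex.continuous_im.comp (hf.continuous.mul
      ((continuous_const.mul (cSmooth_powerRatio h1 h2).continuous).sub
        ((cSmooth_scalarCurvature h2).continuous.sub continuous_const)))
  have e1 : (∫ x, γ * (f x * detDiv Ω₀ (complexMat p) x) ∂volMeasure Ω₀).im =
      ∫ x, (γ * (f x * detDiv Ω₀ (complexMat p) x)).im ∂volMeasure Ω₀ :=
    (Complex.imCLM.integral_comp_comm (i1.continuous.integrable_volMeasure hΩ₀)).symm
  have e2 : (∫ x, imPart f x * (trDiv Ω₀ (adj (cf p.2)) (ricMat (cf p.2)) x -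
      c * detDiv Ω₀ (cf p.2) x) ∂volMeasure Ω₀).re = ∫ x, (imPart f x *
        (trDiv Ω₀ (adj (cf p.2)) (ricMat (cf p.2)) x - c * detDiv Ω₀ (cf p.2) x)).re
          ∂volMeasure Ω₀ :=
    (Complex.reCLM.integral_comp_comm (i2.continuous.integrable_volMeasure hΩ₀)).symm
  have j1 : Integrable (fun x => (γ * (f x * detDiv Ω₀ (complexMat p) x)).im) (volMeasure Ω₀) :=
    Complex.imCLM.integrable_comp (i1.continuous.integrable_volMeasure hΩ₀)
  have j2 : Integrable (fun x => (imPart f x * (trDiv Ω₀ (adj (cf p.2)) (ricMat (cf p.2)) x -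
      c * detDiv Ω₀ (cf p.2) x)).re) (volMeasure Ω₀) :=
    Complex.reCLM.integrable_comp (i2.continuous.integrable_volMeasure hΩ₀)
  rw [sigma, volIntegral_eq hΩ₀ h2 hcont, sig, e1, e2, ← integral_sub j1 j2]
  refine integral_congr_ae (Filter.Eventually.of_forall fun x => ?_)
  have hx := chart_mem_atlas (Cn n) x
  have hxt := mem_chart_target (Cn n) x
  have hd0 := PosDef.det_eq_re (posDef_cf hΩ₀ hx hxt)
  have hd := PosDef.det_eq_re (posDef_cf h2 hx hxt)
  have hp0 := (PosDef.det_re_pos (posDef_cf hΩ₀ hx hxt)).ne'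
  have hp := (PosDef.det_re_pos (posDef_cf h2 hx hxt)).ne'
  simp only [scalarCurvature_eq h2, powerRatio_eq, volRatio, detDiv, trDiv, glue, adj, imPart,
    smul_eq_mul] at hd hd0 hp hp0 ⊢
  generalize (cf Ω₀ (chartAt (Cn n) x) (chartAt (Cn n) x x)).det = d0 at *
  generalize (cf p.2 (chartAt (Cn n) x) (chartAt (Cn n) x x)).det = d at *
  obtain ⟨r0, hr0⟩ : ∃ r : ℝ, r = d0.re := ⟨_, rfl⟩
  obtain ⟨r, hr⟩ : ∃ s : ℝ, s = d.re := ⟨_, rfl⟩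
  rw [← hr0] at hd0 hp0
  rw [← hr] at hd hp
  subst hd0 hd
  generalize (complexMat p (chartAt (Cn n) x) (chartAt (Cn n) x x)).det = dc
  generalize ((cf p.2 (chartAt (Cn n) x) (chartAt (Cn n) x x)).adjugate *
    ricMat (cf p.2) (chartAt (Cn n) x) (chartAt (Cn n) x x)).trace = t
  rw [← Complex.ofReal_div, Complex.ofReal_re, ← Complex.im_ofReal_mul]
  have q1 : ((r / r0 : ℝ) : ℂ) * (f x * (γ * (dc / (r : ℂ)) - (((t / (r : ℂ)).re : ℝ) - (c : ℂ)))) =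
      γ * (f x * (dc / (r0 : ℂ))) - f x * (((t / (r0 : ℂ)).re - c * (r / r0) : ℝ) : ℂ) := by
    rw [Complex.div_ofReal_re, Complex.div_ofReal_re]
    push_cast
    have : (r : ℂ) ≠ 0 := Complex.ofReal_ne_zero.2 hp
    have : (r0 : ℂ) ≠ 0 := Complex.ofReal_ne_zero.2 hp0
    field_simp
  rw [q1, Complex.sub_im, Complex.im_mul_ofReal, ← Complex.ofReal_mul, Complex.re_ofReal_mul,
    Complex.sub_re, Complex.ofReal_re]

end Holomorphic

end Variation

/-! ### The second variation -/

section SecondVariation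

open MeasureTheory

variable {n : ℕ} {X : Type*} [TopologicalSpace X] [ChartedSpace (Cn n) X]
variable {e e' : OpenPartialHomeomorph X (Cn n)} {z : Cn n} {Ω₀ : DForm n 2 X}
variable {C G : ChartMat n X} {γ : ℂ} {c : ℝ} {T : Set ℝ} {t : ℝ}
variable {φ φ' f f' v v' : ℝ → X → ℂ}

/-- Smooth paths `φ` of complex functions with velocity `φ'`, with time in an open set `T`. -/
structure SmoothPath (n : ℕ) {X : Type*} [TopologicalSpace X] [ChartedSpace (Cn n) X] (T : Set ℝ)
    (φ φ' : ℝ → X → ℂ) : Prop where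
  isOpen : IsOpen T
  smooth : SmoothFam n T φ
  smooth' : SmoothFam n T φ'
  hasDerivAt : ∀ t ∈ T, ∀ x, HasDerivAt (fun s => φ s x) (φ' t x) t

theorem SmoothPath.imPart (h : SmoothPath n T φ φ') :
    SmoothPath n T (fun t => imPart (φ t)) fun t => imPart (φ' t) where
  isOpen := h.isOpen
  smooth := h.smooth.im
  smooth' := h.smooth'.im
  hasDerivAt t ht x := (Complex.ofRealCLM.comp Complex.imCLM).hasFDerivAt.comp_hasDerivAt t
    (h.hasDerivAt t ht x)

theorem SmoothPath.hasDerivAt_hess (h : SmoothPath n T φ φ') (he : e ∈ atlas (Cn n) X)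
    (hz : z ∈ e.target) (ht : t ∈ T) (j k : Fin n) :
    HasDerivAt (fun s => hess (φ s) e z j k) (hess (φ' t) e z j k) t := by
  have h1 : ∀ s ∈ T, ∀ y ∈ e.target, HasDerivAt (fun r => φ r (e.symm y)) (φ' s (e.symm y)) s :=
    fun s hs y _ => h.hasDerivAt s hs _
  exact hasDerivAt_dz_slice h.isOpen e.open_target
    (F := fun s => dzbar k fun y => φ s (e.symm y)) (F' := fun s => dzbar k fun y => φ' s (e.symm y))
    (contDiffOn_dzbar_slice h.isOpen.uniqueDiffOn e.open_target
      (F := fun s y => φ s (e.symm y)) (h.smooth e he) k)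
    (fun s hs y hy => hasDerivAt_dzbar_slice h.isOpen e.open_target (F := fun s y => φ s (e.symm y))
      (F' := fun s y => φ' s (e.symm y)) (h.smooth e he) h1 hs hy k) ht hz j

/-- The coefficients of `G + i∂∂̄u`. -/
abbrev addHess (G : ChartMat n X) (u : X → ℂ) : ChartMat n X := G + hess u

section Holomorphic

variable [IsManifold 𝓘(ℂ, Cn n) ω X]

theorem isClosed11_add_hess {u : X → ℂ} (hG : IsClosed11 G) (hu : CSmooth n u) :
    IsClosed11 (addHess G u) := hG.add (isClosed11_hess hu)

theorem SmoothPath.hasDerivAt_add_hess (h : SmoothPath n T φ φ') (he : e ∈ atlas (Cn n) X)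
    (hz : z ∈ e.target) (ht : t ∈ T) (j k : Fin n) :
    HasDerivAt (fun s => (addHess G (φ s)) e z j k) (hess (φ' t) e z j k) t := by
  simpa using (h.hasDerivAt_hess he hz ht j k).const_add (G e z j k)

theorem smoothMatFam_add_hess {E : Type*} [NormedAddCommGroup E] [NormedSpace ℝ E] {W : Set E}
    (hW : UniqueDiffOn ℝ W) (hG : IsClosed11 G) {u : E → X → ℂ} (hu : SmoothFam n W u) :
    SmoothMatFam W fun w => addHess G (u w) :=
  (smoothMatFam_const hG.smooth).add (hu.hess hW)

/-- The derivative of `log det` is the Laplacian of the potential. -/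
theorem SmoothPath.hasDerivAt_logDet (h : SmoothPath n T v v') (hG : IsClosed11 G)
    (hpos : ∀ t ∈ T, IsPosMat (addHess G (v t))) (he : e ∈ atlas (Cn n) X) (hz : z ∈ e.target)
    (ht : t ∈ T) :
    HasDerivAt (fun s => ((Real.log ((addHess G (v s)) e z).det.re : ℝ) : ℂ))
      (lap (addHess G (v t)) (v' t) (e.symm z)) t := by
  have h1 := hasDerivAt_det (K := fun s => (addHess G (v s)) e z) (K' := hess (v' t) e z)
    fun j k => h.hasDerivAt_add_hess he hz ht j k
  have hp := hpos t ht e he z hz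
  have h2 : HasDerivAt (fun s => ((addHess G (v s)) e z).det.re) _ t :=
    Complex.reCLM.hasFDerivAt.comp_hasDerivAt t h1
  have h3 := h2.ofReal_comp
  have h4 : (fun s => ((((addHess G (v s)) e z).det.re : ℝ) : ℂ)) =ᶠ[nhds t]
      fun s => ((addHess G (v s)) e z).det := by
    filter_upwards [h.isOpen.mem_nhds ht] with s hs
    exact (PosDef.det_eq_re (hpos s hs e he z hz)).symm
  have h5 := h3.unique (h1.congr_of_eventuallyEq h4)
  have h6 := (h2.log (PosDef.det_re_pos hp).ne').ofReal_comp
  convert h6 using 1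
  have hcl := isClosed11_add_hess hG (h.smooth.slice ht)
  rw [lap, glue_symm ((isTensor_hess (h.smooth'.slice ht)).isInvariant_trace_inv hcl.tensor
    (hpos t ht)) he hz, trace_inv_mul_eq hp.det_pos.ne', Complex.ofReal_div, h5,
    ← PosDef.det_eq_re hp]

/-- The derivative of the Ricci form is `-i∂∂̄` of the Laplacian of the potential. -/
theorem SmoothPath.hasDerivAt_ricMat (h : SmoothPath n T v v') (hG : IsClosed11 G)
    (hpos : ∀ t ∈ T, IsPosMat (addHess G (v t))) (he : e ∈ atlas (Cn n) X) (hz : z ∈ e.target)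
    (ht : t ∈ T) (j k : Fin n) :
    HasDerivAt (fun s => ricMat (addHess G (v s)) e z j k)
      (-hess (lap (addHess G (v t)) (v' t)) e z j k) t := by
  have hT := h.isOpen.uniqueDiffOn (𝕜 := ℝ)
  have hK := smoothMatFam_add_hess hT hG h.smooth
  have hs : ContDiffOn ℝ ∞ (fun q : ℝ × Cn n =>
      ((Real.log ((addHess G (v q.1)) e q.2).det.re : ℝ) : ℂ)) (T ×ˢ e.target) :=
    contDiffOn_logDet (hK e he) fun q hq => hpos q.1 hq.1 e he q.2 hq.2
  have h1 : ∀ s ∈ T, ∀ y ∈ e.target,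
      HasDerivAt (fun r => ((Real.log ((addHess G (v r)) e y).det.re : ℝ) : ℂ))
        (lap (addHess G (v s)) (v' s) (e.symm y)) s := fun s hs y hy =>
    h.hasDerivAt_logDet hG hpos he hy hs
  exact (hasDerivAt_dz_slice h.isOpen e.open_target
    (F := fun s => dzbar k fun y => ((Real.log ((addHess G (v s)) e y).det.re : ℝ) : ℂ))
    (F' := fun s => dzbar k fun y => lap (addHess G (v s)) (v' s) (e.symm y))
    (contDiffOn_dzbar_slice h.isOpen.uniqueDiffOn e.open_target
      (F := fun s y => ((Real.log ((addHess G (v s)) e y).det.re : ℝ) : ℂ)) hs k)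
    (fun s hs' y hy => hasDerivAt_dzbar_slice h.isOpen e.open_target
      (F := fun s y => ((Real.log ((addHess G (v s)) e y).det.re : ℝ) : ℂ))
      (F' := fun s y => lap (addHess G (v s)) (v' s) (e.symm y)) hs h1 hs' hy k) ht hz j).neg

theorem SmoothPath.hasDerivAt_detDiv (h : SmoothPath n T φ φ') (ht : t ∈ T) (x : X) :
    HasDerivAt (fun s => detDiv Ω₀ (addHess C (φ s)) x)
      (trDiv Ω₀ (adj (addHess C (φ t))) (hess (φ' t)) x) t :=
  (hasDerivAt_det fun j k => h.hasDerivAt_add_hess (chart_mem_atlas _ x) (mem_chart_target _ x)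
    ht j k).div_const _

theorem hasDerivAt_trace_mul {A B : ℝ → Matrix (Fin n) (Fin n) ℂ} {A' B' : Matrix (Fin n) (Fin n) ℂ}
    (hA : ∀ j k, HasDerivAt (fun s => A s j k) (A' j k) t)
    (hB : ∀ j k, HasDerivAt (fun s => B s j k) (B' j k) t) :
    HasDerivAt (fun s => (A s * B s).trace) ((A' * B t).trace + (A t * B').trace) t := by
  simp only [Matrix.trace, Matrix.diag, Matrix.mul_apply, ← Finset.sum_add_distrib]
  exact HasDerivAt.fun_sum fun j _ => HasDerivAt.fun_sum fun k _ => (hA j k).mul (hB k j)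

theorem SmoothPath.hasDerivAt_trDiv_ric (h : SmoothPath n T v v') (hG : IsClosed11 G)
    (hpos : ∀ t ∈ T, IsPosMat (addHess G (v t))) (ht : t ∈ T) (x : X) :
    HasDerivAt (fun s => trDiv Ω₀ (adj (addHess G (v s))) (ricMat (addHess G (v s))) x)
      (trDiv Ω₀ (adjD (addHess G (v t)) (ricMat (addHess G (v t)))) (hess (v' t)) x -
        trDiv Ω₀ (adj (addHess G (v t))) (hess (lap (addHess G (v t)) (v' t))) x) t := by
  have hx := chart_mem_atlas (Cn n) x
  have hxt := mem_chart_target (Cn n) x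
  have h1 := hasDerivAt_trace_mul (hasDerivAt_adjugate (hpos t ht _ hx _ hxt).det_pos.ne'
      fun j k => h.hasDerivAt_add_hess (G := G) hx hxt ht j k)
    (B' := -hess (lap (addHess G (v t)) (v' t)) (chartAt (Cn n) x) (chartAt (Cn n) x x))
    fun j k => h.hasDerivAt_ricMat hG hpos hx hxt ht j k
  have h2 := h1.div_const (cf Ω₀ (chartAt (Cn n) x) (chartAt (Cn n) x x)).det
  refine h2.congr_deriv ?_
  rw [trace_adjDeriv_mul_comm, Matrix.mul_neg, Matrix.trace_neg, ← sub_eq_add_neg, sub_div]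
  rfl

section Families

variable {E : Type*} [NormedAddCommGroup E] [NormedSpace ℝ E] {W : Set E} {u g : E → X → ℂ}

theorem smoothFam_detDiv_term (hΩ₀ : IsKahlerForm Ω₀) (hW : UniqueDiffOn ℝ W) (hC : IsClosed11 C)
    (hu : SmoothFam n W u) (hg : SmoothFam n W g) (a : ℂ) :
    SmoothFam n W fun w x => a * (g w x * detDiv Ω₀ (addHess C (u w)) x) :=
  (smoothFam_param contDiffOn_const).mul (hg.mul (smoothFam_detDiv hΩ₀
    (smoothMatFam_add_hess hW hC hu) fun _ hw => (isClosed11_add_hess hC (hu.slice hw)).tensor))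

theorem smoothFam_scalar_term (hΩ₀ : IsKahlerForm Ω₀) (hW : UniqueDiffOn ℝ W) (hG : IsClosed11 G)
    (hu : SmoothFam n W u) (hpos : ∀ w ∈ W, IsPosMat (addHess G (u w))) (hg : SmoothFam n W g) :
    SmoothFam n W fun w x => g w x * (trDiv Ω₀ (adj (addHess G (u w))) (ricMat (addHess G (u w))) x -
      c * detDiv Ω₀ (addHess G (u w)) x) := by
  have hK := smoothMatFam_add_hess hW hG hu
  have hcl := fun w hw => isClosed11_add_hess hG (hu.slice (w := w) hw)
  exact hg.mul ((smoothFam_trDiv hΩ₀ hK.adj (fun w hw => (hcl w hw).adjugate.cotensor)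
    (hK.ricMat hW hpos) fun w hw => (isClosed11_ricMat (hcl w hw) (hpos w hw)).tensor).sub
    ((smoothFam_param contDiffOn_const).mul (smoothFam_detDiv hΩ₀ hK fun w hw => (hcl w hw).tensor)))

theorem smoothFam_lap (hW : UniqueDiffOn ℝ W) (hG : IsClosed11 G) (hu : SmoothFam n W u)
    (hpos : ∀ w ∈ W, IsPosMat (addHess G (u w))) (hg : SmoothFam n W g) :
    SmoothFam n W fun w => lap (addHess G (u w)) (g w) := by
  have hK := smoothMatFam_add_hess hW hG hu
  refine smoothFam_glue (F := fun w e z => (((addHess G (u w)) e z)⁻¹ * hess (g w) e z).trace)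
    (fun w hw => (isTensor_hess (hg.slice hw)).isInvariant_trace_inv
    (isClosed11_add_hess hG (hu.slice hw)).tensor (hpos w hw)) fun e he => ?_
  exact contDiffOn_trace (contDiffOn_mul (contDiffOn_inv (hK e he)
    fun q hq => (hpos q.1 hq.1 e he q.2 hq.2).det_pos.ne') (hg.hess hW e he))

theorem smoothFam_detDiv_deriv_term (hΩ₀ : IsKahlerForm Ω₀) (hW : UniqueDiffOn ℝ W)
    (hC : IsClosed11 C) (hu : SmoothFam n W u) {f : E → X → ℂ} (hf : SmoothFam n W f)
    (hg : SmoothFam n W g) (a : ℂ) :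
    SmoothFam n W fun w x => a * (f w x * trDiv Ω₀ (adj (addHess C (u w))) (hess (g w)) x) :=
  (smoothFam_param contDiffOn_const).mul (hf.mul (smoothFam_trDiv hΩ₀
    (smoothMatFam_add_hess hW hC hu).adj
    (fun _ hw => (isClosed11_add_hess hC (hu.slice hw)).adjugate.cotensor) (hg.hess hW)
    fun _ hw => isTensor_hess (hg.slice hw)))

theorem smoothFam_scalar_deriv_term (hΩ₀ : IsKahlerForm Ω₀) (hW : UniqueDiffOn ℝ W)
    (hG : IsClosed11 G) (hu : SmoothFam n W u) (hpos : ∀ w ∈ W, IsPosMat (addHess G (u w)))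
    {f : E → X → ℂ} (hf : SmoothFam n W f) (hg : SmoothFam n W g) :
    SmoothFam n W fun w x => f w x *
      (trDiv Ω₀ (adjD (addHess G (u w)) (ricMat (addHess G (u w)))) (hess (g w)) x -
        trDiv Ω₀ (adj (addHess G (u w))) (hess (lap (addHess G (u w)) (g w))) x -
          c * trDiv Ω₀ (adj (addHess G (u w))) (hess (g w)) x) := by
  have hK := smoothMatFam_add_hess hW hG hu
  have hcl := fun w hw => isClosed11_add_hess hG (hu.slice (w := w) hw)
  have hlap := smoothFam_lap hW hG hu hpos hg
  have hRcl := fun w hw => isClosed11_ricMat (hcl w hw) (hpos w hw)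
  exact hf.mul (((smoothFam_trDiv hΩ₀ (hK.adjDeriv (hK.ricMat hW hpos) hpos)
      (fun w hw => (isCoclosed_adjDeriv (hcl w hw) (hpos w hw) (hRcl w hw)).cotensor)
      (hg.hess hW) fun w hw => isTensor_hess (hg.slice hw)).sub
      (smoothFam_trDiv hΩ₀ hK.adj (fun w hw => (hcl w hw).adjugate.cotensor) (hlap.hess hW)
        fun w hw => isTensor_hess (hlap.slice hw))).sub
      ((smoothFam_param contDiffOn_const).mul (smoothFam_trDiv hΩ₀ hK.adj
        (fun w hw => (hcl w hw).adjugate.cotensor) (hg.hess hW)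
        fun w hw => isTensor_hess (hg.slice hw))))

end Families

variable [T2Space X] [CompactSpace X] [MeasurableSpace X] [BorelSpace X]

theorem continuousOn_sig {E : Type*} [NormedAddCommGroup E] [NormedSpace ℝ E] {W : Set E}
    {u g : E → X → ℂ} (hΩ₀ : IsKahlerForm Ω₀) (hW : UniqueDiffOn ℝ W) (hC : IsClosed11 C)
    (hG : IsClosed11 G) (hu : SmoothFam n W u)
    (hpos : ∀ w ∈ W, IsPosMat (addHess G (imPart (u w)))) (hg : SmoothFam n W g) :
    ContinuousOn (fun w => sig Ω₀ γ c (addHess C (u w)) (addHess G (imPart (u w))) (g w)) W :=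
  (Complex.continuous_im.comp_continuousOn
    (smoothFam_detDiv_term hΩ₀ hW hC hu hg γ |>.continuousOn_integral hΩ₀)).sub
  (Complex.continuous_re.comp_continuousOn
    ((smoothFam_scalar_term hΩ₀ hW hG hu.im hpos hg.im).continuousOn_integral hΩ₀))

theorem continuousOn_sigHess {E : Type*} [NormedAddCommGroup E] [NormedSpace ℝ E] {W : Set E}
    {u f g : E → X → ℂ} (hΩ₀ : IsKahlerForm Ω₀) (hW : UniqueDiffOn ℝ W) (hC : IsClosed11 C)
    (hG : IsClosed11 G) (hu : SmoothFam n W u)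
    (hpos : ∀ w ∈ W, IsPosMat (addHess G (imPart (u w)))) (hf : SmoothFam n W f)
    (hg : SmoothFam n W g) :
    ContinuousOn (fun w => sigHess Ω₀ γ c (addHess C (u w)) (addHess G (imPart (u w)))
      (f w) (g w)) W :=
  (Complex.continuous_im.comp_continuousOn
    (smoothFam_detDiv_deriv_term hΩ₀ hW hC hu hf hg γ |>.continuousOn_integral hΩ₀)).sub
  (Complex.continuous_re.comp_continuousOn
    ((smoothFam_scalar_deriv_term hΩ₀ hW hG hu.im hpos hf.im hg.im).continuousOn_integral hΩ₀))

/-- The derivative of `σ` along a path. -/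
theorem hasDerivAt_sig (hΩ₀ : IsKahlerForm Ω₀) (hC : IsClosed11 C) (hG : IsClosed11 G)
    (h : SmoothPath n T φ φ') (hf : SmoothPath n T f f')
    (hpos : ∀ t ∈ T, IsPosMat (addHess G (imPart (φ t)))) (ht : t ∈ T) :
    HasDerivAt (fun s => sig Ω₀ γ c (addHess C (φ s)) (addHess G (imPart (φ s))) (f s))
      (sig Ω₀ γ c (addHess C (φ t)) (addHess G (imPart (φ t))) (f' t) +
        sigHess Ω₀ γ c (addHess C (φ t)) (addHess G (imPart (φ t))) (f t) (φ' t)) t := by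
  have hT := h.isOpen.uniqueDiffOn (𝕜 := ℝ)
  have hv := h.imPart
  -- the first integral
  have s1 := smoothFam_detDiv_deriv_term hΩ₀ hT hC h.smooth hf.smooth h.smooth' γ
  have s2 := smoothFam_detDiv_term hΩ₀ hT hC h.smooth hf.smooth' γ
  have d1 := hasDerivAt_integral hΩ₀ h.isOpen (smoothFam_detDiv_term hΩ₀ hT hC h.smooth hf.smooth γ)
    (s2.add s1) (fun t ht x => by
      have := ((hf.hasDerivAt t ht x).mul (h.hasDerivAt_detDiv (C := C) (Ω₀ := Ω₀) ht x)).const_mul γ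
      rw [mul_add] at this
      exact this) ht
  -- the second integral
  have s3 := smoothFam_scalar_deriv_term (c := c) hΩ₀ hT hG hv.smooth hpos hf.imPart.smooth
    hv.smooth'
  have s4 := smoothFam_scalar_term (c := c) hΩ₀ hT hG hv.smooth hpos hf.imPart.smooth'
  have d2 := hasDerivAt_integral hΩ₀ h.isOpen
    (smoothFam_scalar_term (c := c) hΩ₀ hT hG hv.smooth hpos hf.imPart.smooth) (s4.add s3)
    (fun t ht x => (hf.imPart.hasDerivAt t ht x).mul
      ((hv.hasDerivAt_trDiv_ric hG hpos ht x).sub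
        ((hv.hasDerivAt_detDiv (C := G) (Ω₀ := Ω₀) ht x).const_mul (c : ℂ)))) ht
  have i1 := fun {F : ℝ → X → ℂ} (hF : SmoothFam n T F) =>
    (hF.slice ht).continuous.integrable_volMeasure hΩ₀
  have d1' := Complex.imCLM.hasFDerivAt.comp_hasDerivAt t d1
  have d2' := Complex.reCLM.hasFDerivAt.comp_hasDerivAt t d2
  rw [integral_add (i1 s2) (i1 s1), Complex.imCLM.map_add] at d1'
  rw [integral_add (i1 s4) (i1 s3), Complex.reCLM.map_add] at d2'
  refine (d1'.sub d2').congr_deriv ?_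
  simp only [sig, sigHess, Complex.imCLM_apply, Complex.reCLM_apply]
  ring

/-- The second variation is symmetric. -/
theorem sigHess_symm (hΩ₀ : IsKahlerForm Ω₀) (hC : IsClosed11 C) (hG : IsClosed11 G)
    (hpos : IsPosMat G) {f g : X → ℂ} (hf : CSmooth n f) (hg : CSmooth n g) :
    sigHess Ω₀ γ c C G f g = sigHess Ω₀ γ c C G g f := by
  have hR := isClosed11_ricMat hG hpos
  have hD : IsCoclosed (adjD G (ricMat G)) := isCoclosed_adjDeriv hG hpos hR
  have hA : IsCoclosed (adj G) := hG.adjugate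
  have key : ∀ f g : X → ℂ, CSmooth n f → CSmooth n g →
      ∫ x, f x * (trDiv Ω₀ (adjD G (ricMat G)) (hess g) x -
        trDiv Ω₀ (adj G) (hess (lap G g)) x - c * trDiv Ω₀ (adj G) (hess g) x) ∂volMeasure Ω₀ =
      ∫ x, f x * trDiv Ω₀ (adjD G (ricMat G)) (hess g) x ∂volMeasure Ω₀ -
        ∫ x, lap G g x * (lap G f x * detDiv Ω₀ G x) ∂volMeasure Ω₀ -
          c * ∫ x, f x * trDiv Ω₀ (adj G) (hess g) x ∂volMeasure Ω₀ := by
    intro f g hf hg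
    have t1 := cSmooth_trDiv hΩ₀ hD.cotensor hD.smooth (isTensor_hess hg) (isClosed11_hess hg).smooth
    have hl := cSmooth_lap hG hpos hg
    have t2 := cSmooth_trDiv hΩ₀ hA.cotensor hA.smooth (isTensor_hess hl) (isClosed11_hess hl).smooth
    have t3 := cSmooth_trDiv hΩ₀ hA.cotensor hA.smooth (isTensor_hess hg) (isClosed11_hess hg).smooth
    have i1 := fun {F : X → ℂ} (hF : CSmooth n F) => hF.continuous.integrable_volMeasure hΩ₀
    have e2 := integral_trDiv_hess_symm hΩ₀ hA hf hl
    have e3 : ∀ x, trDiv Ω₀ (adj G) (hess f) x = lap G f x * detDiv Ω₀ G x := fun x =>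
      trDiv_adj_hess hpos x
    -- the fourth order term becomes `∫ Δf Δg`
    have e2' : ∫ x, f x * trDiv Ω₀ (adj G) (hess (lap G g)) x ∂volMeasure Ω₀ =
      ∫ x, lap G g x * (lap G f x * detDiv Ω₀ G x) ∂volMeasure Ω₀ := by
      simp only [← e3]; exact e2
    have j1 : Integrable (fun x => f x * trDiv Ω₀ (adjD G (ricMat G)) (hess g) x -
        f x * trDiv Ω₀ (adj G) (hess (lap G g)) x) (volMeasure Ω₀) :=
      (i1 (hf.mul t1)).sub (i1 (hf.mul t2))
    rw [← e2', ← integral_const_mul, ← integral_sub (i1 (hf.mul t1)) (i1 (hf.mul t2)),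
      ← integral_sub j1 ((i1 (hf.mul t3)).const_mul _)]
    refine integral_congr_ae (Filter.Eventually.of_forall fun x => ?_)
    show f x * (trDiv Ω₀ (adjD G (ricMat G)) (hess g) x - trDiv Ω₀ (adj G) (hess (lap G g)) x -
      c * trDiv Ω₀ (adj G) (hess g) x) = f x * trDiv Ω₀ (adjD G (ricMat G)) (hess g) x -
        f x * trDiv Ω₀ (adj G) (hess (lap G g)) x - c * (f x * trDiv Ω₀ (adj G) (hess g) x)
    ring
  have h1 : ∫ x, γ * (f x * trDiv Ω₀ (adj C) (hess g) x) ∂volMeasure Ω₀ =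
      ∫ x, γ * (g x * trDiv Ω₀ (adj C) (hess f) x) ∂volMeasure Ω₀ := by
    rw [integral_const_mul, integral_const_mul]
    congr 1
    exact integral_trDiv_hess_symm hΩ₀ hC.adjugate hf hg
  rw [sigHess, sigHess, h1, key _ _ hf.imPart hg.imPart, key _ _ hg.imPart hf.imPart]
  have h2 := integral_trDiv_hess_symm hΩ₀ hD hf.imPart hg.imPart
  have h3 := integral_trDiv_hess_symm hΩ₀ hA hf.imPart hg.imPart
  have h4 : ∫ x, lap G (imPart g) x * (lap G (imPart f) x * detDiv Ω₀ G x) ∂volMeasure Ω₀ =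
      ∫ x, lap G (imPart f) x * (lap G (imPart g) x * detDiv Ω₀ G x) ∂volMeasure Ω₀ := by
    congr 1; ext x; ring
  rw [h4]
  rw [h2, h3]

end Holomorphic

end SecondVariation

/-! ### Potentials and the complexified class -/

section Potentials

open MeasureTheory

variable {n : ℕ} {X : Type*} [TopologicalSpace X] [ChartedSpace (Cn n) X]
variable {e e' : OpenPartialHomeomorph X (Cn n)} {z : Cn n}

/-- Positive definiteness is an open condition on Hermitian matrices: it can be tested on the
compact unit sphere. -/
theorem eventually_posDef {Y : Type*} [TopologicalSpace Y] {A : Y → Matrix (Fin n) (Fin n) ℂ}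
    {y₀ : Y} (hc : ∀ j k, ContinuousAt (fun y => A y j k) y₀)
    (hH : ∀ᶠ y in nhds y₀, (A y).IsHermitian) (h0 : (A y₀).PosDef) :
    ∀ᶠ y in nhds y₀, (A y).PosDef := by
  have hF : ∀ v : Fin n → ℂ, ContinuousAt
      (fun q : Y × (Fin n → ℂ) => (star q.2 ⬝ᵥ (A q.1 *ᵥ q.2)).re) (y₀, v) := by
    intro v
    refine Complex.continuous_re.continuousAt.comp ?_
    simp only [dotProduct, Matrix.mulVec, Finset.mul_sum]
    refine tendsto_finsetSum _ fun j _ => tendsto_finsetSum _ fun k _ => ?_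
    refine Filter.Tendsto.mul (Continuous.tendsto (by fun_prop) _) (Filter.Tendsto.mul ?_
      (Continuous.tendsto (by fun_prop) _))
    exact (hc j k).tendsto.comp (Continuous.tendsto continuous_fst (y₀, v))
  have h1 : ∀ v ∈ Metric.sphere (0 : Fin n → ℂ) 1, ∀ᶠ q : Y × (Fin n → ℂ) in nhds (y₀, v),
      0 < (star q.2 ⬝ᵥ (A q.1 *ᵥ q.2)).re := by
    intro v hv
    refine (hF v).eventually (lt_mem_nhds ?_)
    have : v ≠ 0 := by rintro rfl; simp at hv
    exact (Complex.lt_def.1 (h0.dotProduct_mulVec_pos this)).1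
  have h2 := (isCompact_sphere (0 : Fin n → ℂ) 1).eventually_forall_of_forall_eventually
    (P := fun y v => 0 < (star v ⬝ᵥ (A y *ᵥ v)).re) (x₀ := y₀) h1
  filter_upwards [h2, hH] with y hy hHy
  refine Matrix.PosDef.of_dotProduct_mulVec_pos hHy fun v hv => ?_
  have hvn : ‖v‖ ≠ 0 := norm_ne_zero_iff.2 hv
  have h3 := hy (((‖v‖⁻¹ : ℝ) : ℂ) • v) (by
    rw [mem_sphere_zero_iff_norm, norm_smul, Complex.norm_real, norm_inv, norm_norm,
      inv_mul_cancel₀ hvn])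
  have h4 : star (((‖v‖⁻¹ : ℝ) : ℂ) • v) ⬝ᵥ (A y *ᵥ (((‖v‖⁻¹ : ℝ) : ℂ) • v)) =
      ((‖v‖⁻¹ ^ 2 : ℝ) : ℂ) * (star v ⬝ᵥ (A y *ᵥ v)) := by
    rw [star_smul, Matrix.mulVec_smul, smul_dotProduct, dotProduct_smul, smul_eq_mul, smul_eq_mul,
      ← mul_assoc, Complex.star_def, Complex.conj_ofReal]
    push_cast
    ring
  rw [h4, Complex.re_ofReal_mul] at h3
  have h5 : 0 < (star v ⬝ᵥ (A y *ᵥ v)).re := pos_of_mul_pos_right h3 (by positivity)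
  rw [Complex.lt_def]
  exact ⟨h5, (hHy.im_star_dotProduct_mulVec_self v).symm⟩

section Holomorphic

variable [IsManifold 𝓘(ℂ, Cn n) ω X]

theorem IsTensor.posDef {K : ChartMat n X} (hK : IsTensor K) (he : e ∈ atlas (Cn n) X)
    (he' : e' ∈ atlas (Cn n) X) (hz : z ∈ overlap e e') (h : (K e' (chartChange e e' z)).PosDef) :
    (K e z).PosDef := by
  have hJ : IsUnit (conjM (jac e e' z)) := by
    rw [Matrix.isUnit_iff_isUnit_det, det_conjM]
    exact isUnit_iff_ne_zero.2 (star_ne_zero.2 (det_jac_ne_zero he he' hz))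
  have h1 : (jac e e' z)ᵀ = (conjM (jac e e' z))ᴴ := by
    ext j k
    simp [conjM]
  rw [hK e he e' he' z hz, h1]
  exact h.conjTranspose_mul_mul_same (Matrix.mulVec_injective_iff_isUnit.2 hJ)

theorem eventually_isPosMat [CompactSpace X] {E : Type*} [NormedAddCommGroup E] [NormedSpace ℝ E]
    {W : Set E} {K : E → ChartMat n X} {w₀ : E} (hW : IsOpen W) (hw : w₀ ∈ W)
    (hK : SmoothMatFam W K) (ht : ∀ w ∈ W, IsTensor (K w))
    (hH : ∀ w ∈ W, ∀ e ∈ atlas (Cn n) X, ∀ z ∈ e.target, (K w e z).IsHermitian)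
    (h0 : IsPosMat (K w₀)) : ∀ᶠ w in nhds w₀, IsPosMat (K w) := by
  have h1 : ∀ x ∈ (Set.univ : Set X), {q : E × X | q.1 ∈ W → ∀ e ∈ atlas (Cn n) X, q.2 ∈ e.source →
      (K q.1 e (e q.2)).PosDef} ∈ nhds w₀ ×ˢ nhds x := by
    intro x _
    set c := chartAt (Cn n) x with hcdef
    have hc : c ∈ atlas (Cn n) X := chart_mem_atlas _ _
    have hm : W ×ˢ c.target ∈ nhds (w₀, c x) :=
      (hW.prod c.open_target).mem_nhds ⟨hw, mem_chart_target _ _⟩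
    have h2 : ∀ᶠ q : E × Cn n in nhds (w₀, c x), (K q.1 c q.2).PosDef := by
      refine eventually_posDef (fun j k => (hK c hc j k).continuousOn.continuousAt hm) ?_
        (h0 c hc _ (mem_chart_target _ _))
      filter_upwards [hm] with q hq using hH q.1 hq.1 c hc q.2 hq.2
    have h3 : Filter.Tendsto (fun q : E × X => (q.1, c q.2)) (nhds w₀ ×ˢ nhds x)
        (nhds (w₀, c x)) := by
      rw [nhds_prod_eq]
      exact Filter.tendsto_id.prodMap (c.continuousAt (mem_chart_source _ _))
    have h4 : ∀ᶠ q : E × X in nhds w₀ ×ˢ nhds x, q.2 ∈ c.source :=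
      Filter.tendsto_snd.eventually (c.open_source.mem_nhds (mem_chart_source _ _))
    filter_upwards [h3.eventually h2, h4] with q hq hq2 hqW e he hqe
    have ho : e q.2 ∈ overlap e c := ⟨e.map_source hqe, by rwa [Set.mem_preimage, e.left_inv hqe]⟩
    refine (ht q.1 hqW).posDef he hc ho ?_
    rwa [chartChange, e.left_inv hqe]
  have h2 := isCompact_univ.mem_prod_nhdsSet_of_forall h1
  rw [nhdsSet_univ, Filter.mem_prod_top] at h2
  filter_upwards [h2, hW.mem_nhds hw] with w hw hwW e he z hz
  have := hw (e.symm z) hwW e he (e.map_target hz)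
  rwa [e.right_inv hz] at this

theorem isHermitian_hess {u : X → ℝ} (hu : CSmooth n fun x => (u x : ℂ))
    (he : e ∈ atlas (Cn n) X) (hz : z ∈ e.target) :
    (hess (fun x => (u x : ℂ)) e z).IsHermitian := by
  rw [← cf_iddbar hu he hz]
  exact coeff_isHermitian (type11_inChart (isClosedReal11_iddbar hu).type11 he hz)

theorem isHermitian_cf {η : DForm n 2 X} (hη : IsClosedReal11 η) (he : e ∈ atlas (Cn n) X)
    (hz : z ∈ e.target) : (cf η e z).IsHermitian :=
  coeff_isHermitian (type11_inChart hη.type11 he hz)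

theorem isKahlerForm_of_isPosMat {η : DForm n 2 X} (hη : IsClosedReal11 η)
    (h : IsPosMat (cf η)) : IsKahlerForm η where
  toIsClosedReal11 := hη
  pos x v hv := by
    have h1 := h _ (chart_mem_atlas _ x) _ (mem_chart_target _ x)
    rw [cf_chartAt] at h1
    have h2 := h1.dotProduct_mulVec_pos (x := star v) (by simpa using hv)
    have h3 : star (star v) ⬝ᵥ (coeff (η x) *ᵥ star v) = sesq (η x) v v := by
      rw [sesq_eq_sum (hη.type11 x)]
      simp only [dotProduct, Matrix.mulVec, Finset.mul_sum, Pi.star_apply, star_star, mul_assoc]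
    rw [h3, sesq] at h2
    have h4 := (Complex.lt_def.1 h2).1
    simpa using h4

theorem IsPosMat.segment {G : ChartMat n X} (hG : IsPosMat G) {v : X → ℂ} (hv : CSmooth n v)
    (h : IsPosMat (addHess G v)) {s : ℝ} (hs : s ∈ Set.Icc (0 : ℝ) 1) :
    IsPosMat (addHess G fun x => (s : ℂ) * v x) := by
  intro e he z hz
  have h1 : addHess G (fun x => (s : ℂ) * v x) e z =
      ((1 - s : ℝ) : ℂ) • G e z + (s : ℂ) • addHess G v e z := by
    have := hess_const_mul hv (s : ℂ) e he z hz
    simp only [addHess, Pi.add_apply, Pi.smul_apply] at this ⊢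
    rw [this]
    push_cast
    module
  rw [h1]
  rcases eq_or_lt_of_le hs.1 with h0 | h0
  · rw [← h0]; simpa using hG e he z hz
  · refine Matrix.PosDef.posSemidef_add ((hG e he z hz).posSemidef.smul ?_) ((h e he z hz).smul ?_)
    · rw [Complex.zero_le_real]; linarith [hs.2]
    · rwa [Complex.zero_lt_real]

theorem iddbar_add {u v : X → ℝ} (hu : CSmooth n fun x => (u x : ℂ))
    (hv : CSmooth n fun x => (v x : ℂ)) :
    iddbar n (fun x => u x + v x) = iddbar n u + iddbar n v := by
  have h1 : dJ n (fun x => u x + v x) = dJ n u + dJ n v := by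
    ext1 x
    have h2 : diffAt (n := n) (fun x => u x + v x) x = diffAt u x + diffAt v x :=
      mfderiv_add ((contMDiff_real hu).contMDiffAt.mdifferentiableAt (by simp))
        ((contMDiff_real hv).contMDiffAt.mdifferentiableAt (by simp))
    rw [dJ, h2]
    rfl
  rw [iddbar, h1, dForm_add (isSmoothForm_dJ hu) (isSmoothForm_dJ hv), smul_add]
  rfl

theorem addPotential_add (p : DForm n 2 X × DForm n 2 X) {φ ψ : X → ℂ} (hφ : CSmooth n φ)
    (hψ : CSmooth n ψ) :
    addPotential p (fun x => φ x + ψ x) = addPotential (addPotential p φ) ψ := by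
  have h1 := iddbar_add hφ.rePart hψ.rePart
  have h2 := iddbar_add (u := fun x => (φ x).im) (v := fun x => (ψ x).im) hφ.imPart hψ.imPart
  simp only [addPotential, Complex.add_re, Complex.add_im, h1, h2, add_assoc]

theorem cSmooth_const (a : ℂ) : CSmooth n fun _ : X => a := fun _ _ => contDiffOn_const

theorem addPotential_zero (p : DForm n 2 X × DForm n 2 X) :
    addPotential p (fun _ => 0) = p := by
  have h1 := addPotential_add p (cSmooth_const (n := n) (X := X) 0) (cSmooth_const 0)
  have h0 : iddbar n (fun _ : X => (0 : ℝ)) = 0 := by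
    have := iddbar_add (n := n) (X := X) (u := fun _ => 0) (v := fun _ => 0)
      (cSmooth_const (n := n) (X := X) ((0 : ℝ) : ℂ)) (cSmooth_const ((0 : ℝ) : ℂ))
    simpa using this
  simp [addPotential, h0]

/-- Adding a potential preserves the cohomology classes, so that it leaves the complexified class only
by breaking positivity. -/
theorem mem_complexifiedClass_iff {p₀ p : DForm n 2 X × DForm n 2 X}
    (hp : p ∈ complexifiedClass p₀) {φ : X → ℂ} (hφ : CSmooth n φ) :
    addPotential p φ ∈ complexifiedClass p₀ ↔ IsPosMat (addHess (cf p.2) (imPart φ)) := by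
  have hm := cf_addPotential_snd p hφ
  constructor
  · intro h e he z hz
    have := posDef_cf h.2.1 he hz
    rwa [hm e he z hz] at this
  · intro h
    refine ⟨hp.1.add (isClosedReal11_iddbar hφ.rePart), isKahlerForm_of_isPosMat
      (hp.2.1.toIsClosedReal11.add (isClosedReal11_iddbar hφ.imPart)) fun e he z hz => ?_, ?_, ?_⟩
    · have := h e he z hz
      rw [show (addHess (cf p.2) (imPart φ)) e z = _ from (hm e he z hz).symm] at this
      exact this
    · have := hp.2.2.1.add (isExactForm_iddbar hφ.rePart)
      rwa [sub_add_eq_add_sub] at this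
    · have := hp.2.2.2.add (isExactForm_iddbar (u := fun x => (φ x).im) hφ.imPart)
      rwa [sub_add_eq_add_sub] at this

theorem isPosMat_cf {Ω : DForm n 2 X} (hΩ : IsKahlerForm Ω) : IsPosMat (cf Ω) :=
  fun _ he _ hz => posDef_cf hΩ he hz

theorem eventually_isPosMat_addHess [CompactSpace X] {p : DForm n 2 X × DForm n 2 X}
    (hp : IsClosedReal11 p.2) {E : Type*} [NormedAddCommGroup E] [NormedSpace ℝ E] {W : Set E}
    {φ : E → X → ℂ} {w₀ : E} (hW : IsOpen W) (hw : w₀ ∈ W) (hφ : SmoothFam n W φ)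
    (h0 : IsPosMat (addHess (cf p.2) (imPart (φ w₀)))) :
    ∀ᶠ w in nhds w₀, IsPosMat (addHess (cf p.2) (imPart (φ w))) :=
  eventually_isPosMat hW hw (smoothMatFam_add_hess hW.uniqueDiffOn (isClosed11_cf hp) hφ.im)
    (fun _ hw => (isClosed11_add_hess (isClosed11_cf hp) (hφ.slice hw).imPart).tensor)
    (fun _ hw _ he _ hz => (isHermitian_cf hp he hz).add
      (isHermitian_hess (hφ.slice hw).imPart he hz)) h0

variable [T2Space X] [CompactSpace X] [MeasurableSpace X] [BorelSpace X]

/-- The form `σ` at `p + i∂∂̄φ`. -/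
theorem sigma_addPotential {Ω₀ : DForm n 2 X} (hΩ₀ : IsKahlerForm Ω₀) {γ : ℂ} {c : ℝ}
    {p₀ p : DForm n 2 X × DForm n 2 X} {φ f : X → ℂ} (hφ : CSmooth n φ)
    (h : addPotential p φ ∈ complexifiedClass p₀) (hf : CSmooth n f) :
    sigma γ c (addPotential p φ) f =
      sig Ω₀ γ c (addHess (complexMat p) φ) (addHess (cf p.2) (imPart φ)) f := by
  rw [sigma_eq_sig hΩ₀ h.1 h.2.1 hf]
  exact sig_congr (complexMat_addPotential p hφ) (cf_addPotential_snd p hφ) f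

end Holomorphic

end Potentials

/-! ### The energy along rays in the complexified class -/

section Energy

open MeasureTheory

variable {n : ℕ} {X : Type*} [TopologicalSpace X] [ChartedSpace (Cn n) X]
variable {T : Set ℝ} {t : ℝ} {φ φ' f f' : ℝ → X → ℂ} {γ : ℂ} {c : ℝ}
variable {p₀ p : DForm n 2 X × DForm n 2 X}

theorem smoothPath_const {u : X → ℂ} (hu : CSmooth n u) (hT : IsOpen T) :
    SmoothPath n T (fun _ => u) fun _ _ => 0 :=
  ⟨hT, smoothFam_const hu, smoothFam_const fun _ _ => contDiffOn_const,
    fun _ _ _ => hasDerivAt_const _ _⟩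

theorem contDiff_ofReal : ContDiff ℝ ∞ fun t : ℝ => (t : ℂ) := Complex.ofRealCLM.contDiff

/-- The rays `t ↦ tu`. -/
theorem smoothPath_ray {u : X → ℂ} (hu : CSmooth n u) (hT : IsOpen T) :
    SmoothPath n T (fun t x => (t : ℂ) * u x) fun _ => u :=
  ⟨hT, (smoothFam_param contDiff_ofReal.contDiffOn).mul (smoothFam_const hu), smoothFam_const hu,
    fun t _ x => by simpa using ((hasDerivAt_id t).ofReal_comp.mul_const (u x))⟩

theorem SmoothPath.add_const (h : SmoothPath n T φ φ') {u : X → ℂ} (hu : CSmooth n u) :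
    SmoothPath n T (fun t x => u x + φ t x) φ' :=
  ⟨h.isOpen, (smoothFam_const hu).add h.smooth, h.smooth',
    fun t ht x => (h.hasDerivAt t ht x).const_add _⟩

theorem SmoothPath.const_mul (h : SmoothPath n T φ φ') (a : ℂ) :
    SmoothPath n T (fun t x => a * φ t x) fun t x => a * φ' t x :=
  ⟨h.isOpen, (smoothFam_param contDiffOn_const).mul h.smooth,
    (smoothFam_param contDiffOn_const).mul h.smooth',
    fun t ht x => (h.hasDerivAt t ht x).const_mul _⟩

section Holomorphic

variable [IsManifold 𝓘(ℂ, Cn n) ω X]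

/-- Segments in the complexified class. -/
theorem ray_mem_complexifiedClass (hp : p ∈ complexifiedClass p₀) {u : X → ℂ} (hu : CSmooth n u)
    (h : addPotential p u ∈ complexifiedClass p₀) {s : ℝ} (hs : s ∈ Set.Icc (0 : ℝ) 1) :
    addPotential p (fun x => (s : ℂ) * u x) ∈ complexifiedClass p₀ := by
  rw [mem_complexifiedClass_iff hp ((cSmooth_const _).mul hu)]
  rw [mem_complexifiedClass_iff hp hu] at h
  have := (isPosMat_cf hp.2.1).segment hu.imPart h hs
  convert this using 3
  simp [imPart]

theorem eventually_mem_complexifiedClass [CompactSpace X] (hp : p ∈ complexifiedClass p₀)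
    {E : Type*} [NormedAddCommGroup E] [NormedSpace ℝ E] {W : Set E}
    {φ : E → X → ℂ} {w₀ : E} (hW : IsOpen W) (hw : w₀ ∈ W) (hφ : SmoothFam n W φ)
    (h0 : addPotential p (φ w₀) ∈ complexifiedClass p₀) :
    ∀ᶠ w in nhds w₀, addPotential p (φ w) ∈ complexifiedClass p₀ := by
  rw [mem_complexifiedClass_iff hp (hφ.slice hw)] at h0
  filter_upwards [eventually_isPosMat_addHess hp.2.1.toIsClosedReal11 hW hw hφ h0,
    hW.mem_nhds hw] with w h1 h2
  rwa [mem_complexifiedClass_iff hp (hφ.slice h2)]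

/-- Rays stay in the complexified class for a short time. -/
theorem exists_isOpen_ray_mem [CompactSpace X] (hp : p ∈ complexifiedClass p₀) {u : X → ℂ}
    (hu : CSmooth n u) : ∃ T : Set ℝ, IsOpen T ∧ (0 : ℝ) ∈ T ∧
      ∀ t ∈ T, addPotential p (fun x => (t : ℂ) * u x) ∈ complexifiedClass p₀ := by
  have h := eventually_mem_complexifiedClass (w₀ := (0 : ℝ)) hp isOpen_univ (Set.mem_univ 0)
    (smoothPath_ray hu isOpen_univ).smooth (by simpa [addPotential_zero] using hp)
  obtain ⟨T, h1, h2, h3⟩ := eventually_nhds_iff.1 h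
  exact ⟨T, h2, h3, h1⟩

variable [T2Space X] [CompactSpace X] [MeasurableSpace X] [BorelSpace X]

/-- The derivative of `σ` at `p + i∂∂̄u`. -/
def sigmaHess (γ : ℂ) (c : ℝ) (p₀ p : DForm n 2 X × DForm n 2 X) (u f g : X → ℂ) : ℝ :=
  sigHess p₀.2 γ c (addHess (complexMat p) u) (addHess (cf p.2) (imPart u)) f g

theorem sigmaHess_symm (hΩ₀ : IsKahlerForm p₀.2) (hp : p ∈ complexifiedClass p₀) {u f g : X → ℂ}
    (hu : CSmooth n u) (h : addPotential p u ∈ complexifiedClass p₀) (hf : CSmooth n f)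
    (hg : CSmooth n g) : sigmaHess γ c p₀ p u f g = sigmaHess γ c p₀ p u g f :=
  sigHess_symm hΩ₀ (isClosed11_add_hess (isClosed11_complexMat hp.1 hp.2.1.toIsClosedReal11) hu)
    (isClosed11_add_hess (isClosed11_cf hp.2.1.toIsClosedReal11) hu.imPart)
    ((mem_complexifiedClass_iff hp hu).1 h) hf hg

theorem hasDerivAt_sigma (hΩ₀ : IsKahlerForm p₀.2) (hp : p ∈ complexifiedClass p₀)
    (h : SmoothPath n T φ φ') (hf : SmoothPath n T f f')
    (hmem : ∀ t ∈ T, addPotential p (φ t) ∈ complexifiedClass p₀) (ht : t ∈ T) :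
    HasDerivAt (fun s => sigma γ c (addPotential p (φ s)) (f s))
      (sigma γ c (addPotential p (φ t)) (f' t) + sigmaHess γ c p₀ p (φ t) (f t) (φ' t)) t := by
  rw [sigma_addPotential hΩ₀ (h.smooth.slice ht) (hmem t ht) (hf.smooth'.slice ht)]
  refine (hasDerivAt_sig hΩ₀ (isClosed11_complexMat hp.1 hp.2.1.toIsClosedReal11)
    (isClosed11_cf hp.2.1.toIsClosedReal11) h hf
    (fun t ht => (mem_complexifiedClass_iff hp (h.smooth.slice ht)).1 (hmem t ht))
    ht).congr_of_eventuallyEq ?_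
  filter_upwards [h.isOpen.mem_nhds ht] with s hs
  exact sigma_addPotential hΩ₀ (h.smooth.slice hs) (hmem s hs) (hf.smooth.slice hs)

section Families

variable {E : Type*} [NormedAddCommGroup E] [NormedSpace ℝ E] {W : Set E} {u f g : E → X → ℂ}

theorem continuousOn_sigma (hΩ₀ : IsKahlerForm p₀.2) (hp : p ∈ complexifiedClass p₀)
    (hW : UniqueDiffOn ℝ W) (hu : SmoothFam n W u) (hg : SmoothFam n W g)
    (hmem : ∀ w ∈ W, addPotential p (u w) ∈ complexifiedClass p₀) :
    ContinuousOn (fun w => sigma γ c (addPotential p (u w)) (g w)) W :=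
  (continuousOn_sig hΩ₀ hW (isClosed11_complexMat hp.1 hp.2.1.toIsClosedReal11)
    (isClosed11_cf hp.2.1.toIsClosedReal11) hu
    (fun w hw => (mem_complexifiedClass_iff hp (hu.slice hw)).1 (hmem w hw)) hg).congr
    fun _ hw => sigma_addPotential hΩ₀ (hu.slice hw) (hmem _ hw) (hg.slice hw)

theorem continuousOn_sigmaHess (hΩ₀ : IsKahlerForm p₀.2) (hp : p ∈ complexifiedClass p₀)
    (hW : UniqueDiffOn ℝ W) (hu : SmoothFam n W u) (hf : SmoothFam n W f) (hg : SmoothFam n W g)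
    (hmem : ∀ w ∈ W, addPotential p (u w) ∈ complexifiedClass p₀) :
    ContinuousOn (fun w => sigmaHess γ c p₀ p (u w) (f w) (g w)) W :=
  continuousOn_sigHess hΩ₀ hW (isClosed11_complexMat hp.1 hp.2.1.toIsClosedReal11)
    (isClosed11_cf hp.2.1.toIsClosedReal11) hu
    (fun w hw => (mem_complexifiedClass_iff hp (hu.slice hw)).1 (hmem w hw)) hf hg

end Families

theorem sigma_zero (γ : ℂ) (c : ℝ) (q : DForm n 2 X × DForm n 2 X) :
    sigma γ c q (fun _ => 0) = 0 := by
  simp [sigma, volIntegral]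

/-- The integral of `σ` along the ray from `p` to `p + i∂∂̄φ`. -/
def rayEnergy (γ : ℂ) (c : ℝ) (p : DForm n 2 X × DForm n 2 X) (φ : X → ℂ) : ℝ :=
  ∫ s in (0 : ℝ)..1, sigma γ c (addPotential p fun x => (s : ℂ) * φ x) φ

/-- As `σ` is closed, it is the differential of its integral along rays. -/
theorem hasDerivAt_rayEnergy (hΩ₀ : IsKahlerForm p₀.2) (hp : p ∈ complexifiedClass p₀)
    (h : SmoothPath n T φ φ') (hmem : ∀ t ∈ T, addPotential p (φ t) ∈ complexifiedClass p₀)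
    (ht : t ∈ T) : HasDerivAt (fun s => rayEnergy γ c p (φ s))
      (sigma γ c (addPotential p (φ t)) (φ' t)) t := by
  set W : Set (ℝ × ℝ) := T ×ˢ Set.Icc (0 : ℝ) 1 with hWdef
  have hW : UniqueDiffOn ℝ W := h.isOpen.uniqueDiffOn.prod (uniqueDiffOn_Icc zero_lt_one)
  have hmemW : ∀ w ∈ W, addPotential p (fun x => (w.2 : ℂ) * φ w.1 x) ∈ complexifiedClass p₀ :=
    fun w hw => ray_mem_complexifiedClass hp (h.smooth.slice hw.1) (hmem w.1 hw.1) hw.2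
  have f1 : SmoothFam n W fun w => φ w.1 := h.smooth.comp contDiffOn_fst fun w hw => hw.1
  have f1' : SmoothFam n W fun w => φ' w.1 := h.smooth'.comp contDiffOn_fst fun w hw => hw.1
  have c2 : SmoothFam n W fun w (_ : X) => (w.2 : ℂ) :=
    smoothFam_param (contDiff_ofReal.comp contDiff_snd).contDiffOn
  have f2 := c2.mul f1
  have f2' := c2.mul f1'
  set D : ℝ × ℝ → ℝ := fun w => sigma γ c (addPotential p fun x => (w.2 : ℂ) * φ w.1 x) (φ' w.1) +
    sigmaHess γ c p₀ p (fun x => (w.2 : ℂ) * φ w.1 x) (φ w.1) (fun x => (w.2 : ℂ) * φ' w.1 x)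
    with hD
  have cF : ContinuousOn (fun w : ℝ × ℝ =>
      sigma γ c (addPotential p fun x => (w.2 : ℂ) * φ w.1 x) (φ w.1)) W :=
    continuousOn_sigma hΩ₀ hp hW f2 f1 hmemW
  have cD : ContinuousOn D W := (continuousOn_sigma hΩ₀ hp hW f2 f1' hmemW).add
    (continuousOn_sigmaHess hΩ₀ hp hW f2 f1 f2' hmemW)
  have cH : ContinuousOn (fun w : ℝ × ℝ =>
      sigma γ c (addPotential p fun x => (w.2 : ℂ) * φ w.1 x) (fun x => (w.2 : ℂ) * φ' w.1 x)) W :=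
    continuousOn_sigma hΩ₀ hp hW f2 f2' hmemW
  have slice : ∀ {F : ℝ × ℝ → ℝ}, ContinuousOn F W → ∀ r ∈ T,
      ContinuousOn (fun s => F (r, s)) (Set.Icc 0 1) := fun hF r hr =>
    hF.comp (by fun_prop) fun s hs => ⟨hr, hs⟩
  have slice_i : ∀ {F : ℝ × ℝ → ℝ}, ContinuousOn F W → ∀ r ∈ T,
      IntervalIntegrable (fun s => F (r, s)) volume 0 1 := fun hF r hr => by
    refine ContinuousOn.intervalIntegrable ?_
    rw [Set.uIcc_of_le zero_le_one]
    exact slice hF r hr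
  -- the velocity of the integrand is a derivative along the ray
  have hray : ∫ s in (0 : ℝ)..1, D (t, s) = sigma γ c (addPotential p (φ t)) (φ' t) := by
    have hu := h.smooth.slice ht
    have hu' := h.smooth'.slice ht
    have h1 : ∀ s ∈ Set.Ioo (0 : ℝ) 1, HasDerivAt (fun s : ℝ => sigma γ c
        (addPotential p fun x => (s : ℂ) * φ t x) (fun x => (s : ℂ) * φ' t x)) (D (t, s)) s := by
      intro s hs
      have hs' := Set.Ioo_subset_Icc_self hs
      refine (hasDerivAt_sigma hΩ₀ hp (smoothPath_ray hu isOpen_Ioo)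
        (smoothPath_ray hu' isOpen_Ioo)
        (fun s hs => hmemW (t, s) ⟨ht, Set.Ioo_subset_Icc_self hs⟩) hs).congr_deriv ?_
      rw [hD]
      congr 1
      exact sigmaHess_symm hΩ₀ hp ((cSmooth_const _).mul hu) (hmemW (t, s) ⟨ht, hs'⟩)
        ((cSmooth_const _).mul hu') hu
    rw [intervalIntegral.integral_eq_sub_of_hasDerivAt_of_le zero_le_one (slice cH t ht) h1
      (slice_i cD t ht)]
    simp [sigma_zero]
  -- differentiation under the integral sign
  obtain ⟨δ, hδ, hball⟩ := Metric.nhds_basis_closedBall.mem_iff.1 (h.isOpen.mem_nhds ht)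
  obtain ⟨B, hB⟩ := ((isCompact_closedBall t δ).prod isCompact_Icc).exists_bound_of_continuousOn
    (cD.mono (Set.prod_mono hball (subset_refl (Set.Icc (0 : ℝ) 1))))
  rw [← hray]
  have hI : Set.uIoc (0 : ℝ) 1 ⊆ Set.Icc 0 1 := by
    rw [Set.uIoc_of_le zero_le_one]; exact Set.Ioc_subset_Icc_self
  refine (intervalIntegral.hasDerivAt_integral_of_dominated_loc_of_deriv_le
    (F := fun r s => sigma γ c (addPotential p fun x => (s : ℂ) * φ r x) (φ r))
    (F' := fun r s => D (r, s)) (bound := fun _ => B) (Metric.closedBall_mem_nhds t hδ)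
    ?_ (slice_i cF t ht) ?_ ?_ intervalIntegrable_const ?_).2
  · filter_upwards [h.isOpen.mem_nhds ht] with r hr
    exact (intervalIntegrable_iff.1 (slice_i cF r hr)).aestronglyMeasurable
  · exact (intervalIntegrable_iff.1 (slice_i cD t ht)).aestronglyMeasurable
  · exact Filter.Eventually.of_forall fun s hs r hr => hB (r, s) ⟨hr, hI hs⟩
  · refine Filter.Eventually.of_forall fun s hs r hr => ?_
    have h2 := hasDerivAt_sigma (γ := γ) (c := c) hΩ₀ hp (h.const_mul (s : ℂ)) h
      (fun r hr => hmemW (r, s) ⟨hr, hI hs⟩) (hball hr)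
    exact h2

/-- `σ` is closed. -/
theorem exists_hasDerivAt_sigma (hΩ₀ : IsKahlerForm p₀.2) (hp : p ∈ complexifiedClass p₀)
    {u v : X → ℂ} (hu : CSmooth n u) (hv : CSmooth n v) : ∃ D : ℝ,
      HasDerivAt (fun t : ℝ => sigma γ c (addPotential p fun x => (t : ℂ) * v x) u) D 0 ∧
      HasDerivAt (fun t : ℝ => sigma γ c (addPotential p fun x => (t : ℂ) * u x) v) D 0 := by
  have key : ∀ {u v : X → ℂ}, CSmooth n u → CSmooth n v →
      HasDerivAt (fun t : ℝ => sigma γ c (addPotential p fun x => (t : ℂ) * v x) u)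
        (sigmaHess γ c p₀ p (fun _ => 0) u v) 0 := by
    intro u v hu hv
    obtain ⟨T, hT, h0, hmem⟩ := exists_isOpen_ray_mem hp hv
    refine (hasDerivAt_sigma hΩ₀ hp (smoothPath_ray hv hT) (smoothPath_const hu hT) hmem
      h0).congr_deriv ?_
    simp [sigma_zero]
  refine ⟨_, key hu hv, ?_⟩
  rw [sigmaHess_symm hΩ₀ hp (cSmooth_const 0) (by rwa [addPotential_zero]) hu hv]
  exact key hv hu

end Holomorphic

end Energy

/-! ### The Euler–Lagrange equation -/

section EulerLagrange

open MeasureTheory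

variable {n : ℕ} {X : Type*} [TopologicalSpace X] [ChartedSpace (Cn n) X]
variable {γ : ℂ} {c : ℝ} {p₀ p : DForm n 2 X × DForm n 2 X}
variable [IsManifold 𝓘(ℂ, Cn n) ω X] [T2Space X] [CompactSpace X]

theorem volIntegral_eq_integral [MeasurableSpace X] [BorelSpace X] {F : Type*}
    [NormedAddCommGroup F] [NormedSpace ℝ F] {Ω : DForm n 2 X} (hΩ : IsKahlerForm Ω)
    {f : X → F} (hf : Continuous f) : volIntegral Ω f = ∫ x, f x ∂volMeasure Ω := by
  rw [integral_volMeasure hΩ hf, volIntegral_eq_sum]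

/-- The form `σ` vanishes exactly at the solutions: this is seen by testing it on `i` times the
conjugate of the error. -/
theorem sigma_eq_zero_iff [MeasurableSpace X] [BorelSpace X] (h1 : IsClosedReal11 p.1)
    (h2 : IsKahlerForm p.2) :
    (∀ φ : X → ℂ, CSmooth n φ → sigma γ c p φ = 0) ↔ SolvesBFieldEquation γ c p := by
  set E : X → ℂ := fun x => γ * powerRatio p x - ((scalarCurvature p.2 x : ℂ) - (c : ℂ)) with hE
  have hEs : CSmooth n E := fun e he => (contDiffOn_const.mul (cSmooth_powerRatio h1 h2 e he)).sub
    ((cSmooth_scalarCurvature h2 e he).sub contDiffOn_const)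
  constructor
  · intro h x
    have hφ : CSmooth n fun x => Complex.I * star (E x) := fun e he =>
      contDiffOn_const.mul (Complex.conjCLE.contDiff.comp_contDiffOn (hEs e he))
    have hc : Continuous fun x => Complex.normSq (E x) :=
      Complex.continuous_normSq.comp hEs.continuous
    have h3 : sigma γ c p (fun x => Complex.I * star (E x)) =
        ∫ x, Complex.normSq (E x) ∂volMeasure p.2 := by
      have h4 : (fun x => (Complex.I * star (E x) * E x).im) = fun x => Complex.normSq (E x) := by
        ext x
        rw [mul_assoc, mul_comm (star (E x)), Complex.star_def, Complex.mul_conj]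
        simp
      have h5 : sigma γ c p (fun x => Complex.I * star (E x)) =
          volIntegral p.2 fun x => (Complex.I * star (E x) * E x).im := rfl
      rw [h5, h4, volIntegral_eq_integral h2 hc]
    haveI := isOpenPosMeasure_volMeasure h2
    rw [h _ hφ] at h3
    have h6 := (integral_eq_zero_iff_of_nonneg (fun x => Complex.normSq_nonneg (E x))
      (hc.integrable_volMeasure h2)).1 h3.symm
    have h7 := (hc.ae_eq_iff_eq (volMeasure p.2) continuous_zero).1 h6
    have h8 : E x = 0 := Complex.normSq_eq_zero.1 (congrFun h7 x)
    rw [hE] at h8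
    linear_combination -h8
  · intro h φ _
    have h3 : (fun x => (φ x * E x).im) = fun _ => 0 := by
      ext x
      have : E x = 0 := by
        rw [hE]
        linear_combination -(h x)
      rw [this, mul_zero, Complex.zero_im]
    have h5 : sigma γ c p φ = volIntegral p.2 fun x => (φ x * E x).im := rfl
    rw [h5, h3]
    simp [volIntegral]

theorem hasFirstVariationAt_zero_iff {M : DForm n 2 X × DForm n 2 X → ℝ}
    (hM : HasFirstVariationAt M (sigma γ c p) p) (h1 : IsClosedReal11 p.1)
    (h2 : IsKahlerForm p.2) :
    HasFirstVariationAt M (fun _ => 0) p ↔ SolvesBFieldEquation γ c p := by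
  letI := borel X
  haveI : BorelSpace X := ⟨rfl⟩
  rw [← sigma_eq_zero_iff h1 h2]
  constructor
  · intro h φ hφ
    exact (hM φ (isSmoothFun_iff.2 hφ)).unique (h φ (isSmoothFun_iff.2 hφ))
  · intro h φ hφ
    have := hM φ hφ
    rwa [h φ (isSmoothFun_iff.1 hφ)] at this

end EulerLagrange

/-! ### Integral invariants of the complexified class -/

section Invariants

open MeasureTheory

variable {n : ℕ} {X : Type*} [TopologicalSpace X] [ChartedSpace (Cn n) X]
variable {γ : ℂ} {c : ℝ} {p₀ p : DForm n 2 X × DForm n 2 X} {Ω₀ : DForm n 2 X} {K L : ChartMat n X}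
variable [IsManifold 𝓘(ℂ, Cn n) ω X] [T2Space X] [CompactSpace X] [MeasurableSpace X] [BorelSpace X]

theorem hasDerivAt_integral_detDiv (hΩ₀ : IsKahlerForm Ω₀) (hK : IsClosed11 K) (hL : IsClosed11 L)
    (t : ℝ) : HasDerivAt (fun s : ℝ => ∫ x, detDiv Ω₀ (K + (s : ℂ) • L) x ∂volMeasure Ω₀)
      (∫ x, trDiv Ω₀ (adj (K + (t : ℂ) • L)) L x ∂volMeasure Ω₀) t := by
  have hs : ∀ s : ℝ, IsClosed11 (K + (s : ℂ) • L) := fun s => hK.add (hL.smul _)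
  have hf : SmoothMatFam (Set.univ : Set ℝ) fun s => K + (s : ℂ) • L :=
    (smoothMatFam_const hK.smooth).add
      ((smoothMatFam_const hL.smooth).smul (contDiff_ofReal.contDiffOn))
  refine hasDerivAt_integral hΩ₀ isOpen_univ (smoothFam_detDiv hΩ₀ hf fun s _ => (hs s).tensor)
    (smoothFam_trDiv hΩ₀ hf.adj (fun s _ => (hs s).adjugate.cotensor)
      (smoothMatFam_const hL.smooth) fun s _ => hL.tensor) (fun s _ x => ?_) (Set.mem_univ t)
  refine (hasDerivAt_det fun j k => ?_).div_const _
  simp only [Pi.add_apply, Pi.smul_apply, Matrix.add_apply, Matrix.smul_apply, smul_eq_mul]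
  simpa using (((hasDerivAt_id s).ofReal_comp.mul_const
    (L (chartAt (Cn n) x) (chartAt (Cn n) x x) j k)).const_add
      (K (chartAt (Cn n) x) (chartAt (Cn n) x x) j k))

theorem IsExactForm.integral_trDiv {η : DForm n 2 X} {N : ChartMat n X} (hΩ₀ : IsKahlerForm Ω₀)
    (hN : IsCoclosed N) (hη : IsExactForm η) (h11 : IsClosedReal11 η) :
    ∫ x, trDiv Ω₀ N (cf η) x ∂volMeasure Ω₀ = 0 := by
  obtain ⟨ξ, hξ, rfl⟩ := hη
  exact integral_trDiv_dForm hΩ₀ hN hξ h11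

theorem trDiv_smul {N : ChartMat n X} (a : ℂ) (x : X) :
    trDiv Ω₀ N (a • L) x = a * trDiv Ω₀ N L x := by
  simp only [trDiv, glue, Pi.smul_apply, Matrix.mul_smul, Matrix.trace_smul, smul_eq_mul, mul_div_assoc]

/-- The integral of the top power of a closed `(1,1)`-form depends only on its class. -/
theorem integral_detDiv_add_exact {η : DForm n 2 X} (hΩ₀ : IsKahlerForm Ω₀) (hK : IsClosed11 K)
    (hη : IsExactForm η) (h11 : IsClosedReal11 η) (a : ℂ) :
    ∫ x, detDiv Ω₀ (K + a • cf η) x ∂volMeasure Ω₀ = ∫ x, detDiv Ω₀ K x ∂volMeasure Ω₀ := by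
  have hL := (isClosed11_cf h11).smul a
  have h1 : ∀ t : ℝ, HasDerivAt
      (fun s : ℝ => ∫ x, detDiv Ω₀ (K + (s : ℂ) • a • cf η) x ∂volMeasure Ω₀) 0 t := fun t => by
    refine (hasDerivAt_integral_detDiv hΩ₀ hK hL t).congr_deriv ?_
    have hA : IsCoclosed (adj (K + (t : ℂ) • a • cf η)) := (hK.add (hL.smul _)).adjugate
    simp only [trDiv_smul]
    rw [integral_const_mul, hη.integral_trDiv hΩ₀ hA h11, mul_zero]
  have h2 := is_const_of_deriv_eq_zero (fun t => (h1 t).differentiableAt) (fun t => (h1 t).deriv) 1 0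
  simpa using h2

theorem isClosedReal11_sub {η ζ : DForm n 2 X} (hη : IsClosedReal11 η) (hζ : IsClosedReal11 ζ) :
    IsClosedReal11 (η - ζ) := by
  have h : η - ζ = η + (-1 : ℝ) • ζ := by
    ext x v
    simp [sub_eq_add_neg]
  rw [h]
  exact hη.add (hζ.smul (-1))

theorem cf_sub_add (η ζ : DForm n 2 X) : cf ζ + cf (η - ζ) = cf η := by
  rw [← cf_add, add_sub_cancel]

theorem integral_detDiv_complexMat (hB₀ : IsClosedReal11 p₀.1) (hΩ₀ : IsKahlerForm p₀.2)
    (hp : p ∈ complexifiedClass p₀) :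
    ∫ x, detDiv p₀.2 (complexMat p) x ∂volMeasure p₀.2 =
      ∫ x, detDiv p₀.2 (complexMat p₀) x ∂volMeasure p₀.2 := by
  have h1 := isClosedReal11_sub hp.1 hB₀
  have h2 := isClosedReal11_sub hp.2.1.toIsClosedReal11 hΩ₀.toIsClosedReal11
  have hC := isClosed11_complexMat hB₀ hΩ₀.toIsClosedReal11
  have e1 : complexMat p = complexMat p₀ + (1 : ℂ) • cf (p.1 - p₀.1) +
      Complex.I • cf (p.2 - p₀.2) := by
    rw [complexMat, complexMat, ← cf_sub_add p.1 p₀.1, ← cf_sub_add p.2 p₀.2, smul_add, one_smul]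
    abel
  rw [e1, integral_detDiv_add_exact hΩ₀ (hC.add ((isClosed11_cf h1).smul 1)) hp.2.2.2 h2,
    integral_detDiv_add_exact hΩ₀ hC hp.2.2.1 h1]

theorem integral_detDiv_cf (hΩ₀ : IsKahlerForm p₀.2) (hp : p ∈ complexifiedClass p₀)
    (hK : IsClosed11 K) (s : ℂ) :
    ∫ x, detDiv p₀.2 (cf p.2 + s • K) x ∂volMeasure p₀.2 =
      ∫ x, detDiv p₀.2 (cf p₀.2 + s • K) x ∂volMeasure p₀.2 := by
  have h2 := isClosedReal11_sub hp.2.1.toIsClosedReal11 hΩ₀.toIsClosedReal11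
  have e1 : cf p.2 + s • K = cf p₀.2 + s • K + (1 : ℂ) • cf (p.2 - p₀.2) := by
    rw [← cf_sub_add p.2 p₀.2, one_smul]
    abel
  rw [e1, integral_detDiv_add_exact hΩ₀ ((isClosed11_cf hΩ₀.toIsClosedReal11).add (hK.smul s))
    hp.2.2.2 h2]

/-- The Ricci forms of two Kähler metrics differ by `i∂∂̄` of the logarithm of the ratio of
their volume forms. -/
theorem exists_ricMat_eq {Ω : DForm n 2 X} (hΩ₀ : IsKahlerForm Ω₀) (hΩ : IsKahlerForm Ω) :
    ∃ w : X → ℂ, CSmooth n w ∧ MatEq (ricMat (cf Ω)) (ricMat (cf Ω₀) + hess w) := by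
  have hK := isClosed11_cf hΩ.toIsClosedReal11
  have hr := cSmooth_detDiv hΩ₀ hK.tensor hK.smooth
  have hrs : ∀ {e : OpenPartialHomeomorph X (Cn n)} {z : Cn n}, e ∈ atlas (Cn n) X → z ∈ e.target →
      detDiv Ω₀ (cf Ω) (e.symm z) = (((cf Ω e z).det.re / (cf Ω₀ e z).det.re : ℝ) : ℂ) := by
    intro e z he hz
    rw [detDiv, glue_symm (hK.tensor.isInvariant_det_div (isTensor_cf hΩ₀.type11)) he hz,
      PosDef.det_eq_re (posDef_cf hΩ he hz), PosDef.det_eq_re (posDef_cf hΩ₀ he hz)]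
    simp
  have hw : CSmooth n fun x => ((-Real.log (detDiv Ω₀ (cf Ω) x).re : ℝ) : ℂ) := fun e he => by
    refine Complex.ofRealCLM.contDiff.comp_contDiffOn (ContDiffOn.neg (ContDiffOn.log
      (Complex.reCLM.contDiff.comp_contDiffOn (hr e he)) fun z hz => ?_))
    show (detDiv Ω₀ (cf Ω) (e.symm z)).re ≠ 0
    rw [hrs he hz, Complex.ofReal_re]
    exact (div_pos (PosDef.det_re_pos (posDef_cf hΩ he hz))
      (PosDef.det_re_pos (posDef_cf hΩ₀ he hz))).ne'
  refine ⟨_, hw, fun e he z hz => ?_⟩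
  ext j k
  have hl : ∀ {Ω : DForm n 2 X}, IsKahlerForm Ω →
      ContDiffOn ℝ ∞ (fun z => ((Real.log (cf Ω e z).det.re : ℝ) : ℂ)) e.target := fun hΩ =>
    contDiffOn_logDet ((isClosed11_cf hΩ.toIsClosedReal11).smooth e he)
      fun z hz => posDef_cf hΩ he hz
  have h1 : dz j (dzbar k fun w => ((Real.log (cf Ω₀ e w).det.re : ℝ) : ℂ)) z =
      dz j (dzbar k fun w => ((Real.log (cf Ω e w).det.re : ℝ) : ℂ) +
        ((-Real.log (detDiv Ω₀ (cf Ω) (e.symm w)).re : ℝ) : ℂ)) z := by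
    refine dz_congr ?_ j
    filter_upwards [e.open_target.mem_nhds hz] with y hy
    refine dzbar_congr ?_ k
    filter_upwards [e.open_target.mem_nhds hy] with w hw
    rw [hrs he hw, Complex.ofReal_re, Real.log_div (PosDef.det_re_pos (posDef_cf hΩ he hw)).ne'
      (PosDef.det_re_pos (posDef_cf hΩ₀ he hw)).ne']
    push_cast
    ring
  rw [dz_dzbar_add e.open_target (hl hΩ) (hw e he) hz] at h1
  simp only [ricMat, hess, Pi.add_apply, Matrix.add_apply, Matrix.of_apply]
  rw [h1]
  ring

theorem trDiv_add {N : ChartMat n X} (x : X) :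
    trDiv Ω₀ N (K + L) x = trDiv Ω₀ N K x + trDiv Ω₀ N L x := by
  simp only [trDiv, glue, Pi.add_apply, Matrix.mul_add, Matrix.trace_add, add_div]

/-- The total scalar curvature depends only on the Kähler class. -/
theorem integral_trDiv_ricMat (hΩ₀ : IsKahlerForm p₀.2) (hp : p ∈ complexifiedClass p₀) :
    ∫ x, trDiv p₀.2 (adj (cf p.2)) (ricMat (cf p.2)) x ∂volMeasure p₀.2 =
      ∫ x, trDiv p₀.2 (adj (cf p₀.2)) (ricMat (cf p₀.2)) x ∂volMeasure p₀.2 := by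
  obtain ⟨w, hw, hwe⟩ := exists_ricMat_eq hΩ₀ hp.2.1
  have hG := isClosed11_cf hp.2.1.toIsClosedReal11
  have hG₀ := isClosed11_cf hΩ₀.toIsClosedReal11
  have hR := isClosed11_ricMat_cf hΩ₀
  have hA : IsCoclosed (adj (cf p.2)) := hG.adjugate
  have i1 := (cSmooth_trDiv hΩ₀ hA.cotensor hA.smooth hR.tensor
    hR.smooth).continuous.integrable_volMeasure hΩ₀
  have hhw := isClosed11_hess (n := n) (X := X) hw
  have i2 := (cSmooth_trDiv hΩ₀ hA.cotensor hA.smooth hhw.tensor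
    hhw.smooth).continuous.integrable_volMeasure hΩ₀
  rw [(matEq_refl (adj (cf p.2))).trDiv hwe]
  simp only [trDiv_add]
  rw [integral_add i1 i2, integral_trDiv_hess hΩ₀ hA hw, add_zero]
  -- both sides are derivatives of integrals of top powers
  have d1 := hasDerivAt_integral_detDiv hΩ₀ hG hR 0
  have d2 := hasDerivAt_integral_detDiv hΩ₀ hG₀ hR 0
  simp only [integral_detDiv_cf hΩ₀ hp hR] at d1
  simpa using d1.unique d2

/-- The form `σ` vanishes on constants, by the choice of the constant `c`. -/
theorem sigma_const [Nonempty X] (hB₀ : IsClosedReal11 p₀.1) (hΩ₀ : IsKahlerForm p₀.2)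
    (hγ : (γ * complexVolume p₀).im = 0) (hp : p ∈ complexifiedClass p₀) (a : ℂ) :
    sigma γ (cGamma γ p₀) p (fun _ => a) = 0 := by
  set c := cGamma γ p₀ with hc
  have hC₀ := isClosed11_complexMat hB₀ hΩ₀.toIsClosedReal11
  have hsig : ∀ q : DForm n 2 X × DForm n 2 X, IsClosedReal11 q.1 → IsKahlerForm q.2 →
      sig p₀.2 γ c (complexMat q) (cf q.2) (fun _ => a) =
      (γ * (a * ∫ x, detDiv p₀.2 (complexMat q) x ∂volMeasure p₀.2)).im -
        ((a.im : ℂ) * (∫ x, trDiv p₀.2 (adj (cf q.2)) (ricMat (cf q.2)) x ∂volMeasure p₀.2 -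
          c * ∫ x, detDiv p₀.2 (cf q.2) x ∂volMeasure p₀.2)).re := by
    intro q h1 h2
    have hG := isClosed11_cf h2.toIsClosedReal11
    have hA : IsCoclosed (adj (cf q.2)) := hG.adjugate
    have hR := isClosed11_ricMat_cf h2
    have i1 := (cSmooth_trDiv hΩ₀ hA.cotensor hA.smooth hR.tensor
      hR.smooth).continuous.integrable_volMeasure hΩ₀
    have i2 := (cSmooth_detDiv hΩ₀ hG.tensor hG.smooth).continuous.integrable_volMeasure hΩ₀
    rw [sig, integral_const_mul, integral_const_mul]
    simp only [imPart]
    rw [integral_const_mul, integral_sub i1 (i2.const_mul _), integral_const_mul]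
  -- all integrals are invariants of the class, which reduces the claim to `p = p₀`
  have e2 := integral_detDiv_cf hΩ₀ hp hC₀ 0
  rw [zero_smul, add_zero, add_zero] at e2
  rw [sigma_eq_sig hΩ₀ hp.1 hp.2.1 (cSmooth_const a), hsig p hp.1 hp.2.1,
    integral_detDiv_complexMat hB₀ hΩ₀ hp, integral_trDiv_ricMat hΩ₀ hp, e2, ← hsig p₀ hB₀ hΩ₀,
    ← sigma_eq_sig hΩ₀ hB₀ hΩ₀ (cSmooth_const a)]
  have cP := (cSmooth_powerRatio hB₀ hΩ₀).continuous
  have cS : Continuous (scalarCurvature p₀.2) := by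
    have := Complex.continuous_re.comp (cSmooth_scalarCurvature hΩ₀).continuous
    simpa [Function.comp_def] using this
  have iP := cP.integrable_volMeasure hΩ₀
  have iS := cS.integrable_volMeasure hΩ₀
  haveI := isFiniteMeasure_volMeasure hΩ₀
  haveI := isOpenPosMeasure_volMeasure hΩ₀
  have hV : complexVolume p₀ = ∫ x, powerRatio p₀ x ∂volMeasure p₀.2 :=
    volIntegral_eq_integral hΩ₀ cP
  have hv1 : volIntegral p₀.2 (fun _ => (1 : ℝ)) = (volMeasure p₀.2).real Set.univ := by
    rw [volIntegral_eq_integral hΩ₀ continuous_const]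
    simp
  have hv0 : (volMeasure p₀.2).real Set.univ ≠ 0 := by
    rw [Measure.real, ENNReal.toReal_ne_zero]
    exact ⟨isOpen_univ.measure_ne_zero _ Set.univ_nonempty, measure_ne_top _ _⟩
  have hcm : c * (volMeasure p₀.2).real Set.univ =
      ∫ x, scalarCurvature p₀.2 x ∂volMeasure p₀.2 - (γ * complexVolume p₀).re := by
    rw [hc, cGamma, hv1, div_mul_cancel₀ _ hv0, volIntegral_eq_integral hΩ₀ cS]
  have i3 : Integrable (fun x => γ * powerRatio p₀ x - ((scalarCurvature p₀.2 x : ℂ) - (c : ℂ)))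
      (volMeasure p₀.2) := (iP.const_mul γ).sub (iS.ofReal.sub (integrable_const _))
  have h5 : sigma γ c p₀ (fun _ => a) = (a * ∫ x, (γ * powerRatio p₀ x -
      ((scalarCurvature p₀.2 x : ℂ) - (c : ℂ))) ∂volMeasure p₀.2).im := by
    have hcont : Continuous fun x => (a * (γ * powerRatio p₀ x -
        ((scalarCurvature p₀.2 x : ℂ) - (c : ℂ)))).im := by fun_prop
    rw [sigma, volIntegral_eq_integral hΩ₀ hcont, ← integral_const_mul]
    exact Complex.imCLM.integral_comp_comm (i3.const_mul a)
  have i4 : Integrable (fun x => (scalarCurvature p₀.2 x : ℂ)) (volMeasure p₀.2) := iS.ofReal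
  have i5 : Integrable (fun x => (scalarCurvature p₀.2 x : ℂ) - (c : ℂ)) (volMeasure p₀.2) :=
    i4.sub (integrable_const _)
  rw [h5, integral_sub (iP.const_mul γ) i5, integral_const_mul,
    integral_sub i4 (integrable_const _), integral_const, integral_complex_ofReal, ← hV]
  have h6 : γ * complexVolume p₀ = (((γ * complexVolume p₀).re : ℝ) : ℂ) :=
    Complex.ext rfl (by rw [hγ, Complex.ofReal_im])
  have h7 : γ * complexVolume p₀ - (((∫ x, scalarCurvature p₀.2 x ∂volMeasure p₀.2 : ℝ) : ℂ) -
      (volMeasure p₀.2).real Set.univ • (c : ℂ)) = 0 := by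
    rw [h6, Complex.real_smul]
    have := congrArg Complex.ofReal hcm
    push_cast at this
    linear_combination this
  rw [h7, mul_zero, Complex.zero_im]

end Invariants

/-! ### Uniqueness of potentials and existence of the complexified K-energy -/

section Existence

open MeasureTheory

variable {n : ℕ} {X : Type*} [TopologicalSpace X] [ChartedSpace (Cn n) X]
variable {e e' : OpenPartialHomeomorph X (Cn n)} {z : Cn n} {Ω : DForm n 2 X}
variable {γ : ℂ} {c : ℝ} {p₀ p : DForm n 2 X × DForm n 2 X}
variable [IsManifold 𝓘(ℂ, Cn n) ω X]

/-- The vector of the derivatives `∂v/∂z_j` in a chart. -/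
def dzVec (v : X → ℂ) (e : OpenPartialHomeomorph X (Cn n)) (z : Cn n) : Fin n → ℂ :=
  fun j => dz j (fun w => v (e.symm w)) z

theorem gradMat_real (v : X → ℝ) (e : OpenPartialHomeomorph X (Cn n)) (z : Cn n) :
    gradMat (fun x => (v x : ℂ)) (fun x => (v x : ℂ)) e z =
      Matrix.vecMulVec (dzVec (fun x => (v x : ℂ)) e z) (star (dzVec (fun x => (v x : ℂ)) e z)) := by
  ext j k
  have h := dzbar_conj (fun w => ((v (e.symm w) : ℝ) : ℂ)) z k
  simp only [Complex.star_def, Complex.conj_ofReal] at h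
  simp only [gradMat, dzVec, Matrix.vecMulVec_apply, Matrix.of_apply, Pi.star_apply,
    Complex.star_def]
  rw [h]

theorem trace_mul_vecMulVec (A : Matrix (Fin n) (Fin n) ℂ) (a b : Fin n → ℂ) :
    (A * Matrix.vecMulVec a b).trace = b ⬝ᵥ (A *ᵥ a) := by
  rw [Matrix.mul_vecMulVec, Matrix.trace_vecMulVec, dotProduct_comm]

/-- A real function whose derivatives `∂v/∂z_j` vanish in all charts is constant. -/
theorem eq_of_dz_eq_zero [PreconnectedSpace X] {v : X → ℝ} (hv : CSmooth n fun x => (v x : ℂ))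
    (h : ∀ e ∈ atlas (Cn n) X, ∀ z ∈ e.target, dzVec (fun x => (v x : ℂ)) e z = 0) (x y : X) :
    v x = v y := by
  refine IsLocallyConstant.apply_eq_of_preconnectedSpace
    ((IsLocallyConstant.iff_eventually_eq _).2 fun x => ?_) x y
  set c := chartAt (Cn n) x with hc
  have hcm : c ∈ atlas (Cn n) X := chart_mem_atlas _ _
  obtain ⟨r, hr, hball⟩ := Metric.isOpen_iff.1 c.open_target (c x) (mem_chart_target _ _)
  have h0 : ∀ z ∈ c.target, fderiv ℝ (fun w => (v (c.symm w) : ℂ)) z = 0 := by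
    intro z hz
    ext a
    rw [clm_apply_eq_sum]
    refine Finset.sum_eq_zero fun i _ => ?_
    have h1 : wz i (fderiv ℝ (fun w => (v (c.symm w) : ℂ)) z) = 0 := congrFun (h c hcm z hz) i
    have h2 : wzbar i (fderiv ℝ (fun w => (v (c.symm w) : ℂ)) z) = 0 := by
      have h3 := dzbar_conj (fun w => ((v (c.symm w) : ℝ) : ℂ)) z i
      simp only [Complex.star_def, Complex.conj_ofReal] at h3
      refine h3.trans ?_
      rw [show dz i (fun w => ((v (c.symm w) : ℝ) : ℂ)) z = 0 from congrFun (h c hcm z hz) i, map_zero]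
    rw [h1, h2, zero_mul, zero_mul, add_zero]
  have h1 : c ⁻¹' Metric.ball (c x) r ∩ c.source ∈ nhds x :=
    Filter.inter_mem ((c.continuousAt (mem_chart_source _ _)) (Metric.ball_mem_nhds _ hr))
      (c.open_source.mem_nhds (mem_chart_source _ _))
  filter_upwards [h1] with y hy
  have h2 := Metric.isOpen_ball.is_const_of_fderiv_eq_zero (𝕜 := ℝ)
    (convex_ball (c x) r).isPreconnected
    (((hv c hcm).differentiableOn (by simp)).mono hball)
    (fun z hz => h0 z (hball hz)) hy.1 (Metric.mem_ball_self hr)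
  simp only [c.left_inv hy.2, c.left_inv (mem_chart_source (Cn n) x)] at h2
  exact Complex.ofReal_injective h2

variable [T2Space X] [CompactSpace X]

/-- Pluriharmonic real functions on a compact connected Kähler manifold are constant. -/
theorem eq_of_iddbar_eq_zero [PreconnectedSpace X] (hΩ : IsKahlerForm Ω) {v : X → ℝ}
    (hv : CSmooth n fun x => (v x : ℂ)) (h : iddbar n v = 0) (x y : X) : v x = v y := by
  letI := borel X
  haveI : BorelSpace X := ⟨rfl⟩
  have hh : MatEq (hess fun x => (v x : ℂ)) (0 : ChartMat n X) := by
    intro e he z hz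
    rw [← cf_iddbar hv he hz, h]
    ext j k
    simp [cf, coeff, inChart]
  have hG := isClosed11_cf hΩ.toIsClosedReal11
  have hA : IsCoclosed (adj (cf Ω)) := hG.adjugate
  have hgt := isTensor_gradMat (n := n) (X := X) hv hv
  -- `∫ v i∂∂̄v ∧ Ωⁿ⁻¹ = 0`, so that the square norm `g` of the gradient has integral zero
  have h1 := integral_trDiv_hess_add_grad hΩ hA hv hv
  set g := trDiv Ω (adj (cf Ω)) (gradMat (fun x => (v x : ℂ)) fun x => (v x : ℂ)) with hg
  have h2 : ∀ x, trDiv Ω (adj (cf Ω)) (hess fun x => (v x : ℂ)) x = 0 := fun x => by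
    rw [(matEq_refl _).trDiv hh]
    simp [trDiv, glue]
  simp only [h2, mul_zero, zero_add] at h1
  have hgs : CSmooth n g := cSmooth_trDiv hΩ hA.cotensor hA.smooth hgt (isSmoothMat_gradMat hv hv)
  have hge : ∀ e ∈ atlas (Cn n) X, ∀ z ∈ e.target, g (e.symm z) =
      star (dzVec (fun x => (v x : ℂ)) e z) ⬝ᵥ ((cf Ω e z)⁻¹ *ᵥ dzVec (fun x => (v x : ℂ)) e z) := by
    intro e he z hz
    rw [hg, trDiv_symm hΩ hA.cotensor hgt he hz, adj, ← trace_inv_mul_eq (det_cf_ne_zero hΩ he hz),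
      gradMat_real, trace_mul_vecMulVec]
  have hnn : ∀ x, 0 ≤ g x := fun x => by
    have hx := mem_chart_target (Cn n) x
    have h3 := hge _ (chart_mem_atlas _ x) _ hx
    rw [(chartAt (Cn n) x).left_inv (mem_chart_source _ _)] at h3
    rw [h3]
    exact (posDef_cf hΩ (chart_mem_atlas _ x) hx).inv.posSemidef.dotProduct_mulVec_nonneg _
  have hre : ∀ x, 0 ≤ (g x).re := fun x => (Complex.le_def.1 (hnn x)).1
  have hcr : Continuous fun x => (g x).re := Complex.continuous_re.comp hgs.continuous
  have h3 : ∫ x, (g x).re ∂volMeasure Ω = 0 := by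
    have := (Complex.reCLM.integral_comp_comm (hgs.continuous.integrable_volMeasure hΩ))
    rw [h1, map_zero] at this
    exact this
  haveI := isOpenPosMeasure_volMeasure hΩ
  have h4 := (hcr.ae_eq_iff_eq (volMeasure Ω) continuous_zero).1
    ((integral_eq_zero_iff_of_nonneg hre (hcr.integrable_volMeasure hΩ)).1 h3)
  refine eq_of_dz_eq_zero hv (fun e he z hz => ?_) x y
  by_contra hne
  have h5 := (posDef_cf hΩ he hz).inv.dotProduct_mulVec_pos hne
  rw [← hge e he z hz] at h5
  exact (Complex.lt_def.1 h5).1.ne' (congrFun h4 _)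

/-- Potentials are unique up to constants. -/
theorem exists_eq_add_const_of_addPotential_eq [ConnectedSpace X] (hp : p ∈ complexifiedClass p₀)
    {φ ψ : X → ℂ} (hφ : CSmooth n φ) (hψ : CSmooth n ψ) (h : addPotential p φ = addPotential p ψ) :
    ∃ a : ℂ, ψ = fun x => φ x + a := by
  have hk : CSmooth n fun x => ψ x - φ x := fun e he => (hψ e he).sub (hφ e he)
  have h1 := addPotential_add p hφ hk
  simp only [add_sub_cancel] at h1
  rw [← h] at h1
  have h2 := congrArg Prod.fst h1
  have h3 := congrArg Prod.snd h1
  simp only [addPotential, left_eq_add] at h2 h3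
  obtain ⟨x₀⟩ : Nonempty X := inferInstance
  refine ⟨ψ x₀ - φ x₀, funext fun x => ?_⟩
  have h4 := eq_of_iddbar_eq_zero hp.2.1 hk.rePart h2 x x₀
  have h5 := eq_of_iddbar_eq_zero (v := fun x => (ψ x - φ x).im) hp.2.1 hk.imPart h3 x x₀
  have h6 : ψ x - φ x = ψ x₀ - φ x₀ := Complex.ext h4 h5
  rw [← h6]
  ring

theorem addPotential_add_const (p : DForm n 2 X × DForm n 2 X) {φ : X → ℂ} (hφ : CSmooth n φ)
    (a : ℂ) : addPotential p (fun x => φ x + a) = addPotential p φ := by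
  have h0 : ∀ r : ℝ, iddbar n (fun _ : X => r) = 0 := by
    intro r
    have : dJ n (fun _ : X => r) = (0 : ℝ) • dJ n (fun _ : X => r) := by
      ext1 x
      have h : diffAt (n := n) (fun _ : X => r) x = 0 := mfderiv_const
      rw [zero_smul, dJ, h]
      rfl
    rw [iddbar, this, dForm_smul, zero_smul, smul_zero]
  rw [addPotential_add p hφ (cSmooth_const a)]
  simp [addPotential, h0]

/-- The integral of `σ` along the ray to `p + i∂∂̄φ` depends only on `p + i∂∂̄φ`. -/
theorem rayEnergy_eq_of_addPotential_eq [ConnectedSpace X] (hB₀ : IsClosedReal11 p₀.1)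
    (hΩ₀ : IsKahlerForm p₀.2) (hγ : (γ * complexVolume p₀).im = 0) (hp : p ∈ complexifiedClass p₀)
    {φ ψ : X → ℂ} (hφ : CSmooth n φ) (hψ : CSmooth n ψ) (hm : addPotential p φ ∈ complexifiedClass p₀)
    (h : addPotential p φ = addPotential p ψ) :
    rayEnergy γ (cGamma γ p₀) p φ = rayEnergy γ (cGamma γ p₀) p ψ := by
  letI := borel X
  haveI : BorelSpace X := ⟨rfl⟩
  obtain ⟨a, rfl⟩ := exists_eq_add_const_of_addPotential_eq hp hφ hψ h
  have hpath : SmoothPath n Set.univ (fun t x => φ x + (t : ℂ) * a) fun _ _ => a :=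
    (smoothPath_ray (cSmooth_const a) isOpen_univ).add_const hφ
  have h1 : ∀ t : ℝ, HasDerivAt
      (fun s : ℝ => rayEnergy γ (cGamma γ p₀) p fun x => φ x + (s : ℂ) * a) 0 t := fun t => by
    have hmem : ∀ s : ℝ, addPotential p (fun x => φ x + (s : ℂ) * a) ∈ complexifiedClass p₀ :=
      fun s => by rwa [addPotential_add_const p hφ]
    have := hasDerivAt_rayEnergy (γ := γ) (c := cGamma γ p₀) hΩ₀ hp hpath (fun s _ => hmem s)
      (Set.mem_univ t)
    rwa [sigma_const hB₀ hΩ₀ hγ (hmem t) a] at this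
  have h2 := is_const_of_deriv_eq_zero (fun t => (h1 t).differentiableAt) (fun t => (h1 t).deriv) 0 1
  simpa using h2

/-- The elements of the complexified class from which `q` is obtained by adding a potential. -/
def potentialOrbit (p₀ q : DForm n 2 X × DForm n 2 X) : Set (DForm n 2 X × DForm n 2 X) :=
  {b | b ∈ complexifiedClass p₀ ∧ ∃ φ : X → ℂ, CSmooth n φ ∧ q = addPotential b φ}

theorem potentialOrbit_addPotential (p₀ q : DForm n 2 X × DForm n 2 X) {ψ : X → ℂ}
    (hψ : CSmooth n ψ) : potentialOrbit p₀ (addPotential q ψ) = potentialOrbit p₀ q := by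
  have key : ∀ (q : DForm n 2 X × DForm n 2 X) {ψ : X → ℂ}, CSmooth n ψ →
      potentialOrbit p₀ q ⊆ potentialOrbit p₀ (addPotential q ψ) := by
    rintro q ψ hψ b ⟨hb, φ, hφ, rfl⟩
    exact ⟨hb, _, hφ.add hψ, (addPotential_add b hφ hψ).symm⟩
  refine Set.Subset.antisymm ?_ (key q hψ)
  have hn : CSmooth n fun x => -ψ x := fun e he => (hψ e he).neg
  have h := key (addPotential q ψ) hn
  rw [← addPotential_add q hψ hn] at h
  simpa [addPotential_zero] using h

theorem self_mem_potentialOrbit {q : DForm n 2 X × DForm n 2 X} (hq : q ∈ complexifiedClass p₀) :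
    q ∈ potentialOrbit p₀ q := ⟨hq, _, cSmooth_const 0, (addPotential_zero q).symm⟩

open Classical in
/-- A complexified K-energy: a base point is chosen in each set of forms that differ by potentials,
and `σ` is integrated along the ray from the base point. The value off the class is irrelevant. -/
def kEnergy (γ : ℂ) (p₀ q : DForm n 2 X × DForm n 2 X) : ℝ :=
  if h : (potentialOrbit p₀ q).Nonempty then
    rayEnergy γ (cGamma γ p₀) h.some h.some_mem.2.choose else 0

theorem kEnergy_eq [ConnectedSpace X] (hB₀ : IsClosedReal11 p₀.1) (hΩ₀ : IsKahlerForm p₀.2)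
    (hγ : (γ * complexVolume p₀).im = 0) (hp : p ∈ complexifiedClass p₀) : ∃ b ∈ complexifiedClass p₀,
    ∃ φ : X → ℂ, CSmooth n φ ∧ p = addPotential b φ ∧ ∀ ψ : X → ℂ, CSmooth n ψ →
      addPotential p ψ ∈ complexifiedClass p₀ → kEnergy γ p₀ (addPotential p ψ) =
        rayEnergy γ (cGamma γ p₀) b fun x => φ x + ψ x := by
  have hne : (potentialOrbit p₀ p).Nonempty := ⟨p, self_mem_potentialOrbit hp⟩
  obtain ⟨hb, φ, hφ, hpφ⟩ := hne.some_mem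
  refine ⟨hne.some, hb, φ, hφ, hpφ, fun ψ hψ hm => ?_⟩
  have horb := potentialOrbit_addPotential p₀ p hψ
  have hne' : (potentialOrbit p₀ (addPotential p ψ)).Nonempty := horb ▸ hne
  have hsome : hne'.some = hne.some := by
    simp only [Set.Nonempty.some, horb]
  rw [kEnergy, dif_pos hne']
  obtain ⟨hc1, hc2⟩ := hne'.some_mem.2.choose_spec
  generalize hne'.some_mem.2.choose = χ at hc1 hc2 ⊢
  rw [hsome] at hc2 ⊢
  refine rayEnergy_eq_of_addPotential_eq hB₀ hΩ₀ hγ hb hc1 (hφ.add hψ) (hc2 ▸ hm) ?_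
  rw [← hc2, addPotential_add _ hφ hψ, ← hpφ]

theorem isComplexifiedKEnergy_kEnergy [ConnectedSpace X] (hB₀ : IsClosedReal11 p₀.1)
    (hΩ₀ : IsKahlerForm p₀.2) (hγ : (γ * complexVolume p₀).im = 0) :
    IsComplexifiedKEnergy γ p₀ (kEnergy γ p₀) := by
  intro p hp ψ hψ
  letI := borel X
  haveI : BorelSpace X := ⟨rfl⟩
  rw [isSmoothFun_iff] at hψ
  obtain ⟨b, hb, φ, hφ, hpφ, hE⟩ := kEnergy_eq hB₀ hΩ₀ hγ hp
  obtain ⟨T, hT, h0, hmem⟩ := exists_isOpen_ray_mem hp hψ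
  have hray := smoothPath_ray hψ hT
  have heq : ∀ t : ℝ, addPotential b (fun x => φ x + (t : ℂ) * ψ x) =
      addPotential p fun x => (t : ℂ) * ψ x := fun t => by
    rw [addPotential_add b hφ ((cSmooth_const _).mul hψ), ← hpφ]
  have h1 := hasDerivAt_rayEnergy (γ := γ) (c := cGamma γ p₀) hΩ₀ hb (hray.add_const hφ)
    (fun t ht => by rw [heq]; exact hmem t ht) h0
  beta_reduce at h1
  rw [heq 0] at h1
  simp only [Complex.ofReal_zero, zero_mul, addPotential_zero] at h1
  refine h1.congr_of_eventuallyEq ?_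
  filter_upwards [hT.mem_nhds h0] with t ht
  exact hE _ ((cSmooth_const _).mul hψ) (hmem t ht)

/-- A complexified K-energy is recovered from `σ` by integration along rays. -/
theorem IsComplexifiedKEnergy.eq_add_rayEnergy [MeasurableSpace X] [BorelSpace X]
    {M : DForm n 2 X × DForm n 2 X → ℝ} (hM : IsComplexifiedKEnergy γ p₀ M)
    (hΩ₀ : IsKahlerForm p₀.2) (hp : p ∈ complexifiedClass p₀) {u : X → ℂ} (hu : CSmooth n u)
    (h : addPotential p u ∈ complexifiedClass p₀) :
    M (addPotential p u) = M p + rayEnergy γ (cGamma γ p₀) p u := by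
  have hmem : ∀ s ∈ Set.Icc (0 : ℝ) 1, addPotential p (fun x => (s : ℂ) * u x) ∈ complexifiedClass p₀ :=
    fun s hs => ray_mem_complexifiedClass hp hu h hs
  have hsm : ∀ s : ℝ, CSmooth n fun x => (s : ℂ) * u x := fun s => (cSmooth_const _).mul hu
  have hd : ∀ s ∈ Set.Icc (0 : ℝ) 1, HasDerivAt (fun r : ℝ => M (addPotential p fun x => (r : ℂ) * u x))
      (sigma γ (cGamma γ p₀) (addPotential p fun x => (s : ℂ) * u x) u) s := by
    intro s hs
    have h1 := hM _ (hmem s hs) u (isSmoothFun_iff.2 hu)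
    have h2 : ∀ t : ℝ, addPotential (addPotential p fun x => (s : ℂ) * u x) (fun x => (t : ℂ) * u x) =
        addPotential p fun x => ((s + t : ℝ) : ℂ) * u x := fun t => by
      rw [← addPotential_add p (hsm s) (hsm t)]
      push_cast
      simp only [add_mul]
    simp only [h2] at h1
    rw [← sub_self s] at h1
    have h4 := h1.comp_sub_const s s
    simpa using h4
  have hc : ContinuousOn (fun s : ℝ => sigma γ (cGamma γ p₀) (addPotential p fun x => (s : ℂ) * u x) u)
      (Set.Icc 0 1) := continuousOn_sigma hΩ₀ hp (uniqueDiffOn_Icc zero_lt_one)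
    ((smoothPath_ray hu isOpen_univ).smooth.mono (Set.subset_univ _)) (smoothFam_const hu) hmem
  have h1 := intervalIntegral.integral_eq_sub_of_hasDerivAt_of_le zero_le_one
    (fun s hs => (hd s hs).continuousAt.continuousWithinAt)
    (fun s hs => hd s (Set.Ioo_subset_Icc_self hs)) (ContinuousOn.intervalIntegrable (by
      rwa [Set.uIcc_of_le zero_le_one]))
  rw [rayEnergy, h1]
  simp [addPotential_zero]

end Existence

/-! ### The Bochner formula -/

section Bochner

open MeasureTheory

variable {n : ℕ} {X : Type*} [TopologicalSpace X] [ChartedSpace (Cn n) X]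
variable {e e' : OpenPartialHomeomorph X (Cn n)} {z : Cn n} {Ω₀ : DForm n 2 X}
variable {G : ChartMat n X} {u : X → ℂ} {ψ : X → ℝ}

/-- The vector `g^{lj} ∂_j u` in a chart; for real `u`, it is conjugate to the `(1,0)`-part of the
gradient. -/
def gradVec (G : ChartMat n X) (u : X → ℂ) (e : OpenPartialHomeomorph X (Cn n)) (z : Cn n) :
    Fin n → ℂ :=
  (G e z)⁻¹ *ᵥ dzVec u e z

/-- The matrix `∂_l̄ V^j`, where `V` is the `(1,0)`-part of the gradient of `u`. -/
def dbarGrad (G : ChartMat n X) (u : X → ℂ) : ChartMat n X := fun e z =>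
  Matrix.of fun j l => dzbar l (fun w => star (gradVec G u e w j)) z

section Holomorphic

variable [IsManifold 𝓘(ℂ, Cn n) ω X]

theorem contDiffOn_gradVec (hG : IsClosed11 G) (hpos : IsPosMat G) (hu : CSmooth n u)
    (he : e ∈ atlas (Cn n) X) (l : Fin n) :
    ContDiffOn ℝ ∞ (fun z => gradVec G u e z l) e.target := by
  simp only [gradVec, Matrix.mulVec, dotProduct]
  exact ContDiffOn.sum fun j _ => (contDiffOn_inv (hG.smooth e he)
    (fun z hz => (hpos e he z hz).det_pos.ne') l j).mul ((hu e he).dz e.open_target j)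

theorem contDiffOn_star_gradVec (hG : IsClosed11 G) (hpos : IsPosMat G) (hu : CSmooth n u)
    (he : e ∈ atlas (Cn n) X) (l : Fin n) :
    ContDiffOn ℝ ∞ (fun z => star (gradVec G u e z l)) e.target :=
  Complex.conjCLE.contDiff.comp_contDiffOn (contDiffOn_gradVec hG hpos hu he l)

theorem isSmoothMat_dbarGrad (hG : IsClosed11 G) (hpos : IsPosMat G) (hu : CSmooth n u) :
    IsSmoothMat (dbarGrad G u) := fun _ he j l =>
  (contDiffOn_star_gradVec hG hpos hu he j).dzbar (OpenPartialHomeomorph.open_target _) l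

theorem dzVec_chartChange (hu : CSmooth n u) (he : e ∈ atlas (Cn n) X) (he' : e' ∈ atlas (Cn n) X)
    (hz : z ∈ overlap e e') :
    dzVec u e z = (jac e e' z)ᵀ *ᵥ dzVec u e' (chartChange e e' z) := by
  ext j
  rw [dzVec, dz_congr (comp_symm_eventuallyEq u hz), dz_chartChange he he' hz
    (f := fun w => u (e'.symm w)) (differentiableAt_comp_symm hu he' (chartChange_mem hz).1)]
  rfl

theorem gradVec_chartChange (hG : IsTensor G) (hu : CSmooth n u) (he : e ∈ atlas (Cn n) X)
    (he' : e' ∈ atlas (Cn n) X) (hz : z ∈ overlap e e') :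
    gradVec G u e' (chartChange e e' z) = conjM (jac e e' z) *ᵥ gradVec G u e z := by
  rw [gradVec, gradVec, dzVec_chartChange hu he he' hz, ← hG.conjM_mul_inv_mul he he' hz]
  simp only [Matrix.mulVec_mulVec, Matrix.mul_assoc]

theorem dbarGrad_chartChange (hG : IsClosed11 G) (hpos : IsPosMat G) (hu : CSmooth n u)
    (he : e ∈ atlas (Cn n) X) (he' : e' ∈ atlas (Cn n) X) (hz : z ∈ overlap e e') :
    dbarGrad G u e' (chartChange e e' z) * conjM (jac e e' z) = jac e e' z * dbarGrad G u e z := by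
  ext i l
  have h1 : (fun w => star (gradVec G u e' (chartChange e e' w) i)) =ᶠ[nhds z]
      fun w => ∑ j, jac e e' w i j * star (gradVec G u e w j) := by
    filter_upwards [(isOpen_overlap e e').mem_nhds hz] with w hw
    rw [gradVec_chartChange hG.tensor hu he he' hw, Matrix.mulVec, dotProduct, star_sum]
    refine Finset.sum_congr rfl fun j _ => ?_
    simp [conjM]
  have h2 := dzbar_congr h1 l
  have hd : ∀ {e : OpenPartialHomeomorph X (Cn n)} {z : Cn n}, e ∈ atlas (Cn n) X → z ∈ e.target →
      ∀ j, DifferentiableAt ℝ (fun w => star (gradVec G u e w j)) z := fun he hz j =>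
    (contDiffOn_star_gradVec hG hpos hu he j).differentiableAt_of_isOpen
      (OpenPartialHomeomorph.open_target _) hz
  have hJ : ∀ j, DifferentiableAt ℝ (fun w => jac e e' w i j) z := fun j =>
    (differentiableAt_jac he he' hz i j).restrictScalars ℝ
  rw [dzbar_chartChange he he' hz (f := fun w => star (gradVec G u e' w i))
    (hd he' (chartChange_mem hz).1 i), dzbar_sum fun j _ => (hJ j).fun_mul (hd he hz.1 j)] at h2
  simp only [Matrix.mul_apply, dbarGrad, Matrix.of_apply, conjM, Matrix.map_apply]
  refine Eq.trans (Finset.sum_congr rfl fun m _ => ?_) (h2.trans (Finset.sum_congr rfl fun j _ => ?_))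
  · rw [starRingEnd_apply, mul_comm]
  · rw [dzbar_mul (hJ j) (hd he hz.1 j),
      dzbar_eq_zero_of_differentiableAt (differentiableAt_jac he he' hz i j), zero_mul, add_zero]

/-- The square norm of the `(0,1)`-derivative of the gradient is well defined. -/
theorem isInvariant_trace_dbarGrad (hG : IsClosed11 G) (hpos : IsPosMat G) (hu : CSmooth n u) :
    IsInvariant fun e z => (dbarGrad G u e z * conjM (dbarGrad G u e z)).trace := by
  intro e he e' he' z hz
  have h := dbarGrad_chartChange hG hpos hu he he' hz
  have hJ : IsUnit (jac e e' z).det := isUnit_iff_ne_zero.2 (det_jac_ne_zero he he' hz)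
  have hc := congrArg conjM h
  have hcc : conjM (conjM (jac e e' z)) = jac e e' z := by ext i j; simp [conjM]
  rw [conjM_mul, conjM_mul, hcc] at hc
  have h1 : dbarGrad G u e z = (jac e e' z)⁻¹ *
      (dbarGrad G u e' (chartChange e e' z) * conjM (jac e e' z)) := by
    rw [h, Matrix.nonsing_inv_mul_cancel_left _ _ hJ]
  have h2 : conjM (jac e e' z) * conjM (dbarGrad G u e z) =
    conjM (dbarGrad G u e' (chartChange e e' z)) * jac e e' z := hc.symm
  calc (dbarGrad G u e z * conjM (dbarGrad G u e z)).trace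
      = ((jac e e' z)⁻¹ * (dbarGrad G u e' (chartChange e e' z) * conjM (jac e e' z)) *
          conjM (dbarGrad G u e z)).trace := by rw [← h1]
    _ = ((jac e e' z)⁻¹ * (dbarGrad G u e' (chartChange e e' z) *
          (conjM (dbarGrad G u e' (chartChange e e' z)) * jac e e' z))).trace := by
        rw [← h2]
        simp only [Matrix.mul_assoc]
    _ = _ := by
        rw [Matrix.trace_mul_comm, Matrix.mul_assoc, Matrix.mul_assoc,
          Matrix.mul_nonsing_inv _ hJ, Matrix.mul_one]

theorem isInvariant_dbarGrad_gradVec (hG : IsClosed11 G) (hpos : IsPosMat G) (hu : CSmooth n u)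
    {ρ : X → ℂ} (hρ : CSmooth n ρ) :
    IsInvariant fun e z => dzVec ρ e z ⬝ᵥ (dbarGrad G u e z *ᵥ gradVec G u e z) := by
  intro e he e' he' z hz
  simp only
  rw [gradVec_chartChange hG.tensor hu he he' hz, Matrix.mulVec_mulVec,
    dbarGrad_chartChange hG hpos hu he he' hz, dzVec_chartChange hρ he he' hz,
    Matrix.mulVec_transpose, ← Matrix.dotProduct_mulVec, Matrix.mulVec_mulVec]

theorem star_gradVec (hpos : IsPosMat G) (he : e ∈ atlas (Cn n) X) (hz : z ∈ e.target) :
    star (gradVec G u e z) = star (dzVec u e z) ᵥ* (G e z)⁻¹ := by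
  rw [gradVec, Matrix.star_mulVec, (hpos e he z hz).inv.1.eq]

theorem star_dzVec (ψ : X → ℝ) (e : OpenPartialHomeomorph X (Cn n)) (z : Cn n) (k : Fin n) :
    star (dzVec (fun x => (ψ x : ℂ)) e z k) = dzbar k (fun w => (ψ (e.symm w) : ℂ)) z := by
  have h := dzbar_conj (fun w => ((ψ (e.symm w) : ℝ) : ℂ)) z k
  simp only [Complex.star_def, Complex.conj_ofReal] at h
  exact h.symm

/-- Lowering the index of the gradient gives back the differential. -/
theorem sum_star_gradVec_mul (hpos : IsPosMat G) (he : e ∈ atlas (Cn n) X) (hz : z ∈ e.target)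
    (k : Fin n) : ∑ j, star (gradVec G (fun x => (ψ x : ℂ)) e z j) * G e z j k =
      dzbar k (fun w => (ψ (e.symm w) : ℂ)) z := by
  have hu : IsUnit (G e z).det := isUnit_iff_ne_zero.2 (hpos e he z hz).det_pos.ne'
  have h := congrArg (fun v => (v ᵥ* G e z) k)
    (star_gradVec (u := fun x => (ψ x : ℂ)) hpos he hz)
  simp only [Matrix.vecMul_vecMul, Matrix.nonsing_inv_mul _ hu, Matrix.vecMul_one, Pi.star_apply,
    star_dzVec] at h
  exact h

/-- As the metric is Kähler, `∂̄` of the gradient is symmetric after lowering its index. -/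
theorem transpose_mul_dbarGrad (hG : IsClosed11 G) (hpos : IsPosMat G)
    (hψ : CSmooth n fun x => (ψ x : ℂ)) (he : e ∈ atlas (Cn n) X) (hz : z ∈ e.target) :
    ((G e z)ᵀ * dbarGrad G (fun x => (ψ x : ℂ)) e z)ᵀ =
      (G e z)ᵀ * dbarGrad G (fun x => (ψ x : ℂ)) e z := by
  have hV : ∀ j, DifferentiableAt ℝ (fun w => star (gradVec G (fun x => (ψ x : ℂ)) e w j)) z :=
    fun j => (contDiffOn_star_gradVec hG hpos hψ he j).differentiableAt_of_isOpen e.open_target hz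
  have key : ∀ k l, ((G e z)ᵀ * dbarGrad G (fun x => (ψ x : ℂ)) e z) k l =
      dzbar l (dzbar k fun w => (ψ (e.symm w) : ℂ)) z -
        ∑ j, star (gradVec G (fun x => (ψ x : ℂ)) e z j) * dzbar l (fun w => G e w j k) z := by
    intro k l
    have h1 : dzbar k (fun w => (ψ (e.symm w) : ℂ)) =ᶠ[nhds z]
        fun w => ∑ j, star (gradVec G (fun x => (ψ x : ℂ)) e w j) * G e w j k := by
      filter_upwards [e.open_target.mem_nhds hz] with w hw
      exact (sum_star_gradVec_mul hpos he hw k).symm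
    rw [dzbar_congr h1, dzbar_sum fun j _ => (hV j).fun_mul (hG.differentiableAt he hz j k),
      ← Finset.sum_sub_distrib, Matrix.mul_apply]
    refine Finset.sum_congr rfl fun j _ => ?_
    rw [dzbar_mul (hV j) (hG.differentiableAt he hz j k)]
    simp only [Matrix.transpose_apply, dbarGrad, Matrix.of_apply]
    ring
  ext k l
  rw [Matrix.transpose_apply, key, key]
  congr 1
  · exact dzbar_dzbar_comm ((hψ e he).contDiffAt_two e.open_target hz) k l
  · exact Finset.sum_congr rfl fun j _ => by rw [hG.dzbar_symm e he z hz]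

/-- The weighted divergence of the gradient is the Laplacian. -/
theorem sum_dz_star_gradVec (hG : IsClosed11 G) (hpos : IsPosMat G)
    (hψ : CSmooth n fun x => (ψ x : ℂ)) (he : e ∈ atlas (Cn n) X) (hz : z ∈ e.target) :
    ∑ j, (dz j (fun w => star (gradVec G (fun x => (ψ x : ℂ)) e w j)) z +
      dz j (fun w => ((Real.log (G e w).det.re : ℝ) : ℂ)) z *
        star (gradVec G (fun x => (ψ x : ℂ)) e z j)) = lap G (fun x => (ψ x : ℂ)) (e.symm z) := by
  have hd0 : (G e z).det ≠ 0 := (hpos e he z hz).det_pos.ne'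
  have hV : ∀ j, DifferentiableAt ℝ (fun w => star (gradVec G (fun x => (ψ x : ℂ)) e w j)) z :=
    fun j => (contDiffOn_star_gradVec hG hpos hψ he j).differentiableAt_of_isOpen e.open_target hz
  have hL : DifferentiableAt ℝ (fun w => ((Real.log (G e w).det.re : ℝ) : ℂ)) z :=
    (contDiffOn_logDet (hG.smooth e he) (hpos e he)).differentiableAt_of_isOpen e.open_target hz
  have hA : IsCoclosed (adj G) := hG.adjugate
  have hAd : ∀ k j, DifferentiableAt ℝ (fun w => adj G e w k j) z := fun k j =>
    (hA.smooth e he k j).differentiableAt_of_isOpen e.open_target hz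
  have hb : ∀ k, DifferentiableAt ℝ (dzbar k fun w => (ψ (e.symm w) : ℂ)) z := fun k =>
    ((hψ e he).dzbar e.open_target k).differentiableAt_of_isOpen e.open_target hz
  have h1 : ∀ j, (fun w => Complex.exp ((Real.log (G e w).det.re : ℝ) : ℂ) *
      star (gradVec G (fun x => (ψ x : ℂ)) e w j)) =ᶠ[nhds z]
        fun w => ∑ k, adj G e w k j * dzbar k (fun w => (ψ (e.symm w) : ℂ)) w := by
    intro j
    filter_upwards [e.open_target.mem_nhds hz] with w hw
    have h2 := congrFun (star_gradVec (u := fun x => (ψ x : ℂ)) hpos he hw) j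
    rw [Pi.star_apply] at h2
    rw [PosDef.cexp_logDet (hpos e he w hw), h2, adj,
      adjugate_eq_det_smul_inv (hpos e he w hw).det_pos.ne', Matrix.vecMul, dotProduct,
      Finset.mul_sum]
    refine Finset.sum_congr rfl fun k _ => ?_
    rw [Pi.star_apply, star_dzVec, Matrix.smul_apply, smul_eq_mul]
    ring
  have h3 : ∀ j, (G e z).det * (dz j (fun w => star (gradVec G (fun x => (ψ x : ℂ)) e w j)) z +
      dz j (fun w => ((Real.log (G e w).det.re : ℝ) : ℂ)) z *
        star (gradVec G (fun x => (ψ x : ℂ)) e z j)) =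
      ∑ k, (dz j (fun w => adj G e w k j) z * dzbar k (fun w => (ψ (e.symm w) : ℂ)) z +
        adj G e z k j * hess (fun x => (ψ x : ℂ)) e z j k) := by
    intro j
    have h4 := dz_congr (h1 j) j
    rw [dz_mul hL.cexp (hV j), dz_cexp hL, PosDef.cexp_logDet (hpos e he z hz),
      dz_sum fun k _ => (hAd k j).fun_mul (hb k)] at h4
    rw [show ∑ k, (dz j (fun w => adj G e w k j) z * dzbar k (fun w => (ψ (e.symm w) : ℂ)) z +
      adj G e z k j * hess (fun x => (ψ x : ℂ)) e z j k) = ∑ k, dz j (fun w => adj G e w k j *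
        dzbar k (fun w => (ψ (e.symm w) : ℂ)) w) z from Finset.sum_congr rfl fun k _ => by
          rw [dz_mul (hAd k j) (hb k), add_comm]; rfl, ← h4]
    ring
  rw [lap, glue_symm ((isTensor_hess hψ).isInvariant_trace_inv hG.tensor hpos) he hz,
    trace_inv_mul_eq hd0, eq_div_iff hd0, mul_comm, Finset.mul_sum]
  simp only [h3, Finset.sum_add_distrib]
  rw [Finset.sum_comm]
  simp only [← Finset.sum_mul, hA.sum_dz e he z hz, zero_mul, Finset.sum_const_zero, zero_add,
    Matrix.trace, Matrix.diag, Matrix.mul_apply]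
  rw [Finset.sum_comm]
  rfl

/-- The Ricci identity: the weighted divergence of `∂̄V`, for the gradient `V`, is `∂̄` of the
Laplacian plus the contraction of `V` with the Ricci form. -/
theorem sum_dz_dbarGrad (hG : IsClosed11 G) (hpos : IsPosMat G)
    (hψ : CSmooth n fun x => (ψ x : ℂ)) (he : e ∈ atlas (Cn n) X) (hz : z ∈ e.target) (l : Fin n) :
    ∑ j, (dz j (fun w => dbarGrad G (fun x => (ψ x : ℂ)) e w j l) z +
      dz j (fun w => ((Real.log (G e w).det.re : ℝ) : ℂ)) z *
        dbarGrad G (fun x => (ψ x : ℂ)) e z j l) =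
      dzbar l (fun w => lap G (fun x => (ψ x : ℂ)) (e.symm w)) z +
        ∑ j, star (gradVec G (fun x => (ψ x : ℂ)) e z j) * ricMat G e z j l := by
  have hVs := fun j => contDiffOn_star_gradVec hG hpos hψ he (l := j)
  have hLs := contDiffOn_logDet (hG.smooth e he) (hpos e he)
  have hV : ∀ j, DifferentiableAt ℝ (fun w => star (gradVec G (fun x => (ψ x : ℂ)) e w j)) z :=
    fun j => (hVs j).differentiableAt_of_isOpen e.open_target hz
  have hdV : ∀ j, DifferentiableAt ℝ
      (fun w => dz j (fun w => star (gradVec G (fun x => (ψ x : ℂ)) e w j)) w) z := fun j =>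
    ((hVs j).dz e.open_target j).differentiableAt_of_isOpen e.open_target hz
  have hdL : ∀ j, DifferentiableAt ℝ
      (fun w => dz j (fun w => ((Real.log (G e w).det.re : ℝ) : ℂ)) w) z := fun j =>
    (hLs.dz e.open_target j).differentiableAt_of_isOpen e.open_target hz
  have h1 : (fun w => lap G (fun x => (ψ x : ℂ)) (e.symm w)) =ᶠ[nhds z] fun w =>
      ∑ j, (dz j (fun w => star (gradVec G (fun x => (ψ x : ℂ)) e w j)) w +
        dz j (fun w => ((Real.log (G e w).det.re : ℝ) : ℂ)) w *
          star (gradVec G (fun x => (ψ x : ℂ)) e w j)) := by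
    filter_upwards [e.open_target.mem_nhds hz] with w hw
    exact (sum_dz_star_gradVec hG hpos hψ he hw).symm
  rw [dzbar_congr h1, dzbar_sum fun j _ => (hdV j).fun_add ((hdL j).fun_mul (hV j)),
    ← Finset.sum_add_distrib]
  refine Finset.sum_congr rfl fun j _ => ?_
  rw [dzbar_add (hdV j) ((hdL j).fun_mul (hV j)), dzbar_mul (hdL j) (hV j)]
  have h2 := dz_dzbar_comm ((hVs j).contDiffAt_two e.open_target hz) j l
  have h3 := dz_dzbar_comm (hLs.contDiffAt_two e.open_target hz) j l
  have h4 : ricMat G e z j l = -dzbar l (fun w => dz j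
      (fun w => ((Real.log (G e w).det.re : ℝ) : ℂ)) w) z := by
    rw [ricMat, Matrix.of_apply, h3]
  rw [h4]
  simp only [dbarGrad, Matrix.of_apply]
  rw [show dz j (fun w => dzbar l (fun w => star (gradVec G (fun x => (ψ x : ℂ)) e w j)) w) z =
    dzbar l (fun w => dz j (fun w => star (gradVec G (fun x => (ψ x : ℂ)) e w j)) w) z from h2]
  ring

end Holomorphic

end Bochner

/-! ### Non-negativity of the second variation along geodesics -/

section Positivity

open MeasureTheory

variable {n : ℕ} {X : Type*} [TopologicalSpace X] [ChartedSpace (Cn n) X]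
variable {e e' : OpenPartialHomeomorph X (Cn n)} {z : Cn n} {Ω₀ : DForm n 2 X}
variable {C G : ChartMat n X} {u v a : X → ℂ} {ψ : X → ℝ} {γ : ℂ} {c : ℝ}

/-- The function `g^{jk̄} ∂_j u ∂_k̄ u`. -/
def gradSq (G : ChartMat n X) (u : X → ℂ) : X → ℂ :=
  glue fun e z => ((G e z)⁻¹ * gradMat u u e z).trace

/-- The square norm of the `(0,1)`-derivative of the `(1,0)`-part of the gradient. -/
def dbarGradSq (G : ChartMat n X) (u : X → ℂ) : X → ℂ :=
  glue fun e z => (dbarGrad G u e z * conjM (dbarGrad G u e z)).trace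

theorem trDiv_adj_gradMat (hpos : IsPosMat G) (x : X) :
    trDiv Ω₀ (adj G) (gradMat u u) x = gradSq G u x * detDiv Ω₀ G x := by
  have h0 := (hpos _ (chart_mem_atlas _ x) _ (mem_chart_target _ x)).det_pos.ne'
  simp only [trDiv, gradSq, detDiv, glue, adj]
  rw [trace_inv_mul_eq h0]
  field_simp

section Holomorphic

variable [IsManifold 𝓘(ℂ, Cn n) ω X]

theorem cSmooth_gradSq (hG : IsClosed11 G) (hpos : IsPosMat G) (hu : CSmooth n u) :
    CSmooth n (gradSq G u) :=
  cSmooth_glue ((isTensor_gradMat hu hu).isInvariant_trace_inv hG.tensor hpos) fun e he =>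
    contDiffOn_trace (contDiffOn_mul (contDiffOn_inv (hG.smooth e he)
      fun q hq => (hpos e he q hq).det_pos.ne') (isSmoothMat_gradMat hu hu e he))

theorem cSmooth_dbarGradSq (hG : IsClosed11 G) (hpos : IsPosMat G) (hu : CSmooth n u) :
    CSmooth n (dbarGradSq G u) :=
  cSmooth_glue (isInvariant_trace_dbarGrad hG hpos hu) fun e he =>
    contDiffOn_trace (contDiffOn_mul (isSmoothMat_dbarGrad hG hpos hu e he) fun j k =>
      Complex.conjCLE.contDiff.comp_contDiffOn (isSmoothMat_dbarGrad hG hpos hu e he j k))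

theorem dbarGradSq_nonneg (hG : IsClosed11 G) (hpos : IsPosMat G)
    (hψ : CSmooth n fun x => (ψ x : ℂ)) (x : X) :
    0 ≤ (dbarGradSq G (fun x => (ψ x : ℂ)) x).re :=
  trace_mul_conjM_nonneg (hpos _ (chart_mem_atlas _ x) _ (mem_chart_target _ x))
    (transpose_mul_dbarGrad hG hpos hψ (chart_mem_atlas _ x) (mem_chart_target _ x))

/-- The divergence of the vector density `det(g) ∂_l̄V^j V^l̄`. -/
theorem sum_dz_det_mul_dbarGrad_gradVec (hG : IsClosed11 G) (hpos : IsPosMat G)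
    (hψ : CSmooth n fun x => (ψ x : ℂ)) (he : e ∈ atlas (Cn n) X) (hz : z ∈ e.target) :
    ∑ j, dz j (fun w => (G e w).det * (dbarGrad G (fun x => (ψ x : ℂ)) e w *ᵥ
      gradVec G (fun x => (ψ x : ℂ)) e w) j) z = (G e z).det *
      ((dbarGrad G (fun x => (ψ x : ℂ)) e z * conjM (dbarGrad G (fun x => (ψ x : ℂ)) e z)).trace +
        ((G e z)⁻¹ * gradMat (fun x => (ψ x : ℂ)) (lap G fun x => (ψ x : ℂ)) e z).trace +
        ((G e z)⁻¹ * ricMat G e z * (G e z)⁻¹ *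
          gradMat (fun x => (ψ x : ℂ)) (fun x => (ψ x : ℂ)) e z).trace) := by
  set f : X → ℂ := fun x => (ψ x : ℂ) with hf
  have hUs := fun j => contDiffOn_gradVec hG hpos hψ he (l := j)
  have hDs := isSmoothMat_dbarGrad hG hpos hψ e he
  have hU : ∀ j, DifferentiableAt ℝ (fun w => gradVec G f e w j) z := fun j =>
    (hUs j).differentiableAt_of_isOpen e.open_target hz
  have hD : ∀ j l, DifferentiableAt ℝ (fun w => dbarGrad G f e w j l) z := fun j l =>
    (hDs j l).differentiableAt_of_isOpen e.open_target hz
  have hL : DifferentiableAt ℝ (fun w => ((Real.log (G e w).det.re : ℝ) : ℂ)) z :=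
    (contDiffOn_logDet (hG.smooth e he) (hpos e he)).differentiableAt_of_isOpen e.open_target hz
  have h1 : ∀ j, (fun w => (G e w).det * (dbarGrad G f e w *ᵥ gradVec G f e w) j) =ᶠ[nhds z]
      fun w => Complex.exp ((Real.log (G e w).det.re : ℝ) : ℂ) *
        ∑ l, dbarGrad G f e w j l * gradVec G f e w l := by
    intro j
    filter_upwards [e.open_target.mem_nhds hz] with w hw
    rw [PosDef.cexp_logDet (hpos e he w hw)]
    rfl
  have hdU : ∀ j l, dz j (fun w => gradVec G f e w l) z = star (dbarGrad G f e z l j) := by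
    intro j l
    rw [dbarGrad, Matrix.of_apply, dzbar_conj, star_star]
  have h2 : ∀ j, dz j (fun w => (G e w).det * (dbarGrad G f e w *ᵥ gradVec G f e w) j) z =
      (G e z).det * ∑ l, ((dz j (fun w => dbarGrad G f e w j l) z +
        dz j (fun w => ((Real.log (G e w).det.re : ℝ) : ℂ)) z * dbarGrad G f e z j l) *
          gradVec G f e z l + dbarGrad G f e z j l * star (dbarGrad G f e z l j)) := by
    intro j
    rw [dz_congr (h1 j), dz_mul hL.cexp (DifferentiableAt.fun_sum fun l _ => (hD j l).fun_mul (hU l)),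
      dz_cexp hL, PosDef.cexp_logDet (hpos e he z hz),
      dz_sum fun l _ => (hD j l).fun_mul (hU l), mul_assoc, ← mul_add, Finset.mul_sum,
      ← Finset.sum_add_distrib]
    congr 1
    refine Finset.sum_congr rfl fun l _ => ?_
    rw [dz_mul (hD j l) (hU l), hdU]
    ring
  have h3 := fun l => sum_dz_dbarGrad hG hpos hψ he hz l
  simp only [h2]
  rw [← Finset.mul_sum]
  congr 1
  simp only [Finset.sum_add_distrib]
  have e1 : (dbarGrad G f e z * conjM (dbarGrad G f e z)).trace =
      ∑ j, ∑ l, dbarGrad G f e z j l * star (dbarGrad G f e z l j) := rfl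
  have e2 : ((G e z)⁻¹ * gradMat f (lap G f) e z).trace =
      ∑ l, dzbar l (fun w => lap G f (e.symm w)) z * gradVec G f e z l := by
    have : gradMat f (lap G f) e z = Matrix.vecMulVec (dzVec f e z)
      fun l => dzbar l (fun w => lap G f (e.symm w)) z := rfl
    rw [this, trace_mul_vecMulVec]
    rfl
  have e3 : ((G e z)⁻¹ * ricMat G e z * (G e z)⁻¹ * gradMat f f e z).trace =
      ∑ l, (∑ j, star (gradVec G f e z j) * ricMat G e z j l) * gradVec G f e z l := by
    rw [hf, gradMat_real, ← hf, trace_mul_vecMulVec, ← Matrix.mulVec_mulVec, ← Matrix.mulVec_mulVec,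
      Matrix.dotProduct_mulVec, ← star_gradVec hpos he hz, Matrix.dotProduct_mulVec]
    rfl
  have h4 : ∑ j, ∑ l, (dz j (fun w => dbarGrad G f e w j l) z +
      dz j (fun w => ((Real.log (G e w).det.re : ℝ) : ℂ)) z * dbarGrad G f e z j l) *
        gradVec G f e z l =
      ∑ l, dzbar l (fun w => lap G f (e.symm w)) z * gradVec G f e z l +
        ∑ l, (∑ j, star (gradVec G f e z j) * ricMat G e z j l) * gradVec G f e z l := by
    rw [Finset.sum_comm, ← Finset.sum_add_distrib]
    refine Finset.sum_congr rfl fun l _ => ?_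
    rw [← Finset.sum_mul, h3 l, add_mul]
  rw [e1, e2, e3, h4]
  ring

variable [T2Space X] [CompactSpace X] [MeasurableSpace X] [BorelSpace X]

/-- The integrated Bochner formula: the divergence theorem for the derivative of the gradient `V` of
`ψ` in the direction of its own `(0,1)`-part, with density `det G · ∂_l̄ V^j · V^l̄`. -/
theorem integral_bochner (hΩ₀ : IsKahlerForm Ω₀) (hG : IsClosed11 G) (hpos : IsPosMat G)
    (hψ : CSmooth n fun x => (ψ x : ℂ)) :
    ∫ x, (detDiv Ω₀ G x * dbarGradSq G (fun x => (ψ x : ℂ)) x +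
      trDiv Ω₀ (adj G) (gradMat (fun x => (ψ x : ℂ)) (lap G fun x => (ψ x : ℂ))) x +
      (gradSq G (fun x => (ψ x : ℂ)) x * trDiv Ω₀ (adj G) (ricMat G) x -
        trDiv Ω₀ (adjD G (ricMat G)) (gradMat (fun x => (ψ x : ℂ)) fun x => (ψ x : ℂ)) x))
          ∂volMeasure Ω₀ = 0 := by
  set f : X → ℂ := fun x => (ψ x : ℂ) with hf
  have hR := isClosed11_ricMat hG hpos
  have hA : IsCoclosed (adj G) := hG.adjugate
  have hN : IsCoclosed (adjD G (ricMat G)) := isCoclosed_adjDeriv hG hpos hR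
  have hlap := cSmooth_lap hG hpos hψ
  have hg1 := isTensor_gradMat (n := n) (X := X) hψ hlap
  have hg2 := isTensor_gradMat (n := n) (X := X) hψ hψ
  have s1 := (cSmooth_detDiv hΩ₀ hG.tensor hG.smooth).mul (cSmooth_dbarGradSq hG hpos hψ)
  have s2 := cSmooth_trDiv hΩ₀ hA.cotensor hA.smooth hg1 (isSmoothMat_gradMat hψ hlap)
  have s3 := (cSmooth_gradSq hG hpos hψ).mul
    (cSmooth_trDiv hΩ₀ hA.cotensor hA.smooth hR.tensor hR.smooth)
  have s4 := cSmooth_trDiv hΩ₀ hN.cotensor hN.smooth hg2 (isSmoothMat_gradMat hψ hψ)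
  refine integral_divergence hΩ₀ ((s1.add s2).add fun e he => (s3 e he).sub (s4 e he))
    (Y := fun e z j => (G e z).det * (dbarGrad G f e z *ᵥ gradVec G f e z) j)
    (Y' := fun _ _ _ => 0) ?_ (fun _ _ _ => contDiffOn_const) ?_ ?_
  · intro e he j
    refine (contDiffOn_det (hG.smooth e he)).mul ?_
    simp only [Matrix.mulVec, dotProduct]
    exact ContDiffOn.sum fun l _ => (isSmoothMat_dbarGrad hG hpos hψ e he j l).mul
      (contDiffOn_gradVec hG hpos hψ he l)
  · intro e he z hz
    have h0 := det_cf_ne_zero hΩ₀ he hz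
    have hd := (hpos e he z hz).det_pos.ne'
    rw [sum_dz_det_mul_dbarGrad_gradVec hG hpos hψ he hz]
    simp only [dzbar_const, Finset.sum_const_zero, add_zero]
    rw [detDiv_symm hΩ₀ hG.tensor he hz, dbarGradSq, gradSq,
      glue_symm (isInvariant_trace_dbarGrad hG hpos hψ) he hz,
      glue_symm (hg2.isInvariant_trace_inv hG.tensor hpos) he hz,
      trDiv_symm hΩ₀ hA.cotensor hg1 he hz, trDiv_symm hΩ₀ hA.cotensor hR.tensor he hz,
      trDiv_symm hΩ₀ hN.cotensor hg2 he hz]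
    simp only [adj, adjD, adjugate_eq_det_smul_inv hd, adjDeriv, Matrix.smul_mul, Matrix.sub_mul,
      Matrix.trace_smul, Matrix.trace_sub, smul_eq_mul]
    field_simp
    ring
  · intro ρ hρ
    have h1 : ∀ e z, (∑ j, (G e z).det * (dbarGrad G f e z *ᵥ gradVec G f e z) j *
        dz j (fun w => ρ (e.symm w)) z + ∑ j, 0 * dzbar j (fun w => ρ (e.symm w)) z) /
          (cf Ω₀ e z).det = (G e z).det / (cf Ω₀ e z).det *
            (dzVec ρ e z ⬝ᵥ (dbarGrad G f e z *ᵥ gradVec G f e z)) := by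
      intro e z
      simp only [zero_mul, Finset.sum_const_zero, add_zero, dotProduct, dzVec]
      rw [div_mul_eq_mul_div, Finset.mul_sum]
      congr 1
      exact Finset.sum_congr rfl fun j _ => by ring
    intro e he e' he' z hz
    have h2 := hG.tensor.isInvariant_det_div (isTensor_cf hΩ₀.type11) e he e' he' z hz
    have h3 := isInvariant_dbarGrad_gradVec hG hpos hψ hρ e he e' he' z hz
    simp only at h2 h3
    beta_reduce
    rw [h1, h1, h2, h3]

/-- The contribution of the scalar curvature to the second variation of a complexified K-energy along
a geodesic: it is, up to sign, the integral of a square. -/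
theorem integral_scalar_second_variation (hΩ₀ : IsKahlerForm Ω₀) (hG : IsClosed11 G)
    (hpos : IsPosMat G) (hψ : CSmooth n fun x => (ψ x : ℂ)) :
    ∫ x, gradSq G (fun x => (ψ x : ℂ)) x * (trDiv Ω₀ (adj G) (ricMat G) x - c * detDiv Ω₀ G x)
        ∂volMeasure Ω₀ +
      ∫ x, (ψ x : ℂ) * (trDiv Ω₀ (adjD G (ricMat G)) (hess fun x => (ψ x : ℂ)) x -
        trDiv Ω₀ (adj G) (hess (lap G fun x => (ψ x : ℂ))) x -
          c * trDiv Ω₀ (adj G) (hess fun x => (ψ x : ℂ)) x) ∂volMeasure Ω₀ =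
      -∫ x, detDiv Ω₀ G x * dbarGradSq G (fun x => (ψ x : ℂ)) x ∂volMeasure Ω₀ := by
  set f : X → ℂ := fun x => (ψ x : ℂ) with hf
  have hR := isClosed11_ricMat hG hpos
  have hA : IsCoclosed (adj G) := hG.adjugate
  have hN : IsCoclosed (adjD G (ricMat G)) := isCoclosed_adjDeriv hG hpos hR
  have hlap := cSmooth_lap hG hpos hψ
  have i1 := fun {F : X → ℂ} (hF : CSmooth n F) => hF.continuous.integrable_volMeasure hΩ₀
  have sh := fun {N : ChartMat n X} {w : X → ℂ} (hN : IsCoclosed N) (hw : CSmooth n w) =>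
    cSmooth_trDiv hΩ₀ hN.cotensor hN.smooth (isTensor_hess hw) (isClosed11_hess hw).smooth
  have sg := fun {N : ChartMat n X} {w : X → ℂ} (hN : IsCoclosed N) (hw : CSmooth n w) =>
    cSmooth_trDiv hΩ₀ hN.cotensor hN.smooth (isTensor_gradMat hψ hw) (isSmoothMat_gradMat hψ hw)
  have hparts : ∀ {N : ChartMat n X} {w : X → ℂ}, IsCoclosed N → CSmooth n w →
      ∫ x, f x * trDiv Ω₀ N (hess w) x ∂volMeasure Ω₀ =
        -∫ x, trDiv Ω₀ N (gradMat f w) x ∂volMeasure Ω₀ := fun hN hw => by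
    have := integral_trDiv_hess_add_grad hΩ₀ hN hψ hw
    rw [integral_add (i1 (hψ.mul (sh hN hw))) (i1 (sg hN hw))] at this
    exact eq_neg_of_add_eq_zero_left this
  have b := integral_bochner hΩ₀ hG hpos hψ
  rw [← hf] at b
  have s1 := (cSmooth_detDiv hΩ₀ hG.tensor hG.smooth).mul (cSmooth_dbarGradSq hG hpos hψ)
  have s3 := (cSmooth_gradSq hG hpos hψ).mul
    (cSmooth_trDiv hΩ₀ hA.cotensor hA.smooth hR.tensor hR.smooth)
  have s5 := (cSmooth_gradSq hG hpos hψ).mul (cSmooth_detDiv hΩ₀ hG.tensor hG.smooth)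
  have j1 : Integrable (fun x => gradSq G f x * trDiv Ω₀ (adj G) (ricMat G) x -
      trDiv Ω₀ (adjD G (ricMat G)) (gradMat f f) x) (volMeasure Ω₀) :=
    (i1 s3).sub (i1 (sg hN hψ))
  have j2 : Integrable (fun x => detDiv Ω₀ G x * dbarGradSq G f x +
      trDiv Ω₀ (adj G) (gradMat f (lap G f)) x) (volMeasure Ω₀) := (i1 s1).add (i1 (sg hA hlap))
  rw [integral_add j2 j1, integral_add (i1 s1) (i1 (sg hA hlap)),
    integral_sub (i1 s3) (i1 (sg hN hψ))] at b
  have e1 : ∫ x, gradSq G f x * (trDiv Ω₀ (adj G) (ricMat G) x - c * detDiv Ω₀ G x)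
      ∂volMeasure Ω₀ = ∫ x, gradSq G f x * trDiv Ω₀ (adj G) (ricMat G) x ∂volMeasure Ω₀ -
        c * ∫ x, trDiv Ω₀ (adj G) (gradMat f f) x ∂volMeasure Ω₀ := by
    simp only [trDiv_adj_gradMat hpos]
    rw [← integral_const_mul, ← integral_sub (i1 s3) ((i1 s5).const_mul _)]
    congr 1; ext x; ring
  have j3 : Integrable (fun x => f x * trDiv Ω₀ (adjD G (ricMat G)) (hess f) x -
      f x * trDiv Ω₀ (adj G) (hess (lap G f)) x) (volMeasure Ω₀) :=
    (i1 (hψ.mul (sh hN hψ))).sub (i1 (hψ.mul (sh hA hlap)))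
  have e2 : ∫ x, f x * (trDiv Ω₀ (adjD G (ricMat G)) (hess f) x -
      trDiv Ω₀ (adj G) (hess (lap G f)) x - c * trDiv Ω₀ (adj G) (hess f) x) ∂volMeasure Ω₀ =
      ∫ x, f x * trDiv Ω₀ (adjD G (ricMat G)) (hess f) x ∂volMeasure Ω₀ -
        ∫ x, f x * trDiv Ω₀ (adj G) (hess (lap G f)) x ∂volMeasure Ω₀ -
          c * ∫ x, f x * trDiv Ω₀ (adj G) (hess f) x ∂volMeasure Ω₀ := by
    rw [← integral_const_mul, ← integral_sub (i1 (hψ.mul (sh hN hψ))) (i1 (hψ.mul (sh hA hlap))),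
      ← integral_sub j3 ((i1 (hψ.mul (sh hA hψ))).const_mul _)]
    congr 1; ext x; ring
  rw [e1]
  refine (congrArg (_ + ·) e2).trans ?_
  rw [hparts hN hψ, hparts hA hlap, hparts hA hψ]
  linear_combination b

/-- The second variation of a complexified K-energy along a geodesic is non-negative. Here `v` and
`a` are the velocity and the acceleration, `h1` is the geodesic equation for Kähler potentials, which
makes the scalar curvature part a square, and `h2` is the pointwise sign of the other part. -/
theorem sig_add_sigHess_nonneg (hΩ₀ : IsKahlerForm Ω₀) (hC : IsClosed11 C) (hG : IsClosed11 G)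
    (hpos : IsPosMat G) (hv : CSmooth n v) (ha : CSmooth n a)
    (h1 : imPart a = gradSq G (imPart v))
    (h2 : ∀ x, 0 ≤ (γ * (a x * detDiv Ω₀ C x - trDiv Ω₀ (adj C) (gradMat v v) x)).im) :
    0 ≤ sig Ω₀ γ c C G a + sigHess Ω₀ γ c C G v v := by
  have hA : IsCoclosed (adj C) := hC.adjugate
  have i1 := fun {F : X → ℂ} (hF : CSmooth n F) => hF.continuous.integrable_volMeasure hΩ₀
  have sd := cSmooth_detDiv hΩ₀ hC.tensor hC.smooth
  have sh := cSmooth_trDiv hΩ₀ hA.cotensor hA.smooth (isTensor_hess hv) (isClosed11_hess hv).smooth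
  have sg := cSmooth_trDiv hΩ₀ hA.cotensor hA.smooth (isTensor_gradMat hv hv)
    (isSmoothMat_gradMat hv hv)
  have h3 := integral_trDiv_hess_add_grad hΩ₀ hA hv hv
  rw [integral_add (i1 (hv.mul sh)) (i1 sg)] at h3
  have h4 : ∫ x, γ * (a x * detDiv Ω₀ C x) ∂volMeasure Ω₀ +
      ∫ x, γ * (v x * trDiv Ω₀ (adj C) (hess v) x) ∂volMeasure Ω₀ =
      ∫ x, γ * (a x * detDiv Ω₀ C x - trDiv Ω₀ (adj C) (gradMat v v) x) ∂volMeasure Ω₀ := by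
    rw [integral_const_mul, integral_const_mul, integral_const_mul,
      integral_sub (i1 (ha.mul sd)) (i1 sg)]
    linear_combination γ * h3
  have i5 : Integrable (fun x => γ * (a x * detDiv Ω₀ C x - trDiv Ω₀ (adj C) (gradMat v v) x))
      (volMeasure Ω₀) := ((i1 (ha.mul sd)).sub (i1 sg)).const_mul γ
  have h5 : 0 ≤ (∫ x, γ * (a x * detDiv Ω₀ C x - trDiv Ω₀ (adj C) (gradMat v v) x)
      ∂volMeasure Ω₀).im := by
    have := Complex.imCLM.integral_comp_comm i5
    simp only [Complex.imCLM_apply] at this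
    rw [← this]
    exact integral_nonneg h2
  have h6 := integral_scalar_second_variation (c := c) hΩ₀ hG hpos (ψ := fun x => (v x).im) hv.imPart
  have s1 := (cSmooth_detDiv hΩ₀ hG.tensor hG.smooth).mul
    (cSmooth_dbarGradSq hG hpos (u := fun x => ((v x).im : ℂ)) hv.imPart)
  have h7 : 0 ≤ (∫ x, detDiv Ω₀ G x * dbarGradSq G (fun x => ((v x).im : ℂ)) x ∂volMeasure Ω₀).re := by
    have := Complex.reCLM.integral_comp_comm (i1 s1)
    simp only [Complex.reCLM_apply] at this
    rw [← this]
    refine integral_nonneg fun x => ?_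
    have hd : detDiv Ω₀ G x = ((detDiv Ω₀ G x).re : ℂ) ∧ 0 ≤ (detDiv Ω₀ G x).re := by
      have hx := chart_mem_atlas (Cn n) x
      have hxt := mem_chart_target (Cn n) x
      have q1 := hpos _ hx _ hxt
      have q2 := posDef_cf hΩ₀ hx hxt
      have q3 : detDiv Ω₀ G x = (((G (chartAt (Cn n) x) (chartAt (Cn n) x x)).det.re /
          (cf Ω₀ (chartAt (Cn n) x) (chartAt (Cn n) x x)).det.re : ℝ) : ℂ) := by
        rw [detDiv, glue, PosDef.det_eq_re q1, PosDef.det_eq_re q2]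
        simp
      rw [q3, Complex.ofReal_re]
      exact ⟨rfl, (div_pos (PosDef.det_re_pos q1) (PosDef.det_re_pos q2)).le⟩
    show 0 ≤ (detDiv Ω₀ G x * dbarGradSq G (fun x => ((v x).im : ℂ)) x).re
    rw [hd.1, Complex.re_ofReal_mul]
    exact mul_nonneg hd.2 (dbarGradSq_nonneg hG hpos (ψ := fun x => (v x).im) hv.imPart x)
  have h8 := congrArg Complex.re h6
  have h9 := congrArg Complex.im h4
  rw [Complex.add_re, Complex.neg_re] at h8
  rw [Complex.add_im] at h9
  rw [sig, sigHess, h1]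
  have h10 : imPart v = fun x => ((v x).im : ℂ) := rfl
  rw [h10]
  linarith

end Holomorphic

/-- A pointwise inequality for almost calibrated forms: the imaginary part of the density of the
geodesic equation is non-negative when its real part vanishes. -/
theorem im_calibrated_nonneg {G H : Matrix (Fin n) (Fin n) ℂ} (hG : G.PosDef)
    (hH : H.IsHermitian) (U V : Fin n → ℂ) {a κ : ℂ} (hpos : 0 < (κ * (H + Complex.I • G).det).re)
    (hre : (κ * (a * (H + Complex.I • G).det - ((H + Complex.I • G).adjugate *
      Matrix.vecMulVec (U + Complex.I • V) (star U + Complex.I • star V)).trace)).re = 0)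
    (him : a.im = (star V ⬝ᵥ (G⁻¹ *ᵥ V)).re) :
    0 ≤ (κ * (a * (H + Complex.I • G).det - ((H + Complex.I • G).adjugate *
      Matrix.vecMulVec (U + Complex.I • V) (star U + Complex.I • star V)).trace)).im := by
  set C := H + Complex.I • G with hC
  have hd : C.det ≠ 0 := by
    intro h
    rw [h, mul_zero, Complex.zero_re] at hpos
    exact lt_irrefl _ hpos
  have h1 := im_dotProduct_inv_mulVec_le hG hH hd U V
  rw [← him, ← hC] at h1
  have h2 : κ * (a * C.det - (C.adjugate *
      Matrix.vecMulVec (U + Complex.I • V) (star U + Complex.I • star V)).trace) =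
      κ * C.det * (a - (star U + Complex.I • star V) ⬝ᵥ (C⁻¹ *ᵥ (U + Complex.I • V))) := by
    rw [adjugate_eq_det_smul_inv hd, Matrix.smul_mul, Matrix.trace_smul, trace_mul_vecMulVec,
      smul_eq_mul]
    ring
  rw [h2] at hre ⊢
  generalize (star U + Complex.I • star V) ⬝ᵥ (C⁻¹ *ᵥ (U + Complex.I • V)) = b at *
  generalize κ * C.det = q at *
  rw [Complex.mul_re] at hre
  rw [Complex.mul_im]
  have h3 : 0 ≤ (a - b).im := by rw [Complex.sub_im]; linarith
  have h4 : q.re * (q.re * (a - b).im + q.im * (a - b).re) =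
      (q.re ^ 2 + q.im ^ 2) * (a - b).im := by
    linear_combination q.im * hre
  exact nonneg_of_mul_nonneg_right (by rw [h4]; positivity) hpos

end Positivity

/-! ### Convexity along geodesics -/

section Geodesics

open MeasureTheory

variable {n : ℕ} {X : Type*} [TopologicalSpace X] [ChartedSpace (Cn n) X]
variable {e : OpenPartialHomeomorph X (Cn n)} {z : Cn n} {S : Set ℝ} {φ : ℝ → X → ℂ} {t : ℝ}
variable {u v a : X → ℂ} {γ : ℂ} {c θ : ℝ} {p₀ p q : DForm n 2 X × DForm n 2 X} {x : X}

section Holomorphic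

variable [IsManifold 𝓘(ℂ, Cn n) ω X]

theorem diffAt_chartAt (hv : CSmooth n v) (x : X) :
    diffAt v x = fderiv ℝ (fun w => v ((chartAt (Cn n) x).symm w)) (chartAt (Cn n) x x) := by
  have hs := (chartAt (Cn n) x).left_inv (mem_chart_source (Cn n) x)
  have h := diffAt_comp_chartFrame (f := v) (chart_mem_atlas (Cn n) x) (mem_chart_target (Cn n) x)
    ((isSmoothFun_iff.2 hv).contMDiffAt.mdifferentiableAt (by simp))
  rw [chartFrame_chartAt, ContinuousLinearMap.comp_id, hs] at h
  exact h

theorem gradCoeff_eq (hv : CSmooth n v) (x : X) :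
    gradCoeff v x = gradMat v v (chartAt (Cn n) x) (chartAt (Cn n) x x) := by
  ext j k
  simp only [gradCoeff, gradMat, Matrix.of_apply, partialAt, partialBarAt, diffAt_chartAt hv, dz,
    dzbar]

theorem complexCoeff_eq (q : DForm n 2 X × DForm n 2 X) (x : X) :
    complexCoeff q x = complexMat q (chartAt (Cn n) x) (chartAt (Cn n) x x) := by
  simp only [complexCoeff, complexMat, Pi.add_apply, Pi.smul_apply, cf_chartAt]

theorem gradSq_eq_ofReal {G : ChartMat n X} (hG : IsPosMat G) (ψ : X → ℝ) (x : X) :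
    gradSq G (fun y => (ψ y : ℂ)) x = ((gradSq G (fun y => (ψ y : ℂ)) x).re : ℂ) := by
  have h := (hG _ (chart_mem_atlas _ x) _ (mem_chart_target _ x)).inv.posSemidef
  have h1 := h.dotProduct_mulVec_nonneg
    (dzVec (fun y => (ψ y : ℂ)) (chartAt (Cn n) x) (chartAt (Cn n) x x))
  rw [← trace_mul_vecMulVec, ← gradMat_real] at h1
  exact Complex.ext rfl (Complex.le_def.1 h1).2.symm

/-- The matrix of `i∂v ∧ ∂̄v` in terms of the derivatives of the real and imaginary parts. -/
theorem gradMat_eq_vecMulVec (hv : CSmooth n v) (he : e ∈ atlas (Cn n) X) (hz : z ∈ e.target) :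
    gradMat v v e z = Matrix.vecMulVec
      (dzVec (fun x => ((v x).re : ℂ)) e z + Complex.I • dzVec (fun x => ((v x).im : ℂ)) e z)
      (star (dzVec (fun x => ((v x).re : ℂ)) e z) +
        Complex.I • star (dzVec (fun x => ((v x).im : ℂ)) e z)) := by
  have h1 := differentiableAt_comp_symm hv.rePart he hz
  have h2 := differentiableAt_comp_symm (u := fun x => ((v x).im : ℂ)) hv.imPart he hz
  have h3 : (fun w => v (e.symm w)) = fun w => ((v (e.symm w)).re : ℂ) +
      Complex.I * ((v (e.symm w)).im : ℂ) := funext fun w => by rw [mul_comm, Complex.re_add_im]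
  ext j k
  simp only [gradMat, Matrix.vecMulVec_apply, Matrix.of_apply, Pi.add_apply, Pi.smul_apply,
    Pi.star_apply, smul_eq_mul, star_dzVec]
  rw [h3, dz_add h1 (h2.const_mul _), dzbar_add h1 (h2.const_mul _), dz_const_mul h2,
    dzbar_const_mul h2]
  rfl

/-- Where the geodesic equations hold for the velocity `v` and the acceleration `a`, the imaginary
part of their complex density is non-negative. -/
theorem im_calibrated_density_nonneg (h1 : IsClosedReal11 q.1) (h2 : IsKahlerForm q.2)
    (hv : CSmooth n v) {κ : ℂ} (hpos : 0 < (κ * powerRatio q x).re)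
    (hre : (κ * geodesicDensity q a v x).re = 0)
    (him : (a x).im = normSqPartial q.2 (fun y => (v y).im) x) :
    0 ≤ (κ * geodesicDensity q a v x).im := by
  have hx := chart_mem_atlas (Cn n) x
  have hxt := mem_chart_target (Cn n) x
  have hG := posDef_cf h2 hx hxt
  have hH := isHermitian_cf h1 hx hxt
  have hd := PosDef.det_re_pos hG
  have hd' := PosDef.det_eq_re hG
  rw [cf_chartAt] at hd hd'
  rw [normSqPartial, gradCoeff_eq (v := fun y => ((v y).im : ℂ)) hv.imPart, gradMat_real,
    trace_mul_vecMulVec, ← cf_chartAt] at him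
  have key : ∀ N : ℂ, κ * (N / (coeff (q.2 x)).det) =
      (((coeff (q.2 x)).det.re⁻¹ : ℝ) : ℂ) * (κ * N) := fun N => by
    rw [hd']; push_cast; simp only [Complex.ofReal_re]; ring
  rw [powerRatio, key, Complex.re_ofReal_mul] at hpos
  rw [geodesicDensity, key, Complex.re_ofReal_mul, mul_eq_zero, or_iff_right (inv_pos.2 hd).ne'] at hre
  rw [geodesicDensity, key, Complex.im_ofReal_mul]
  refine mul_nonneg (inv_pos.2 hd).le ?_
  have hpos' := pos_of_mul_pos_right hpos (inv_pos.2 hd).le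
  rw [complexCoeff_eq, gradCoeff_eq hv, gradMat_eq_vecMulVec hv hx hxt] at *
  exact im_calibrated_nonneg hG hH _ _ hpos' hre him

variable [T2Space X] [CompactSpace X] [MeasurableSpace X] [BorelSpace X]

/-- The second derivative of a complexified K-energy along a path of potentials `φ`, with `v` and `a`
the velocity and the acceleration, is non-negative where the geodesic equations hold. -/
theorem sigma_add_sigmaHess_nonneg (hΩ₀ : IsKahlerForm p₀.2) (hp : p ∈ complexifiedClass p₀)
    (hθ : γ = (‖γ‖ : ℂ) * Complex.exp (-(θ : ℂ) * Complex.I))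
    (hu : CSmooth n u) (hv : CSmooth n v) (ha : CSmooth n a)
    (hmem : addPotential p u ∈ almostCalibrated θ p₀)
    (him : ∀ x, (a x).im - normSqPartial (addPotential p u).2 (fun y => (v y).im) x = 0)
    (hre : ∀ x, (Complex.exp (-(θ : ℂ) * Complex.I) *
      geodesicDensity (addPotential p u) a v x).re = 0) :
    0 ≤ sigma γ c (addPotential p u) a + sigmaHess γ c p₀ p u v v := by
  rw [sigma_addPotential hΩ₀ hu hmem.1 ha]
  have hpos := (mem_complexifiedClass_iff hp hu).1 hmem.1
  have hC := complexMat_addPotential p hu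
  have hG := cf_addPotential_snd p hu
  refine sig_add_sigHess_nonneg hΩ₀
    (isClosed11_add_hess (isClosed11_complexMat hp.1 hp.2.1.toIsClosedReal11) hu)
    (isClosed11_add_hess (isClosed11_cf hp.2.1.toIsClosedReal11) hu.imPart) hpos hv ha ?_ ?_
  · ext x
    have hx := chart_mem_atlas (Cn n) x
    have hxt := mem_chart_target (Cn n) x
    have h1 : normSqPartial (addPotential p u).2 (fun y => (v y).im) x =
        (gradSq (addHess (cf p.2) (imPart u)) (fun y => ((v y).im : ℂ)) x).re := by
      rw [normSqPartial, gradCoeff_eq (v := fun y => ((v y).im : ℂ)) hv.imPart, ← cf_chartAt,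
        hG _ hx _ hxt]
      rfl
    show (((a x).im : ℝ) : ℂ) = gradSq _ (fun y => ((v y).im : ℂ)) x
    rw [gradSq_eq_ofReal hpos, ← h1, sub_eq_zero.1 (him x)]
  · intro x
    have hx := chart_mem_atlas (Cn n) x
    have hxt := mem_chart_target (Cn n) x
    have q1 := posDef_cf hmem.1.2.1 hx hxt
    have q2 := posDef_cf hΩ₀ hx hxt
    have h0 := im_calibrated_density_nonneg hmem.1.1 hmem.1.2.1 hv (hmem.2 x) (hre x)
      (sub_eq_zero.1 (him x))
    set r : ℝ := (cf (addPotential p u).2 (chartAt (Cn n) x) (chartAt (Cn n) x x)).det.re /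
      (cf p₀.2 (chartAt (Cn n) x) (chartAt (Cn n) x x)).det.re with hr
    have hr0 : 0 ≤ r := (div_pos (PosDef.det_re_pos q1) (PosDef.det_re_pos q2)).le
    have h1 : a x * detDiv p₀.2 (addHess (complexMat p) u) x -
        trDiv p₀.2 (adj (addHess (complexMat p) u)) (gradMat v v) x =
          (r : ℂ) * geodesicDensity (addPotential p u) a v x := by
      have hne := q1.det_pos.ne'
      rw [geodesicDensity, complexCoeff_eq, gradCoeff_eq hv, ← cf_chartAt, hC _ hx _ hxt, hr,
        Complex.ofReal_div, ← PosDef.det_eq_re q1, ← PosDef.det_eq_re q2]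
      simp only [detDiv, trDiv, glue, adj]
      field_simp
    have h2 : γ * ((r : ℂ) * geodesicDensity (addPotential p u) a v x) =
        ((‖γ‖ * r : ℝ) : ℂ) * (Complex.exp (-(θ : ℂ) * Complex.I) *
          geodesicDensity (addPotential p u) a v x) := by
      conv_lhs => rw [hθ]
      push_cast
      ring
    rw [h1, h2, Complex.im_ofReal_mul]
    exact mul_nonneg (mul_nonneg (norm_nonneg γ) hr0) h0

end Holomorphic

section Paths

theorem contDiffOn_derivWithin_slice {E F : Type*} [NormedAddCommGroup E] [NormedSpace ℝ E]
    [NormedAddCommGroup F] [NormedSpace ℝ F] {U : Set E} (hS : UniqueDiffOn ℝ S) (hU : IsOpen U)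
    {f : ℝ × E → F} (hf : ContDiffOn ℝ ∞ f (S ×ˢ U)) :
    ContDiffOn ℝ ∞ (fun w : ℝ × E => derivWithin (fun s => f (s, w.2)) S w.1) (S ×ˢ U) := by
  have h1 : ContDiffOn ℝ ∞ (fun w => fderivWithin ℝ f (S ×ˢ U) w (1, 0)) (S ×ˢ U) :=
    (hf.fderivWithin (hS.prod hU.uniqueDiffOn) (by simp)).clm_apply contDiffOn_const
  refine h1.congr fun w hw => ?_
  have h2 := (hf.differentiableOn (by simp) w hw).hasFDerivWithinAt
  have h3 : HasDerivWithinAt (fun s : ℝ => (s, w.2)) ((1 : ℝ), (0 : E)) S w.1 :=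
    (hasDerivWithinAt_id _ _).prodMk (hasDerivWithinAt_const _ _ _)
  have hm : Set.MapsTo (fun s : ℝ => (s, w.2)) S (S ×ˢ U) := fun s hs => ⟨hs, hw.2⟩
  exact (HasFDerivWithinAt.comp_hasDerivWithinAt w.1 h2 h3 hm).derivWithin (hS _ hw.1)

theorem SmoothFam.velocity (h : SmoothFam n S φ) (hS : UniqueDiffOn ℝ S) :
    SmoothFam n S (velocity S φ) := fun e he =>
  contDiffOn_derivWithin_slice hS e.open_target (h e he)

theorem acceleration_eq (S : Set ℝ) (φ : ℝ → X → ℂ) (t : ℝ) (x : X) :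
    acceleration S φ t x = velocity S (velocity S φ) t x := by
  rw [acceleration, iteratedDerivWithin_succ]
  rw [iteratedDerivWithin_one]
  rfl

/-- In the interior of the interval, the velocity is a genuine derivative. -/
theorem SmoothFam.smoothPath (h : SmoothFam n S φ) (hS : UniqueDiffOn ℝ S) :
    SmoothPath n (interior S) φ (BField.velocity S φ) where
  isOpen := isOpen_interior
  smooth := h.mono interior_subset
  smooth' := (h.velocity hS).mono interior_subset
  hasDerivAt t ht x := by
    have h1 : DifferentiableOn ℝ (fun s => φ s x) S := by
      have := (h _ (chart_mem_atlas (Cn n) x)).comp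
        (contDiffOn_id.prodMk contDiffOn_const (s := S))
        (fun s hs => ⟨hs, mem_chart_target (Cn n) x⟩)
      have h2 := this.differentiableOn (by simp)
      refine h2.congr fun s hs => ?_
      simp [(chartAt (Cn n) x).left_inv (mem_chart_source (Cn n) x)]
    exact (h1 t (interior_subset ht)).hasDerivWithinAt.hasDerivAt (mem_interior_iff_mem_nhds.1 ht)

variable [IsManifold 𝓘(ℂ, Cn n) ω X]

theorem smoothFam_of_contMDiffOn
    (h : ContMDiffOn (𝓘(ℝ, ℝ).prod 𝓘(ℝ, Cn n)) 𝓘(ℝ, ℂ) ∞ (fun q : ℝ × X => φ q.1 q.2)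
      (S ×ˢ Set.univ)) : SmoothFam n S φ := by
  haveI := isManifold_real n X
  intro e he
  have h1 : ContMDiffOn 𝓘(ℝ, Cn n) 𝓘(ℝ, Cn n) ∞ e.symm e.target :=
    contMDiffOn_symm_of_mem_maximalAtlas (IsManifold.subset_maximalAtlas he)
  have h2 : ContMDiffOn 𝓘(ℝ, ℝ × Cn n) (𝓘(ℝ, ℝ).prod 𝓘(ℝ, Cn n)) ∞
      (fun w : ℝ × Cn n => (w.1, e.symm w.2)) (S ×ˢ e.target) :=
    contDiff_fst.contMDiff.contMDiffOn.prodMk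
      (h1.comp contDiff_snd.contMDiff.contMDiffOn fun w hw => hw.2)
  exact contMDiffOn_iff_contDiffOn.1 (h.comp h2 fun w hw => ⟨hw.1, Set.mem_univ _⟩)

variable [T2Space X] [CompactSpace X] [MeasurableSpace X] [BorelSpace X]

theorem continuousOn_rayEnergy {l r : ℝ} (hlr : l < r) (hΩ₀ : IsKahlerForm p₀.2)
    (hp : p ∈ complexifiedClass p₀) (h : SmoothFam n (Set.Icc l r) φ)
    (hmem : ∀ t ∈ Set.Icc l r, addPotential p (φ t) ∈ complexifiedClass p₀) :
    ContinuousOn (fun t => rayEnergy γ c p (φ t)) (Set.Icc l r) := by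
  have f1 : SmoothFam n (Set.Icc l r ×ˢ Set.Icc (0 : ℝ) 1) fun w => φ w.1 :=
    h.comp contDiffOn_fst fun w hw => hw.1
  have c2 : SmoothFam n (Set.Icc l r ×ˢ Set.Icc (0 : ℝ) 1) fun w (_ : X) => (w.2 : ℂ) :=
    smoothFam_param (contDiff_ofReal.comp contDiff_snd).contDiffOn
  have cF : ContinuousOn (fun w : ℝ × ℝ =>
      sigma γ c (addPotential p fun x => (w.2 : ℂ) * φ w.1 x) (φ w.1))
        (Set.Icc l r ×ˢ Set.Icc (0 : ℝ) 1) :=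
    continuousOn_sigma hΩ₀ hp ((uniqueDiffOn_Icc hlr).prod (uniqueDiffOn_Icc zero_lt_one))
      (c2.mul f1) f1 fun w hw => ray_mem_complexifiedClass hp (h.slice hw.1) (hmem w.1 hw.1) hw.2
  obtain ⟨B, hB⟩ := (isCompact_Icc.prod isCompact_Icc).exists_bound_of_continuousOn cF
  have hI : Set.uIoc (0 : ℝ) 1 ⊆ Set.Icc 0 1 := by
    rw [Set.uIoc_of_le zero_le_one]; exact Set.Ioc_subset_Icc_self
  intro t ht
  refine intervalIntegral.continuousWithinAt_of_dominated_interval (bound := fun _ => B) ?_ ?_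
    intervalIntegrable_const ?_
  · filter_upwards [self_mem_nhdsWithin] with s hs
    have h1 : ContinuousOn (fun y : ℝ =>
        sigma γ c (addPotential p fun x => (y : ℂ) * φ s x) (φ s)) (Set.Icc 0 1) :=
      cF.comp (f := fun y => (s, y)) (by fun_prop) fun y hy => ⟨hs, hy⟩
    exact (h1.mono hI).aestronglyMeasurable measurableSet_uIoc
  · filter_upwards [self_mem_nhdsWithin] with s hs
    exact Filter.Eventually.of_forall fun y hy => hB (s, y) ⟨hs, hI hy⟩
  · refine Filter.Eventually.of_forall fun y hy => ?_
    have h1 : ContinuousOn (fun s : ℝ =>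
        sigma γ c (addPotential p fun x => (y : ℂ) * φ s x) (φ s)) (Set.Icc l r) :=
      cF.comp (f := fun s => (s, y)) (by fun_prop) fun s hs => ⟨hs, hI hy⟩
    exact h1 t ht

/-- Complexified K-energies are convex along geodesics of almost calibrated representatives. -/
theorem IsComplexifiedKEnergy.convexOn {M : DForm n 2 X × DForm n 2 X → ℝ}
    (hM : IsComplexifiedKEnergy γ p₀ M) (hΩ₀ : IsKahlerForm p₀.2)
    (hθ : γ = (‖γ‖ : ℂ) * Complex.exp (-(θ : ℂ) * Complex.I)) (hp : p ∈ complexifiedClass p₀)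
    (hS : Convex ℝ S) (h : IsCoupledGeodesic θ p₀ p S φ) :
    ConvexOn ℝ S fun t => M (addPotential p (φ t)) := by
  refine LinearOrder.convexOn_of_lt hS fun l hl r hr hlr => ?_
  have hsub : Set.Icc l r ⊆ S := hS.ordConnected.out hl hr
  have hint : interior (Set.Icc l r) ⊆ interior S := interior_mono hsub
  have hSu : UniqueDiffOn ℝ S := uniqueDiffOn_convex hS
    ((Set.nonempty_Ioo.2 hlr).mono (by rwa [interior_Icc] at hint))
  have hφ := smoothFam_of_contMDiffOn h.smooth
  have hv := hφ.velocity hSu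
  have ha := hv.velocity hSu
  have h1 := hφ.smoothPath hSu
  have h2 := hv.smoothPath hSu
  have hmem : ∀ t ∈ S, addPotential p (φ t) ∈ complexifiedClass p₀ := fun t ht => (h.mem t ht).1
  have hmemi : ∀ t ∈ interior S, addPotential p (φ t) ∈ complexifiedClass p₀ :=
    fun t ht => hmem t (interior_subset ht)
  have key : ConvexOn ℝ (Set.Icc l r) fun t => M p + rayEnergy γ (cGamma γ p₀) p (φ t) := by
    refine convexOn_of_hasDerivWithinAt2_nonneg (convex_Icc l r)
      (continuousOn_const.add (continuousOn_rayEnergy hlr hΩ₀ hp (hφ.mono hsub)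
        fun t ht => hmem t (hsub ht)))
      (fun t ht => ((hasDerivAt_rayEnergy hΩ₀ hp h1 hmemi (hint ht)).const_add _).hasDerivWithinAt)
      (fun t ht => (hasDerivAt_sigma hΩ₀ hp h1 h2 hmemi (hint ht)).hasDerivWithinAt) ?_
    intro t ht
    have htS := interior_subset (hint ht)
    have hacc : acceleration S φ t = velocity S (velocity S φ) t :=
      funext fun x => acceleration_eq S φ t x
    have e1 := h.kahler_geodesic t htS
    have e2 := h.calibrated_geodesic t htS
    rw [hacc] at e2
    simp only [hacc] at e1
    exact sigma_add_sigmaHess_nonneg hΩ₀ hp hθ (hφ.slice htS) (hv.slice htS) (ha.slice htS)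
      (h.mem t htS) e1 e2
  have heq : ∀ t ∈ S, M (addPotential p (φ t)) = M p + rayEnergy γ (cGamma γ p₀) p (φ t) :=
    fun t ht => hM.eq_add_rayEnergy hΩ₀ hp (hφ.slice ht) (hmem t ht)
  intro b b' hb hb' hbb
  have h5 := key.2 (Set.left_mem_Icc.2 hlr.le) (Set.right_mem_Icc.2 hlr.le) hb.le hb'.le hbb
  rw [heq l hl, heq r hr, heq _ (hS hl hr hb.le hb'.le hbb)]
  exact h5

end Paths

end Geodesics

end BField

end

theorem theorem1 {n : ℕ} {X : Type*} [TopologicalSpace X] [T2Space X] [CompactSpace X]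
    [ConnectedSpace X] [ChartedSpace (Cn n) X] [IsManifold 𝓘(ℂ, Cn n) ω X]
    (p₀ : DForm n 2 X × DForm n 2 X) (hB₀ : IsClosedReal11 p₀.1) (hΩ₀ : IsKahlerForm p₀.2)
    (γ : ℂ) (θ : ℝ) (hθ : γ = (‖γ‖ : ℂ) * Complex.exp (-(θ : ℂ) * Complex.I))
    (hγ : (γ * complexVolume p₀).im = 0) :
    -- the first variation `1`-form is closed
    (∀ p ∈ complexifiedClass p₀, ∀ φ₁ φ₂ : X → ℂ, IsSmoothFun n φ₁ → IsSmoothFun n φ₂ →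
      ∃ D : ℝ,
        HasDerivAt (fun t : ℝ =>
          sigma γ (cGamma γ p₀) (addPotential p fun x => (t : ℂ) * φ₂ x) φ₁) D 0 ∧
        HasDerivAt (fun t : ℝ =>
          sigma γ (cGamma γ p₀) (addPotential p fun x => (t : ℂ) * φ₁ x) φ₂) D 0) ∧
    -- there is a functional with this first variation
    (∃ M : DForm n 2 X × DForm n 2 X → ℝ, IsComplexifiedKEnergy γ p₀ M) ∧
    ∀ M : DForm n 2 X × DForm n 2 X → ℝ, IsComplexifiedKEnergy γ p₀ M →
      -- its Euler–Lagrange equation is the scalar curvature equation with B-field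
      (∀ p ∈ complexifiedClass p₀,
        HasFirstVariationAt M (fun _ => 0) p ↔ SolvesBFieldEquation γ (cGamma γ p₀) p) ∧
      -- it is convex along geodesics of almost calibrated representatives
      (∀ p ∈ complexifiedClass p₀, ∀ (S : Set ℝ) (φ : ℝ → X → ℂ), Convex ℝ S →
        IsCoupledGeodesic θ p₀ p S φ →
        ConvexOn ℝ S fun t => M (addPotential p (φ t))) := by
  letI : MeasurableSpace X := borel X
  haveI : BorelSpace X := ⟨rfl⟩
  refine ⟨fun p hp φ₁ φ₂ h₁ h₂ => exists_hasDerivAt_sigma hΩ₀ hp (isSmoothFun_iff.1 h₁)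
    (isSmoothFun_iff.1 h₂), ⟨_, isComplexifiedKEnergy_kEnergy hB₀ hΩ₀ hγ⟩, fun M hM => ⟨fun p hp =>
    hasFirstVariationAt_zero_iff (hM p hp) hp.1 hp.2.1, fun p hp S φ hS h =>
      hM.convexOn hΩ₀ hθ hp hS h⟩⟩
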